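/- Let $n\ge 0$, let $L=\mathbb Z^n$ with basis $l_1,\dots,l_n$, and let $\mathbb Q_n$ be the complex Lie group, under entrywise multiplication, of complex $n\times n$ matrices $q=(q_{ij})$ with $q_{ii}=1$ and $q_{ij}=q_{ji}^{-1}$; write $\mathbf 1$ for its unit element. For $q\in\mathbb Q_n$ let $A_q$ be the quantum torus, i.e. the $\mathbb C$-algebra generated by invertible elements $x_1,\dots,x_n$ with $x_ix_j=q_{ij}x_jx_i$. Let $\mathrm{HP}_0(A_q)$ be its periodic cyclic homology, the degree zero cohomology of $(M((u)),b+uB)$, where $M$ is the Hochschild mixed complex of $A_q$ and $u$ has degree two, with the Hodge filtration $F^p$ given by the image of the classes of $u^pM[[u]]$. As $q$ varies these spaces carry Getzler's flat Gauss--Manin connection. At $q=\mathbf 1$ the Hochschild--Kostant--Rosenberg map identifies $\mathrm{HP}_0(A_{\mathbf 1})$ with $\bigoplus_p H^{2p}((\mathbb C^\times)^n;\mathbb C)$; there take as lattice the image of the topological K-theory $K^0((\mathbb C^\times)^n)$ under the Chern character (normalized without factors $2\pi i$, so that its degree $2p$ part has periods in $(2\pi i)^p\mathbb Z$), and as weight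 filtration $W_k=\bigoplus_{2p\le k}H^{2p}((\mathbb C^\times)^n;\mathbb C)$. Transport both by the Gauss--Manin connection along a smooth path in $\mathbb Q_n$ from $\mathbf 1$ to $q$ (such paths exist), and write $K^0(A_q)$ for $\mathrm{HP}_0(A_q)$ with its Hodge filtration and the transported lattice and weights. Then the following hold. 1. For every $q$ the subspaces $W_k$ with $k\le 2$, and the lattice in $W_2$, do not depend on the path. Moreover $W_2K^0(A_q)$ is an integral mixed Hodge structure, and parallel transport of the unit class and of the projection to $H^2$ (where $l_i\wedge l_j$ corresponds to $\mathrm{dlog}\,x_i\wedge\mathrm{dlog}\,x_j$) makes it an extension of mixed Hodge structures $$0\to\mathbb Z\to W_2K^0(A_q)\to(\wedge^2L)(-1)\to 0,$$ whose class $[W_2K^0(A_q)]$ is independent of the path. 2. The period map $$\wp:\mathbb Q_n\to \mathrm{Ext}^1_{\mathrm{MHS}}((\wedge^2L)(-1),\mathbb Z),\qquad q\mapsto[W_2K^0(A_q)],$$ is an isomorphism of complex Lie groups, where $\mathrm{Ext}^1_{\mathrm{MHS}}$ has the Baer sum as group law and the complex structure for which Carlson's projection $\mathrm{Hom}_{\mathbb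 C}(\wedge^2L\otimes\mathbb C,\mathbb C)\to\mathrm{Ext}^1_{\mathrm{MHS}}((\wedge^2L)(-1),\mathbb Z)$ (taking the composite of a Hodge section and an integral retraction to the class of the extension) is a local isomorphism. 3. There is a group isomorphism $\mathrm{Ext}^1_{\mathrm{MHS}}((\wedge^2L)(-1),\mathbb Z)\cong\mathrm{Hom}(\wedge^2L,\mathbb C^\times)$ that sends the class of $\psi\in\mathrm{Hom}_{\mathbb C}(\wedge^2L\otimes\mathbb C,\mathbb C)$ to $v\mapsto e^{\psi(v\otimes 1)}$. -/

import Mathlib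

open scoped TensorProduct ContDiff

noncomputable section

namespace QTori

/-! ### The parameter space of multiplicatively skew-symmetric matrices -/

/-- Multiplicatively skew-symmetric complex `n × n` matrices: `q i i = 1` and
`q i j = (q j i)⁻¹` (written as `q i j * q j i = 1`, so that all entries are nonzero). -/
@[ext]
structure QP (n : ℕ) where
  val : Fin n → Fin n → ℂ
  diag : ∀ i, val i i = 1
  skew : ∀ i j, val i j * val j i = 1

instance (n : ℕ) : One (QP n) := ⟨⟨fun _ _ => 1, fun _ => rfl, fun _ _ => one_mul 1⟩⟩

/-- The group law of the parameter space is entrywise multiplication. -/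
instance (n : ℕ) : Mul (QP n) :=
  ⟨fun q r => ⟨fun i j => q.val i j * r.val i j,
    fun i => by rw [q.diag, r.diag, one_mul],
    fun i j => by rw [mul_mul_mul_comm, q.skew, r.skew, one_mul]⟩⟩

/-! ### Hochschild chains

Throughout, `V` is a complex vector space, `μ` a bilinear product on `V` and `e` a unit for it. -/

section Hochschild

variable {V : Type} [AddCommGroup V] [Module ℂ V]

/-- Hochschild chains of degree `k`, that is `V ⊗ ⋯ ⊗ V` with `k + 1` factors. -/
abbrev HC (V : Type) [AddCommGroup V] [Module ℂ V] (k : ℕ) : Type :=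
  PiTensorProduct ℂ (fun _ : Fin (k + 1) => V)

/-- The cyclic rotation `a₀ ⊗ ⋯ ⊗ aₖ ↦ aₖ ⊗ a₀ ⊗ ⋯ ⊗ aₖ₋₁`. -/
def rot (V : Type) [AddCommGroup V] [Module ℂ V] (k : ℕ) : HC V k ≃ₗ[ℂ] HC V k :=
  PiTensorProduct.reindex ℂ (fun _ => V) (finRotate (k + 1))

theorem rot_tprod (k : ℕ) (a : Fin (k + 1) → V) :
    rot V k (PiTensorProduct.tprod ℂ a) =
      PiTensorProduct.tprod ℂ fun i => a ((finRotate (k + 1)).symm i) := by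
  simp [rot]

/-- `a₀ ⊗ a₁ ⊗ a₂ ⊗ ⋯ ↦ β(a₀, a₁) ⊗ a₂ ⊗ ⋯` for a bilinear map `β`. -/
def mergeHead (β : V →ₗ[ℂ] V →ₗ[ℂ] V) (k : ℕ) : HC V (k + 1) →ₗ[ℂ] HC V k :=
  PiTensorProduct.lift <|
    (multilinearCurryLeftEquiv ℂ (fun _ : Fin (k + 2) => V) (HC V k)).symm <|
      (multilinearCurryLeftEquiv ℂ (fun _ : Fin (k + 1) => V) (HC V k)).symm.toLinearMap ∘ₗ
        LinearMap.llcomp ℂ V V (MultilinearMap ℂ (fun _ : Fin k => V) (HC V k))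
          (multilinearCurryLeftEquiv ℂ (fun _ : Fin (k + 1) => V) (HC V k)
            (PiTensorProduct.tprod ℂ)) ∘ₗ β

theorem mergeHead_tprod (β : V →ₗ[ℂ] V →ₗ[ℂ] V) (k : ℕ) (a : Fin (k + 2) → V) :
    mergeHead β k (PiTensorProduct.tprod ℂ a) =
      PiTensorProduct.tprod ℂ
        (Fin.cons (β (a 0) (a 1)) (fun j : Fin k => a j.succ.succ) : Fin (k + 1) → V) := by
  simp only [mergeHead, PiTensorProduct.lift.tprod]
  rfl

/-- `a₀ ⊗ ⋯ ⊗ aₖ ↦ e ⊗ a₀ ⊗ ⋯ ⊗ aₖ`. -/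
def insertHead (e : V) (k : ℕ) : HC V k →ₗ[ℂ] HC V (k + 1) :=
  PiTensorProduct.lift <|
    multilinearCurryLeftEquiv ℂ (fun _ : Fin (k + 2) => V) (HC V (k + 1))
      (PiTensorProduct.tprod ℂ) e

theorem insertHead_tprod (e : V) (k : ℕ) (a : Fin (k + 1) → V) :
    insertHead e k (PiTensorProduct.tprod ℂ a) =
      PiTensorProduct.tprod ℂ (Fin.cons e a : Fin (k + 2) → V) := by
  simp only [insertHead, PiTensorProduct.lift.tprod]
  rfl

/-- Apply `β` to the cyclically adjacent pair in positions `i` and `i + 1`: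
`a₀ ⊗ ⋯ ⊗ β(aᵢ, aᵢ₊₁) ⊗ ⋯ ⊗ aₖ₊₁` for `i ≤ k`, and
`β(aₖ₊₁, a₀) ⊗ a₁ ⊗ ⋯ ⊗ aₖ` for `i = k + 1`. -/
def face (β : V →ₗ[ℂ] V →ₗ[ℂ] V) (k i : ℕ) : HC V (k + 1) →ₗ[ℂ] HC V k :=
  (rot V k ^ i).toLinearMap ∘ₗ mergeHead β k ∘ₗ ((rot V (k + 1))⁻¹ ^ i).toLinearMap

/-- The Hochschild differential. -/
def hochB (μ : V →ₗ[ℂ] V →ₗ[ℂ] V) (k : ℕ) : HC V (k + 1) →ₗ[ℂ] HC V k :=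
  ∑ i ∈ Finset.range (k + 2), (-1 : ℂ) ^ i • face μ k i

/-- The Connes--Tsygan operator (on normalized chains)
`a₀ ⊗ ⋯ ⊗ aₖ ↦ ∑ᵢ (-1)^(ki) e ⊗ aₖ₋ᵢ₊₁ ⊗ ⋯ ⊗ aₖ ⊗ a₀ ⊗ ⋯ ⊗ aₖ₋ᵢ`. -/
def connesB (e : V) (k : ℕ) : HC V k →ₗ[ℂ] HC V (k + 1) :=
  ∑ i ∈ Finset.range (k + 1),
    (-1 : ℂ) ^ (k * i) • (insertHead e k ∘ₗ (rot V k ^ i).toLinearMap)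

/-- Degenerate chains: spanned by `a₀ ⊗ ⋯ ⊗ aₖ` with `aᵢ = e` for some `i ≥ 1`.
The normalized chains `V ⊗ (V / ℂe) ⊗ ⋯ ⊗ (V / ℂe)` are the quotient by this subspace. -/
def degenerate (e : V) (k : ℕ) : Submodule ℂ (HC V k) :=
  Submodule.span ℂ
    {x | ∃ a : Fin (k + 1) → V, (∃ i, i ≠ 0 ∧ a i = e) ∧ x = PiTensorProduct.tprod ℂ a}

/-- Degree zero periodic cyclic chains: a family `(c_{2p})` stands for `∑ₚ c_{2p} uᵖ`. -/
abbrev EvenChains (V : Type) [AddCommGroup V] [Module ℂ V] : Type := ∀ p : ℕ, HC V (2 * p)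

/-- Degree `-1` periodic cyclic chains: a family `(c_{2p+1})` stands for `∑ₚ c_{2p+1} uᵖ`. -/
abbrev OddChains (V : Type) [AddCommGroup V] [Module ℂ V] : Type := ∀ p : ℕ, HC V (2 * p + 1)

/-- `b + uB` from degree `0` to degree `1`. -/
def dEven (μ : V →ₗ[ℂ] V →ₗ[ℂ] V) (e : V) : EvenChains V →ₗ[ℂ] OddChains V :=
  LinearMap.pi fun p =>
    hochB μ (2 * p + 1) ∘ₗ
      (LinearMap.proj (p + 1) : (∀ p : ℕ, HC V (2 * p)) →ₗ[ℂ] HC V (2 * (p + 1))) +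
    connesB e (2 * p) ∘ₗ
      (LinearMap.proj p : (∀ p : ℕ, HC V (2 * p)) →ₗ[ℂ] HC V (2 * p))

/-- The `p`-th component of `b + uB` from degree `-1` to degree `0`. -/
def dOddComp (μ : V →ₗ[ℂ] V →ₗ[ℂ] V) (e : V) : ∀ p : ℕ, OddChains V →ₗ[ℂ] HC V (2 * p)
  | 0 => hochB μ 0 ∘ₗ
      (LinearMap.proj 0 : (∀ p : ℕ, HC V (2 * p + 1)) →ₗ[ℂ] HC V (2 * 0 + 1))
  | p + 1 =>
    hochB μ (2 * (p + 1)) ∘ₗ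
      (LinearMap.proj (p + 1) : (∀ p : ℕ, HC V (2 * p + 1)) →ₗ[ℂ] HC V (2 * (p + 1) + 1)) +
    connesB e (2 * p + 1) ∘ₗ
      (LinearMap.proj p : (∀ p : ℕ, HC V (2 * p + 1)) →ₗ[ℂ] HC V (2 * p + 1))

/-- `b + uB` from degree `-1` to degree `0`. -/
def dOdd (μ : V →ₗ[ℂ] V →ₗ[ℂ] V) (e : V) : OddChains V →ₗ[ℂ] EvenChains V :=
  LinearMap.pi (dOddComp μ e)

/-- Degenerate even chains. -/
def degEven (e : V) : Submodule ℂ (EvenChains V) :=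
  Submodule.pi Set.univ fun p => degenerate e (2 * p)

/-- Degenerate odd chains. -/
def degOdd (e : V) : Submodule ℂ (OddChains V) :=
  Submodule.pi Set.univ fun p => degenerate e (2 * p + 1)

/-- Cocycles of degree `0` of the normalized periodic cyclic complex `(M((u)), b + uB)`. -/
def cycles (μ : V →ₗ[ℂ] V →ₗ[ℂ] V) (e : V) : Submodule ℂ (EvenChains V) :=
  (degOdd e).comap (dEven μ e)

/-- Coboundaries of degree `0` of the normalized periodic cyclic complex. -/
def boundaries (μ : V →ₗ[ℂ] V →ₗ[ℂ] V) (e : V) : Submodule ℂ (EvenChains V) :=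
  LinearMap.range (dOdd μ e) ⊔ degEven e

/-- Periodic cyclic homology in degree zero of the algebra `(V, μ, e)`. -/
abbrev HP (μ : V →ₗ[ℂ] V →ₗ[ℂ] V) (e : V) : Type :=
  cycles μ e ⧸ (boundaries μ e).comap (cycles μ e).subtype

/-- The Hodge filtration on periodic cyclic homology: `F^p` consists of the classes that are
represented by cocycles in `uᵖ M[[u]]`. -/
def hodgeF (μ : V →ₗ[ℂ] V →ₗ[ℂ] V) (e : V) (p : ℤ) : Submodule ℂ (HP μ e) :=
  ((Submodule.pi {j : ℕ | (j : ℤ) < p} fun j => degenerate e (2 * j)).comap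
    (cycles μ e).subtype).map ((boundaries μ e).comap (cycles μ e).subtype).mkQ

/-- Contraction with a Hochschild two-cochain `D`:
`a₀ ⊗ ⋯ ↦ a₀ D(a₁, a₂) ⊗ a₃ ⊗ ⋯`. -/
def contr (μ D : V →ₗ[ℂ] V →ₗ[ℂ] V) (k : ℕ) : HC V (k + 2) →ₗ[ℂ] HC V k :=
  mergeHead μ k ∘ₗ face D (k + 1) 1

/-- The cyclic correction to the contraction with a Hochschild two-cochain `D`:
the signed sum of all `e ⊗ aₗ₊₁ ⊗ ⋯ ⊗ aₖ ⊗ a₀ ⊗ ⋯ ⊗ D(aᵢ, aᵢ₊₁) ⊗ ⋯ ⊗ aₗ`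
with `1 ≤ i` and `i + 1 ≤ l ≤ k`, where `r = k - l`. -/
def contrS (e : V) (D : V →ₗ[ℂ] V →ₗ[ℂ] V) : ∀ k : ℕ, HC V k →ₗ[ℂ] HC V k
  | 0 => 0
  | k + 1 =>
    ∑ i ∈ Finset.Ico 1 (k + 1), ∑ r ∈ Finset.range (k + 1 - i),
      (-1 : ℂ) ^ (i + 1 + r * k) •
        (insertHead e k ∘ₗ (rot V k ^ r).toLinearMap ∘ₗ face D k i)

/-- Getzler's operator `u⁻¹ ι(D)` on even periodic cyclic chains, where `ι(D)` is the sum of the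
contraction with `D` and `u` times its cyclic correction. -/
def getzlerOp (μ : V →ₗ[ℂ] V →ₗ[ℂ] V) (e : V) (D : V →ₗ[ℂ] V →ₗ[ℂ] V)
    (c : EvenChains V) : EvenChains V :=
  fun p => contr μ D (2 * p) (c (p + 1)) + contrS e D (2 * p) (c p)

/-- The product of all tensor factors, from left to right. -/
def prodAll (μ : V →ₗ[ℂ] V →ₗ[ℂ] V) : ∀ k : ℕ, HC V k →ₗ[ℂ] V
  | 0 => (PiTensorProduct.subsingletonEquiv (0 : Fin 1)).toLinearMap
  | k + 1 => prodAll μ k ∘ₗ mergeHead μ k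

end Hochschild

/-! ### Quantum tori -/

/-- The underlying vector space of all quantum tori of dimension `n`, with its basis of
monomials `x₁^{g₁} ⋯ xₙ^{gₙ}`, `g ∈ ℤⁿ`. -/
abbrev TorusModule (n : ℕ) : Type := (Fin n → ℤ) →₀ ℂ

/-- The monomial `x₁^{g₁} ⋯ xₙ^{gₙ}`. -/
def monomial {n : ℕ} (g : Fin n → ℤ) : TorusModule n := Finsupp.single g 1

/-- The bilinear map on monomials given by structure constants `w`. -/
def twistedMul {n : ℕ} (w : (Fin n → ℤ) → (Fin n → ℤ) → ℂ) :
    TorusModule n →ₗ[ℂ] TorusModule n →ₗ[ℂ] TorusModule n :=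
  Finsupp.linearCombination ℂ fun g =>
    (Finsupp.linearCombination ℂ fun h => w g h • monomial (g + h) :
      TorusModule n →ₗ[ℂ] TorusModule n)

theorem twistedMul_monomial {n : ℕ} (w : (Fin n → ℤ) → (Fin n → ℤ) → ℂ) (g h : Fin n → ℤ) :
    twistedMul w (monomial g) (monomial h) = w g h • monomial (g + h) := by
  simp [twistedMul, monomial]

/-- The structure constants of the quantum torus in the basis of ordered monomials: since
`x_i x_j = q_ij x_j x_i`, one has `x^g x^h = ∏_{j < i} q_ij^{g_i h_j} x^{g+h}`. -/
def cocycle {n : ℕ} (q : QP n) (g h : Fin n → ℤ) : ℂ :=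
  ∏ i, ∏ j, if j < i then q.val i j ^ (g i * h j) else 1

/-- The product of the quantum torus `A_q`. -/
def torusMul {n : ℕ} (q : QP n) : TorusModule n →ₗ[ℂ] TorusModule n →ₗ[ℂ] TorusModule n :=
  twistedMul (cocycle q)

/-- The unit of the quantum torus. -/
def torusOne (n : ℕ) : TorusModule n := monomial 0

/-- The generator `x_i` of the quantum torus. -/
def torusGen {n : ℕ} (i : Fin n) : TorusModule n := monomial (Pi.single i 1)

/-- The action of the basis element `e_i = x_i ∂/∂x_i` of the Lie algebra of the torus. -/
def torusDer {n : ℕ} (i : Fin n) : TorusModule n →ₗ[ℂ] TorusModule n :=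
  Finsupp.linearCombination ℂ fun g => (g i : ℂ) • monomial g

/-- Projection onto the torus invariant part. -/
def torusTrace (n : ℕ) : TorusModule n →ₗ[ℂ] ℂ := Finsupp.lapply 0

/-- The pairing of `e_{I 1} ∧ ⋯ ∧ e_{I k}` with Hochschild chains:
`a₀ ⊗ ⋯ ⊗ aₖ ↦ (1 / k!) ∑_π sgn(π) τ(a₀ e_{I(π 1)}(a₁) ⋯ e_{I(π k)}(aₖ))`. -/
def pairing {n : ℕ} (q : QP n) (k : ℕ) (I : Fin k → Fin n) : HC (TorusModule n) k →ₗ[ℂ] ℂ :=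
  (k.factorial : ℂ)⁻¹ • ∑ π : Equiv.Perm (Fin k), ((Equiv.Perm.sign π : ℤ) : ℂ) •
    (torusTrace n ∘ₗ prodAll (torusMul q) k ∘ₗ
      PiTensorProduct.map
        (Fin.cons LinearMap.id (fun j => torusDer (I (π j))) :
          Fin (k + 1) → (TorusModule n →ₗ[ℂ] TorusModule n)))

theorem cocycle_add_left {n : ℕ} (q : QP n) (g g' h : Fin n → ℤ) :
    cocycle q (g + g') h = cocycle q g h * cocycle q g' h := by
  have h0 : ∀ i j, q.val i j ≠ 0 := fun i j => left_ne_zero_of_mul_eq_one (q.skew i j)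
  simp only [cocycle, ← Finset.prod_mul_distrib]
  refine Finset.prod_congr rfl fun i _ => Finset.prod_congr rfl fun j _ => ?_
  split_ifs
  · rw [Pi.add_apply, add_mul, zpow_add₀ (h0 i j)]
  · simp

theorem cocycle_add_right {n : ℕ} (q : QP n) (g h h' : Fin n → ℤ) :
    cocycle q g (h + h') = cocycle q g h * cocycle q g h' := by
  have h0 : ∀ i j, q.val i j ≠ 0 := fun i j => left_ne_zero_of_mul_eq_one (q.skew i j)
  simp only [cocycle, ← Finset.prod_mul_distrib]
  refine Finset.prod_congr rfl fun i _ => Finset.prod_congr rfl fun j _ => ?_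
  split_ifs
  · rw [Pi.add_apply, mul_add, zpow_add₀ (h0 i j)]
  · simp

theorem torusMul_assoc {n : ℕ} (q : QP n) (x y z : TorusModule n) :
    torusMul q (torusMul q x y) z = torusMul q x (torusMul q y z) := by
  have key : ∀ g h k : Fin n → ℤ,
      torusMul q (torusMul q (monomial g) (monomial h)) (monomial k) =
        torusMul q (monomial g) (torusMul q (monomial h) (monomial k)) := fun g h k => by
    simp only [torusMul, twistedMul_monomial, map_smul, LinearMap.smul_apply, smul_smul,
      cocycle_add_left, cocycle_add_right, add_assoc]
    congr 1
    ring
  induction x using Finsupp.induction_linear with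
  | zero => simp
  | add x x' hx hx' => simp [hx, hx']
  | single g a =>
    induction y using Finsupp.induction_linear with
    | zero => simp
    | add y y' hy hy' => simp only [map_add, LinearMap.add_apply, hy, hy']
    | single h b =>
      induction z using Finsupp.induction_linear with
      | zero => simp
      | add z z' hz hz' => simp only [map_add, hz, hz']
      | single k d =>
        have hs : ∀ (u : Fin n → ℤ) (a : ℂ),
            (Finsupp.single u a : TorusModule n) = a • monomial u := fun u a => by
          simp [monomial]
        simp only [hs, map_smul, LinearMap.smul_apply, key]

theorem torusMul_one {n : ℕ} (q : QP n) (x : TorusModule n) :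
    torusMul q x (torusOne n) = x ∧ torusMul q (torusOne n) x = x := by
  induction x using Finsupp.induction_linear with
  | zero => simp
  | add x y hx hy => simp [hx, hy]
  | single g a =>
    have hs : (Finsupp.single g a : TorusModule n) = a • monomial g := by simp [monomial]
    have h1 : cocycle q g 0 = 1 := by simp [cocycle]
    have h2 : cocycle q 0 g = 1 := by simp [cocycle]
    simp [hs, torusOne, torusMul, twistedMul_monomial, h1, h2]

theorem cocycle_single {n : ℕ} (q : QP n) (i j : Fin n) :
    cocycle q (Pi.single i 1) (Pi.single j 1) = if j < i then q.val i j else 1 := by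
  rw [cocycle, Finset.prod_eq_single i, Finset.prod_eq_single j]
  · simp
  · intro l _ hl; simp [hl]
  · simp
  · intro k _ hk
    exact Finset.prod_eq_one fun l _ => by simp [hk]
  · simp

/-- The defining relations `x_i x_j = q_ij x_j x_i` of the quantum torus. -/
theorem torusMul_gen {n : ℕ} (q : QP n) (i j : Fin n) :
    torusMul q (torusGen i) (torusGen j) = q.val i j • torusMul q (torusGen j) (torusGen i) := by
  simp only [torusMul, torusGen, twistedMul_monomial, cocycle_single, smul_smul]
  rw [add_comm (Pi.single j (1 : ℤ) : Fin n → ℤ)]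
  congr 1
  rcases lt_trichotomy i j with h | h | h
  · simp [h, h.not_gt, q.skew]
  · subst h; simp [q.diag]
  · simp [h, h.not_gt]

/-- Periodic cyclic homology in degree zero of the quantum torus `A_q`. -/
abbrev torusHP {n : ℕ} (q : QP n) : Type := HP (torusMul q) (torusOne n)

/-! ### The K-theory lattice of the commutative torus -/

/-- Even cohomology of `(ℂˣ)ⁿ`, that is even exterior powers of the dual of its Lie algebra:
a class is recorded by its values on the tuples `(e_{I 1}, …, e_{I 2p})`. -/
abbrev Coh (n : ℕ) : Type := ∀ p : ℕ, (Fin (2 * p) → Fin n) → ℂ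

/-- The Hochschild--Kostant--Rosenberg map on periodic cyclic chains of the commutative torus,
followed by the projection onto invariant forms. -/
def hkr (n : ℕ) : EvenChains (TorusModule n) →ₗ[ℂ] Coh n :=
  LinearMap.pi fun p => LinearMap.pi fun I =>
    pairing (1 : QP n) (2 * p) I ∘ₗ
      (LinearMap.proj p :
        (∀ p : ℕ, HC (TorusModule n) (2 * p)) →ₗ[ℂ] HC (TorusModule n) (2 * p))

/-- A smooth idempotent matrix on `(ℂˣ)ⁿ`, representing a smooth complex vector bundle. -/
structure SmoothIdempotent (n : ℕ) where
  size : ℕ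
  E : (Fin n → ℂ) → Matrix (Fin size) (Fin size) ℂ
  smooth : ∀ a b, ContDiffOn ℝ ∞ (fun x => E x a b) {x | ∀ i, x i ≠ 0}
  idem : ∀ x, (∀ i, x i ≠ 0) → E x * E x = E x

namespace SmoothIdempotent

variable {n : ℕ} (P : SmoothIdempotent n)

/-- The restriction to the compact torus, in angular coordinates. -/
def onTorus (θ : Fin n → ℝ) : Matrix (Fin P.size) (Fin P.size) ℂ :=
  P.E fun i => Complex.exp (θ i * Complex.I)

/-- The derivative along `e_j = x_j ∂/∂x_j = -i ∂/∂θ_j`. -/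
def deriv (j : Fin n) (θ : Fin n → ℝ) : Matrix (Fin P.size) (Fin P.size) ℂ :=
  Matrix.of fun a b =>
    -Complex.I * fderiv ℝ (fun θ' => P.onTorus θ' a b) θ (Pi.single j 1)

/-- The value on `(e_{I 1}, …, e_{I 2p})` of the degree `2p` component `tr(E (dE dE)ᵖ) / p!` of
the Chern character form of the connection `E d`. -/
def chernForm (p : ℕ) (I : Fin (2 * p) → Fin n) (θ : Fin n → ℝ) : ℂ :=
  (p.factorial : ℂ)⁻¹ * ∑ π : Equiv.Perm (Fin (2 * p)), ((Equiv.Perm.sign π : ℤ) : ℂ) *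
    Matrix.trace (P.onTorus θ * (List.ofFn fun j => P.deriv (I (π j)) θ).prod)

/-- The Chern character in de Rham cohomology: the class of a closed form on the torus is the
class of its average. -/
def chern : Coh n := fun p I =>
  ((2 * Real.pi : ℝ) : ℂ)⁻¹ ^ n *
    ∫ θ in Set.Icc (0 : Fin n → ℝ) (fun _ => 2 * Real.pi), P.chernForm p I θ

end SmoothIdempotent

/-- The image of the topological K-theory `K⁰((ℂˣ)ⁿ)` under the Chern character. -/
def chernLattice (n : ℕ) : AddSubgroup (Coh n) :=
  AddSubgroup.closure (Set.range SmoothIdempotent.chern)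

/-- The weight filtration on the even cohomology of `(ℂˣ)ⁿ`, where cohomology in degree `2p` has
weight `2p`, after the twist in K-theory. -/
def cohWeight (n : ℕ) (k : ℤ) : Submodule ℂ (Coh n) :=
  Submodule.pi {p : ℕ | k < 2 * (p : ℤ)} fun _ => ⊥

/-! ### The Gauss--Manin connection and parallel transport -/

/-- `c : ℝ → W` is a smooth family, with derivative `c'`, in a complex vector space `W`
(an element of `C^∞(ℝ) ⊗ W`, with its derivative). -/
def SmoothFamily {W : Type} [AddCommGroup W] [Module ℂ W] (c c' : ℝ → W) : Prop :=
  ∃ (N : ℕ) (f : Fin N → ℝ → ℂ) (w : Fin N → W), (∀ j, ContDiff ℝ ∞ (f j)) ∧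
    (∀ t, c t = ∑ j, f j t • w j) ∧ ∀ t, c' t = ∑ j, deriv (f j) t • w j

theorem SmoothFamily.zero {W : Type} [AddCommGroup W] [Module ℂ W] :
    SmoothFamily (0 : ℝ → W) 0 :=
  ⟨0, fun _ _ => 0, fun _ => 0, fun j => j.elim0, fun t => by simp, fun t => by simp⟩

theorem SmoothFamily.add {W : Type} [AddCommGroup W] [Module ℂ W] {c c' d d' : ℝ → W}
    (hc : SmoothFamily c c') (hd : SmoothFamily d d') : SmoothFamily (c + d) (c' + d') := by
  obtain ⟨N, f, w, hf, h1, h2⟩ := hc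
  obtain ⟨M, g, v, hg, h3, h4⟩ := hd
  refine ⟨N + M, Fin.append f g, Fin.append w v, ?_, fun t => ?_, fun t => ?_⟩
  · intro j
    induction j using Fin.addCases with
    | left j => simpa using hf j
    | right j => simpa using hg j
  · simp [Fin.sum_univ_add, h1, h3]
  · simp [Fin.sum_univ_add, h2, h4]

theorem SmoothFamily.smul {W : Type} [AddCommGroup W] [Module ℂ W] {c c' : ℝ → W} (a : ℂ)
    (hc : SmoothFamily c c') : SmoothFamily (a • c) (a • c') := by
  obtain ⟨N, f, w, hf, h1, h2⟩ := hc
  refine ⟨N, f, fun j => a • w j, hf, fun t => ?_, fun t => ?_⟩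
  · simp [h1, Finset.smul_sum, smul_comm a]
  · simp [h2, Finset.smul_sum, smul_comm a]

/-- A smooth path in the parameter space from the base point `1` to `q`. -/
structure QPath {n : ℕ} (q : QP n) where
  toFun : ℝ → QP n
  smooth : ∀ i j, ContDiff ℝ ∞ fun t => (toFun t).val i j
  start : toFun 0 = 1
  finish : toFun 1 = q

namespace QPath

variable {n : ℕ} {q : QP n} (γ : QPath q)

/-- The derivative along the path of the product of the quantum tori (in the basis of monomials,
in which the underlying module of the family is constant), a Hochschild two-cochain. -/
def mulDeriv (t : ℝ) : TorusModule n →ₗ[ℂ] TorusModule n →ₗ[ℂ] TorusModule n :=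
  twistedMul fun g h => deriv (fun s => cocycle (γ.toFun s) g h) t

/-- Flat sections of periodic cyclic homology along the path, at chain level: `c` is a smooth
family of cocycles, and its covariant derivative `c' - u⁻¹ ι(∂μ) c` with respect to Getzler's
Gauss--Manin connection is the coboundary of a smooth family `η` in the normalized complex. -/
def IsFlat (c : ℝ → EvenChains (TorusModule n)) : Prop :=
  ∃ (c' : ℝ → EvenChains (TorusModule n)) (η η' : ℝ → OddChains (TorusModule n)),
    (∀ p, SmoothFamily (fun t => c t p) fun t => c' t p) ∧
    (∀ p, SmoothFamily (fun t => η t p) fun t => η' t p) ∧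
    (∀ t, c t ∈ cycles (torusMul (γ.toFun t)) (torusOne n)) ∧
    ∀ t, c' t - getzlerOp (torusMul (γ.toFun t)) (torusOne n) (γ.mulDeriv t) (c t) -
      dOdd (torusMul (γ.toFun t)) (torusOne n) (η t) ∈ degEven (torusOne n)

/-- The space of flat sections along the path. -/
def flat : Submodule ℂ (ℝ → EvenChains (TorusModule n)) where
  carrier := {c | γ.IsFlat c}
  zero_mem' := by
    refine ⟨0, 0, 0, fun p => SmoothFamily.zero, fun p => SmoothFamily.zero,
      fun t => Submodule.zero_mem _, fun t => ?_⟩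
    have : getzlerOp (torusMul (γ.toFun t)) (torusOne n) (γ.mulDeriv t) 0 = 0 := by
      funext p; simp [getzlerOp]
    simp [this]
  add_mem' := by
    rintro c d ⟨c', η, η', h1, h2, h3, h4⟩ ⟨d', θ, θ', k1, k2, k3, k4⟩
    refine ⟨c' + d', η + θ, η' + θ', fun p => (h1 p).add (k1 p), fun p => (h2 p).add (k2 p),
      fun t => Submodule.add_mem _ (h3 t) (k3 t), fun t => ?_⟩
    have : getzlerOp (torusMul (γ.toFun t)) (torusOne n) (γ.mulDeriv t) (c t + d t) =
        getzlerOp (torusMul (γ.toFun t)) (torusOne n) (γ.mulDeriv t) (c t) +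
        getzlerOp (torusMul (γ.toFun t)) (torusOne n) (γ.mulDeriv t) (d t) := by
      funext p; simp [getzlerOp]; abel
    convert Submodule.add_mem _ (h4 t) (k4 t) using 1
    simp only [Pi.add_apply, this, map_add]
    abel
  smul_mem' := by
    rintro a c ⟨c', η, η', h1, h2, h3, h4⟩
    refine ⟨a • c', a • η, a • η', fun p => (h1 p).smul a, fun p => (h2 p).smul a,
      fun t => Submodule.smul_mem _ a (h3 t), fun t => ?_⟩
    have : getzlerOp (torusMul (γ.toFun t)) (torusOne n) (γ.mulDeriv t) (a • c t) =
        a • getzlerOp (torusMul (γ.toFun t)) (torusOne n) (γ.mulDeriv t) (c t) := by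
      funext p; simp [getzlerOp]
    convert Submodule.smul_mem _ a (h4 t) using 1
    simp only [Pi.smul_apply, this, map_smul, smul_sub]

/-- The value at the base point of a flat section, as a class in the cohomology of `(ℂˣ)ⁿ`. -/
def startClass : γ.flat →ₗ[ℂ] Coh n :=
  hkr n ∘ₗ LinearMap.proj (0 : ℝ) ∘ₗ γ.flat.subtype

theorem flat_mem_cycles (c : γ.flat) :
    c.1 1 ∈ cycles (torusMul q) (torusOne n) := by
  obtain ⟨_, _, _, _, _, h, _⟩ := c.2
  have h1 := h 1
  rwa [γ.finish] at h1

/-- The value at the end point of a flat section, as a periodic cyclic homology class. -/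
def endClass : γ.flat →ₗ[ℂ] torusHP q :=
  ((boundaries (torusMul q) (torusOne n)).comap
      (cycles (torusMul q) (torusOne n)).subtype).mkQ ∘ₗ
    LinearMap.codRestrict (cycles (torusMul q) (torusOne n))
      (LinearMap.proj (1 : ℝ) ∘ₗ γ.flat.subtype) γ.flat_mem_cycles

/-- The parallel transport to the end point of the K-theory lattice at the base point. -/
def lattice : Submodule ℤ (torusHP q) :=
  AddSubgroup.toIntSubmodule
    (((chernLattice n).comap γ.startClass.toAddMonoidHom).map γ.endClass.toAddMonoidHom)

/-- The parallel transport to the end point of the weight filtration at the base point. -/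
def weight (k : ℤ) : Submodule ℂ (torusHP q) :=
  ((cohWeight n k).comap γ.startClass).map γ.endClass

end QPath

/-! ### Mixed Hodge structures -/

/-- The data of an integral mixed Hodge structure. -/
structure HodgeData where
  dR : Type
  B : Type
  [dRGroup : AddCommGroup dR]
  [dRModule : Module ℂ dR]
  [BGroup : AddCommGroup B]
  /-- the comparison map -/
  c : B →ₗ[ℤ] dR
  /-- the Hodge filtration -/
  F : ℤ → Submodule ℂ dR
  /-- the weight filtration -/
  W : ℤ → Submodule ℂ dR

attribute [instance] HodgeData.dRGroup HodgeData.dRModule HodgeData.BGroup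

namespace HodgeData

/-- The `k`-th weight graded piece. -/
abbrev gr (X : HodgeData) (k : ℤ) : Type := X.W k ⧸ (X.W (k - 1)).comap (X.W k).subtype

/-- The subspace of the `k`-th weight graded piece induced by a subspace of `X.dR`. -/
def induced (X : HodgeData) (k : ℤ) (S : Submodule ℂ X.dR) : Submodule ℂ (X.gr k) :=
  (S.comap (X.W k).subtype).map ((X.W (k - 1)).comap (X.W k).subtype).mkQ

/-- The axioms of an integral mixed Hodge structure. The real structure is the complex
conjugation `σ` determined by the lattice. -/
structure IsMixedHodge (X : HodgeData) : Prop where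
  finite : Module.Finite ℤ X.B
  baseChange : IsBaseChange ℂ X.c
  F_anti : Antitone X.F
  F_bounded : ∃ a b, X.F a = ⊤ ∧ X.F b = ⊥
  W_mono : Monotone X.W
  W_bounded : ∃ a b, X.W a = ⊥ ∧ X.W b = ⊤
  /-- the weight filtration is defined over the rational numbers -/
  W_rational : ∀ k, X.W k = Submodule.span ℂ {x | x ∈ X.W k ∧ ∃ v, X.c v = x}
  /-- the Hodge filtration induces a pure Hodge structure of weight `k` on `gr k` -/
  opposed : ∃ σ : X.dR →ₛₗ[starRingEnd ℂ] X.dR, (∀ v, σ (X.c v) = X.c v) ∧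
    ∀ k : ℤ, DirectSum.IsInternal fun p : ℤ =>
      X.induced k (X.F p) ⊓ X.induced k ((X.F (k - p)).comap σ)

/-- Morphisms of (data of) mixed Hodge structures. -/
structure Hom (X Y : HodgeData) where
  onB : X.B →ₗ[ℤ] Y.B
  onDR : X.dR →ₗ[ℂ] Y.dR
  comm : ∀ v, onDR (X.c v) = Y.c (onB v)
  map_F : ∀ k x, x ∈ X.F k → onDR x ∈ Y.F k
  map_W : ∀ k x, x ∈ X.W k → onDR x ∈ Y.W k

/-- The `k`-th step `W_k X` of the weight filtration, with the induced lattice and filtrations. -/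
def weightStep (X : HodgeData) (k : ℤ) : HodgeData where
  dR := X.W k
  B := ((X.W k).restrictScalars ℤ).comap X.c
  c := AddMonoidHom.toIntLinearMap
    { toFun := fun v => ⟨X.c v.1, v.2⟩
      map_zero' := Subtype.ext (map_zero X.c)
      map_add' := fun v w => Subtype.ext (map_add X.c v.1 w.1) }
  F p := (X.F p).comap (X.W k).subtype
  W j := (X.W j).comap (X.W k).subtype

/-- An element of `W_k X`, viewed in `X.weightStep k`. -/
def weightStepMk (X : HodgeData) (k : ℤ) (x : X.dR) (h : x ∈ X.W k) : (X.weightStep k).dR :=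
  (⟨x, h⟩ : X.W k)

/-- `M(-j)`, i.e. `M ⊗ ℤ(-j)`, for an abelian group `M`: it is pure of type `(j, j)`, and its
lattice is `(2πi)⁻ʲ M`. -/
def tate (M : Type) [AddCommGroup M] (j : ℤ) : HodgeData where
  dR := ℂ ⊗[ℤ] M
  B := M
  c := TensorProduct.mk ℤ ℂ M ((2 * Real.pi * Complex.I) ^ (-j))
  F p := if p ≤ j then ⊤ else ⊥
  W k := if 2 * j ≤ k then ⊤ else ⊥

/-- The identity morphism. -/
def Hom.refl (X : HodgeData) : Hom X X :=
  ⟨LinearMap.id, LinearMap.id, fun _ => rfl, fun _ _ h => h, fun _ _ h => h⟩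

/-- Composition of morphisms. -/
def Hom.trans {X Y Z : HodgeData} (f : Hom X Y) (g : Hom Y Z) : Hom X Z :=
  ⟨g.onB ∘ₗ f.onB, g.onDR ∘ₗ f.onDR, fun v => by simp [f.comm, g.comm],
    fun k x h => g.map_F k _ (f.map_F k x h), fun k x h => g.map_W k _ (f.map_W k x h)⟩

end HodgeData

open HodgeData

/-! ### Extensions of mixed Hodge structures -/

/-- An extension `0 → Y → mid → X → 0` in the category of mixed Hodge structures. (In this
category a sequence is exact if and only if it is exact on the underlying abelian groups.) -/
structure Extension (X Y : HodgeData) where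
  mid : HodgeData
  isMixedHodge : mid.IsMixedHodge
  i : Hom Y mid
  p : Hom mid X
  inj : Function.Injective i.onB
  surj : Function.Surjective p.onB
  exact : Function.Exact i.onB p.onB

namespace Extension

variable {X Y : HodgeData}

/-- Congruence of extensions: an isomorphism of the middle terms, compatible with the maps. -/
def Congr (E E' : Extension X Y) : Prop :=
  ∃ (f : Hom E.mid E'.mid) (g : Hom E'.mid E.mid),
    (∀ v, g.onB (f.onB v) = v) ∧ (∀ v, f.onB (g.onB v) = v) ∧
    (∀ x, g.onDR (f.onDR x) = x) ∧ (∀ x, f.onDR (g.onDR x) = x) ∧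
    (∀ v, f.onB (E.i.onB v) = E'.i.onB v) ∧ (∀ v, E'.p.onB (f.onB v) = E.p.onB v)

instance setoid (X Y : HodgeData) : Setoid (Extension X Y) where
  r := Congr
  iseqv :=
    { refl := fun E => ⟨.refl _, .refl _, fun _ => rfl, fun _ => rfl, fun _ => rfl,
        fun _ => rfl, fun _ => rfl, fun _ => rfl⟩
      symm := by
        rintro E E' ⟨f, g, h1, h2, h3, h4, h5, h6⟩
        refine ⟨g, f, h2, h1, h4, h3, fun v => ?_, fun v => ?_⟩
        · rw [← h5, h1]
        · rw [← h6, h2]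
      trans := by
        rintro E E' E'' ⟨f, g, h1, h2, h3, h4, h5, h6⟩ ⟨f', g', k1, k2, k3, k4, k5, k6⟩
        refine ⟨f.trans f', g'.trans g, ?_, ?_, ?_, ?_, ?_, ?_⟩ <;> intro v <;>
          simp [Hom.trans, *] }

/-- The fibre product of two extensions over `X`. -/
def fibreProduct (E₁ E₂ : Extension X Y) : HodgeData where
  dR := LinearMap.eqLocus (E₁.p.onDR ∘ₗ LinearMap.fst ℂ E₁.mid.dR E₂.mid.dR)
    (E₂.p.onDR ∘ₗ LinearMap.snd ℂ E₁.mid.dR E₂.mid.dR)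
  B := LinearMap.eqLocus (E₁.p.onB ∘ₗ LinearMap.fst ℤ E₁.mid.B E₂.mid.B)
    (E₂.p.onB ∘ₗ LinearMap.snd ℤ E₁.mid.B E₂.mid.B)
  c :=
    { toFun := fun v => ⟨(E₁.mid.c v.1.1, E₂.mid.c v.1.2), by
        have h : E₁.p.onB v.1.1 = E₂.p.onB v.1.2 := v.2
        simp [LinearMap.mem_eqLocus, E₁.p.comm, E₂.p.comm, h]⟩
      map_add' := fun v w => by ext <;> simp
      map_smul' := fun a v => by ext <;> simp }
  F k := ((E₁.mid.F k).prod (E₂.mid.F k)).comap (Submodule.subtype _)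
  W k := ((E₁.mid.W k).prod (E₂.mid.W k)).comap (Submodule.subtype _)

/-- `E₃` is the Baer sum of `E₁` and `E₂`: there is a morphism from the fibre product of `E₁` and
`E₂` over `X` to `E₃` that lies over the identity of `X` and induces the addition
`Y × Y → Y` on the kernels. -/
def IsBaerSum (E₁ E₂ E₃ : Extension X Y) : Prop :=
  ∃ φ : Hom (fibreProduct E₁ E₂) E₃.mid,
    (∀ v, E₃.p.onB (φ.onB v) = E₁.p.onB v.1.1) ∧
    ∀ y y' v, v.1 = (E₁.i.onB y, E₂.i.onB y') → φ.onB v = E₃.i.onB (y + y')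

/-- Carlson's description of the class of an extension: `ψ = r ∘ s` for an integral retraction `r`
of the inclusion of `Y` and a section `s` of the projection to `X` that respects the Hodge
filtrations, both respecting the weights. The class is determined by `ψ` modulo
`F⁰ W₀ Hom_ℂ(X, Y) + W₀ Hom_ℤ(X, Y)`. -/
def HasCarlson (E : Extension X Y) (ψ : X.dR →ₗ[ℂ] Y.dR) : Prop :=
  ∃ (rB : E.mid.B →ₗ[ℤ] Y.B) (r : E.mid.dR →ₗ[ℂ] Y.dR) (s : X.dR →ₗ[ℂ] E.mid.dR),
    (∀ y, rB (E.i.onB y) = y) ∧ (∀ v, r (E.mid.c v) = Y.c (rB v)) ∧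
    (∀ k x, x ∈ E.mid.W k → r x ∈ Y.W k) ∧
    (∀ x, E.p.onDR (s x) = x) ∧ (∀ k x, x ∈ X.F k → s x ∈ E.mid.F k) ∧
    (∀ k x, x ∈ X.W k → s x ∈ E.mid.W k) ∧ ψ = r ∘ₗ s

end Extension

/-- `Ext¹(X, Y)` in the category of mixed Hodge structures (Yoneda). -/
def Ext (X Y : HodgeData) : Type 1 := Quotient (Extension.setoid X Y)

namespace Ext

variable {X Y : HodgeData}

/-- The class of an extension. -/
def mk (E : Extension X Y) : Ext X Y := Quotient.mk _ E

/-- The group law of `Ext¹`: `z` is the Baer sum of `x` and `y`. -/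
def IsSum (x y z : Ext X Y) : Prop :=
  ∃ E₁ E₂ E₃ : Extension X Y, mk E₁ = x ∧ mk E₂ = y ∧ mk E₃ = z ∧ E₁.IsBaerSum E₂ E₃

/-- The image of `ψ` under Carlson's projection from `Hom_ℂ(X, Y)` to `Ext¹(X, Y)` is `x`. -/
def HasCarlson (x : Ext X Y) (ψ : X.dR →ₗ[ℂ] Y.dR) : Prop :=
  ∃ E : Extension X Y, mk E = x ∧ E.HasCarlson ψ

end Ext

/-! ### The period map -/

/-- The free abelian group `∧² L`, where `L = ℤⁿ`. -/
abbrev wedgeTwo (n : ℕ) : Type := ⋀[ℤ]^2 (Fin n → ℤ)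

/-- The basis elements `l_i ∧ l_j`. -/
def wedge {n : ℕ} (i j : Fin n) : wedgeTwo n :=
  exteriorPower.ιMulti ℤ 2 ![Pi.single i 1, Pi.single j 1]

/-- The Hodge structure `(∧² L)(-1)`. -/
def wedgeTwist (n : ℕ) : HodgeData := tate (wedgeTwo n) 1

/-- The Hodge structure `ℤ`. -/
def unitHodge : HodgeData := tate ℤ 0

/-- The identification of the complex vector space underlying `ℤ` with `ℂ`. -/
def unitHodgeEquiv : unitHodge.dR ≃+ ℂ := (TensorProduct.rid ℤ ℂ).toAddEquiv

/-- The mixed Hodge structure `K⁰(A_q)`: periodic cyclic homology with its Hodge filtration, and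
with the lattice and the weight filtration that are transported along the path `γ`. -/
def kTheory {n : ℕ} {q : QP n} (γ : QPath q) : HodgeData where
  dR := torusHP q
  B := γ.lattice
  c := γ.lattice.subtype
  F := hodgeF (torusMul q) (torusOne n)
  W := γ.weight

/-- `(∧² L) ⊗ ℂ` as the degree two part of cohomology, where `l_i` corresponds to `dlog x_i`. -/
def degTwo {n : ℕ} (z : Coh n) : ℂ ⊗[ℤ] wedgeTwo n :=
  ∑ i, ∑ j, if i < j then z 1 ![i, j] ⊗ₜ[ℤ] wedge i j else 0

/-- The unit of cohomology. -/
def cohOne (n : ℕ) : Coh n := fun p _ => if p = 0 then 1 else 0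

/-- The maps of the canonical extension `0 → ℤ → W₂ K⁰(A_q) → (∧² L)(-1) → 0`: they are obtained
by parallel transport along `γ` from the base point, where they are the inclusion of the unit and
the projection to cohomology of degree two. -/
def IsCanonical {n : ℕ} {q : QP n} (γ : QPath q) (i : Hom unitHodge ((kTheory γ).weightStep 2))
    (p : Hom ((kTheory γ).weightStep 2) (wedgeTwist n)) : Prop :=
  (∃ (s : γ.flat) (h : γ.endClass s ∈ γ.weight 2), γ.startClass s = cohOne n ∧
    i.onDR ((1 : ℂ) ⊗ₜ[ℤ] (1 : ℤ)) = (kTheory γ).weightStepMk 2 (γ.endClass s) h) ∧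
  ∀ (s : γ.flat) (h : γ.endClass s ∈ γ.weight 2),
    p.onDR ((kTheory γ).weightStepMk 2 (γ.endClass s) h) = degTwo (γ.startClass s)

/-- `W₂ K⁰(A_q)` is a mixed Hodge structure, and with the canonical maps it is an extension of
`(∧² L)(-1)` by `ℤ` whose class is `x`. -/
def IsPeriod {n : ℕ} {q : QP n} (γ : QPath q) (x : Ext (wedgeTwist n) unitHodge) : Prop :=
  ∃ (hmid : ((kTheory γ).weightStep 2).IsMixedHodge)
    (i : Hom unitHodge ((kTheory γ).weightStep 2))
    (p : Hom ((kTheory γ).weightStep 2) (wedgeTwist n))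
    (hi : Function.Injective i.onB) (hp : Function.Surjective p.onB)
    (hip : Function.Exact i.onB p.onB),
    IsCanonical γ i p ∧ x = Ext.mk ⟨(kTheory γ).weightStep 2, hmid, i, p, hi, hp, hip⟩

/-- `period` is an isomorphism of complex Lie groups. The domain is a complex submanifold of the space
of matrices, and the complex structure on `Ext¹` is the one for which Carlson's projection from
`Hom_ℂ(X, Y)` is a local isomorphism. So a map into `Ext¹` is holomorphic if it lifts locally to a
holomorphic map into `Hom_ℂ(X, Y)`, and a map on `Ext¹` is holomorphic if its composition with
Carlson's projection is. -/
structure IsLieGroupIso {n : ℕ} {X Y : HodgeData} (period : QP n → Ext X Y) : Prop where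
  bijective : Function.Bijective period
  map_mul : ∀ q r, (period q).IsSum (period r) (period (q * r))
  holomorphic : ∀ q₀ : QP n, ∃ (U : Set (Fin n → Fin n → ℂ))
    (Ψ : (Fin n → Fin n → ℂ) → (X.dR →ₗ[ℂ] Y.dR)), IsOpen U ∧ q₀.val ∈ U ∧
    (∀ l : (X.dR →ₗ[ℂ] Y.dR) →ₗ[ℂ] ℂ, DifferentiableOn ℂ (fun z => l (Ψ z)) U) ∧
    ∀ q : QP n, q.val ∈ U → (period q).HasCarlson (Ψ q.val)
  inv_holomorphic : ∃ Q : (X.dR →ₗ[ℂ] Y.dR) → QP n,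
    (∀ ψ, (period (Q ψ)).HasCarlson ψ) ∧
    ∀ (m : ℕ) (l : (Fin m → ℂ) →ₗ[ℂ] (X.dR →ₗ[ℂ] Y.dR)) (i j : Fin n),
      Differentiable ℂ fun z => (Q (l z)).val i j

end QTori

end

open QTori

noncomputable section

namespace QTori

open Finset (range sum_congr sum_range_succ sum_range_succ' mem_range sum_nbij' Ico
  sum_Ico_consecutive mem_Ico sum_add_distrib smul_sum sum_empty sum_sub_distrib sum_range_add
  mul_sum sum_smul sum_eq_single sum_neg_distrib Ico_eq_empty range_zero sum_insert sum_eq_zero)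
open Submodule (subset_span span mem_comap smul_mem mem_sup_right mem_sup_left
  mem_span_singleton_self mem_bot mem_span_singleton mem_sup span_le mem_top)
open LinearMap (comp_apply toSpanSingleton id_apply mem_ker)
open Complex (exp log exp_add exp_log exp_ne_zero ofRealCLM arg exp_zero exp_neg contDiff_exp)
open Real (pi)
open TensorProduct (smul_tmul')

notation:max "Γ" n:max => Fin n → ℤ
notation:max "HT" n:max => HC (TorusModule n)
notation:max "Bil" V:max => V →ₗ[ℂ] V →ₗ[ℂ] V
notation "ⅈ" => Complex.I
notation:25 M:26 " ⊸ " N:25 => M →ₗ[ℂ] N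
notation:max "EV" n:max => EvenChains (TorusModule n)
notation:max "LΓ" n:max => List (Γ n)
notation:max "Θ" M:max => HodgeData.tate M 1
notation "⊡" => unitHodge
notation "℮" => unitHodgeEquiv
notation "ϖ" => (2 * (Real.pi : ℂ) * Complex.I)
notation "𝟏" => torusOne _
notation "μ₁" => torusMul 1

/-! ### Cyclic operators -/

section Cyclic

variable {C : ℕ → Type} [∀ k, AddCommGroup (C k)] [∀ k, Module ℂ (C k)]

/-- Integer powers of an automorphism, as linear maps. -/
def zp {W : Type} [AddCommGroup W] [Module ℂ W] (t : W ≃ₗ[ℂ] W) (a : ℤ) : W ⊸ W :=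
  (t ^ a : W ≃ₗ[ℂ] W).toLinearMap

section zp

variable {W : Type} [AddCommGroup W] [Module ℂ W] (t : W ≃ₗ[ℂ] W)

@[simp] lemma zp_zp (a b : ℤ) (x : W) : zp t a (zp t b x) = zp t (a + b) x := by
  simp [zp, zpow_add]

@[simp] lemma zp_zero (x : W) : zp t 0 x = x := by simp [zp]

lemma zp_ord {m : ℕ} (h : t ^ m = 1) (a : ℤ) (x : W) : zp t (a + m) x = zp t a x := by
  simp [zp, zpow_add, h]

lemma zp_sub_order {m : ℕ} (h : t ^ m = 1) (a : ℤ) (x : W) : zp t (a - m) x = zp t a x := by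
  rw [← zp_ord t h (a - m), sub_add_cancel]

lemma zp_order {m : ℕ} (h : t ^ m = 1) (x : W) : zp t m x = x := by
  simpa using zp_ord t h 0 x

end zp

/-- A graded vector space with a signed cyclic rotation `t`, a product `M` of the first two
tensor factors and the insertion `s` of a unit. -/
structure CyclicOps (C : ℕ → Type) [∀ k, AddCommGroup (C k)] [∀ k, Module ℂ (C k)] where
  t : ∀ k, C k ≃ₗ[ℂ] C k
  M : ∀ k, C (k + 1) ⊸ C k
  s : ∀ k, C k ⊸ C (k + 1)
  order : ∀ k, t k ^ (k + 1) = 1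
  assoc : ∀ k x, M k (zp (t (k + 1)) 1 (M (k + 1) x)) = -M k (M (k + 1) (zp (t (k + 2)) 1 x))
  comm : ∀ (k : ℕ) (a : ℤ) x, 2 ≤ a → a ≤ k + 1 →
    M k (zp (t (k + 1)) a (M (k + 1) x)) =
      -zp (t k) (a - 1) (M k (zp (t (k + 1)) (1 - a) (M (k + 1) (zp (t (k + 2)) a x))))
  M_s : ∀ k x, M k (s k x) = x
  M_t_s : ∀ k x, M k (zp (t (k + 1)) 1 (s k x)) = -zp (t k) 1 x
  comm_s : ∀ (k : ℕ) (a : ℤ) x, 2 ≤ a → a ≤ k + 2 →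
    M (k + 1) (zp (t (k + 2)) a (s (k + 1) x)) =
      -zp (t (k + 1)) (a - 1) (s k (zp (t k) (1 - a) (M k (zp (t (k + 1)) a x))))

notation:max "ϑ" P:max => zp (CyclicOps.t P _)
notation:max "ϱ" V:max => zp (rot V _)

namespace CyclicOps

variable (P : CyclicOps C)

def b (k : ℕ) : C (k + 1) ⊸ C k :=
  ∑ i ∈ range (k + 2), ϑ P i ∘ₗ P.M k ∘ₗ ϑ P (-i)

lemma b_apply (k : ℕ) (x : C (k + 1)) :
    P.b k x = ∑ i ∈ range (k + 2), ϑ P i (P.M k (ϑ P (-i) x)) := by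
  simp [b]

def b' (k : ℕ) : C (k + 1) ⊸ C k :=
  ∑ i ∈ range (k + 1), ϑ P i ∘ₗ P.M k ∘ₗ ϑ P (-i)

lemma b'_apply (k : ℕ) (x : C (k + 1)) :
    P.b' k x = ∑ i ∈ range (k + 1), ϑ P i (P.M k (ϑ P (-i) x)) := by
  simp [b']

def norm (k : ℕ) : C k ⊸ C k := ∑ i ∈ range (k + 1), ϑ P i

lemma norm_apply (k : ℕ) (x : C k) :
    P.norm k x = ∑ i ∈ range (k + 1), ϑ P i x := by
  simp [norm]

/-- Connes' operator on normalized chains. -/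
def B (k : ℕ) : C k ⊸ C (k + 1) := P.s k ∘ₗ P.norm k

lemma t_norm (k : ℕ) (x : C k) : ϑ P 1 (P.norm k x) = P.norm k x := by
  have h : ∀ i : ℕ, ϑ P 1 (ϑ P i x) = ϑ P ((i + 1 : ℕ) : ℤ) x := fun i => by
    rw [zp_zp]; congr 2; push_cast; ring
  rw [norm_apply, map_sum, sum_congr rfl fun i _ => h i,
    sum_range_succ, sum_range_succ' _ k, zp_order _ (P.order k)]
  simp

lemma b_eq (k : ℕ) (x : C (k + 1)) :
    P.b k x = P.b' k x + P.M k (ϑ P 1 x) := by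
  rw [b_apply, b'_apply, sum_range_succ]
  have h2 : ϑ P (-((k + 1 : ℕ) : ℤ)) x = ϑ P 1 x := by
    rw [← zp_ord _ (P.order (k + 1))]; congr 2; push_cast; ring
  rw [h2, zp_order _ (P.order k)]

lemma b_s (k : ℕ) (x : C (k + 1)) :
    P.b (k + 1) (P.s (k + 1) x) = x - ϑ P 1 x - P.s k (P.b' k x) := by
  rw [b_eq, P.M_t_s, b'_apply, sum_range_succ']
  have h : ∀ i ∈ range (k + 1), ϑ P ((i + 1 : ℕ) : ℤ)
      (P.M (k + 1) (ϑ P (-((i + 1 : ℕ) : ℤ)) (P.s (k + 1) x))) =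
      -P.s k (ϑ P i (P.M k (ϑ P (-i) x))) := by
    intro i hi
    rw [mem_range] at hi
    rw [← zp_ord _ (P.order (k + 2)), P.comm_s k _ _ (by push_cast; omega)
      (by push_cast; omega), map_neg, zp_zp,
      show ((i + 1 : ℕ) : ℤ) + (-((i + 1 : ℕ) : ℤ) + ((k + 2 + 1 : ℕ) : ℤ) - 1) =
        0 + ((k + 1 + 1 : ℕ) : ℤ) by push_cast; ring, zp_ord _ (P.order (k + 1)), zp_zero,
      show (1 : ℤ) - (-((i + 1 : ℕ) : ℤ) + ((k + 2 + 1 : ℕ) : ℤ)) = i - ((k + 1 : ℕ) : ℤ) by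
        push_cast; ring, zp_sub_order _ (P.order k),
      show -((i + 1 : ℕ) : ℤ) + ((k + 2 + 1 : ℕ) : ℤ) = -(i : ℤ) + ((k + 1 + 1 : ℕ) : ℤ) by
        push_cast; ring, zp_ord _ (P.order (k + 1))]
  rw [sum_congr rfl h, sum_neg_distrib, ← map_sum, ← b'_apply]
  simp [P.M_s]
  abel

lemma b'_norm (k : ℕ) (x : C (k + 1)) : P.b' k (P.norm (k + 1) x) = P.norm k (P.b k x) := by
  have h1 : ∀ a : ℤ, ϑ P a (P.norm (k + 1) x) = P.norm (k + 1) x := by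
    intro a
    induction a using Int.induction_on with
    | zero => simp
    | succ i ih => rw [add_comm (i : ℤ), ← zp_zp, ih, t_norm]
    | pred i ih =>
      nth_rw 1 [← P.t_norm]
      rw [zp_zp, sub_add_cancel, ih]
  have h2 : ∀ (a : ℤ) (y : C k), P.norm k (ϑ P a y) = P.norm k y := by
    intro a y
    have h3 : ∀ z, P.norm k (ϑ P 1 z) = P.norm k z := fun z => by
      rw [← P.t_norm k z, norm_apply, norm_apply, map_sum]
      exact sum_congr rfl fun i _ => by rw [zp_zp, zp_zp, add_comm]
    induction a using Int.induction_on with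
    | zero => simp
    | succ i ih => rw [add_comm (i : ℤ), ← zp_zp, h3, ih]
    | pred i ih => rw [← h3, zp_zp, add_sub_cancel, ih]
  rw [b'_apply, b_apply, map_sum]
  simp only [h1, h2, ← map_sum]
  rw [← norm_apply]
  congr 2
  rw [norm_apply, ← Finset.sum_range_reflect]
  rw [sum_range_succ, sum_range_succ' _ (k + 1)]
  congr 1
  · refine sum_congr rfl fun i hi => ?_
    rw [mem_range] at hi
    rw [← zp_ord _ (P.order (k + 1)) (-((i + 1 : ℕ) : ℤ))]
    congr 2; push_cast; omega
  · simp

lemma bB_add_Bb (k : ℕ) (x : C (k + 1)) :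
    P.b (k + 1) (P.B (k + 1) x) + P.B k (P.b k x) = 0 := by
  simp only [B, comp_apply]
  rw [b_s, t_norm, b'_norm]
  simp

end CyclicOps

end Cyclic

section HeadOp

variable {C : ℕ → Type} [∀ k, AddCommGroup (C k)] [∀ k, Module ℂ (C k)]

/-- An operator `X` which replaces the first `d + 1` tensor factors by one and is a Hochschild
cocycle. Here `A k` stands for `C (k + d)`, and `ε = (-1) ^ d`. -/
structure HeadOp (P : CyclicOps C) (A : ℕ → Type) [∀ k, AddCommGroup (A k)]
    [∀ k, Module ℂ (A k)] (d : ℕ) where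
  ε : ℂ
  ε_mul : ε * ε = 1
  t : ∀ k, A k ≃ₗ[ℂ] A k
  M : ∀ k, A (k + 1) ⊸ A k
  s : ∀ k, A k ⊸ A (k + 1)
  X : ∀ k, A k ⊸ C k
  order : ∀ k, t k ^ (k + d + 1) = 1
  comm : ∀ (k : ℕ) (a : ℤ) x, 2 ≤ a → a ≤ k + 1 →
    P.M k (ϑ P a (X (k + 1) x)) =
      ε • ϑ P (a - 1) (X k (zp (t k) (1 - a) (M k (zp (t (k + 1)) a x))))
  cocycle : ∀ k x, P.M k (X (k + 1) x) + P.M k (ϑ P 1 (X (k + 1)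
      (zp (t (k + 1)) (-1) x))) =
    ε • ∑ l ∈ range (d + 1), X k (zp (t k) l (M k (zp (t (k + 1)) (-l) x)))
  X_s : ∀ k x, ϑ P 1 (X (k + 1) (zp (t (k + 1)) (-1) (s k x))) =
    ε • P.s k (X k x)

notation:max "ξ" H:max => zp (HeadOp.t H _)

lemma sum_cartan_aux {W : Type} [AddCommGroup W] (h : ℤ → ℤ → W) (N d m : ℕ) (hm : m ≤ N)
    (per : ∀ a c, h (a - (N + d + 1 : ℕ)) (c + 1) = h a c) :
    ∑ i ∈ range (m + 1), ∑ l ∈ range m, h ((l : ℤ) - m) (-i) +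
      ∑ i ∈ range m, ∑ l ∈ range (d + 1), h l (-i - 1) +
      ∑ i ∈ range m, ∑ l ∈ Ico (m + 1) (N + 1), h ((l : ℤ) - m - N - 1) (-i) =
    ∑ i ∈ range m, ∑ l ∈ range (N + d + 2), h ((l : ℤ) - i - 1) (-i - 1) := by
  have e1 : ∀ i ∈ range m,
      ∑ l ∈ range (N + d + 2), h ((l : ℤ) - i - 1) (-i - 1) =
      ∑ α ∈ Ico 1 (i + 2), h (-(α : ℤ)) (-i - 1) +
      ∑ l ∈ range (d + 1), h l (-i - 1) +
      (∑ α ∈ Ico (i + 1) (m + 1), h (-(α : ℤ)) (-i) +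
       ∑ α ∈ Ico (m + 1) (N + 1), h (-(α : ℤ)) (-i)) := by
    intro i hi
    rw [mem_range] at hi
    rw [sum_Ico_consecutive _ (by omega) (by omega), Finset.range_eq_Ico,
      ← sum_Ico_consecutive _ (Nat.zero_le (i + 1)) (by omega : i + 1 ≤ N + d + 2),
      ← sum_Ico_consecutive _ (by omega : i + 1 ≤ i + d + 2) (by omega : i + d + 2 ≤ N + d + 2),
      ← add_assoc]
    congr 1
    · congr 1
      · refine sum_nbij' (fun l => i + 1 - l) (fun α => i + 1 - α) ?_ ?_ ?_ ?_ ?_ <;>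
          intro l hl <;> simp only [mem_Ico] at * <;> try omega
        congr 1; omega
      · refine sum_nbij' (fun l => l - (i + 1)) (fun α => α + (i + 1)) ?_ ?_ ?_ ?_ ?_ <;>
          intro l hl <;> simp only [mem_Ico, mem_range] at * <;> try omega
        congr 1; omega
    · refine sum_nbij' (fun l => N + d + 2 + i - l) (fun α => N + d + 2 + i - α)
        ?_ ?_ ?_ ?_ ?_ <;>
          intro l hl <;> simp only [mem_Ico] at * <;> try omega
      rw [← per]
      congr 1 <;> push_cast <;> omega
  rw [sum_congr rfl e1]
  simp only [sum_add_distrib]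
  have e2 : ∑ i ∈ range m, ∑ l ∈ Ico (m + 1) (N + 1), h ((l : ℤ) - m - N - 1) (-i) =
      ∑ i ∈ range m, ∑ α ∈ Ico (m + 1) (N + 1), h (-(α : ℤ)) (-i) := by
    refine sum_congr rfl fun i _ => ?_
    refine sum_nbij' (fun l => N + m + 1 - l) (fun α => N + m + 1 - α) ?_ ?_ ?_ ?_ ?_ <;>
          intro l hl <;> simp only [mem_Ico] at * <;> try omega
    congr 1; omega
  have e3 : ∑ i ∈ range (m + 1), ∑ l ∈ range m, h ((l : ℤ) - m) (-i) =
      ∑ i ∈ range m, ∑ α ∈ Ico 1 (i + 2), h (-(α : ℤ)) (-i - 1) +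
      ∑ i ∈ range m, ∑ α ∈ Ico (i + 1) (m + 1), h (-(α : ℤ)) (-i) := by
    have f1 : ∑ i ∈ range m, ∑ α ∈ Ico 1 (i + 2), h (-(α : ℤ)) (-i - 1) =
        ∑ i ∈ range (m + 1), ∑ α ∈ Ico 1 (i + 1), h (-(α : ℤ)) (-i) := by
      rw [sum_range_succ' _ m]
      simp only [Nat.cast_add, Nat.cast_one, neg_add]
      simp [sub_eq_add_neg]
    have f2 : ∑ i ∈ range m, ∑ α ∈ Ico (i + 1) (m + 1), h (-(α : ℤ)) (-i) =
        ∑ i ∈ range (m + 1), ∑ α ∈ Ico (i + 1) (m + 1), h (-(α : ℤ)) (-i) := by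
      rw [sum_range_succ _ m]; simp
    rw [f1, f2, ← sum_add_distrib]
    refine sum_congr rfl fun i hi => ?_
    rw [mem_range] at hi
    rw [sum_Ico_consecutive _ (by omega) (by omega)]
    refine sum_nbij' (fun l => m - l) (fun α => m - α) ?_ ?_ ?_ ?_ ?_ <;>
          intro l hl <;> simp only [mem_Ico, mem_range] at * <;> try omega
    congr 1; omega
  rw [e2, e3]
  abel

namespace HeadOp

variable {P : CyclicOps C} {A : ℕ → Type} [∀ k, AddCommGroup (A k)] [∀ k, Module ℂ (A k)]
  {d : ℕ} (H : HeadOp P A d)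

def b (k : ℕ) : A (k + 1) ⊸ A k :=
  ∑ i ∈ range (k + d + 2), ξ H i ∘ₗ H.M k ∘ₗ ξ H (-i)

lemma b_apply (k : ℕ) (x : A (k + 1)) :
    H.b k x = ∑ i ∈ range (k + d + 2), ξ H i (H.M k (ξ H (-i) x)) := by
  simp [b]

/-- Connes' operator on the source. -/
def B (k : ℕ) : A k ⊸ A (k + 1) := H.s k ∘ₗ ∑ i ∈ range (k + d + 1), ξ H i

def L (k : ℕ) : A k ⊸ C k :=
  ∑ i ∈ range (k + d + 1), ϑ P i ∘ₗ H.X k ∘ₗ ξ H (-i)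

def c (k : ℕ) : A (k + 1) ⊸ C k :=
  P.M k ∘ₗ ϑ P 1 ∘ₗ H.X (k + 1) ∘ₗ ξ H (-1)

def S' (k : ℕ) : A k ⊸ C k :=
  ∑ j ∈ range k, ∑ i ∈ range (j + 1),
    ϑ P (j + 1 : ℕ) ∘ₗ H.X k ∘ₗ ξ H (-(i + 1 : ℕ))

lemma S'_apply (k : ℕ) (x : A k) : H.S' k x =
    ∑ j ∈ range k, ∑ i ∈ range (j + 1),
      ϑ P (j + 1 : ℕ) (H.X k (ξ H (-(i + 1 : ℕ)) x)) := by
  simp [S']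

def S (k : ℕ) : A k ⊸ C (k + 1) := P.s k ∘ₗ H.S' k

lemma b'_S' (k : ℕ) (x : A (k + 1)) :
    P.b' k (H.S' (k + 1) x) = P.norm k (H.c k x) + H.ε • H.S' k (H.b k x) := by
  let f : ℕ → ℤ → ℤ → C k := fun m a c =>
    ϑ P m (H.X k (ξ H a (H.M k (ξ H c x))))
  let g1 : ℕ → ℕ → C k := fun m i =>
    ϑ P m (P.M k (ϑ P 1 (H.X (k + 1) (ξ H (-(i : ℤ)) x))))
  let g0 : ℕ → ℕ → C k := fun m i =>
    ϑ P m (P.M k (H.X (k + 1) (ξ H (-(i : ℤ)) x)))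
  have hg1 : ∀ m, g1 m 1 = ϑ P m (H.c k x) := fun m => by simp [g1, c]
  have hg : ∀ m i, g1 m (i + 2) + g0 m (i + 1) =
      H.ε • ∑ l ∈ range (d + 1), f m l (-l - i - 1) := by
    intro m i
    have := congrArg (ϑ P m) (H.cocycle k (ξ H (-((i + 1 : ℕ) : ℤ)) x))
    rw [map_add, map_smul, map_sum, zp_zp] at this
    rw [add_comm]
    simp only [g0, g1, f]
    rw [show -((i + 2 : ℕ) : ℤ) = -1 + -((i + 1 : ℕ) : ℤ) by push_cast; ring, this]
    congr 1
    refine sum_congr rfl fun l _ => ?_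
    rw [zp_zp]
    congr 5; push_cast; ring_nf
  have lo : ∀ m i l, l < m → m ≤ k → ϑ P l (P.M k (ϑ P (-l)
      (ϑ P (m + 1 : ℕ) (H.X (k + 1) (ξ H (-(i + 1 : ℕ)) x))))) =
      H.ε • f m ((l : ℤ) - m) (m - l - i) := by
    intro m i l hl hm
    rw [zp_zp, H.comm _ _ _ (by push_cast; omega) (by push_cast; omega), map_smul, zp_zp, zp_zp]
    congr 2
    · push_cast; congr 1; ring
    · congr 2
      · push_cast; congr 1; ring
      · congr 2; push_cast; ring_nf
  have hi : ∀ m i l, m + 2 ≤ l → l ≤ k → ϑ P l (P.M k (ϑ P (-l)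
      (ϑ P (m + 1 : ℕ) (H.X (k + 1) (ξ H (-(i + 1 : ℕ)) x))))) =
      H.ε • f (m + 1) ((l : ℤ) - (m + 1 : ℕ) - k - 1) ((m + 1 : ℕ) - l + k + 1 - i) := by
    intro m i l hl hm
    rw [zp_zp, ← zp_ord _ (P.order (k + 1)),
      H.comm _ _ _ (by push_cast; omega) (by push_cast; omega), map_smul, zp_zp, zp_zp]
    rw [show (l : ℤ) + (-(l : ℤ) + ((m + 1 : ℕ) : ℤ) + ((k + 1 + 1 : ℕ) : ℤ) - 1) =
      ((m + 1 : ℕ) : ℤ) + ((k + 1 : ℕ) : ℤ) by push_cast; ring, zp_ord _ (P.order k)]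
    congr 4
    · push_cast; ring_nf
    · congr 3; push_cast; ring
  have per1 : ∀ m a c, f m (a - (k + d + 1 : ℕ)) c = f m a c := fun m a c => by
    simp only [f, zp_sub_order _ (H.order k)]
  have per2 : ∀ m a c, f m a (c + (k + 1 + d + 1 : ℕ)) = f m a c := fun m a c => by
    simp only [f, zp_ord _ (H.order (k + 1))]
  -- the sum over `l` for fixed rotations
  have row : ∀ m i, m ≤ k → P.b' k (ϑ P (m + 1 : ℕ) (H.X (k + 1)
        (ξ H (-(i + 1 : ℕ)) x))) =
      H.ε • ∑ l ∈ range m, f m ((l : ℤ) - m) (m - l - i) + g1 m (i + 1) +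
      (if m + 1 ≤ k then g0 (m + 1) (i + 1) + H.ε • ∑ l ∈ Ico (m + 2) (k + 1),
        f (m + 1) ((l : ℤ) - (m + 1 : ℕ) - k - 1) ((m + 1 : ℕ) - l + k + 1 - i) else 0) := by
    intro m i hm
    have hmid : ϑ P m (P.M k (ϑ P (-m)
      (ϑ P (m + 1 : ℕ) (H.X (k + 1) (ξ H (-(i + 1 : ℕ)) x))))) =
      g1 m (i + 1) := by
      rw [zp_zp]; simp only [g1]; congr 4; push_cast; ring
    rw [CyclicOps.b'_apply, Finset.range_eq_Ico,
      ← sum_Ico_consecutive _ (Nat.zero_le m) (by omega : m ≤ k + 1),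
      Finset.sum_eq_sum_Ico_succ_bot (by omega : m < k + 1), ← Finset.range_eq_Ico, hmid,
      sum_congr rfl fun l hl => lo m i l (mem_range.1 hl) hm, ← smul_sum,
      ← add_assoc]
    congr 1
    split_ifs with h
    · rw [Finset.sum_eq_sum_Ico_succ_bot (by omega : m + 1 < k + 1), smul_sum]
      congr 1
      · rw [zp_zp]; simp only [g0]; rw [neg_add_cancel, zp_zero]
      · refine sum_congr rfl fun l hl => ?_
        rw [mem_Ico] at hl
        exact hi m i l (by omega) (by omega)
    · rw [Ico_eq_empty (by omega), sum_empty]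
  have e : P.b' k (H.S' (k + 1) x) = ∑ m ∈ range (k + 1),
      (∑ i ∈ range (m + 1), (H.ε • ∑ l ∈ range m, f m ((l : ℤ) - m) (m - l - i)
        + g1 m (i + 1)) +
      ∑ i ∈ range m, (g0 m (i + 1) + H.ε • ∑ l ∈ Ico (m + 1) (k + 1),
        f m ((l : ℤ) - m - k - 1) (m - l + k + 1 - i))) := by
    rw [sum_add_distrib, sum_range_succ' (fun m => ∑ i ∈ range m,
      (g0 m (i + 1) + _))]
    simp only [range_zero, sum_empty, add_zero]
    have hlast : ∑ m ∈ range k, ∑ i ∈ range (m + 1),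
        (g0 (m + 1) (i + 1) + H.ε • ∑ l ∈ Ico (m + 1 + 1) (k + 1),
        f (m + 1) ((l : ℤ) - (m + 1 : ℕ) - k - 1) ((m + 1 : ℕ) - l + k + 1 - i)) =
      ∑ m ∈ range (k + 1), ∑ i ∈ range (m + 1),
      (if m + 1 ≤ k then g0 (m + 1) (i + 1) + H.ε • ∑ l ∈ Ico (m + 2) (k + 1),
        f (m + 1) ((l : ℤ) - (m + 1 : ℕ) - k - 1) ((m + 1 : ℕ) - l + k + 1 - i) else 0) := by
      rw [sum_range_succ _ k]
      simp only [show ¬ k + 1 ≤ k by omega, if_false, Finset.sum_const_zero, add_zero]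
      refine sum_congr rfl fun m hm => sum_congr rfl fun i _ => ?_
      rw [mem_range] at hm
      rw [if_pos (by omega)]
    rw [hlast, ← sum_add_distrib]
    simp only [S', LinearMap.sum_apply, map_sum, comp_apply]
    refine sum_congr rfl fun m hm => ?_
    rw [mem_range] at hm
    rw [← sum_add_distrib]
    exact sum_congr rfl fun i _ => row m i (by omega)
  have e2 : H.S' k (H.b k x) = ∑ m ∈ range (k + 1), ∑ i ∈ range m,
      ∑ l ∈ range (k + d + 2), f m ((l : ℤ) - i - 1) (-l) := by
    rw [sum_range_succ', S'_apply]
    simp only [range_zero, sum_empty, add_zero, b_apply, map_sum]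
    refine sum_congr rfl fun m _ => sum_congr rfl fun i _ =>
      sum_congr rfl fun l _ => ?_
    rw [zp_zp]
    simp only [f]
    congr 3; push_cast; congr 1; ring
  rw [e, e2, CyclicOps.norm_apply, smul_sum, ← sum_add_distrib]
  refine sum_congr rfl fun m hm => ?_
  rw [mem_range] at hm
  have main := sum_cartan_aux (fun a c => f m a (c - a)) k d m (by omega) (fun a c => by
    rw [per1, show c + 1 - (a - ((k + d + 1 : ℕ) : ℤ)) = c - a + ((k + 1 + d + 1 : ℕ) : ℤ) by
      push_cast; ring, per2])
  have main' : ∑ i ∈ range m, ∑ l ∈ range (k + d + 2), f m ((l : ℤ) - i - 1) (-l) =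
    ∑ i ∈ range (m + 1), ∑ l ∈ range m, f m ((l : ℤ) - m) (m - l - i) +
      ∑ i ∈ range m, ∑ l ∈ range (d + 1), f m l (-l - i - 1) +
      ∑ i ∈ range m, ∑ l ∈ Ico (m + 1) (k + 1),
        f m ((l : ℤ) - m - k - 1) (m - l + k + 1 - i) := by
    have r1 : ∀ a c e : ℤ, c - a = e → f m a (c - a) = f m a e := fun a c e h => by rw [h]
    refine Eq.trans ?_ (main.symm.trans (congrArg₂ _ (congrArg₂ _ ?_ ?_) ?_)) <;>
      refine sum_congr rfl fun i _ => sum_congr rfl fun l _ => ?_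
    · exact (r1 _ _ _ (by ring)).symm
    all_goals exact r1 _ _ _ (by ring)
  rw [main', sum_add_distrib, sum_add_distrib, sum_range_succ' (fun i => g1 m (i + 1))]
  simp only [zero_add, hg1, smul_add, smul_sum]
  simp only [← smul_sum]
  rw [show H.ε • ∑ i ∈ range m, ∑ l ∈ range (d + 1), f m l (-l - i - 1) =
    ∑ i ∈ range m, (g1 m (i + 1 + 1) + g0 m (i + 1)) by
      rw [smul_sum]; exact sum_congr rfl fun i _ => (hg m i).symm,
    sum_add_distrib]
  abel

lemma c_B (k : ℕ) (x : A k) : H.ε • H.c k (H.B k x) =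
    ∑ i ∈ range (k + d + 1), H.X k (ξ H (-i) x) := by
  have h1 : H.ε • H.c k (H.B k x) = ∑ i ∈ range (k + d + 1), H.X k (ξ H i x) := by
    simp only [c, B, comp_apply]
    rw [H.X_s, map_smul, smul_smul, H.ε_mul, one_smul, P.M_s]
    simp
  rw [h1, sum_range_succ', sum_range_succ' _ (k + d)]
  congr 1
  rw [← Finset.sum_range_reflect]
  refine sum_congr rfl fun i hi => ?_
  rw [mem_range] at hi
  rw [← zp_ord _ (H.order k) (-((i + 1 : ℕ) : ℤ))]
  congr 3; push_cast; omega

lemma S'_sub_t_S' (k : ℕ) (x : A k) :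
    H.S' k x - ϑ P 1 (H.S' k x) =
      ∑ i ∈ range k, (ϑ P (i + 1 : ℕ) (H.X k (ξ H (-(i + 1 : ℕ)) x)) -
        H.X k (ξ H (-(i + 1 : ℕ)) x)) := by
  have tel : ∀ n, ∑ j ∈ range n, ∑ i ∈ range (j + 1),
      (ϑ P (j + 1 : ℕ) (H.X k (ξ H (-(i + 1 : ℕ)) x)) -
       ϑ P (j + 1 + 1 : ℕ) (H.X k (ξ H (-(i + 1 : ℕ)) x))) =
      ∑ i ∈ range n, (ϑ P (i + 1 : ℕ) (H.X k (ξ H (-(i + 1 : ℕ)) x)) -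
      ϑ P (n + 1 : ℕ) (H.X k (ξ H (-(i + 1 : ℕ)) x))) := by
    intro n
    induction n with
    | zero => simp
    | succ n ih =>
      rw [sum_range_succ, ih, sum_range_succ _ n, sum_range_succ _ n]
      simp only [sum_sub_distrib]
      abel
  have h1 : ϑ P 1 (H.S' k x) = ∑ j ∈ range k, ∑ i ∈ range (j + 1),
      ϑ P (j + 1 + 1 : ℕ) (H.X k (ξ H (-(i + 1 : ℕ)) x)) := by
    rw [S'_apply, map_sum]
    refine sum_congr rfl fun j _ => ?_
    rw [map_sum]
    refine sum_congr rfl fun i _ => ?_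
    rw [zp_zp]; congr 2; push_cast; ring
  rw [h1, S'_apply, ← sum_sub_distrib,
    sum_congr rfl fun j _ => (sum_sub_distrib _ _).symm, tel]
  exact sum_congr rfl fun i _ => by rw [zp_order _ (P.order k)]

lemma L_apply (hd : d ≤ 1) (k : ℕ) (x : A k) : H.L k x =
    ∑ i ∈ range k, ϑ P (i + 1 : ℕ) (H.X k (ξ H (-(i + 1 : ℕ)) x)) +
      ∑ i ∈ range d, H.X k (ξ H (-(k + i + 1 : ℕ)) x) + H.X k x := by
  simp only [L, LinearMap.sum_apply, comp_apply]
  rw [sum_range_succ', sum_range_add]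
  congr 1
  · congr 1
    refine sum_congr rfl fun i hi => ?_
    obtain rfl : i = 0 := by rw [mem_range] at hi; omega
    exact zp_order _ (P.order k) _

lemma cartan (hd : d ≤ 1) (k : ℕ) (x : A (k + 1)) :
    P.b (k + 1) (H.S (k + 1) x) + H.ε • H.S k (H.b k x) + P.B k (H.c k x) +
      H.ε • H.c (k + 1) (H.B (k + 1) x) = H.L (k + 1) x := by
  have h1 : P.b (k + 1) (H.S (k + 1) x) = P.b (k + 1) (P.s (k + 1) (H.S' (k + 1) x)) := rfl
  have h2 : H.S k (H.b k x) = P.s k (H.S' k (H.b k x)) := rfl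
  have h3 : P.B k (H.c k x) = P.s k (P.norm k (H.c k x)) := rfl
  rw [h1, h2, h3, P.b_s, b'_S', c_B, L_apply H hd, S'_sub_t_S', sum_range_succ' _ (k + 1 + d),
    sum_range_add _ (k + 1) d, sum_sub_distrib, map_add, map_smul]
  simp only [Nat.cast_zero, neg_zero, zp_zero]
  abel

lemma cartan_zero (x : A 0) : H.ε • H.c 0 (H.B 0 x) = H.L 0 x := by
  have h0 : ∀ (a : ℕ) (y : C 0), ϑ P a y = y := fun a y => by
    induction a with
    | zero => simp
    | succ a ih =>
      have := zp_ord _ (P.order 0) (a : ℤ) y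
      rw [ih] at this
      simpa using this
  rw [c_B]
  simp [L, h0]

lemma S_zero (x : A 0) : H.S 0 x = 0 := by simp [S, S']

lemma b_c (k : ℕ) (x : A (k + 2)) :
    P.b k (H.c (k + 1) x) = -(H.ε • H.c k (H.b (k + 1) x)) := by
  let F : ℕ → C k := fun i => P.M k (ϑ P 1 (H.X (k + 1)
    (ξ H (i - 1) (H.M (k + 1) (ξ H (-i) x)))))
  have hR : H.c k (H.b (k + 1) x) = ∑ i ∈ range (k + 1 + d + 2), F i := by
    simp only [c, comp_apply, b_apply, map_sum, zp_zp]
    refine sum_congr rfl fun i _ => ?_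
    simp only [F]; congr 4 <;> ring_nf
  have mt : ∀ y : C (k + 2), P.M k (P.M (k + 1) y) =
      -P.M k (ϑ P 1 (P.M (k + 1) (ϑ P (-1) y))) := fun y => by
    rw [P.assoc, zp_zp]; simp
  have t2 : ∀ y : A (k + 2), P.M (k + 1) (ϑ P 2 (H.X (k + 2) y)) =
      H.ε • ϑ P 1 (H.X (k + 1) (ξ H (-1)
        (H.M (k + 1) (ξ H 2 y)))) := fun y => by
    rw [H.comm (k + 1) 2 _ le_rfl (by push_cast; omega)]; norm_num
  -- the first and the last face
  have mtm : ∀ y : A (k + 2), P.M k (ϑ P 1 (P.M (k + 1) (ϑ P 1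
      (H.X (k + 2) y)))) = -(H.ε • P.M k (ϑ P 1 (H.X (k + 1) (ξ H (-1)
        (H.M (k + 1) (ξ H 2 y)))))) := fun y => by
    rw [P.assoc, zp_zp, show (1 : ℤ) + 1 = 2 by norm_num, t2, map_smul]
  have first : P.M k (H.c (k + 1) x) = -(H.ε • ∑ i ∈ range (d + 2), F i) := by
    rw [c, comp_apply, mt]
    simp only [comp_apply]
    rw [zp_zp]
    have hc := H.cocycle (k + 1) (ξ H (-1) x)
    rw [← eq_sub_iff_add_eq, zp_zp] at hc
    have hc' := congrArg (fun y => -P.M k (ϑ P 1 y)) hc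
    simp only [map_sub] at hc'
    rw [show (-1 : ℤ) + 1 = 0 by norm_num, zp_zero, hc', mtm, zp_zp]
    rw [sum_range_succ' F (d + 1)]
    simp only [map_smul, map_sum, zp_zp]
    rw [show ∑ i ∈ range (d + 1), P.M k (ϑ P 1 (H.X (k + 1)
      (ξ H i (H.M (k + 1) (ξ H (-(i : ℤ) + -1) x))))) =
      ∑ i ∈ range (d + 1), F (i + 1) from sum_congr rfl fun i _ => by
        simp only [F]; congr 5
        · push_cast; ring
        · congr 2; push_cast; ring]
    have f0 : F 0 = P.M k (ϑ P 1 (H.X (k + 1) (ξ H (-1)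
        (H.M (k + 1) (ξ H (2 + (-1 + -1)) x))))) := by
      simp [F]
    rw [f0, smul_add]
    abel
  have last : ϑ P (k + 1 : ℕ) (P.M k (ϑ P (-(k + 1 : ℕ))
      (H.c (k + 1) x))) = -(H.ε • F (k + 1 + d + 1)) := by
    rw [zp_order _ (P.order k), ← zp_ord _ (P.order (k + 1)), c]
    simp only [comp_apply]
    rw [show -((k + 1 : ℕ) : ℤ) + ((k + 1 + 1 : ℕ) : ℤ) = 1 by push_cast; ring, mtm, zp_zp]
    simp only [F]
    rw [← zp_ord _ (H.order (k + 1)) (-1), ← zp_ord _ (H.order (k + 2))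
      (-((k + 1 + d + 1 : ℕ) : ℤ))]
    congr 7
    push_cast; ring_nf
  have mid : ∀ l ∈ range k, ϑ P (l + 1 : ℕ) (P.M k (ϑ P (-(l + 1 : ℕ))
      (H.c (k + 1) x))) = -(H.ε • F (d + 2 + l)) := by
    intro l hl
    rw [mem_range] at hl
    simp only [c, comp_apply]
    rw [← zp_ord _ (P.order (k + 1)), P.comm k _ _ (by push_cast; omega)
      (by push_cast; omega), map_neg, zp_zp, zp_zp,
      ← zp_sub_order _ (P.order (k + 2)) (-((l + 1 : ℕ) : ℤ) + ((k + 1 + 1 : ℕ) : ℤ) + 1),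
      ← zp_ord _ (P.order (k + 2)),
      H.comm (k + 1) _ _ (by push_cast; omega) (by push_cast; omega), map_smul, map_smul, map_smul,
      zp_zp, zp_zp]
    rw [show ((l + 1 : ℕ) : ℤ) + (-((l + 1 : ℕ) : ℤ) + ((k + 1 + 1 : ℕ) : ℤ) - 1) =
      0 + (k + 1 : ℕ) by push_cast; ring, zp_ord _ (P.order k), zp_zero]
    simp only [F]
    rw [← zp_ord _ (H.order (k + 1)) _ (H.M (k + 1) _),
      ← zp_sub_order _ (H.order (k + 2)) _ x]
    congr 5
    · push_cast; ring
    · congr 2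
      · push_cast; ring
      · congr 2; push_cast; ring
  rw [hR, P.b_apply, sum_range_succ, last, sum_range_succ', sum_congr rfl mid,
    show k + 1 + d + 2 = (d + 2 + k) + 1 by ring, sum_range_succ, sum_range_add]
  simp only [Nat.cast_zero, neg_zero, zp_zero, first, sum_neg_distrib, ← smul_sum,
    smul_add, show k + 1 + d + 1 = d + 2 + k by ring]
  abel

end HeadOp

end HeadOp

/-! ### The cyclic operators on Hochschild chains -/

section Chains

variable {V : Type} [AddCommGroup V] [Module ℂ V]

/-- The elementary tensor with the first `k + 1` members of a sequence as factors. -/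
def tp (k : ℕ) (x : ℕ → V) : HC V k := PiTensorProduct.tprod ℂ fun i : Fin (k + 1) => x i

lemma tp_congr {k : ℕ} {x y : ℕ → V} (h : ∀ i ≤ k, x i = y i) : tp k x = tp k y := by
  unfold tp
  congr 1
  funext i
  exact h i (by omega)

lemma exists_tp {k : ℕ} (a : Fin (k + 1) → V) :
    ∃ x : ℕ → V, (∀ i : Fin (k + 1), x i = a i) ∧ PiTensorProduct.tprod ℂ a = tp k x := by
  have h : ∀ i : Fin (k + 1), (fun j : ℕ => a (Fin.ofNat (k + 1) j)) i = a i := fun i => by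
    simp only
    congr 1
    ext
    simp
  refine ⟨fun j => a (Fin.ofNat (k + 1) j), h, ?_⟩
  unfold tp
  congr 1
  funext i
  exact (h i).symm

lemma hc_ext {W : Type} [AddCommGroup W] [Module ℂ W] {k : ℕ} {f g : HC V k ⊸ W}
    (h : ∀ x : ℕ → V, f (tp k x) = g (tp k x)) : f = g := by
  refine PiTensorProduct.ext (MultilinearMap.ext fun a => ?_)
  obtain ⟨x, -, hx⟩ := exists_tp a
  simp only [LinearMap.compMultilinearMap_apply, hx, h]

lemma merge_tp (β : Bil V) (k : ℕ) (x : ℕ → V) :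
    mergeHead β k (tp (k + 1) x) = tp k fun i => if i = 0 then β (x 0) (x 1) else x (i + 1) := by
  unfold tp
  rw [mergeHead_tprod]
  congr 1
  funext i
  refine Fin.cases ?_ (fun j => ?_) i <;> simp

lemma ins_tp (e : V) (k : ℕ) (x : ℕ → V) :
    insertHead e k (tp k x) = tp (k + 1) fun i => if i = 0 then e else x (i - 1) := by
  unfold tp
  rw [insertHead_tprod]
  congr 1
  funext i
  refine Fin.cases ?_ (fun j => ?_) i <;> simp

lemma rot_tp (k : ℕ) (x : ℕ → V) :
    rot V k (tp k x) = tp k fun i => if i = 0 then x k else x (i - 1) := by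
  unfold tp
  rw [rot_tprod]
  congr 1
  funext i
  obtain ⟨j, rfl⟩ := (finRotate (k + 1)).surjective i
  rw [Equiv.symm_apply_apply, coe_finRotate]
  by_cases h : j = Fin.last k
  · simp [h]
  · simp [h]

lemma zp_rot_cast (k a : ℕ) (ha : a ≤ k + 1) (x : ℕ → V) :
    ϱ V a (tp k x) = tp k fun i => if i < a then x (i + (k + 1) - a) else x (i - a) := by
  induction a with
  | zero => simp
  | succ a ih =>
    rw [Nat.cast_succ, add_comm (a : ℤ), ← zp_zp, ih (by omega)]
    have : ϱ V 1 = (rot V k).toLinearMap := by simp [zp]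
    rw [this, LinearEquiv.coe_coe, rot_tp]
    refine tp_congr fun i hi => ?_
    split_ifs <;> first | omega | (congr 1; omega)

lemma rot_order (k : ℕ) : rot V k ^ (k + 1) = 1 := by
  apply LinearEquiv.toLinearMap_injective
  refine hc_ext fun x => ?_
  have := zp_rot_cast k (k + 1) le_rfl x
  simp only [zp, zpow_natCast] at this
  rw [this]
  exact tp_congr fun i hi => by rw [if_pos (by omega)]; congr 1; omega

lemma zp_rot_neg (k a : ℕ) (ha : a ≤ k + 1) (x : ℕ → V) :
    ϱ V (-a) (tp k x) =
      tp k fun i => if i + a ≤ k then x (i + a) else x (i + a - (k + 1)) := by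
  rw [← zp_ord _ (rot_order k), show -(a : ℤ) + ((k + 1 : ℕ) : ℤ) = ((k + 1 - a : ℕ) : ℤ) by
    omega, zp_rot_cast _ _ (by omega)]
  refine tp_congr fun i hi => ?_
  split_ifs <;> first | omega | (congr 1; omega)

lemma zp_rot_one (k : ℕ) (x : ℕ → V) :
    ϱ V 1 (tp k x) = tp k fun i => if i = 0 then x k else x (i - 1) := by
  rw [← rot_tp]; simp [zp]

def hMap (D : V ⊸ V) (k : ℕ) : HC V k ⊸ HC V k :=
  PiTensorProduct.map (Fin.cons D fun _ => LinearMap.id)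

lemma hMap_tp (D : V ⊸ V) (k : ℕ) (x : ℕ → V) :
    hMap D k (tp k x) = tp k fun i => if i = 0 then D (x 0) else x i := by
  unfold tp hMap
  rw [PiTensorProduct.map_tprod]
  congr 1
  funext i
  refine Fin.cases ?_ (fun j => ?_) i <;> simp

lemma merge_rot_merge (α β : Bil V) (k a : ℕ) (ha : a ≤ k) (h0 : 1 ≤ a)
    (x : HC V (k + 2)) :
    mergeHead α k (ϱ V (a + 1 : ℕ) (mergeHead β (k + 1) x)) =
      ϱ V a (mergeHead β k (ϱ V (-a)
        (mergeHead α (k + 1) (ϱ V (a + 1 : ℕ) x)))) := by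
  refine LinearMap.congr_fun (f := mergeHead α k ∘ₗ ϱ V (a + 1 : ℕ) ∘ₗ
    mergeHead β (k + 1)) (g := ϱ V a ∘ₗ mergeHead β k ∘ₗ ϱ V (-a) ∘ₗ
      mergeHead α (k + 1) ∘ₗ ϱ V (a + 1 : ℕ)) (hc_ext fun x => ?_) x
  simp only [comp_apply]
  rw [merge_tp, zp_rot_cast _ _ (by omega), merge_tp, zp_rot_cast _ _ (by omega),
    merge_tp, zp_rot_neg _ _ (by omega), merge_tp, zp_rot_cast _ _ (by omega)]
  refine tp_congr fun i hi => ?_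
  grind

lemma merge_rot_head (α : Bil V) (D : V ⊸ V) (k a : ℕ) (ha : a ≤ k)
    (h0 : 1 ≤ a) (x : HC V (k + 1)) :
    mergeHead α k (ϱ V (a + 1 : ℕ) (hMap D (k + 1) x)) =
      ϱ V a (hMap D k (ϱ V (-a)
        (mergeHead α k (ϱ V (a + 1 : ℕ) x)))) := by
  refine LinearMap.congr_fun (f := mergeHead α k ∘ₗ ϱ V (a + 1 : ℕ) ∘ₗ
    hMap D (k + 1)) (g := ϱ V a ∘ₗ hMap D k ∘ₗ ϱ V (-a) ∘ₗ
      mergeHead α k ∘ₗ ϱ V (a + 1 : ℕ)) (hc_ext fun x => ?_) x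
  simp only [comp_apply]
  rw [hMap_tp, zp_rot_cast _ _ (by omega), merge_tp, zp_rot_cast _ _ (by omega),
    merge_tp, zp_rot_neg _ _ (by omega), hMap_tp, zp_rot_cast _ _ (by omega)]
  refine tp_congr fun i hi => ?_
  grind

lemma merge_rot_insert (α : Bil V) (e : V) (k a : ℕ) (ha : a ≤ k + 1)
    (h0 : 1 ≤ a) (x : HC V (k + 1)) :
    mergeHead α (k + 1) (ϱ V (a + 1 : ℕ) (insertHead e (k + 1) x)) =
      ϱ V a (insertHead e k (ϱ V (-a)
        (mergeHead α k (ϱ V (a + 1 : ℕ) x)))) := by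
  refine LinearMap.congr_fun (f := mergeHead α (k + 1) ∘ₗ ϱ V (a + 1 : ℕ) ∘ₗ
    insertHead e (k + 1)) (g := ϱ V a ∘ₗ insertHead e k ∘ₗ ϱ V (-a) ∘ₗ
      mergeHead α k ∘ₗ ϱ V (a + 1 : ℕ)) (hc_ext fun x => ?_) x
  simp only [comp_apply]
  rw [ins_tp, zp_rot_cast _ _ (by omega), merge_tp, zp_rot_cast _ _ (by omega),
    merge_tp, zp_rot_neg _ _ (by omega), ins_tp, zp_rot_cast _ _ (by omega)]
  refine tp_congr fun i hi => ?_
  grind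

def srot (V : Type) [AddCommGroup V] [Module ℂ V] (k : ℕ) : HC V k ≃ₗ[ℂ] HC V k :=
  LinearEquiv.smulOfNeZero ℂ (HC V k) ((-1) ^ k) (by simp) * rot V k

lemma zp_srot (k : ℕ) (a : ℤ) (x : HC V k) :
    zp (srot V k) a x = ((-1 : ℂ) ^ k) ^ a • ϱ V a x := by
  have hs : ∀ x : HC V k, LinearEquiv.smulOfNeZero ℂ (HC V k) ((-1 : ℂ) ^ k) (by simp) x =
      (-1 : ℂ) ^ k • x := fun x => rfl
  have hc : Commute (LinearEquiv.smulOfNeZero ℂ (HC V k) ((-1 : ℂ) ^ k) (by simp)) (rot V k) := by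
    refine LinearEquiv.ext fun x => ?_
    simp only [LinearEquiv.mul_apply, hs, map_smul]
  have h1 : ∀ y, (LinearEquiv.smulOfNeZero ℂ (HC V k) ((-1 : ℂ) ^ k) (by simp) ^ a) y =
      ((-1 : ℂ) ^ k) ^ a • y := by
    intro y
    rcases neg_one_pow_eq_or ℂ k with h | h
    · have : LinearEquiv.smulOfNeZero ℂ (HC V k) ((-1 : ℂ) ^ k) (by simp) = 1 := by
        refine LinearEquiv.ext fun x => ?_; rw [hs, h]; simp
      rw [this, h]; simp
    · set u := LinearEquiv.smulOfNeZero ℂ (HC V k) ((-1 : ℂ) ^ k) (by simp)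
      have h2 : ∀ x, u x = -x := fun x => by rw [hs, h]; simp
      have h3 : u ^ 2 = 1 := by refine LinearEquiv.ext fun x => ?_; simp [pow_two, h2]
      rw [h]
      rcases Int.even_or_odd' a with ⟨c, rfl | rfl⟩
      · rw [zpow_mul, zpow_mul]; simp [show u ^ (2 : ℤ) = 1 by exact_mod_cast h3]
      · rw [zpow_add₀ (by simp), zpow_mul, zpow_add, zpow_mul]
        simp [show u ^ (2 : ℤ) = 1 by exact_mod_cast h3, h2]
  rw [zp, srot, hc.mul_zpow]
  simp only [zp, LinearEquiv.coe_coe, LinearEquiv.mul_apply]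
  exact h1 _

lemma sign_cast (k a : ℕ) : ((-1 : ℂ) ^ k) ^ (a : ℤ) = (-1) ^ (k * a) := by
  rw [zpow_natCast, pow_mul]

lemma sign_neg (k a : ℕ) : ((-1 : ℂ) ^ k) ^ (-(a : ℤ)) = (-1) ^ (k * a) := by
  rw [zpow_neg, sign_cast, ← inv_pow]; norm_num

lemma sign_one (k : ℕ) : ((-1 : ℂ) ^ k) ^ (1 : ℤ) = (-1) ^ k := zpow_one _

def ops (μ : Bil V) (e : V) (hμ : ∀ x y z, μ (μ x y) z = μ x (μ y z))
    (he : ∀ x, μ e x = x) (he' : ∀ x, μ x e = x) : CyclicOps (HC V) where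
  t := srot V
  M := mergeHead μ
  s := insertHead e
  order k := by
    refine LinearEquiv.ext fun x => ?_
    have h := zp_srot (V := V) k (k + 1 : ℕ) x
    rw [sign_cast, Even.neg_one_pow (Nat.even_mul_succ_self k), one_smul,
      zp_order _ (rot_order k)] at h
    rw [zp, zpow_natCast] at h
    exact h
  assoc k x := by
    simp only [zp_srot, map_smul, sign_one]
    rw [pow_succ _ (k + 1), mul_neg_one, neg_smul, neg_neg]
    congr 1
    refine LinearMap.congr_fun (f := mergeHead μ k ∘ₗ ϱ V 1 ∘ₗ mergeHead μ (k + 1))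
      (g := mergeHead μ k ∘ₗ mergeHead μ (k + 1) ∘ₗ ϱ V 1) (hc_ext fun x => ?_) x
    simp only [comp_apply, merge_tp, zp_rot_one]
    refine tp_congr fun i hi => ?_
    by_cases h : i = 0
    · simp [h, hμ]
    · simp [h]
  comm k a x h1 h2 := by
    obtain ⟨a, rfl⟩ : ∃ a' : ℕ, a = ((a' + 1 : ℕ) : ℤ) := ⟨(a - 1).toNat, by omega⟩
    have e1 : ((a + 1 : ℕ) : ℤ) - 1 = (a : ℕ) := by push_cast; ring
    have e2 : 1 - ((a + 1 : ℕ) : ℤ) = -(a : ℕ) := by push_cast; ring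
    rw [e1, e2]
    simp only [zp_srot, map_smul, smul_smul, sign_cast, sign_neg]
    rw [merge_rot_merge _ _ _ _ (by omega) (by omega), ← neg_smul]
    congr 1
    rw [← pow_add, ← pow_add, ← neg_one_mul ((-1 : ℂ) ^ _), ← pow_succ']
    refine neg_one_pow_congr ?_
    simp only [Nat.even_add, Nat.even_mul, Nat.even_add_one, parity_simps]
    tauto
  M_s k x := by
    refine LinearMap.congr_fun (f := mergeHead μ k ∘ₗ insertHead e k) (g := LinearMap.id)
      (hc_ext fun x => ?_) x
    simp only [comp_apply, merge_tp, ins_tp]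
    refine tp_congr fun i hi => ?_
    by_cases h : i = 0
    · simp [h, he]
    · simp [h]
  M_t_s k x := by
    simp only [zp_srot, map_smul, sign_one]
    rw [pow_succ, mul_neg_one, neg_smul]
    congr 2
    refine LinearMap.congr_fun (f := mergeHead μ k ∘ₗ ϱ V 1 ∘ₗ insertHead e k)
      (g := ϱ V 1) (hc_ext fun x => ?_) x
    simp only [comp_apply, merge_tp, ins_tp, zp_rot_one]
    refine tp_congr fun i hi => ?_
    by_cases h : i = 0
    · simp [h, he']
    · simp [h]
  comm_s k a x h1 h2 := by
    obtain ⟨a, rfl⟩ : ∃ a' : ℕ, a = ((a' + 1 : ℕ) : ℤ) := ⟨(a - 1).toNat, by omega⟩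
    have e1 : ((a + 1 : ℕ) : ℤ) - 1 = (a : ℕ) := by push_cast; ring
    have e2 : 1 - ((a + 1 : ℕ) : ℤ) = -(a : ℕ) := by push_cast; ring
    rw [e1, e2]
    simp only [zp_srot, map_smul, smul_smul, sign_cast, sign_neg]
    rw [merge_rot_insert _ _ _ _ (by omega) (by omega), ← neg_smul]
    congr 1
    rw [← pow_add, ← pow_add, ← neg_one_mul ((-1 : ℂ) ^ _), ← pow_succ']
    refine neg_one_pow_congr ?_
    simp only [Nat.even_add, Nat.even_mul, Nat.even_add_one, parity_simps]
    tauto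

lemma ex_head (k : ℕ) (x : ℕ → V) : ∃ h : V ⊸ HC V k,
    ∀ y, h y = tp k fun i => if i = 0 then y else x i := by
  refine ⟨(PiTensorProduct.tprod ℂ).toLinearMap (fun i : Fin (k + 1) => x i) 0, fun y => ?_⟩
  rw [MultilinearMap.toLinearMap_apply]
  unfold tp
  congr 1
  funext i
  refine Fin.cases ?_ (fun j => ?_) i <;> simp [Function.update]

lemma merge_merge_tp (α β : Bil V) (k : ℕ) (x : ℕ → V) :
    mergeHead α k (mergeHead β (k + 1) (tp (k + 2) x)) =
      tp k fun i => if i = 0 then α (β (x 0) (x 1)) (x 2) else x (i + 2) := by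
  rw [merge_tp, merge_tp]
  exact tp_congr fun i hi => by grind

lemma merge_rot_merge_tp (α β : Bil V) (k : ℕ) (x : ℕ → V) :
    mergeHead α k (ϱ V 1 (mergeHead β (k + 1) (ϱ V (-1)
      (tp (k + 2) x)))) =
      tp k fun i => if i = 0 then α (x 0) (β (x 1) (x 2)) else x (i + 2) := by
  have hr := zp_rot_neg (V := V) (k + 2) 1 (by omega) x
  rw [Nat.cast_one] at hr
  rw [hr, merge_tp, zp_rot_one, merge_tp]
  exact tp_congr fun i hi => by grind

section HeadOps

variable {μ : Bil V} {e : V} (hμ : ∀ x y z, μ (μ x y) z = μ x (μ y z))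
  (he : ∀ x, μ e x = x) (he' : ∀ x, μ x e = x)

/-- A Hochschild two-cocycle as an operator on the first two tensor factors. -/
def twoOp (D : Bil V)
    (hD : ∀ x y z, μ x (D y z) - D (μ x y) z + D x (μ y z) - μ (D x y) z = 0) :
    HeadOp (ops μ e hμ he he') (fun k => HC V (k + 1)) 1 where
  ε := -1
  ε_mul := by norm_num
  t k := srot V (k + 1)
  M k := mergeHead μ (k + 1)
  s k := insertHead e (k + 1)
  X k := mergeHead D k
  order k := (ops μ e hμ he he').order (k + 1)
  comm k a x h1 h2 := by
    obtain ⟨a, rfl⟩ : ∃ a' : ℕ, a = ((a' + 1 : ℕ) : ℤ) := ⟨(a - 1).toNat, by omega⟩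
    have e1 : ((a + 1 : ℕ) : ℤ) - 1 = (a : ℕ) := by push_cast; ring
    have e2 : 1 - ((a + 1 : ℕ) : ℤ) = -(a : ℕ) := by push_cast; ring
    rw [e1, e2]
    simp only [ops, zp_srot, map_smul, smul_smul, sign_cast, sign_neg]
    rw [merge_rot_merge _ _ _ _ (by omega) (by omega)]
    congr 1
    rw [← pow_add, neg_one_mul, ← pow_add, ← neg_one_mul ((-1 : ℂ) ^ _), ← pow_succ']
    refine neg_one_pow_congr ?_
    simp only [Nat.even_add, Nat.even_mul, Nat.even_add_one, parity_simps]
    tauto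
  cocycle k x := by
    simp only [ops, zp_srot, map_smul, smul_smul, sum_range_succ, range_zero,
      sum_empty, zero_add, sign_one, sign_cast, sign_neg, Nat.cast_zero, neg_zero,
      zp_zero, Nat.cast_one,
      show ((-1 : ℂ) ^ (k + 1 + 1)) ^ (-1 : ℤ) = (-1) ^ k by
        have := sign_neg (k + 1 + 1) 1; simpa [pow_succ] using this]
    have s1 : (-1 : ℂ) ^ k * (-1) ^ (k + 1) = -1 := by
      rw [← pow_add]; exact Odd.neg_one_pow ⟨k, by ring⟩
    have s2 : (-1 : ℂ) ^ (k + 1 + 1) * (-1) ^ (k + 1) = -1 := by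
      rw [← pow_add]; exact Odd.neg_one_pow ⟨k + 1, by ring⟩
    simp only [s1, s2, mul_zero, pow_zero, mul_one, neg_one_smul, one_smul]
    refine LinearMap.congr_fun (f := mergeHead μ k ∘ₗ mergeHead D (k + 1) + -(mergeHead μ k ∘ₗ
      ϱ V 1 ∘ₗ mergeHead D (k + 1) ∘ₗ ϱ V (-1)))
      (g := -(mergeHead D k ∘ₗ mergeHead μ (k + 1) + -(mergeHead D k ∘ₗ
      ϱ V 1 ∘ₗ mergeHead μ (k + 1) ∘ₗ ϱ V (-1)))) (hc_ext fun x => ?_) x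
    simp only [LinearMap.add_apply, LinearMap.neg_apply, comp_apply, merge_merge_tp,
      merge_rot_merge_tp]
    obtain ⟨h, hh⟩ := ex_head k (fun i => x (i + 2))
    simp only [← hh]
    have h0 := congrArg h (hD (x 0) (x 1) (x 2))
    rw [map_sub h, map_add h, map_sub h, map_zero h] at h0
    rw [← sub_eq_zero, ← neg_eq_zero, ← h0]
    abel
  X_s k x := by
    simp only [ops, zp_srot, map_smul, smul_smul, sign_one,
      show ((-1 : ℂ) ^ (k + 1 + 1)) ^ (-1 : ℤ) = (-1) ^ k by
        have := sign_neg (k + 1 + 1) 1; simpa [pow_succ] using this]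
    rw [show (-1 : ℂ) ^ k * (-1) ^ (k + 1) = -1 by rw [← pow_add]; exact Odd.neg_one_pow ⟨k, by ring⟩]
    congr 1
    refine LinearMap.congr_fun (f := ϱ V 1 ∘ₗ mergeHead D (k + 1) ∘ₗ
      ϱ V (-1) ∘ₗ insertHead e (k + 1)) (g := insertHead e k ∘ₗ mergeHead D k)
      (hc_ext fun x => ?_) x
    have hr := fun x => zp_rot_neg (V := V) (k + 2) 1 (by omega) x
    simp only [Nat.cast_one] at hr
    simp only [comp_apply, hr, merge_tp, zp_rot_one, ins_tp]
    refine tp_congr fun i hi => ?_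
    grind

def oneOp (D : V ⊸ V) (hD : ∀ x y, D (μ x y) = μ (D x) y + μ x (D y)) :
    HeadOp (ops μ e hμ he he') (fun k => HC V k) 0 where
  ε := 1
  ε_mul := by norm_num
  t k := srot V k
  M k := mergeHead μ k
  s k := insertHead e k
  X k := hMap D k
  order k := (ops μ e hμ he he').order k
  comm k a x h1 h2 := by
    obtain ⟨a, rfl⟩ : ∃ a' : ℕ, a = ((a' + 1 : ℕ) : ℤ) := ⟨(a - 1).toNat, by omega⟩
    have e1 : ((a + 1 : ℕ) : ℤ) - 1 = (a : ℕ) := by push_cast; ring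
    have e2 : 1 - ((a + 1 : ℕ) : ℤ) = -(a : ℕ) := by push_cast; ring
    rw [e1, e2]
    simp only [ops, zp_srot, map_smul, smul_smul, sign_cast, sign_neg]
    rw [merge_rot_head _ _ _ _ (by omega) (by omega)]
    congr 1
    rw [one_mul, ← pow_add, ← pow_add]
    refine neg_one_pow_congr ?_
    simp only [Nat.even_add, Nat.even_mul, Nat.even_add_one, parity_simps]
    tauto
  cocycle k x := by
    have s1 : ((-1 : ℂ) ^ (k + 1)) ^ (-1 : ℤ) = (-1) ^ (k + 1) := by
      have := sign_neg (k + 1) 1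
      simpa [pow_succ] using this
    simp only [ops, zp_srot, map_smul, smul_smul, sum_range_succ, range_zero,
      sum_empty, zero_add, sign_one, Nat.cast_zero, neg_zero, zpow_zero, mul_one,
      zp_zero, one_smul, s1]
    rw [show (-1 : ℂ) ^ (k + 1) * (-1) ^ (k + 1) = 1 by
      rw [← pow_add]; exact Even.neg_one_pow ⟨k + 1, by ring⟩, one_smul]
    refine LinearMap.congr_fun (f := mergeHead μ k ∘ₗ hMap D (k + 1) + mergeHead μ k ∘ₗ
      ϱ V 1 ∘ₗ hMap D (k + 1) ∘ₗ ϱ V (-1))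
      (g := hMap D k ∘ₗ mergeHead μ k) (hc_ext fun x => ?_) x
    have hr := zp_rot_neg (V := V) (k + 1) 1 (by omega) x
    rw [Nat.cast_one] at hr
    have h1 : mergeHead μ k (hMap D (k + 1) (tp (k + 1) x)) =
        tp k fun i => if i = 0 then μ (D (x 0)) (x 1) else x (i + 1) := by
      rw [hMap_tp, merge_tp]
      exact tp_congr fun i hi => by grind
    have h2 : mergeHead μ k (ϱ V 1 (hMap D (k + 1) (ϱ V (-1)
        (tp (k + 1) x)))) = tp k fun i => if i = 0 then μ (x 0) (D (x 1)) else x (i + 1) := by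
      rw [hr, hMap_tp, zp_rot_one, merge_tp]
      exact tp_congr fun i hi => by grind
    have h3 : hMap D k (mergeHead μ k (tp (k + 1) x)) =
        tp k fun i => if i = 0 then D (μ (x 0) (x 1)) else x (i + 1) := by
      rw [merge_tp, hMap_tp]
      exact tp_congr fun i hi => by grind
    simp only [LinearMap.add_apply, comp_apply, h1, h2, h3]
    obtain ⟨h, hh⟩ := ex_head k (fun i => x (i + 1))
    simp only [← hh, ← map_add, hD]
  X_s k x := by
    simp only [ops, zp_srot, map_smul, smul_smul, sign_one,
      show ((-1 : ℂ) ^ (k + 1)) ^ (-1 : ℤ) = (-1) ^ (k + 1) by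
        have := sign_neg (k + 1) 1; simpa [pow_succ] using this]
    rw [show (-1 : ℂ) ^ (k + 1) * (-1) ^ (k + 1) = 1 by
      rw [← pow_add]; exact Even.neg_one_pow ⟨k + 1, by ring⟩]
    congr 1
    refine LinearMap.congr_fun (f := ϱ V 1 ∘ₗ hMap D (k + 1) ∘ₗ
      ϱ V (-1) ∘ₗ insertHead e k) (g := insertHead e k ∘ₗ hMap D k)
      (hc_ext fun x => ?_) x
    have hr := fun x => zp_rot_neg (V := V) (k + 1) 1 (by omega) x
    simp only [Nat.cast_one] at hr
    simp only [comp_apply, hr, hMap_tp, zp_rot_one, ins_tp]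
    refine tp_congr fun i hi => ?_
    grind

end HeadOps

lemma hochB_eq (β : Bil V) (k : ℕ) (x : HC V (k + 1)) :
    hochB β k x = ∑ i ∈ range (k + 2),
      zp (srot V k) i (mergeHead β k (zp (srot V (k + 1)) (-i) x)) := by
  simp only [hochB, LinearMap.sum_apply, LinearMap.smul_apply]
  refine sum_congr rfl fun i _ => ?_
  simp only [zp_srot, map_smul, smul_smul, sign_cast, sign_neg]
  congr 1
  · rw [← pow_add]
    refine neg_one_pow_congr ?_
    simp only [Nat.even_add, Nat.even_mul, Nat.even_add_one, parity_simps]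
    tauto
  · simp [face, zp]

lemma cB_eq (e : V) (k : ℕ) (x : HC V k) :
    connesB e k x = insertHead e k (∑ i ∈ range (k + 1), zp (srot V k) i x) := by
  simp only [connesB, LinearMap.sum_apply, LinearMap.smul_apply, map_sum]
  refine sum_congr rfl fun i _ => ?_
  simp only [zp_srot, map_smul, sign_cast]
  simp [zp]

lemma contr_eq (μ D : Bil V) (k : ℕ) (x : HC V (k + 2)) :
    contr μ D k x = -mergeHead μ k (zp (srot V (k + 1)) 1 (mergeHead D (k + 1)
      (zp (srot V (k + 2)) (-1) x))) := by
  simp only [zp_srot, map_smul, smul_smul, sign_one,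
      show ((-1 : ℂ) ^ (k + 2)) ^ (-1 : ℤ) = (-1) ^ k by
        have := sign_neg (k + 1 + 1) 1; simpa [pow_succ] using this]
  rw [show (-1 : ℂ) ^ k * (-1) ^ (k + 1) = -1 by rw [← pow_add]; exact Odd.neg_one_pow ⟨k, by ring⟩]
  simp [contr, face, zp]

lemma contrS_eq (e : V) (D : Bil V) (k : ℕ) (x : HC V (k + 1)) :
    contrS e D (k + 1) x = -insertHead e k (∑ j ∈ range k, ∑ i ∈ range (j + 1),
      zp (srot V k) (j + 1 : ℕ) (mergeHead D k (zp (srot V (k + 1)) (-(i + 1 : ℕ)) x))) := by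
  have e1 : contrS e D (k + 1) x = -insertHead e k (∑ i ∈ Ico 1 (k + 1),
      ∑ r ∈ range (k + 1 - i), zp (srot V k) (r + i : ℕ) (mergeHead D k
        (zp (srot V (k + 1)) (-i) x))) := by
    simp only [contrS, LinearMap.sum_apply, LinearMap.smul_apply, map_sum, ← sum_neg_distrib]
    refine sum_congr rfl fun i _ => sum_congr rfl fun r _ => ?_
    simp only [zp_srot, map_smul, smul_smul, sign_cast, sign_neg, ← neg_smul]
    congr 1
    · rw [← pow_add, ← neg_one_mul ((-1 : ℂ) ^ _), ← pow_succ']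
      refine neg_one_pow_congr ?_
      simp only [Nat.even_add, Nat.even_mul, Nat.even_add_one, parity_simps]
      tauto
    · rw [Nat.cast_add, ← zp_zp]; simp [face, zp]
  rw [e1]
  congr 2
  rw [Finset.sum_sigma', Finset.sum_sigma']
  refine sum_nbij' (fun p => ⟨p.2 + p.1 - 1, p.1 - 1⟩) (fun p => ⟨p.2 + 1, p.1 - p.2⟩)
    ?_ ?_ ?_ ?_ ?_
  · rintro ⟨i, r⟩; simp; omega
  · rintro ⟨j, i⟩; simp; omega
  · rintro ⟨i, r⟩ h; simp at h ⊢; omega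
  · rintro ⟨j, i⟩ h; simp at h ⊢; omega
  · rintro ⟨i, r⟩ h
    simp at h
    simp only
    rw [show r + i - 1 + 1 = r + i by omega, show i - 1 + 1 = i by omega]

end Chains

/-! ### Degenerate chains -/

section Degenerate

variable {V : Type} [AddCommGroup V] [Module ℂ V]

lemma face_eq (β : Bil V) (k i : ℕ) (x : HC V (k + 1)) :
    face β k i x = ϱ V i (mergeHead β k (ϱ V (-i) x)) := by
  simp [face, zp]

lemma face_tp (β : Bil V) (k i : ℕ) (hi : i ≤ k) (x : ℕ → V) :
    face β k i (tp (k + 1) x) = tp k fun m =>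
      if m < i then x m else if m = i then β (x i) (x (i + 1)) else x (m + 1) := by
  rw [face_eq, zp_rot_neg _ _ (by omega), merge_tp, zp_rot_cast _ _ (by omega)]
  exact tp_congr fun m hm => by grind

lemma hochB_apply (β : Bil V) (k : ℕ) (x : HC V (k + 1)) :
    hochB β k x = ∑ i ∈ range (k + 2), (-1 : ℂ) ^ i • face β k i x := by
  simp [hochB]

lemma tp_mem_deg {e : V} {k : ℕ} {x : ℕ → V} (j : ℕ) (h0 : j ≠ 0) (hk : j ≤ k)
    (h : x j = e) : tp k x ∈ degenerate e k :=
  subset_span ⟨_, ⟨⟨j, by omega⟩, by simpa [Fin.ext_iff] using h0, h⟩, rfl⟩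

lemma deg_le {e : V} {k : ℕ} {S : Submodule ℂ (HC V k)}
    (h : ∀ x : ℕ → V, ∀ j, j ≠ 0 → j ≤ k → x j = e → tp k x ∈ S) : degenerate e k ≤ S := by
  refine span_le.2 ?_
  rintro _ ⟨a, ⟨i, hi, hai⟩, rfl⟩
  obtain ⟨x, hx, hx'⟩ := exists_tp a
  rw [hx']
  exact h x i (fun h0 => hi (Fin.ext h0)) (by omega) (by rw [hx, hai])

/-- Chains spanned by elementary tensors in which the unit occurs. -/
def unital (e : V) (k : ℕ) : Submodule ℂ (HC V k) :=
  span ℂ {z | ∃ (x : ℕ → V) (j : ℕ), j ≤ k ∧ x j = e ∧ z = tp k x}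

lemma tp_unital {e : V} {k : ℕ} {x : ℕ → V} (j : ℕ) (hk : j ≤ k) (h : x j = e) :
    tp k x ∈ unital e k :=
  subset_span ⟨x, j, hk, h, rfl⟩

lemma unital_le {e : V} {k : ℕ} {S : Submodule ℂ (HC V k)}
    (h : ∀ x : ℕ → V, ∀ j, j ≤ k → x j = e → tp k x ∈ S) : unital e k ≤ S := by
  refine span_le.2 ?_
  rintro _ ⟨x, j, hj, hx, rfl⟩
  exact h x j hj hx

lemma deg_le_unital (e : V) (k : ℕ) : degenerate e k ≤ unital e k :=
  deg_le fun _ j _ hk h => tp_unital j hk h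

lemma unital_rot (e : V) (k a : ℕ) {z : HC V k} (hz : z ∈ unital e k) :
    ϱ V a z ∈ unital e k := by
  induction a with
  | zero => simpa using hz
  | succ a ih =>
    rw [Nat.cast_succ, add_comm (a : ℤ), ← zp_zp]
    revert ih
    generalize ϱ V a z = z
    refine fun hz => (unital_le (S := (unital e k).comap (ϱ V 1)) ?_) hz
    intro x j hj h
    rw [mem_comap, zp_rot_one]
    by_cases hjk : j = k
    · exact tp_unital 0 (by omega) (by simp [← hjk, h])
    · exact tp_unital (j + 1) (by omega) (by simp [h])

lemma unital_zp_srot (e : V) (k : ℕ) (a : ℤ) {z : HC V k} (hz : z ∈ unital e k) :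
    zp (srot V k) a z ∈ unital e k := by
  rw [zp_srot]
  refine smul_mem _ _ ?_
  obtain ⟨b, hb⟩ : ∃ b : ℕ, ϱ V a z = ϱ V b z := by
    refine ⟨(a + (k + 1 : ℕ) * a.natAbs).toNat, ?_⟩
    have h0 : 0 ≤ a + (k + 1 : ℕ) * (a.natAbs : ℤ) := by
      have : (0 : ℤ) ≤ k * |a| := by positivity
      rw [Int.natCast_natAbs]
      push_cast
      linarith [neg_abs_le a]
    rw [Int.toNat_of_nonneg h0]
    simp only [zp, LinearEquiv.coe_coe, zpow_add, zpow_mul, zpow_natCast, rot_order, one_pow,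
      mul_one]
  rw [hb]
  exact unital_rot e k b hz

lemma ins_unital (e : V) (k : ℕ) (z : HC V k) : insertHead e k z ∈ unital e (k + 1) := by
  suffices LinearMap.range (insertHead e k) ≤ unital e (k + 1) from this ⟨z, rfl⟩
  have : (unital e (k + 1)).mkQ ∘ₗ insertHead e k = 0 := hc_ext fun x => by
    rw [comp_apply, ins_tp, LinearMap.zero_apply, Submodule.mkQ_apply,
      Submodule.Quotient.mk_eq_zero]
    exact tp_unital 0 (by omega) (by simp)
  rintro _ ⟨z, rfl⟩
  have := LinearMap.congr_fun this z
  simpa [Submodule.Quotient.mk_eq_zero] using this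

lemma ins_deg (e : V) (k : ℕ) {z : HC V k} (hz : z ∈ unital e k) :
    insertHead e k z ∈ degenerate e (k + 1) := by
  refine (unital_le (S := (degenerate e (k + 1)).comap (insertHead e k)) ?_) hz
  intro x j hj h
  rw [mem_comap, ins_tp]
  exact tp_mem_deg (j + 1) (by omega) (by omega) (by simp [h])

lemma cB_unital (e : V) (k : ℕ) (z : HC V k) : connesB e k z ∈ unital e (k + 1) := by
  rw [cB_eq]; exact ins_unital _ _ _

lemma cB_deg (e : V) (k : ℕ) {z : HC V k} (hz : z ∈ unital e k) :
    connesB e k z ∈ degenerate e (k + 1) := by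
  rw [cB_eq]
  exact ins_deg _ _ (Submodule.sum_mem _ fun i _ => unital_zp_srot _ _ _ hz)

lemma contrS_unital (e : V) (D : Bil V) (k : ℕ) (z : HC V k) :
    contrS e D k z ∈ unital e k := by
  cases k with
  | zero => simp [contrS]
  | succ k => rw [contrS_eq]; exact Submodule.neg_mem _ (ins_unital _ _ _)

lemma merge_mem_unital {e : V} {D : Bil V} (h1 : ∀ x, D e x = 0)
    (h2 : ∀ x, D x e = 0) (k : ℕ) {z : HC V (k + 1)} (hz : z ∈ unital e (k + 1)) :
    mergeHead D k z ∈ unital e k := by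
  refine (unital_le (S := (unital e k).comap (mergeHead D k)) ?_) hz
  intro x j hj h
  rw [mem_comap, merge_tp]
  by_cases h0 : j ≤ 1
  · have : D (x 0) (x 1) = 0 := by
      rcases Nat.le_one_iff_eq_zero_or_eq_one.1 h0 with rfl | rfl
      · rw [h, h1]
      · rw [h, h2]
    obtain ⟨f, hf⟩ := ex_head k (fun i => x (i + 1))
    rw [← hf, this, map_zero]
    exact zero_mem _
  · refine tp_unital (j - 1) (by omega) ?_
    rw [if_neg (by omega), ← h]
    congr 1; omega

lemma contrS_deg {e : V} {D : Bil V} (h1 : ∀ x, D e x = 0)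
    (h2 : ∀ x, D x e = 0) (k : ℕ) {z : HC V k} (hz : z ∈ unital e k) :
    contrS e D k z ∈ degenerate e k := by
  cases k with
  | zero => simp [contrS]
  | succ k =>
    rw [contrS_eq]
    refine Submodule.neg_mem _ (ins_deg _ _ (Submodule.sum_mem _ fun j _ =>
      Submodule.sum_mem _ fun i _ => unital_zp_srot _ _ _ (merge_mem_unital h1 h2 _ ?_)))
    exact unital_zp_srot _ _ _ hz

lemma contr_tp (μ D : Bil V) (k : ℕ) (x : ℕ → V) :
    contr μ D k (tp (k + 2) x) = tp k fun i => if i = 0 then μ (x 0) (D (x 1) (x 2)) else x (i + 2) := by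
  rw [contr, comp_apply, face_tp _ _ _ (by omega), merge_tp]
  exact tp_congr fun i hi => by grind

lemma contr_mem_deg {e : V} {μ D : Bil V} (h1 : ∀ x, D e x = 0)
    (h2 : ∀ x, D x e = 0) (k : ℕ) {z : HC V (k + 2)} (hz : z ∈ degenerate e (k + 2)) :
    contr μ D k z ∈ degenerate e k := by
  refine (deg_le (S := (degenerate e k).comap (contr μ D k)) ?_) hz
  intro x j h0 hj h
  rw [mem_comap, contr_tp]
  by_cases h3 : j ≤ 2
  · have : D (x 1) (x 2) = 0 := by
      rcases (by omega : j = 1 ∨ j = 2) with rfl | rfl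
      · rw [h, h1]
      · rw [h, h2]
    obtain ⟨f, hf⟩ := ex_head k (fun i => x (i + 2))
    rw [← hf, this, map_zero, map_zero]
    exact zero_mem _
  · refine tp_mem_deg (j - 2) (by omega) (by omega) ?_
    rw [if_neg (by omega), ← h]
    congr 1; omega

end Degenerate

/-! ### The periodic cyclic complex -/

section Periodic

variable {V : Type} [AddCommGroup V] [Module ℂ V]

lemma dEven_apply (μ : Bil V) (e : V) (c : EvenChains V) (p : ℕ) :
    dEven μ e c p = hochB μ (2 * p + 1) (c (p + 1)) + connesB e (2 * p) (c p) := rfl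

lemma dOdd_zero (μ : Bil V) (e : V) (c : OddChains V) :
    dOdd μ e c 0 = hochB μ 0 (c 0) := rfl

lemma dOdd_succ (μ : Bil V) (e : V) (c : OddChains V) (p : ℕ) :
    dOdd μ e c (p + 1) = hochB μ (2 * (p + 1)) (c (p + 1)) + connesB e (2 * p + 1) (c p) := rfl

lemma mem_degEven {e : V} {c : EvenChains V} :
    c ∈ degEven e ↔ ∀ p, c p ∈ degenerate e (2 * p) := by
  simp [degEven, Submodule.mem_pi]

lemma mem_degOdd {e : V} {c : OddChains V} :
    c ∈ degOdd e ↔ ∀ p, c p ∈ degenerate e (2 * p + 1) := by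
  simp [degOdd, Submodule.mem_pi]

lemma cB_cB_mem (e : V) (k : ℕ) (x : HC V k) :
    connesB e (k + 1) (connesB e k x) ∈ degenerate e (k + 2) :=
  cB_deg _ _ (cB_unital _ _ _)

variable {μ : Bil V} {e : V} (hμ : ∀ x y z, μ (μ x y) z = μ x (μ y z))
  (he : ∀ x, μ e x = x) (he' : ∀ x, μ x e = x)

include hμ he he'

lemma hochB_eq_ops (k : ℕ) (x : HC V (k + 1)) :
    hochB μ k x = (ops μ e hμ he he').b k x := by
  rw [hochB_eq, CyclicOps.b_apply]; rfl

lemma cB_eq_ops (k : ℕ) (x : HC V k) : connesB e k x = (ops μ e hμ he he').B k x := by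
  rw [cB_eq, CyclicOps.B, comp_apply, CyclicOps.norm_apply]; rfl

lemma hochB_connesB (k : ℕ) (x : HC V (k + 1)) :
    hochB μ (k + 1) (connesB e (k + 1) x) + connesB e k (hochB μ k x) = 0 := by
  simp only [hochB_eq_ops hμ he he', cB_eq_ops hμ he he', CyclicOps.bB_add_Bb]

lemma hochB_contr (D : Bil V)
    (hD : ∀ x y z, μ x (D y z) - D (μ x y) z + D x (μ y z) - μ (D x y) z = 0) (k : ℕ)
    (x : HC V (k + 3)) : hochB μ k (contr μ D (k + 1) x) = contr μ D k (hochB μ (k + 2) x) := by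
  have h := (twoOp hμ he he' D hD).b_c k x
  have h1 : ∀ y, (twoOp hμ he he' D hD).b (k + 1) y = hochB μ (k + 2) y := fun y => by
    rw [hochB_eq, HeadOp.b_apply]; rfl
  have h2 : ∀ k y, contr μ D k y = -(twoOp hμ he he' D hD).c k y := fun k y => contr_eq _ _ _ _
  rw [h1, ← hochB_eq_ops hμ he he'] at h
  rw [h2, h2, map_neg, h]
  simp [twoOp]

lemma cartan_two (D : Bil V)
    (hD : ∀ x y z, μ x (D y z) - D (μ x y) z + D x (μ y z) - μ (D x y) z = 0) (k : ℕ)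
    (x : HC V (k + 2)) :
    hochB μ (k + 1) (contrS e D (k + 2) x) - contrS e D (k + 1) (hochB μ (k + 1) x) +
      connesB e k (contr μ D k x) - contr μ D (k + 1) (connesB e (k + 2) x) =
      -hochB D (k + 1) x := by
  have h := (twoOp hμ he he' D hD).cartan le_rfl k x
  have h1 : ∀ y, (twoOp hμ he he' D hD).b k y = hochB μ (k + 1) y := fun y => by
    rw [hochB_eq, HeadOp.b_apply]; rfl
  have h2 : ∀ k y, contr μ D k y = -(twoOp hμ he he' D hD).c k y := fun k y => contr_eq _ _ _ _
  have h3 : ∀ k y, contrS e D (k + 1) y = -(twoOp hμ he he' D hD).S k y := fun k y => by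
    rw [contrS_eq, HeadOp.S, comp_apply, HeadOp.S'_apply]; rfl
  have h4 : ∀ y, (twoOp hμ he he' D hD).B (k + 1) y = connesB e (k + 2) y := fun y => by
    rw [cB_eq, HeadOp.B, comp_apply, LinearMap.sum_apply]; rfl
  have h5 : (twoOp hμ he he' D hD).L (k + 1) x = hochB D (k + 1) x := by
    rw [hochB_eq, HeadOp.L, LinearMap.sum_apply]; rfl
  have h6 : (twoOp hμ he he' D hD).ε = -1 := rfl
  rw [h1, h4, h5, h6, ← hochB_eq_ops hμ he he', ← cB_eq_ops hμ he he'] at h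
  simp only [h2, h3, map_neg, ← h]
  module

lemma cartan_two_zero (D : Bil V)
    (hD : ∀ x y z, μ x (D y z) - D (μ x y) z + D x (μ y z) - μ (D x y) z = 0)
    (x : HC V 1) : contr μ D 0 (connesB e 1 x) = hochB D 0 x := by
  have h := (twoOp hμ he he' D hD).cartan_zero x
  have h2 : ∀ k y, contr μ D k y = -(twoOp hμ he he' D hD).c k y := fun k y => contr_eq _ _ _ _
  have h4 : ∀ y, (twoOp hμ he he' D hD).B 0 y = connesB e 1 y := fun y => by
    rw [cB_eq, HeadOp.B, comp_apply, LinearMap.sum_apply]; rfl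
  have h5 : (twoOp hμ he he' D hD).L 0 x = hochB D 0 x := by
    rw [hochB_eq, HeadOp.L, LinearMap.sum_apply]; rfl
  have h6 : (twoOp hμ he he' D hD).ε = -1 := rfl
  rw [h4, h5, h6] at h
  rw [h2, ← h]
  module

omit hμ he he' in
lemma contrS_one (D : Bil V) (x : HC V 1) : contrS e D 1 x = 0 := by
  simp [contrS]

omit hμ he he' in
lemma contrS_zero (D : Bil V) (x : HC V 0) : contrS e D 0 x = 0 := rfl

variable (μ e) in
omit hμ he he' in
def gOdd (D : Bil V) (c : OddChains V) : OddChains V :=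
  fun p => contr μ D (2 * p + 1) (c (p + 1)) + contrS e D (2 * p + 1) (c p)

variable (D : Bil V)
    (hD : ∀ x y z, μ x (D y z) - D (μ x y) z + D x (μ y z) - μ (D x y) z = 0)
    (h1 : ∀ x, D e x = 0) (h2 : ∀ x, D x e = 0)

include hD h1 h2

lemma dEven_getzlerOp (c : EvenChains V) (p : ℕ) :
    dEven μ e (getzlerOp μ e D c) p - gOdd μ e D (dEven μ e c) p +
      hochB D (2 * p + 1) (c (p + 1)) ∈ degenerate e (2 * p + 1) := by
  have a1 := hochB_contr hμ he he' D hD (2 * p + 1) (c (p + 2))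
  have a2 := cartan_two hμ he he' D hD (2 * p) (c (p + 1))
  have : dEven μ e (getzlerOp μ e D c) p - gOdd μ e D (dEven μ e c) p +
      hochB D (2 * p + 1) (c (p + 1)) =
      connesB e (2 * p) (contrS e D (2 * p) (c p)) -
        contrS e D (2 * p + 1) (connesB e (2 * p) (c p)) := by
    simp only [dEven_apply, getzlerOp, gOdd, map_add]
    rw [show hochB μ (2 * p + 1) (contr μ D (2 * (p + 1)) (c (p + 1 + 1))) =
      contr μ D (2 * p + 1) (hochB μ (2 * (p + 1) + 1) (c (p + 1 + 1))) from a1]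
    change hochB μ (2 * p + 1) (contrS e D (2 * (p + 1)) (c (p + 1))) - _ + _ -
      contr μ D (2 * p + 1) (connesB e (2 * (p + 1)) (c (p + 1))) = _ at a2
    rw [← sub_eq_zero] at a2 ⊢
    rw [← a2]
    abel
  rw [this]
  exact Submodule.sub_mem _ (cB_deg _ _ (contrS_unital _ _ _ _))
    (contrS_deg h1 h2 _ (cB_unital _ _ _))

lemma dOdd_getzlerOdd_succ (c : OddChains V) (p : ℕ) :
    dOdd μ e (gOdd μ e D c) (p + 1) - getzlerOp μ e D (dOdd μ e c) (p + 1) +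
      hochB D (2 * (p + 1)) (c (p + 1)) ∈ degenerate e (2 * (p + 1)) := by
  have a1 := hochB_contr hμ he he' D hD (2 * (p + 1)) (c (p + 2))
  have a2 := cartan_two hμ he he' D hD (2 * p + 1) (c (p + 1))
  have : dOdd μ e (gOdd μ e D c) (p + 1) - getzlerOp μ e D (dOdd μ e c) (p + 1) +
      hochB D (2 * (p + 1)) (c (p + 1)) =
      connesB e (2 * p + 1) (contrS e D (2 * p + 1) (c p)) -
        contrS e D (2 * (p + 1)) (connesB e (2 * p + 1) (c p)) := by
    simp only [dOdd_succ, getzlerOp, gOdd, map_add]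
    rw [show hochB μ (2 * (p + 1)) (contr μ D (2 * (p + 1) + 1) (c (p + 1 + 1))) =
      contr μ D (2 * (p + 1)) (hochB μ (2 * (p + 1 + 1)) (c (p + 1 + 1))) from a1]
    change hochB μ (2 * (p + 1)) (contrS e D (2 * (p + 1) + 1) (c (p + 1))) -
      contrS e D (2 * (p + 1)) (hochB μ (2 * (p + 1)) (c (p + 1))) + _ -
      contr μ D (2 * (p + 1)) (connesB e (2 * (p + 1) + 1) (c (p + 1))) =
      -hochB D (2 * (p + 1)) (c (p + 1)) at a2
    rw [← sub_eq_zero] at a2 ⊢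
    rw [← a2]
    abel
  rw [this]
  exact Submodule.sub_mem _ (cB_deg _ _ (contrS_unital _ _ _ _))
    (contrS_deg h1 h2 _ (cB_unital _ _ _))

omit h1 h2 in
lemma dOdd_getzlerOdd_zero (c : OddChains V) :
    dOdd μ e (gOdd μ e D c) 0 - getzlerOp μ e D (dOdd μ e c) 0 + hochB D 0 (c 0) = 0 := by
  have a1 := hochB_contr hμ he he' D hD 0 (c 1)
  have a2 := cartan_two_zero hμ he he' D hD (c 0)
  simp only [dOdd_zero, getzlerOp, gOdd, map_add, dOdd_succ]
  rw [show hochB μ 0 (contr μ D (2 * 0 + 1) (c (0 + 1))) =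
    contr μ D (2 * 0) (hochB μ (2 * (0 + 1)) (c (0 + 1))) from a1,
    show contrS e D (2 * 0 + 1) (c 0) = 0 from contrS_one D _,
    show contrS e D (2 * 0) (hochB μ 0 (c 0)) = 0 from contrS_zero D _,
    show contr μ D (2 * 0) (connesB e (2 * 0 + 1) (c 0)) = hochB D 0 (c 0) from a2]
  simp

end Periodic

/-! ### Lie derivatives act trivially -/

section Lie

variable {V : Type} [AddCommGroup V] [Module ℂ V]
variable {μ : Bil V} {e : V} (hμ : ∀ x y z, μ (μ x y) z = μ x (μ y z))
  (he : ∀ x, μ e x = x) (he' : ∀ x, μ x e = x)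
  (D : V ⊸ V) (hD : ∀ x y, D (μ x y) = μ (D x) y + μ x (D y))

def lieD (D : V ⊸ V) (k : ℕ) : HC V k ⊸ HC V k :=
  ∑ i ∈ range (k + 1), ϱ V i ∘ₗ hMap D k ∘ₗ ϱ V (-i)

lemma headMap_mem_unital (h0 : D e = 0) (k : ℕ) {z : HC V k} (hz : z ∈ unital e k) :
    hMap D k z ∈ unital e k := by
  refine (unital_le (S := (unital e k).comap (hMap D k)) ?_) hz
  intro x j hj h
  rw [mem_comap, hMap_tp]
  by_cases hj0 : j = 0
  · subst hj0
    obtain ⟨f, hf⟩ := ex_head k x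
    rw [h, h0, ← hf, map_zero]
    exact zero_mem _
  · exact tp_unital j hj (by rw [if_neg hj0, h])

include hμ he he' hD

lemma lieD_eq (k : ℕ) (x : HC V k) : lieD D k x = (oneOp hμ he he' D hD).L k x := by
  rw [lieD, HeadOp.L, LinearMap.sum_apply, LinearMap.sum_apply]
  refine sum_congr rfl fun i _ => ?_
  change _ = zp (srot V k) i (hMap D k (zp (srot V k) (-i) x))
  simp only [zp_srot, map_smul, smul_smul, sign_cast, sign_neg, ← pow_add, comp_apply]
  rw [Even.neg_one_pow ⟨_, rfl⟩, one_smul]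

lemma lieD_mem_bd (h0 : D e = 0) {c : EvenChains V} (hc : c ∈ cycles μ e) :
    (fun p => lieD D (2 * p) (c p)) ∈ boundaries μ e := by
  set H := oneOp hμ he he' D hD with hH
  have hS : ∀ k (z : HC V k), z ∈ unital e k → H.S k z ∈ degenerate e (k + 1) := by
    intro k z hz
    rw [HeadOp.S, comp_apply, HeadOp.S'_apply]
    refine ins_deg _ _ (Submodule.sum_mem _ fun j _ => Submodule.sum_mem _
      fun i _ => unital_zp_srot _ _ _ (headMap_mem_unital D h0 _ (unital_zp_srot _ _ _ hz)))
  have hS' : ∀ k (z : HC V k), H.S k z ∈ unital e (k + 1) := fun k z =>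
    ins_unital _ _ _
  have hC : ∀ k (x : ℕ → V), H.c k (tp (k + 1) x) = tp k fun i => if i = 0 then
      μ (x 0) (D (x 1)) else x (i + 1) := by
    intro k x
    change mergeHead μ k (zp (srot V (k + 1)) 1 (hMap D (k + 1) (zp (srot V (k + 1)) (-1)
      (tp (k + 1) x)))) = _
    have s1 : ((-1 : ℂ) ^ (k + 1)) ^ (-1 : ℤ) = (-1) ^ (k + 1) := by
      have := sign_neg (k + 1) 1
      simpa [pow_succ] using this
    have hr := zp_rot_neg (V := V) (k + 1) 1 (by omega) x
    rw [Nat.cast_one] at hr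
    simp only [zp_srot, map_smul, smul_smul, sign_one, s1]
    rw [← pow_add, Even.neg_one_pow ⟨k + 1, rfl⟩, one_smul, hr, hMap_tp, zp_rot_one, merge_tp]
    exact tp_congr fun i hi => by grind
  have hC' : ∀ k (z : HC V (k + 1)), z ∈ degenerate e (k + 1) → H.c k z ∈ degenerate e k := by
    intro k z hz
    refine (deg_le (S := (degenerate e k).comap (H.c k)) ?_) hz
    intro x j hj0 hj h
    rw [mem_comap, hC]
    by_cases h1 : j = 1
    · obtain ⟨f, hf⟩ := ex_head k (fun i => x (i + 1))
      have h2 : x 1 = e := h1 ▸ h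
      rw [← hf, h2, h0, map_zero, map_zero]
      exact zero_mem _
    · refine tp_mem_deg (j - 1) (by omega) (by omega) ?_
      rw [if_neg (by omega), ← h]
      congr 1; omega
  have hb : ∀ k z, H.b k z = hochB μ k z := fun k z => by
    rw [hochB_eq, HeadOp.b_apply]; rfl
  have hB : ∀ k z, H.B k z = connesB e k z := fun k z => by
    rw [cB_eq, HeadOp.B, comp_apply, LinearMap.sum_apply]; rfl
  have hε : H.ε = 1 := rfl
  have bc : ∀ k x, hochB μ k (H.c (k + 1) x) = -H.c k (hochB μ (k + 1) x) := fun k x => by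
    have := H.b_c k x
    rwa [hb, hε, one_smul, ← hochB_eq_ops hμ he he'] at this
  have hc' := mem_degOdd.1 (show dEven μ e c ∈ degOdd e from hc)
  refine mem_sup.2 ⟨_, ⟨fun p => H.c (2 * p + 1) (c (p + 1)) + H.S (2 * p) (c p), rfl⟩,
    (fun p => lieD D (2 * p) (c p)) - dOdd μ e _, mem_degEven.2 fun p => ?_,
    add_sub_cancel _ _⟩
  rw [Pi.sub_apply, lieD_eq hμ he he' D hD, ← hH]
  cases p with
  | zero =>
    have h1 := bc 0 (c 1)
    have h2 := H.cartan_zero (c 0)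
    have h3 := hC' 0 _ (hc' 0)
    rw [hε, one_smul, hB] at h2
    rw [dEven_apply, map_add] at h3
    rw [dOdd_zero, map_add]
    rw [show H.S (2 * 0) (c 0) = 0 from H.S_zero _, map_zero, add_zero,
      show hochB μ 0 (H.c (2 * 0 + 1) (c (0 + 1))) = -H.c 0 (hochB μ 1 (c 1)) from h1,
      show H.L (2 * 0) (c 0) = H.c 0 (connesB e 0 (c 0)) from h2.symm, sub_neg_eq_add]
    rw [← add_comm (H.c 0 (hochB μ 1 (c 1)))]
    exact h3
  | succ p =>
    have h1 := bc (2 * (p + 1)) (c (p + 2))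
    have h2 := H.cartan (by omega) (2 * p + 1) (c (p + 1))
    have h3 := hC' _ _ (hc' (p + 1))
    have h4 := hS _ _ (deg_le_unital _ _ (hc' p))
    rw [hε, one_smul, one_smul, hB, hb, ← hochB_eq_ops hμ he he', ← cB_eq_ops hμ he he'] at h2
    rw [dEven_apply, map_add] at h3 h4
    have h5 := cB_deg e _ (hS' _ (c p))
    have h6 := hS _ _ (cB_unital e _ (c p))
    rw [dOdd_succ, map_add, map_add]
    rw [show hochB μ (2 * (p + 1)) (H.c (2 * (p + 1) + 1) (c (p + 1 + 1))) = _ from h1,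
      show H.L (2 * (p + 1)) (c (p + 1)) = _ from h2.symm]
    refine (congrArg (· ∈ degenerate e (2 * (p + 1))) ?_).mpr
      (Submodule.sub_mem _ (Submodule.sub_mem _ (add_mem h3 h4) h5) h6)
    change hochB μ (2 * (p + 1)) (H.S (2 * (p + 1)) (c (p + 1))) +
      H.S (2 * p + 1) (hochB μ (2 * p + 1) (c (p + 1))) +
      connesB e (2 * p + 1) (H.c (2 * p + 1) (c (p + 1))) +
      H.c (2 * (p + 1)) (connesB e (2 * (p + 1)) (c (p + 1))) - _ = _
    abel

end Lie

/-! ### Families of operators that commute with the cyclic structure -/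

section Intertwine

variable {V : Type} [AddCommGroup V] [Module ℂ V] {T U : ∀ k, HC V k ⊸ HC V k}

lemma zp_rot_comm (hT : ∀ k x, T k (rot V k x) = rot V k (T k x)) (k : ℕ) (a : ℤ) (x : HC V k) :
    T k (ϱ V a x) = ϱ V a (T k x) := by
  have h1 : ∀ (a : ℕ) x, T k (ϱ V a x) = ϱ V a (T k x) := fun a x => by
    induction a with
    | zero => simp
    | succ a ih =>
      rw [Nat.cast_succ, add_comm (a : ℤ), ← zp_zp, ← zp_zp, ← ih]
      simpa [zp] using hT k _
  obtain ⟨a, rfl | rfl⟩ := a.eq_nat_or_neg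
  · exact h1 a x
  · have h2 := h1 a (ϱ V (-a) x)
    rw [zp_zp, add_neg_cancel, zp_zero] at h2
    rw [h2, zp_zp, neg_add_cancel, zp_zero]

lemma face_comm {β β' δ : Bil V} (hT : ∀ k x, T k (rot V k x) = rot V k (T k x))
    (hU : ∀ k x, U k (rot V k x) = rot V k (U k x))
    (hM : ∀ k x, T k (mergeHead β' k x) + mergeHead δ k (U (k + 1) x) =
      mergeHead β k (T (k + 1) x)) (k i : ℕ) (x : HC V (k + 1)) :
    T k (face β' k i x) + face δ k i (U (k + 1) x) = face β k i (T (k + 1) x) := by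
  rw [face_eq, face_eq, face_eq, zp_rot_comm hT, ← zp_rot_comm hT _ _ x, ← zp_rot_comm hU, ← hM, map_add]

lemma hochB_comm {β β' δ : Bil V} (hT : ∀ k x, T k (rot V k x) = rot V k (T k x))
    (hU : ∀ k x, U k (rot V k x) = rot V k (U k x))
    (hM : ∀ k x, T k (mergeHead β' k x) + mergeHead δ k (U (k + 1) x) =
      mergeHead β k (T (k + 1) x)) (k : ℕ) (x : HC V (k + 1)) :
    T k (hochB β' k x) + hochB δ k (U (k + 1) x) = hochB β k (T (k + 1) x) := by
  simp only [hochB_apply, map_sum, map_smul, ← sum_add_distrib, ← smul_add,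
    face_comm hT hU hM]

lemma face_intertwine {β β' : Bil V} (hT : ∀ k x, T k (rot V k x) = rot V k (T k x))
    (hM : ∀ k x, T k (mergeHead β' k x) = mergeHead β k (T (k + 1) x)) (k i : ℕ)
    (x : HC V (k + 1)) : T k (face β' k i x) = face β k i (T (k + 1) x) := by
  rw [face_eq, face_eq, zp_rot_comm hT, ← zp_rot_comm hT _ _ x, ← hM]

lemma hochB_intertwine {β β' : Bil V} (hT : ∀ k x, T k (rot V k x) = rot V k (T k x))
    (hM : ∀ k x, T k (mergeHead β' k x) = mergeHead β k (T (k + 1) x)) (k : ℕ)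
    (x : HC V (k + 1)) : T k (hochB β' k x) = hochB β k (T (k + 1) x) := by
  simp only [hochB_apply, map_sum, map_smul, face_intertwine hT hM]

lemma cB_itw {e : V} (hT : ∀ k x, T k (rot V k x) = rot V k (T k x))
    (hs : ∀ k x, T (k + 1) (insertHead e k x) = insertHead e k (T k x)) (k : ℕ) (x : HC V k) :
    T (k + 1) (connesB e k x) = connesB e k (T k x) := by
  simp only [cB_eq, hs, map_sum, zp_srot, map_smul, zp_rot_comm hT]

lemma contr_itw {β β' δ δ' : Bil V}
    (hT : ∀ k x, T k (rot V k x) = rot V k (T k x))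
    (hM : ∀ k x, T k (mergeHead β' k x) = mergeHead β k (T (k + 1) x))
    (hD : ∀ k x, T k (mergeHead δ' k x) = mergeHead δ k (T (k + 1) x)) (k : ℕ)
    (x : HC V (k + 2)) : T k (contr β' δ' k x) = contr β δ k (T (k + 2) x) := by
  simp only [contr, comp_apply, hM, face_intertwine hT hD]

lemma contrS_itw {e : V} {δ δ' : Bil V}
    (hT : ∀ k x, T k (rot V k x) = rot V k (T k x))
    (hs : ∀ k x, T (k + 1) (insertHead e k x) = insertHead e k (T k x))
    (hD : ∀ k x, T k (mergeHead δ' k x) = mergeHead δ k (T (k + 1) x)) (k : ℕ)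
    (x : HC V k) : T k (contrS e δ' k x) = contrS e δ k (T k x) := by
  cases k with
  | zero => simp [contrS]
  | succ k =>
    simp only [contrS_eq, map_neg, hs, map_sum, zp_srot, map_smul, zp_rot_comm hT, hD]

end Intertwine

/-! ### Monomial chains -/

section Mono

variable {n : ℕ}

/-- Elementary tensors of monomials. -/
def mono (k : ℕ) (g : ℕ → Γ n) : HT n k := tp k fun i => monomial (g i)

lemma mono_cg {k : ℕ} {g h : ℕ → Γ n} (H : ∀ i ≤ k, g i = h i) :
    mono k g = mono k h := tp_congr fun i hi => by rw [H i hi]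

def monoBasis (n k : ℕ) : Module.Basis (Fin (k + 1) → Γ n) ℂ (HT n k) :=
  Basis.piTensorProduct fun _ : Fin (k + 1) => Finsupp.basisSingleOne

lemma monoBasis_apply (k : ℕ) (g : ℕ → Γ n) :
    monoBasis n k (fun i => g i) = mono k g := by
  simp [monoBasis, mono, tp, Basis.piTensorProduct_apply, monomial]

def extSeq {k : ℕ} (a : Fin (k + 1) → Γ n) (m : ℕ) : Γ n :=
  if h : m < k + 1 then a ⟨m, h⟩ else 0

lemma extSeq_apply {k : ℕ} (a : Fin (k + 1) → Γ n) (i : Fin (k + 1)) :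
    extSeq a i = a i := dif_pos i.2

lemma monoBasis_apply' (k : ℕ) (a : Fin (k + 1) → Γ n) :
    monoBasis n k a = mono k (extSeq a) := by
  rw [← monoBasis_apply]; congr 1; funext i; rw [extSeq_apply]

lemma mono_ext {W : Type*} [AddCommMonoid W] [Module ℂ W] {k : ℕ}
    {f f' : HT n k ⊸ W} (h : ∀ g, f (mono k g) = f' (mono k g)) : f = f' :=
  (monoBasis n k).ext fun a => by rw [monoBasis_apply', h]

lemma mono_eq {W : Type*} [AddCommGroup W] [Module ℂ W] {k : ℕ} {F G : HT n k → W}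
    (h : ∀ g, F (mono k g) = G (mono k g)) (x : HT n k)
    (hF : IsLinearMap ℂ F := by
      constructor <;> intros <;> simp [smul_comm, mul_add, mul_left_comm])
    (hG : IsLinearMap ℂ G := by
      constructor <;> intros <;> simp [smul_comm, mul_add, mul_left_comm]) :
    F x = G x :=
  LinearMap.congr_fun (f := hF.mk' F) (g := hG.mk' G) (mono_ext h) x

lemma mono_le {k : ℕ} {W : Type*} [AddCommMonoid W] [Module ℂ W]
    (f : HT n k ⊸ W) {S : Submodule ℂ W} (h : ∀ g, f (mono k g) ∈ S)
    (x : HT n k) : f x ∈ S := by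
  have hx : x ∈ span ℂ (Set.range (monoBasis n k)) := by
    rw [(monoBasis n k).span_eq]; trivial
  refine (span_le (p := S.comap f)).2 ?_ hx
  rintro _ ⟨a, rfl⟩
  rw [monoBasis_apply']
  exact h _

/-- `f` only depends on the first `k + 1` terms of a sequence. -/
def Loc {W : Type*} (k : ℕ) (f : (ℕ → Γ n) → W) : Prop :=
  ∀ g h, (∀ i ≤ k, g i = h i) → f g = f h

def monoLift {W : Type*} [AddCommGroup W] [Module ℂ W] (k : ℕ) (f : (ℕ → Γ n) → W) :
    HT n k ⊸ W :=
  (monoBasis n k).constr ℂ fun a => f (extSeq a)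

lemma monoLift_mono {W : Type*} [AddCommGroup W] [Module ℂ W] {k : ℕ}
    {f : (ℕ → Γ n) → W} (hf : Loc k f) (g : ℕ → Γ n) :
    monoLift k f (mono k g) = f g := by
  rw [← monoBasis_apply, monoLift, Module.Basis.constr_basis]
  exact hf _ _ fun i hi => extSeq_apply (fun i : Fin (k + 1) => g i) ⟨i, by omega⟩

lemma Loc.smul {W : Type*} [AddCommGroup W] [Module ℂ W] {k : ℕ} {f : (ℕ → Γ n) → ℂ}
    {F : (ℕ → Γ n) → W} (hf : Loc k f) (hF : Loc k F) :
    Loc k fun g => f g • F g := fun g h H => by simp only [hf g h H, hF g h H]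

lemma mono_mem_deg {k : ℕ} {g : ℕ → Γ n} (j : ℕ) (h0 : j ≠ 0) (hk : j ≤ k)
    (h : g j = 0) : mono k g ∈ degenerate 𝟏 k :=
  tp_mem_deg j h0 hk (by rw [h]; rfl)

lemma deg_le_of_mono {k : ℕ} {S : Submodule ℂ (HT n k)}
    (h : ∀ g : ℕ → Γ n, ∀ j, j ≠ 0 → j ≤ k → g j = 0 → mono k g ∈ S) :
    degenerate 𝟏 k ≤ S := by
  refine deg_le fun x j h0 hk hx => ?_
  let f : HT n k ⊸ HT n k :=
    PiTensorProduct.map fun i => if (i : ℕ) = j then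
      toSpanSingleton ℂ _ 𝟏 ∘ₗ torusTrace n else LinearMap.id
  have hf : ∀ y : ℕ → TorusModule n, f (tp k y) =
      tp k fun i => if i = j then torusTrace n (y i) • torusOne n else y i := fun y => by
    simp only [f, tp, PiTensorProduct.map_tprod]
    congr 1
    funext i
    split_ifs <;> simp
  have h1 : f (tp k x) = tp k x := by
    rw [hf]
    refine tp_congr fun i _ => ?_
    split_ifs with hij
    · subst hij; rw [hx]; simp [torusTrace, torusOne, monomial]
    · rfl
  rw [← h1]
  refine mono_le f (fun g => ?_) _
  rw [mono, hf]
  by_cases hg : g j = 0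
  · refine (congrArg (· ∈ S) ?_).mpr (h g j h0 hk hg)
    refine tp_congr fun i _ => ?_
    split_ifs with hij
    · subst hij; simp [hg, torusTrace, torusOne, monomial]
    · rfl
  · have : torusTrace n (monomial (g j)) = 0 := by simp [torusTrace, monomial, hg]
    have h2 : (tp k fun i => if i = j then torusTrace n (monomial (g i)) • torusOne n
        else monomial (g i)) = 0 := by
      refine MultilinearMap.map_coord_zero _ ⟨j, by omega⟩ ?_
      simp [this]
    rw [h2]
    exact zero_mem _

def sMerge (g : ℕ → Γ n) (i : ℕ) : Γ n := if i = 0 then g 0 + g 1 else g (i + 1)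

def seqRot (k : ℕ) (g : ℕ → Γ n) (i : ℕ) : Γ n := if i = 0 then g k else g (i - 1)

def seqIns (g : ℕ → Γ n) (i : ℕ) : Γ n := if i = 0 then 0 else g (i - 1)

lemma merge_mono (w : (Γ n) → (Γ n) → ℂ) (k : ℕ) (g : ℕ → Γ n) :
    mergeHead (twistedMul w) k (mono (k + 1) g) = w (g 0) (g 1) • mono k (sMerge g) := by
  obtain ⟨h, hh⟩ := ex_head k (fun i => (monomial (g (i + 1)) : TorusModule n))
  rw [mono, merge_tp, ← hh, twistedMul_monomial, map_smul, hh]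
  congr 1
  refine tp_congr fun i _ => ?_
  unfold sMerge
  split_ifs <;> rfl

lemma rot_mono (k : ℕ) (g : ℕ → Γ n) :
    rot (TorusModule n) k (mono k g) = mono k (seqRot k g) := by
  rw [mono, rot_tp]
  refine tp_congr fun i _ => ?_
  unfold seqRot
  split_ifs <;> rfl

lemma insertHead_mono (k : ℕ) (g : ℕ → Γ n) :
    insertHead 𝟏 k (mono k g) = mono (k + 1) (seqIns g) := by
  rw [mono, ins_tp]
  refine tp_congr fun i _ => ?_
  unfold seqIns
  split_ifs <;> rfl

/-- The total weight of a monomial chain. -/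
def wt (k : ℕ) (g : ℕ → Γ n) : Γ n := ∑ i ∈ range (k + 1), g i

lemma wt_local (k : ℕ) : Loc k (wt (n := n) k) := fun g h H =>
  sum_congr rfl fun i hi => H i (by simpa [Nat.lt_succ_iff] using hi)

lemma wt_merge (k : ℕ) (g : ℕ → Γ n) :
    wt k (sMerge g) = wt (k + 1) g := by
  rw [wt, wt, sum_range_succ', sum_range_succ',
    sum_range_succ']
  simp [sMerge]
  abel

lemma wt_rot (k : ℕ) (g : ℕ → Γ n) :
    wt k (seqRot k g) = wt k g := by
  rw [wt, wt, sum_range_succ', sum_range_succ]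
  simp [seqRot]

lemma wt_ins (k : ℕ) (g : ℕ → Γ n) :
    wt (k + 1) (seqIns g) = wt k g := by
  rw [wt, wt, sum_range_succ']
  simp [seqIns]

variable {A : Type} [AddCommGroup A] (β : (Γ n) →+ (Γ n) →+ A)

/-- `∑_{a < b} β(g_a, g_b)`. -/
def pSum (k : ℕ) (g : ℕ → Γ n) : A :=
  ∑ b ∈ range (k + 1), β (∑ a ∈ range b, g a) (g b)

lemma pSum_local (k : ℕ) : Loc k (pSum β k) := fun g h H =>
  sum_congr rfl fun b hb => by
    rw [mem_range] at hb
    rw [H b (by omega), sum_congr rfl fun a ha =>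
      H a (by rw [mem_range] at ha; omega)]

lemma pairSum_merge (k : ℕ) (g : ℕ → Γ n) :
    pSum β (k + 1) g = β (g 0) (g 1) + pSum β k (sMerge g) := by
  rw [pSum, pSum, sum_range_succ', sum_range_succ', sum_range_succ' _ k]
  have h : ∀ b, ∑ a ∈ range (b + 1), sMerge g a = ∑ a ∈ range (b + 2), g a := by
    intro b
    rw [sum_range_succ', sum_range_succ' _ (b + 1), sum_range_succ']
    simp [sMerge]
    abel
  simp only [h]
  simp [sMerge, add_comm (β (g 0) (g 1))]

lemma pairSum_rot (k : ℕ) (g : ℕ → Γ n) (h0 : wt k g = 0) :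
    pSum β k (seqRot k g) = pSum β k g := by
  rw [pSum, pSum, sum_range_succ', sum_range_succ]
  have h : ∀ b, ∑ a ∈ range (b + 1), seqRot k g a = g k + ∑ a ∈ range b, g a := by
    intro b
    rw [sum_range_succ']
    simp [seqRot, add_comm]
  have h1 : ∑ a ∈ range k, g a = -g k := by
    rw [wt, sum_range_succ] at h0
    exact eq_neg_of_add_eq_zero_left h0
  simp only [h, map_add, AddMonoidHom.add_apply, sum_add_distrib]
  have h2 : ∑ x ∈ range k, β (g k) (seqRot k g (x + 1)) = β (g k) (∑ a ∈ range k, g a) := by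
    rw [map_sum]; simp [seqRot]
  rw [h2, h1]
  simp [seqRot, add_comm]

lemma pairSum_ins (k : ℕ) (g : ℕ → Γ n) :
    pSum β (k + 1) (seqIns g) = pSum β k g := by
  rw [pSum, pSum, sum_range_succ']
  have h : ∀ b, ∑ a ∈ range (b + 1), seqIns g a = ∑ a ∈ range b, g a := by
    intro b
    rw [sum_range_succ']
    simp [seqIns]
  simp only [h]
  simp [seqIns]

/-- The map of chains `mono g ↦ s(g) mono (ρ ∘ g)`. -/
def trf (ρ : (Γ n) →+ (Γ n)) (s : ∀ k : ℕ, (ℕ → Γ n) → ℂ) (k : ℕ) :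
    HT n k ⊸ HT n k :=
  monoLift k fun g => s k g • mono k fun i => ρ (g i)

section Transfer

variable {ρ : (Γ n) →+ (Γ n)} {s : ∀ k : ℕ, (ℕ → Γ n) → ℂ}
  (hl : ∀ k, Loc k (s k))

include hl

lemma trf_mono (k : ℕ) (g : ℕ → Γ n) :
    trf ρ s k (mono k g) = s k g • mono k fun i => ρ (g i) :=
  monoLift_mono ((hl k).smul fun _ _ H => mono_cg fun i hi => by rw [H i hi]) g

lemma transfer_rot (hr : ∀ k g, s k (seqRot k g) = s k g) (k : ℕ) (x : HT n k) :
    trf ρ s k (rot _ k x) = rot _ k (trf ρ s k x) := by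
  apply mono_eq (x := x); intro g
  simp only [trf_mono hl, rot_mono, map_smul, hr]
  congr 1
  refine mono_cg fun i _ => ?_
  simp only [seqRot]
  split_ifs <;> rfl

lemma trf_merge {w w' : (Γ n) → (Γ n) → ℂ}
    (hm : ∀ k g, w' (g 0) (g 1) * s k (sMerge g) = s (k + 1) g * w (ρ (g 0)) (ρ (g 1)))
    (k : ℕ) (x : HT n (k + 1)) :
    trf ρ s k (mergeHead (twistedMul w') k x) =
      mergeHead (twistedMul w) k (trf ρ s (k + 1) x) := by
  apply mono_eq (x := x); intro g
  simp only [trf_mono hl, merge_mono, map_smul, smul_smul, hm]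
  congr 1
  refine mono_cg fun i _ => ?_
  simp only [sMerge]
  split_ifs
  · rw [map_add]
  · rfl

lemma transfer_ins (hi : ∀ k g, s (k + 1) (seqIns g) = s k g)
    (k : ℕ) (x : HT n k) :
    trf ρ s (k + 1) (insertHead 𝟏 k x) =
      insertHead 𝟏 k (trf ρ s k x) := by
  apply mono_eq (x := x); intro g
  simp only [trf_mono hl, insertHead_mono, map_smul, hi]
  congr 1
  refine mono_cg fun i _ => ?_
  simp only [seqIns]
  split_ifs
  · rw [map_zero]
  · rfl

lemma trf_deg (k : ℕ) {x : HT n k}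
    (hx : x ∈ degenerate 𝟏 k) : trf ρ s k x ∈ degenerate 𝟏 k := by
  refine deg_le_of_mono (S := (degenerate 𝟏 k).comap (trf ρ s k)) ?_ hx
  intro g j h0 hk h
  rw [mem_comap, trf_mono hl]
  exact smul_mem _ _ (mono_mem_deg j h0 hk (by rw [h, map_zero]))

end Transfer

end Mono

/-! ### Homogeneous cochains of a lattice -/

section Cochain

variable {n : ℕ}

/-- The simplicial coboundary of a function on lists. -/
def del : (LΓ n → ℂ) → LΓ n → ℂ
  | _, [] => 0
  | G, x :: r => G r - del (fun s => G (x :: s)) r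

lemma del_nil (G : LΓ n → ℂ) : del G [] = 0 := by rw [del]

lemma del_cons (G : LΓ n → ℂ) (x : Γ n) (r : LΓ n) :
    del G (x :: r) = G r - del (fun s => G (x :: s)) r := by rw [del]

lemma del_add (G H : LΓ n → ℂ) : del (G + H) = del G + del H := by
  funext r
  induction r generalizing G H with
  | nil => simp [del_nil]
  | cons x r ih =>
    rw [Pi.add_apply, del_cons, del_cons, del_cons,
      show (fun s => (G + H) (x :: s)) = (fun s => G (x :: s)) + fun s => H (x :: s) from rfl, ih]
    simp only [Pi.add_apply]
    ring

lemma del_smul (a : ℂ) (G : LΓ n → ℂ) : del (a • G) = a • del G := by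
  funext r
  induction r generalizing G with
  | nil => simp [del_nil]
  | cons x r ih =>
    rw [Pi.smul_apply, del_cons, del_cons,
      show (fun s => (a • G) (x :: s)) = a • fun s => G (x :: s) from rfl, ih]
    simp only [Pi.smul_apply, smul_eq_mul]
    ring

variable (n) in
def delL : (LΓ n → ℂ) ⊸ (LΓ n → ℂ) where
  toFun := del
  map_add' := del_add
  map_smul' := del_smul

lemma del_sub (G H : LΓ n → ℂ) : del (G - H) = del G - del H := map_sub (delL n) G H

lemma del_zero : del (0 : LΓ n → ℂ) = 0 := map_zero (delL n)

lemma del_neg (G : LΓ n → ℂ) : del (-G) = -del G := map_neg (delL n) G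

lemma del_del (G : LΓ n → ℂ) : del (del G) = 0 := by
  funext r
  induction r generalizing G with
  | nil => simp [del_nil]
  | cons x r ih =>
    rw [del_cons, show (fun s => del G (x :: s)) = G - del fun s => G (x :: s) by
      funext s; rw [del_cons]; rfl, del_sub, Pi.sub_apply, ih]
    simp

lemma del_eq_sum (G : LΓ n → ℂ) (x : LΓ n) :
    del G x = ∑ i ∈ range x.length, (-1) ^ i * G (x.eraseIdx i) := by
  induction x generalizing G with
  | nil => simp [del_nil]
  | cons x r ih =>
    rw [del_cons, ih, List.length_cons, sum_range_succ']
    simp only [List.eraseIdx_cons_succ, List.eraseIdx_cons_zero, pow_succ, pow_zero, one_mul,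
      mul_neg, mul_one, neg_mul, sum_neg_distrib]
    ring

/-- Normalized cochains. -/
structure IsCoch (G : LΓ n → ℂ) : Prop where
  nil : G [] = 0
  normal : ∀ l y r, G (l ++ y :: y :: r) = 0

lemma del_normal {G : LΓ n → ℂ} (h : ∀ l y r, G (l ++ y :: y :: r) = 0)
    (l : LΓ n) (y : Γ n) (r : LΓ n) : del G (l ++ y :: y :: r) = 0 := by
  induction l generalizing G with
  | nil =>
    have h0 : (fun s => G (y :: y :: s)) = 0 := funext fun s => h [] y s
    rw [List.nil_append, del_cons, del_cons, h0, del_zero]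
    simp
  | cons x l ih =>
    rw [List.cons_append, del_cons, h, ih fun l y r => h (x :: l) y r, sub_zero]

lemma IsCoch.del {G : LΓ n → ℂ} (h : IsCoch G) : IsCoch (del G) :=
  ⟨del_nil G, del_normal h.normal⟩

lemma IsCoch.sub {G H : LΓ n → ℂ} (h : IsCoch G) (h' : IsCoch H) :
    IsCoch (G - H) :=
  ⟨by simp [h.nil, h'.nil], fun l y r => by simp [h.normal, h'.normal]⟩

lemma IsCoch.add {G H : LΓ n → ℂ} (h : IsCoch G) (h' : IsCoch H) :
    IsCoch (G + H) :=
  ⟨by simp [h.nil, h'.nil], fun l y r => by simp [h.normal, h'.normal]⟩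

lemma IsCoch.smul {G : LΓ n → ℂ} (a : ℂ) (h : IsCoch G) :
    IsCoch (a • G) :=
  ⟨by simp [h.nil], fun l y r => by simp [h.normal]⟩

lemma IsCoch.zero : IsCoch (0 : LΓ n → ℂ) := ⟨rfl, fun _ _ _ => rfl⟩

def shift (v : Γ n) (x : LΓ n) : LΓ n := x.map (· + v)

lemma shift_nil (v : Γ n) : shift v [] = [] := rfl

lemma shift_cons (v y : Γ n) (r : LΓ n) :
    shift v (y :: r) = (y + v) :: shift v r := rfl

lemma shift_append (v : Γ n) (l r : LΓ n) :
    shift v (l ++ r) = shift v l ++ shift v r := List.map_append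

lemma shift_shift (v w : Γ n) (x : LΓ n) :
    shift v (shift w x) = shift (w + v) x := by
  simp [shift]

lemma shift_zero (x : LΓ n) : shift 0 x = x := by simp [shift]

def trans (v : Γ n) (G : LΓ n → ℂ) : LΓ n → ℂ := fun x => G (shift v x)

lemma del_trans (v : Γ n) (G : LΓ n → ℂ) :
    del (trans v G) = trans v (del G) := by
  funext r
  induction r generalizing G with
  | nil => simp [del_nil, trans, shift_nil]
  | cons x r ih =>
    rw [del_cons, trans, trans, shift_cons, del_cons]
    congr 1
    exact ih fun s => G ((x + v) :: s)

lemma IsCoch.trans {G : LΓ n → ℂ} (h : IsCoch G) (v : Γ n) :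
    IsCoch (trans v G) :=
  ⟨h.nil, fun l y r => by rw [QTori.trans, shift_append]; exact h.normal _ _ _⟩

def InvTo (m : ℕ) (G : LΓ n → ℂ) : Prop :=
  ∀ j : Fin n, (j : ℕ) < m → trans (Pi.single j 1) G = G

lemma InvTo.del {m : ℕ} {G : LΓ n → ℂ} (h : InvTo m G) : InvTo m (del G) :=
  fun j hj => by rw [← del_trans, h j hj]

lemma trans_sub (v : Γ n) (G H : LΓ n → ℂ) :
    trans v (G - H) = trans v G - trans v H := rfl

lemma trans_add (v : Γ n) (G H : LΓ n → ℂ) :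
    trans v (G + H) = trans v G + trans v H := rfl

lemma InvTo.sub {m : ℕ} {G H : LΓ n → ℂ} (h : InvTo m G) (h' : InvTo m H) :
    InvTo m (G - H) := fun j hj => by rw [trans_sub, h j hj, h' j hj]

lemma InvTo.add {m : ℕ} {G H : LΓ n → ℂ} (h : InvTo m G) (h' : InvTo m H) :
    InvTo m (G + H) := fun j hj => by rw [trans_add, h j hj, h' j hj]

lemma InvTo.smul {m : ℕ} {G : LΓ n → ℂ} (a : ℂ) (h : InvTo m G) :
    InvTo m (a • G) := fun j hj => by
  rw [show QTori.trans (Pi.single j 1) (a • G) = a • QTori.trans (Pi.single j 1) G from rfl, h j hj]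

lemma InvTo.trans {m : ℕ} {G : LΓ n → ℂ} (h : InvTo m G) (v : Γ n) :
    InvTo m (trans v G) := fun j hj => by
  funext x
  have := congrFun (h j hj) (shift v x)
  rwa [QTori.trans, shift_shift, add_comm, ← shift_shift] at this

/-- `f ∪ E` for a function `f` of the first vertex. -/
def headMul (f : (Γ n) → ℂ) (E : LΓ n → ℂ) : LΓ n → ℂ
  | [] => 0
  | x :: r => f x * E (x :: r)

/-- The cup product of the one-cochain `(x, y) ↦ f (y - x)` with `E`. -/
def eMul (f : (Γ n) → ℂ) (E : LΓ n → ℂ) : LΓ n → ℂ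
  | x :: y :: r => f (y - x) * E (y :: r)
  | _ => 0

def stdC : List (Fin n) → LΓ n → ℂ
  | [] => fun x => if x.length = 1 then 1 else 0
  | a :: J => eMul (fun v => (v a : ℂ)) (stdC J)

lemma IsCoch.headMul {E : LΓ n → ℂ} (h : IsCoch E) (f : (Γ n) → ℂ) :
    IsCoch (headMul f E) := by
  refine ⟨rfl, fun l y r => ?_⟩
  cases l with
  | nil => exact mul_eq_zero_of_right _ (h.normal [] y r)
  | cons x l => exact mul_eq_zero_of_right _ (h.normal (x :: l) y r)

lemma IsCoch.eMul {E : LΓ n → ℂ} (h : IsCoch E) {f : (Γ n) → ℂ}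
    (hf : f 0 = 0) : IsCoch (eMul f E) := by
  refine ⟨rfl, fun l y r => ?_⟩
  match l with
  | [] => exact mul_eq_zero_of_left (by rw [sub_self, hf]) _
  | [x] => exact mul_eq_zero_of_right _ (h.normal [] y r)
  | x :: z :: l => exact mul_eq_zero_of_right _ (h.normal (z :: l) y r)

lemma trans_eMul (v : Γ n) (f : (Γ n) → ℂ) (E : LΓ n → ℂ) :
    trans v (eMul f E) = eMul f (trans v E) := by
  funext x
  match x with
  | [] => rfl
  | [x] => rfl
  | x :: y :: r => simp [trans, shift_cons, eMul]

lemma del_edgeMul (f : (Γ n) → ℂ) (E : LΓ n → ℂ) :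
    del (eMul (fun v => f v) E) = fun x => match x with
      | x :: y :: z :: r => (f (z - y) - f (z - x)) * E (z :: r) +
          f (y - x) * (E (z :: r) - del E (y :: z :: r))
      | _ => 0 := by
  funext x
  match x with
  | [] => rfl
  | [x] => simp [del_cons, del_nil, eMul]
  | [x, y] => simp [del_cons, del_nil, eMul]
  | x :: y :: z :: r =>
    have : (fun s => eMul (fun v => f v) E (x :: y :: s)) = f (y - x) • fun s => E (y :: s) := rfl
    have hE := del_cons E y (z :: r)
    rw [del_cons, del_cons, this, del_smul]
    simp only [eMul, Pi.smul_apply, smul_eq_mul, hE]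
    ring

lemma del_edgeMul_add {f : (Γ n) → ℂ} (hf : ∀ v w, f (v + w) = f v + f w)
    {E : LΓ n → ℂ} (h : E [] = 0) :
    del (eMul f E) = -eMul f (del E) := by
  rw [del_edgeMul f E]
  funext x
  match x with
  | [] => simp [eMul]
  | [x] => simp [eMul]
  | [x, y] => simp [eMul, del_cons, del_nil, h]
  | x :: y :: z :: r =>
    have : f (z - x) = f (z - y) + f (y - x) := by rw [← hf]; congr 1; abel
    simp only [this, eMul, Pi.neg_apply]
    ring

lemma coord_add (a : Fin n) (v w : Γ n) : (((v + w) a : ℤ) : ℂ) = (v a : ℂ) + (w a : ℂ) := by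
  simp

lemma stdC_isCochain (I : List (Fin n)) : IsCoch (stdC I) := by
  induction I with
  | nil =>
    refine ⟨by simp [stdC], fun l y r => ?_⟩
    simp [stdC]
    omega
  | cons a J ih => exact ih.eMul (by simp)

lemma trans_stdC (v : Γ n) (I : List (Fin n)) :
    trans v (stdC I) = stdC I := by
  induction I with
  | nil => funext x; simp [trans, stdC, shift]
  | cons a J ih => rw [stdC, trans_eMul, ih]

lemma del_stdC (I : List (Fin n)) : del (stdC I) = 0 := by
  induction I with
  | nil =>
    funext x
    match x with
    | [] => rfl
    | [x] => simp [del_cons, del_nil, stdC]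
    | [x, y] => simp [del_cons, del_nil, stdC]
    | x :: y :: z :: r =>
      have : (fun s => stdC (n := n) [] (x :: y :: s)) = 0 := by funext s; simp [stdC]
      rw [del_cons, del_cons, this, del_zero]
      simp [stdC]
  | cons a J ih =>
    rw [stdC, del_edgeMul_add (coord_add a) (stdC_isCochain J).nil, ih]
    funext x
    match x with
    | [] => simp [eMul]
    | [x] => simp [eMul]
    | x :: y :: r => simp [eMul]

lemma del_headMul (f : (Γ n) → ℂ) (hf : ∀ v w, f (v + w) = f v + f w)
    {E : LΓ n → ℂ} (hE : del E = 0) :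
    del (headMul f E) = eMul f E := by
  funext x
  match x with
  | [] => rfl
  | [x] => simp [del_cons, del_nil, eMul, headMul]
  | x :: y :: r =>
    have h1 : (fun s => headMul f E (x :: s)) = f x • fun s => E (x :: s) := rfl
    have h2 := congrFun hE (x :: y :: r)
    rw [del_cons, Pi.zero_apply, sub_eq_zero] at h2
    have h3 : f y = f (y - x) + f x := by rw [← hf]; congr 1; abel
    rw [del_cons, h1, del_smul, Pi.smul_apply, ← h2]
    simp only [headMul, eMul, smul_eq_mul, h3]
    ring

variable (n) in
def stdSpan : Submodule ℂ (LΓ n → ℂ) := span ℂ (Set.range stdC)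

lemma stdSpan_ind {p : (LΓ n → ℂ) → Prop} {E : LΓ n → ℂ}
    (hE : E ∈ stdSpan n) (h0 : p 0) (hadd : ∀ x y, p x → p y → p (x + y))
    (hsmul : ∀ (a : ℂ) I, p (a • stdC I)) : p E := by
  have h1 : ∀ (a : ℂ) x, (∀ a : ℂ, p (a • x)) → ∀ b : ℂ, p (b • (a • x)) := fun a x h b => by
    rw [smul_smul]; exact h _
  have : ∀ a : ℂ, p (a • E) := by
    refine Submodule.span_induction (p := fun x _ => ∀ a : ℂ, p (a • x)) ?_ ?_ ?_ ?_ hE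
    · rintro _ ⟨I, rfl⟩ a; exact hsmul a I
    · intro a; rwa [smul_zero]
    · intro x y _ _ hx hy a; rw [smul_add]; exact hadd _ _ (hx a) (hy a)
    · intro a x _ hx b; exact h1 a x hx b
  simpa using this 1

lemma trans_stdSpan (v : Γ n) {E : LΓ n → ℂ} (hE : E ∈ stdSpan n) :
    trans v E = E := by
  refine stdSpan_ind (p := fun E => trans v E = E) hE rfl (fun x y hx hy => ?_) fun a I => ?_
  · rw [trans_add, hx, hy]
  · rw [show trans v (a • stdC I) = a • trans v (stdC I) from rfl, trans_stdC]

lemma exists_diff_stdSpan (m : Fin n) {E : LΓ n → ℂ} (hE : E ∈ stdSpan n) :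
    ∃ F, IsCoch F ∧ InvTo m F ∧ trans (Pi.single m 1) F - F = E ∧ del F ∈ stdSpan n := by
  refine stdSpan_ind (p := fun E => ∃ F, IsCoch F ∧ InvTo m F ∧
    trans (Pi.single m 1) F - F = E ∧ del F ∈ stdSpan n) hE ⟨0, .zero, fun _ _ => rfl,
    by funext x; simp [trans], by rw [del_zero]; exact zero_mem _⟩ ?_ ?_
  · rintro x y ⟨F, h1, h2, h3, h4⟩ ⟨F', k1, k2, k3, k4⟩
    refine ⟨F + F', h1.add k1, h2.add k2, ?_, by rw [del_add]; exact add_mem h4 k4⟩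
    rw [trans_add, ← h3, ← k3]; abel
  · intro a I
    have ht : ∀ v, trans v (headMul (fun v => (v m : ℂ)) (stdC I)) =
        headMul (fun v => (v m : ℂ)) (stdC I) + (v m : ℂ) • stdC I := fun v => by
      funext x
      cases x with
      | nil => simp [trans, shift_nil, headMul, (stdC_isCochain I).nil]
      | cons x r =>
        have h := congrFun (trans_stdC v I) (x :: r)
        rw [trans, shift_cons] at h
        simp only [trans, shift_cons, headMul, Pi.add_apply, Pi.smul_apply, smul_eq_mul, h]
        push_cast
        ring
    refine ⟨a • headMul (fun v => (v m : ℂ)) (stdC I),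
      ((stdC_isCochain I).headMul _).smul a, InvTo.smul a fun j hj => ?_, ?_, ?_⟩
    · rw [ht, Pi.single_eq_of_ne (fun h => by rw [h] at hj; exact lt_irrefl _ hj)]; simp
    · rw [show ∀ v G, trans v (a • G) = a • trans v G from fun _ _ => rfl, ht, Pi.single_eq_same]
      simp
    · rw [del_smul, del_headMul _ (coord_add m) (del_stdC I)]
      exact smul_mem _ _ (subset_span ⟨m :: I, rfl⟩)

lemma exists_int_sum (f : ℤ → ℂ) : ∃ S : ℤ → ℂ, (∀ a, S (a + 1) = S a + f a) ∧
    ((∀ a, f a = 0) → ∀ a, S a = 0) := by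
  refine ⟨fun a => ∑ i ∈ Ico 0 a, f i - ∑ i ∈ Ico a 0, f i, fun a => ?_,
    fun h a => by simp [h]⟩
  beta_reduce
  rcases le_or_gt 0 a with h | h
  · rw [Ico_eq_empty (a := a + 1) (by omega), Ico_eq_empty (a := a) (b := 0) (by omega),
      ← Finset.insert_Ico_right_eq_Ico_add_one h, sum_insert (by simp)]
    simp; ring
  · rw [Ico_eq_empty (b := a + 1) (by omega), Ico_eq_empty (b := a) (by omega),
      ← Finset.insert_Ico_add_one_left_eq_Ico h, sum_insert (by simp)]
    simp

lemma exists_diff (m : Fin n) {G : LΓ n → ℂ} (hG : IsCoch G) (hi : InvTo m G) :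
    ∃ F, IsCoch F ∧ InvTo m F ∧ trans (Pi.single m 1) F - F = G := by
  choose S hS hS0 using exists_int_sum
  let u : ℤ → Γ n := fun a => a • Pi.single m 1
  have hu : ∀ a, u a m = a := fun a => by simp [u]
  let φ : LΓ n → ℤ → ℂ := fun x i =>
    G (shift (u (i - (x.headD 0) m)) x)
  refine ⟨fun x => S (φ x) ((x.headD 0) m), ⟨hS0 _ (fun a => hG.nil) _, fun l y r =>
    hS0 _ (fun a => ?_) _⟩, fun j hj => ?_, ?_⟩
  · simp only [φ, shift_append, shift_cons]
    exact hG.normal _ _ _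
  · funext x
    cases x with
    | nil => rfl
    | cons x r =>
      have h0 : (Pi.single j 1 : Γ n) m = 0 :=
        Pi.single_eq_of_ne (fun h => by rw [h] at hj; exact lt_irrefl _ hj) _
      have : φ (shift (Pi.single j 1) (x :: r)) = φ (x :: r) := by
        funext i
        simp only [φ, shift_cons, List.headD_cons, Pi.add_apply, h0, add_zero]
        change G (shift _ (shift (Pi.single j 1) (x :: r))) = _
        rw [shift_shift, add_comm, ← shift_shift]
        exact congrFun (hi j hj) _
      simp only [trans]
      rw [this]
      simp [shift_cons, h0]
  · funext x
    cases x with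
    | nil =>
      rw [Pi.sub_apply, trans, shift_nil, sub_self, hG.nil]
    | cons x r =>
      have : φ (shift (Pi.single m 1) (x :: r)) = φ (x :: r) := by
        funext i
        simp only [φ, shift_cons, List.headD_cons, Pi.add_apply, Pi.single_eq_same]
        change G (shift _ (shift (Pi.single m 1) (x :: r))) = G (shift _ (x :: r))
        rw [shift_shift]
        congr 2
        simp only [u, sub_smul, add_smul, one_smul]
        abel
      simp only [trans, Pi.sub_apply]
      rw [this]
      simp only [shift_cons, List.headD_cons, Pi.add_apply, Pi.single_eq_same, hS]
      rw [add_sub_cancel_left]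
      simp [φ, u, shift_zero]

lemma exists_del_sub_mem (m : ℕ) (hm : m ≤ n) : ∀ G : LΓ n → ℂ, IsCoch G → InvTo m G →
    del G = 0 → ∃ H, IsCoch H ∧ InvTo m H ∧ G - del H ∈ stdSpan n := by
  induction m with
  | zero =>
    intro G hG _ hd
    refine ⟨fun r => if r = [] then 0 else G (0 :: r), ⟨if_pos rfl, fun l y r => ?_⟩,
      fun j hj => absurd hj (Nat.not_lt_zero _), ?_⟩
    · rw [if_neg (by simp)]; exact hG.normal (0 :: l) y r
    · suffices G - del (fun r => if r = [] then 0 else G (0 :: r)) = G [0] • stdC [] by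
        rw [this]; exact smul_mem _ _ (subset_span ⟨_, rfl⟩)
      have h1 : ∀ r, G r = del (fun s => G (0 :: s)) r := fun r => by
        have := congrFun hd (0 :: r)
        rwa [del_cons, Pi.zero_apply, sub_eq_zero] at this
      have h2 : (fun r : LΓ n => if r = [] then 0 else G (0 :: r)) =
          (fun s => G (0 :: s)) - fun r => if r = [] then G [0] else 0 := by
        funext r; by_cases hr : r = [] <;> simp [hr]
      rw [h2, del_sub, ← show G = del (fun s => G (0 :: s)) from funext h1, sub_sub_cancel]
      funext r
      match r with
      | [] => simp [del_nil, stdC]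
      | [x] => simp [del_cons, del_nil, stdC]
      | x :: y :: r =>
        have h3 : (fun s : LΓ n => if x :: s = [] then G [0] else 0) = 0 := by
          funext s; simp
        rw [del_cons, h3, del_zero]
        simp [stdC]
  | succ m ih =>
    intro G hG hi hd
    let e : Fin n := ⟨m, by omega⟩
    have mono : ∀ {F : LΓ n → ℂ}, InvTo (m + 1) F → InvTo m F := fun h j hj =>
      h j (by omega)
    obtain ⟨H, h1, h2, h3⟩ := ih (by omega) G hG (mono hi) hd
    have h4 : del (trans (Pi.single e 1) H - H) = 0 := by
      have h5 : del H = G - (G - del H) := by abel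
      rw [del_sub, del_trans, h5, trans_sub, trans_stdSpan _ h3, hi e (Nat.lt_succ_self m)]
      abel
    obtain ⟨H', k1, k2, k3⟩ := ih (by omega) _ ((h1.trans _).sub h1) ((h2.trans _).sub h2) h4
    obtain ⟨F, f1, f2, f3, f4⟩ := exists_diff_stdSpan e k3
    obtain ⟨K, l1, l2, l3⟩ := exists_diff e k1 (show InvTo (e : ℕ) H' from k2)
    refine ⟨H - del K - F, (h1.sub l1.del).sub f1, fun j hj => ?_, ?_⟩
    · by_cases hje : (j : ℕ) < m
      · exact ((h2.sub (InvTo.del l2)).sub f2) j hje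
      · have : j = e := Fin.ext (by simp only [e]; omega)
        subst this
        have l4 : trans (Pi.single e 1) (del K) - del K = del H' := by
          rw [← del_trans, ← del_sub, l3]
        rw [← sub_eq_zero, trans_sub, trans_sub]
        have l5 : trans (Pi.single e 1) H - H = del H' + (trans (Pi.single e 1) F - F) := by
          rw [f3]; abel
        rw [show trans (Pi.single e 1) H - trans (Pi.single e 1) (del K) - trans (Pi.single e 1) F -
          (H - del K - F) = (trans (Pi.single e 1) H - H) - (trans (Pi.single e 1) (del K) - del K) -
          (trans (Pi.single e 1) F - F) by abel, l4, l5]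
        abel
    · rw [del_sub, del_sub, del_del, show G - (del H - 0 - del F) = G - del H + del F by abel]
      exact add_mem h3 f4

lemma edgeMul_add (f : (Γ n) → ℂ) (E E' : LΓ n → ℂ) :
    eMul f (E + E') = eMul f E + eMul f E' := by
  funext x
  match x with
  | [] => simp [eMul]
  | [x] => simp [eMul]
  | x :: y :: r => simp [eMul]; ring

lemma exists_del_swap (I : List (Fin n)) (a b : Fin n) (J : List (Fin n)) :
    ∃ H, IsCoch H ∧ (∀ v, trans v H = H) ∧
      del H = stdC (I ++ a :: b :: J) + stdC (I ++ b :: a :: J) := by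
  induction I with
  | nil =>
    refine ⟨-eMul (fun v => (v a : ℂ) * (v b : ℂ)) (stdC J), ?_, fun v => ?_, ?_⟩
    · rw [← neg_one_smul ℂ]
      exact ((stdC_isCochain J).eMul (by simp)).smul _
    · change -trans v (eMul _ _) = _
      rw [trans_eMul, trans_stdC]
    · rw [del_neg, del_edgeMul (fun v => (v a : ℂ) * (v b : ℂ)),
        del_stdC]
      funext x
      match x with
      | [] => simp [stdC, eMul]
      | [x] => simp [stdC, eMul]
      | [x, y] => simp [stdC, eMul]
      | x :: y :: z :: r =>
        simp [stdC, eMul]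
        ring
  | cons c I ih =>
    obtain ⟨H, h1, h2, h3⟩ := ih
    refine ⟨-eMul (fun v => (v c : ℂ)) H, ?_, fun v => ?_, ?_⟩
    · rw [← neg_one_smul ℂ]
      exact (h1.eMul (by simp)).smul _
    · change -trans v (eMul _ _) = _
      rw [trans_eMul, h2]
    · rw [del_neg, del_edgeMul_add (coord_add c) h1.nil, h3, neg_neg, edgeMul_add]
      rfl

end Cochain

/-! ### Morphisms of cyclic structures -/

section Itw

variable {V : Type} [AddCommGroup V] [Module ℂ V]

/-- `T` commutes with rotations, products and units and preserves degenerate chains. -/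
structure Itw (T : ∀ k, HC V k ⊸ HC V k) (μ' μ : Bil V) (e : V) : Prop where
  rot : ∀ k x, T k (rot V k x) = QTori.rot V k (T k x)
  merge : ∀ k x, T k (mergeHead μ' k x) = mergeHead μ k (T (k + 1) x)
  ins : ∀ k x, T (k + 1) (insertHead e k x) = insertHead e k (T k x)
  deg : ∀ k x, x ∈ degenerate e k → T k x ∈ degenerate e k

def onE (T : ∀ k, HC V k ⊸ HC V k) : EvenChains V ⊸ EvenChains V :=
  LinearMap.pi fun p => T (2 * p) ∘ₗ LinearMap.proj p

def onOdd (T : ∀ k, HC V k ⊸ HC V k) : OddChains V ⊸ OddChains V :=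
  LinearMap.pi fun p => T (2 * p + 1) ∘ₗ LinearMap.proj p

lemma onE_ap (T : ∀ k, HC V k ⊸ HC V k) (c : EvenChains V) (p : ℕ) :
    onE T c p = T (2 * p) (c p) := rfl

lemma onOdd_apply (T : ∀ k, HC V k ⊸ HC V k) (c : OddChains V) (p : ℕ) :
    onOdd T c p = T (2 * p + 1) (c p) := rfl

namespace Itw

variable {T : ∀ k, HC V k ⊸ HC V k} {μ' μ : Bil V} {e : V}
  (h : Itw T μ' μ e)
include h

lemma hochB (k : ℕ) (x : HC V (k + 1)) : T k (hochB μ' k x) = QTori.hochB μ k (T (k + 1) x) :=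
  hochB_intertwine h.rot h.merge k x

lemma connesB (k : ℕ) (x : HC V k) : T (k + 1) (connesB e k x) = QTori.connesB e k (T k x) :=
  cB_itw h.rot h.ins k x

lemma dEven (c : EvenChains V) : onOdd T (dEven μ' e c) = QTori.dEven μ e (onE T c) := by
  funext p
  rw [onOdd_apply, dEven_apply, dEven_apply, map_add, h.hochB, h.connesB]
  rfl

lemma dOdd (c : OddChains V) : onE T (dOdd μ' e c) = QTori.dOdd μ e (onOdd T c) := by
  funext p
  cases p with
  | zero => rw [onE_ap, dOdd_zero, dOdd_zero]; exact h.hochB 0 _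
  | succ p =>
    rw [onE_ap, dOdd_succ, dOdd_succ, map_add]
    congr 1
    · exact h.hochB _ _
    · exact h.connesB _ _

lemma degEven {c : EvenChains V} (hc : c ∈ degEven e) : onE T c ∈ QTori.degEven e :=
  mem_degEven.2 fun p => h.deg _ _ (mem_degEven.1 hc p)

lemma degOdd {c : OddChains V} (hc : c ∈ degOdd e) : onOdd T c ∈ QTori.degOdd e :=
  mem_degOdd.2 fun p => h.deg _ _ (mem_degOdd.1 hc p)

lemma cycles {c : EvenChains V} (hc : c ∈ cycles μ' e) : onE T c ∈ QTori.cycles μ e := by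
  change QTori.dEven μ e (onE T c) ∈ QTori.degOdd e
  rw [← h.dEven]
  exact h.degOdd hc

lemma boundaries {c : EvenChains V} (hc : c ∈ boundaries μ' e) :
    onE T c ∈ QTori.boundaries μ e := by
  obtain ⟨_, ⟨η, rfl⟩, d, hd, rfl⟩ := mem_sup.1 hc
  rw [map_add, h.dOdd]
  exact Submodule.add_mem_sup ⟨_, rfl⟩ (h.degEven hd)

end Itw

end Itw

/-! ### Comparison of the quantum tori with the commutative torus -/

section Torus

variable {n : ℕ}

lemma trf_itw {ρ : (Γ n) →+ (Γ n)} {s : ∀ k : ℕ, (ℕ → Γ n) → ℂ}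
    (hl : ∀ k, Loc k (s k)) (hr : ∀ k g, s k (seqRot k g) = s k g)
    {w w' : (Γ n) → (Γ n) → ℂ}
    (hm : ∀ k g, w' (g 0) (g 1) * s k (sMerge g) = s (k + 1) g * w (ρ (g 0)) (ρ (g 1)))
    (hi : ∀ k g, s (k + 1) (seqIns g) = s k g) :
    Itw (trf ρ s) (twistedMul w') (twistedMul w) 𝟏 :=
  ⟨fun k x => transfer_rot hl hr k x, fun k x => trf_merge hl hm k x,
    fun k x => transfer_ins hl hi k x, fun k _ hx => trf_deg hl k hx⟩

lemma val_ne_zero (q : QP n) (i j : Fin n) : q.val i j ≠ 0 :=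
  left_ne_zero_of_mul_eq_one (q.skew i j)

lemma cocycle_ne_zero (q : QP n) (g h : Γ n) : cocycle q g h ≠ 0 := by
  refine Finset.prod_ne_zero_iff.2 fun i _ => Finset.prod_ne_zero_iff.2 fun j _ => ?_
  split_ifs
  · exact zpow_ne_zero _ (val_ne_zero q i j)
  · exact one_ne_zero

lemma coc_one (g h : Γ n) : cocycle (1 : QP n) g h = 1 := by
  have : ∀ i j, (1 : QP n).val i j = 1 := fun _ _ => rfl
  simp [cocycle, this]

def cocycleHom (q : QP n) : (Γ n) →+ (Γ n) →+ Additive ℂˣ :=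
  AddMonoidHom.mk' (fun g => AddMonoidHom.mk'
    (fun h => Additive.ofMul (Units.mk0 (cocycle q g h) (cocycle_ne_zero q g h)))
    fun h h' => by
      exact congrArg Additive.ofMul (Units.ext (cocycle_add_right q g h h')))
    fun g g' => by
      refine DFunLike.ext _ _ fun h => ?_
      exact congrArg Additive.ofMul (Units.ext (cocycle_add_left q g g' h))

lemma cocycleHom_apply (q : QP n) (g h : Γ n) :
    ((cocycleHom q g h).toMul : ℂ) = cocycle q g h := rfl

/-- `∏_{a < b} cocycle q g_a g_b`. -/
def phase (q : QP n) (k : ℕ) (g : ℕ → Γ n) : ℂ := ((pSum (cocycleHom q) k g).toMul : ℂˣ)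

lemma phase_ne_zero (q : QP n) (k : ℕ) (g : ℕ → Γ n) : phase q k g ≠ 0 := Units.ne_zero _

lemma phase_local (q : QP n) (k : ℕ) : Loc k (phase q k) := fun g h H => by
  rw [phase, phase, pSum_local _ k g h H]

lemma phase_merge (q : QP n) (k : ℕ) (g : ℕ → Γ n) :
    phase q (k + 1) g = cocycle q (g 0) (g 1) * phase q k (sMerge g) := by
  rw [phase, pairSum_merge, toMul_add, Units.val_mul, cocycleHom_apply, phase]

lemma phase_rot (q : QP n) (k : ℕ) (g : ℕ → Γ n) (h : wt k g = 0) :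
    phase q k (seqRot k g) = phase q k g := by
  rw [phase, phase, pairSum_rot _ _ _ h]

lemma phase_ins (q : QP n) (k : ℕ) (g : ℕ → Γ n) :
    phase q (k + 1) (seqIns g) = phase q k g := by
  rw [phase, phase, pairSum_ins]

/-- A weight function, cut off to chains of total weight zero. -/
def cut (s : ∀ k : ℕ, (ℕ → Γ n) → ℂ) (k : ℕ) (g : ℕ → Γ n) : ℂ :=
  if wt k g = 0 then s k g else 0

lemma cut_local {s : ∀ k : ℕ, (ℕ → Γ n) → ℂ} (hs : ∀ k, Loc k (s k)) (k : ℕ) :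
    Loc k (cut s k) := fun g h H => by
  rw [cut, cut, wt_local k g h H, hs k g h H]

lemma cut_rot {s : ∀ k : ℕ, (ℕ → Γ n) → ℂ}
    (hs : ∀ k g, wt k g = 0 → s k (seqRot k g) = s k g) (k : ℕ) (g : ℕ → Γ n) :
    cut s k (seqRot k g) = cut s k g := by
  rw [cut, cut, wt_rot]
  split_ifs with h
  · exact hs k g h
  · rfl

lemma cut_ins {s : ∀ k : ℕ, (ℕ → Γ n) → ℂ}
    (hs : ∀ k g, s (k + 1) (seqIns g) = s k g) (k : ℕ) (g : ℕ → Γ n) :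
    cut s (k + 1) (seqIns g) = cut s k g := by
  rw [cut, cut, wt_ins, hs]

lemma cut_merge {s : ∀ k : ℕ, (ℕ → Γ n) → ℂ} {w w' : (Γ n) → (Γ n) → ℂ}
    (hs : ∀ k g, w' (g 0) (g 1) * s k (sMerge g) = s (k + 1) g * w (g 0) (g 1))
    (k : ℕ) (g : ℕ → Γ n) :
    w' (g 0) (g 1) * cut s k (sMerge g) = cut s (k + 1) g *
      w (AddMonoidHom.id _ (g 0)) (AddMonoidHom.id _ (g 1)) := by
  rw [cut, cut, wt_merge]
  split_ifs
  · exact hs k g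
  · simp

/-- The isomorphism from invariant chains of the quantum torus to those of the commutative one. -/
def utw (q : QP n) : ∀ k, HT n k ⊸ HT n k :=
  trf (AddMonoidHom.id _) (cut (phase q))

/-- The isomorphism from invariant chains of the commutative torus to those of a quantum one. -/
def rtw (q : QP n) : ∀ k, HT n k ⊸ HT n k :=
  trf (AddMonoidHom.id _) (cut fun k g => (phase q k g)⁻¹)

def wMul (f : (Γ n) → ℂ) : ∀ k, HT n k ⊸ HT n k :=
  trf (AddMonoidHom.id _) fun k g => f (wt k g)

variable (n) in
def inv₀ : ∀ k, HT n k ⊸ HT n k :=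
  wMul fun w => if w = 0 then 1 else 0

lemma inv_phase_local (q : QP n) (k : ℕ) : Loc k fun g => (phase q k g)⁻¹ := fun g h H => by
  simp only [phase_local q k g h H]

lemma utw_mono (q : QP n) (k : ℕ) (g : ℕ → Γ n) :
    utw q k (mono k g) = cut (phase q) k g • mono k g :=
  trf_mono (cut_local (phase_local q)) k g

lemma rtw_mono (q : QP n) (k : ℕ) (g : ℕ → Γ n) :
    rtw q k (mono k g) = cut (fun k g => (phase q k g)⁻¹) k g • mono k g :=
  trf_mono (cut_local (inv_phase_local q)) k g

lemma weightMul_local (f : (Γ n) → ℂ) (k : ℕ) : Loc k fun g => f (wt k g) :=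
  fun g h H => by simp only [wt_local k g h H]

lemma wMul_mono (f : (Γ n) → ℂ) (k : ℕ) (g : ℕ → Γ n) :
    wMul f k (mono k g) = f (wt k g) • mono k g :=
  trf_mono (weightMul_local f) k g

lemma inv₀_mono (k : ℕ) (g : ℕ → Γ n) :
    inv₀ n k (mono k g) = (if wt k g = 0 then (1 : ℂ) else 0) • mono k g :=
  wMul_mono _ k g

lemma retwist_untwist (q : QP n) (k : ℕ) (x : HT n k) :
    rtw q k (utw q k x) = inv₀ n k x := by
  apply mono_eq (x := x); intro g
  rw [utw_mono, map_smul, rtw_mono, inv₀_mono, smul_smul, cut, cut]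
  split_ifs
  · rw [mul_inv_cancel₀ (phase_ne_zero q k g)]
  · simp

lemma untwist_retwist (q : QP n) (k : ℕ) (x : HT n k) :
    utw q k (rtw q k x) = inv₀ n k x := by
  apply mono_eq (x := x); intro g
  rw [rtw_mono, map_smul, utw_mono, inv₀_mono, smul_smul, cut, cut]
  split_ifs
  · rw [inv_mul_cancel₀ (phase_ne_zero q k g)]
  · simp

lemma invPart_untwist (q : QP n) (k : ℕ) (x : HT n k) :
    inv₀ n k (utw q k x) = utw q k x := by
  apply mono_eq (x := x); intro g
  rw [utw_mono, map_smul, inv₀_mono, smul_smul, cut]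
  split_ifs <;> simp

lemma retwist_invPart (q : QP n) (k : ℕ) (x : HT n k) :
    rtw q k (inv₀ n k x) = rtw q k x := by
  apply mono_eq (x := x); intro g
  rw [inv₀_mono, map_smul, rtw_mono, smul_smul, cut]
  split_ifs <;> simp

lemma invPart_invPart (k : ℕ) (x : HT n k) :
    inv₀ n k (inv₀ n k x) = inv₀ n k x := by
  apply mono_eq (x := x); intro g
  rw [inv₀_mono, map_smul, inv₀_mono, smul_smul]
  split_ifs <;> simp

lemma untwist_itw (q : QP n) :
    Itw (utw q) (torusMul q) μ₁ 𝟏 :=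
  trf_itw (cut_local (phase_local q)) (cut_rot (phase_rot q))
    (cut_merge fun k g => by rw [coc_one, phase_merge, mul_one]) (cut_ins (phase_ins q))

lemma rtw_itw (q : QP n) :
    Itw (rtw q) μ₁ (torusMul q) 𝟏 :=
  trf_itw (cut_local (inv_phase_local q))
    (cut_rot fun k g h => by rw [phase_rot q k g h])
    (cut_merge fun k g => by
      have := cocycle_ne_zero q (g 0) (g 1)
      have := phase_ne_zero q k (sMerge g)
      rw [coc_one, phase_merge]; field_simp)
    (cut_ins fun k g => by rw [phase_ins q k g])

lemma weightMul_itw (q : QP n) (f : (Γ n) → ℂ) :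
    Itw (wMul f) (torusMul q) (torusMul q) 𝟏 :=
  trf_itw (weightMul_local f) (fun k g => by rw [wt_rot])
    (fun k g => by rw [wt_merge, mul_comm]; rfl) (fun k g => by rw [wt_ins])

lemma inv₀_itw (q : QP n) :
    Itw (inv₀ n) (torusMul q) (torusMul q) 𝟏 :=
  weightMul_itw q _

def dMul (q : QP n) (θ : (Γ n) →+ (Γ n) →+ ℂ) :
    TorusModule n ⊸ TorusModule n ⊸ TorusModule n :=
  twistedMul fun g h => θ g h * cocycle q g h

variable (θ : (Γ n) →+ (Γ n) →+ ℂ)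

lemma torus_ind {p : TorusModule n → Prop} (x : TorusModule n)
    (hm : ∀ (a : ℂ) g, p (a • monomial g)) (hadd : ∀ x y, p x → p y → p (x + y)) : p x := by
  induction x using Finsupp.induction_linear with
  | zero => simpa using hm 0 0
  | add x y hx hy => exact hadd x y hx hy
  | single g a => simpa [monomial] using hm a g

lemma dMul_cocycle (q : QP n) (x y z : TorusModule n) :
    torusMul q x (dMul q θ y z) - dMul q θ (torusMul q x y) z +
      dMul q θ x (torusMul q y z) - torusMul q (dMul q θ x y) z = 0 := by
  induction x using torus_ind with
  | hadd x x' hx hx' =>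
    refine (Eq.trans ?_ (congrArg₂ (· + ·) hx hx')).trans (add_zero 0)
    simp only [map_add, LinearMap.add_apply]
    abel
  | hm a g =>
    induction y using torus_ind with
    | hadd y y' hy hy' =>
      refine (Eq.trans ?_ (congrArg₂ (· + ·) hy hy')).trans (add_zero 0)
      simp only [map_add, LinearMap.add_apply]
      abel
    | hm b h =>
      induction z using torus_ind with
      | hadd z z' hz hz' =>
        refine (Eq.trans ?_ (congrArg₂ (· + ·) hz hz')).trans (add_zero 0)
        simp only [map_add]
        abel
      | hm c k =>
        simp only [dMul, torusMul, map_smul, LinearMap.smul_apply, twistedMul_monomial,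
          smul_smul, cocycle_add_left, cocycle_add_right, map_add, AddMonoidHom.add_apply, add_assoc,
          ← sub_smul, ← add_smul]
        convert zero_smul ℂ _ using 2
        ring

lemma dMul_one (q : QP n) (x : TorusModule n) :
    dMul q θ 𝟏 x = 0 ∧ dMul q θ x 𝟏 = 0 := by
  induction x using torus_ind with
  | hadd x y hx hy => simp [hx, hy]
  | hm a g => simp [dMul, torusOne, twistedMul_monomial]

lemma untwist_dMul (q : QP n) (k : ℕ) (x : HT n (k + 1)) :
    utw q k (mergeHead (dMul q θ) k x) = mergeHead (dMul 1 θ) k (utw q (k + 1) x) :=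
  trf_merge (cut_local (phase_local q))
    (cut_merge (s := phase q) (w' := fun g h => θ g h * cocycle q g h)
      (w := fun g h => θ g h * cocycle (1 : QP n) g h) fun k g => by
      rw [coc_one, phase_merge]; ring) k x

def fMul : ∀ k, HT n k ⊸ HT n k :=
  trf (AddMonoidHom.id _) (cut (pSum θ))

lemma fMul_mono (k : ℕ) (g : ℕ → Γ n) :
    fMul θ k (mono k g) = cut (pSum θ) k g • mono k g :=
  trf_mono (cut_local (pSum_local θ)) k g

lemma formMul_rot (k : ℕ) (x : HT n k) :
    fMul θ k (rot _ k x) = rot _ k (fMul θ k x) :=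
  transfer_rot (cut_local (pSum_local θ)) (cut_rot (pairSum_rot θ)) k x

lemma formMul_ins (k : ℕ) (x : HT n k) :
    fMul θ (k + 1) (insertHead 𝟏 k x) = insertHead 𝟏 k (fMul θ k x) :=
  transfer_ins (cut_local (pSum_local θ)) (cut_ins (pairSum_ins θ)) k x

lemma formMul_mem_deg (k : ℕ) {x : HT n k}
    (hx : x ∈ degenerate 𝟏 k) : fMul θ k x ∈ degenerate 𝟏 k :=
  trf_deg (cut_local (pSum_local θ)) k hx

lemma formMul_merge (k : ℕ) (x : HT n (k + 1)) :
    fMul θ k (mergeHead μ₁ k x) + mergeHead (dMul 1 θ) k (inv₀ n (k + 1) x) =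
      mergeHead μ₁ k (fMul θ (k + 1) x) := by
  apply mono_eq (x := x) (hF := (fMul θ k ∘ₗ mergeHead _ k + mergeHead _ k ∘ₗ inv₀ n (k + 1)).isLinear)
  intro g
  simp only [fMul_mono, inv₀_mono, map_smul,
    torusMul, dMul, merge_mono, smul_smul, ← add_smul, coc_one, cut, wt_merge,
    pairSum_merge]
  congr 1
  split_ifs <;> simp [add_comm]

lemma fMul_hochB (k : ℕ) (x : HT n (k + 1)) :
    fMul θ k (hochB μ₁ k x) + hochB (dMul 1 θ) k (inv₀ n (k + 1) x) =
      hochB μ₁ k (fMul θ (k + 1) x) :=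
  hochB_comm (formMul_rot θ) (inv₀_itw 1).rot (formMul_merge θ) k x

lemma formMul_connesB (k : ℕ) (x : HT n k) :
    fMul θ (k + 1) (connesB 𝟏 k x) = connesB 𝟏 k (fMul θ k x) :=
  cB_itw (formMul_rot θ) (formMul_ins θ) k x

/-- The Gauss--Manin connection form, transported to the commutative torus. -/
def theta : EV n ⊸ EV n :=
  LinearMap.pi fun p => fMul θ (2 * p) ∘ₗ LinearMap.proj p +
    contr μ₁ (dMul 1 θ) (2 * p) ∘ₗ inv₀ n (2 * p + 2) ∘ₗ
      (LinearMap.proj (p + 1) : (∀ p : ℕ, HT n (2 * p)) ⊸ HC _ (2 * (p + 1))) +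
    contrS 𝟏 (dMul 1 θ) (2 * p) ∘ₗ inv₀ n (2 * p) ∘ₗ LinearMap.proj p

lemma θ_apply (c : EV n) : theta θ c = onE (fMul θ) c +
    getzlerOp μ₁ 𝟏 (dMul 1 θ) (onE (inv₀ n) c) := by
  funext p
  rw [Pi.add_apply]
  simp only [theta, LinearMap.pi_apply, LinearMap.add_apply, comp_apply,
    LinearMap.proj_apply, add_assoc]
  rfl

lemma theta_degEven {c : EV n} (hc : c ∈ degEven 𝟏) :
    theta θ c ∈ degEven 𝟏 := by
  rw [mem_degEven] at hc ⊢
  intro p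
  rw [θ_apply]
  have hi := fun p => (inv₀_itw (n := n) 1).deg _ _ (hc p)
  exact add_mem (formMul_mem_deg θ _ (hc p)) (Submodule.add_mem _
    (contr_mem_deg (fun x => (dMul_one θ 1 x).1) (fun x => (dMul_one θ 1 x).2) _
      (hi (p + 1)))
    (contrS_deg (fun x => (dMul_one θ 1 x).1) (fun x => (dMul_one θ 1 x).2) _
      (deg_le_unital _ _ (hi p))))

lemma theta_cycles {c : EV n} (hc : c ∈ cycles μ₁ 𝟏) :
    theta θ c ∈ cycles μ₁ 𝟏 := by
  refine mem_degOdd.2 fun p => ?_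
  have hP := inv₀_itw (n := n) 1
  have h1 := dEven_getzlerOp (torusMul_assoc 1) (fun x => (torusMul_one 1 x).2)
    (fun x => (torusMul_one 1 x).1) (dMul 1 θ) (dMul_cocycle θ 1)
    (fun x => (dMul_one θ 1 x).1) (fun x => (dMul_one θ 1 x).2) (onE (inv₀ n) c) p
  have h2 := mem_degOdd.1 (show dEven _ _ c ∈ degOdd _ from hc)
  have h3 := mem_degOdd.1 (show dEven _ _ (onE (inv₀ n) c) ∈ degOdd _ from hP.cycles hc)
  have h4 := add_mem h1 (Submodule.add_mem _
    (contr_mem_deg (μ := torusMul 1) (fun x => (dMul_one θ 1 x).1) (fun x => (dMul_one θ 1 x).2) _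
      (h3 (p + 1)))
    (contrS_deg (fun x => (dMul_one θ 1 x).1) (fun x => (dMul_one θ 1 x).2) _
      (deg_le_unital _ _ (h3 p))))
  refine (congrArg (· ∈ degenerate 𝟏 (2 * p + 1)) ?_).mpr (add_mem h4
    (formMul_mem_deg θ _ (h2 p)))
  have h5 := fMul_hochB θ (2 * p + 1) (c (p + 1))
  have h6 := formMul_connesB θ (2 * p) (c p)
  have h7 : dEven μ₁ 𝟏 (onE (fMul θ) c) p =
      fMul θ (2 * p + 1) (dEven μ₁ 𝟏 c p) +
        hochB (dMul 1 θ) (2 * p + 1) (onE (inv₀ n) c (p + 1)) := by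
    rw [dEven_apply, dEven_apply, map_add, h6]
    change hochB μ₁ (2 * p + 1) (fMul θ (2 * p + 1 + 1) (c (p + 1))) + _ = _
    rw [← h5]
    change _ + hochB (dMul 1 θ) (2 * p + 1) (onE (inv₀ n) c (p + 1)) +
      connesB 𝟏 (2 * p) (fMul θ (2 * p) (c p)) = _
    abel
  rw [θ_apply, map_add, Pi.add_apply, h7]
  simp only [gOdd]
  abel

lemma theta_boundaries {c : EV n}
    (hc : c ∈ boundaries μ₁ 𝟏) :
    theta θ c ∈ boundaries μ₁ 𝟏 := by
  obtain ⟨_, ⟨η, rfl⟩, d, hd, rfl⟩ := mem_sup.1 hc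
  rw [map_add]
  refine add_mem ?_ (mem_sup_right (theta_degEven θ hd))
  have hP := inv₀_itw (n := n) 1
  set η' := onOdd (fMul θ) η +
    gOdd μ₁ 𝟏 (dMul 1 θ) (onOdd (inv₀ n) η) with hη'
  suffices h : dOdd μ₁ 𝟏 η' - theta θ (dOdd μ₁ 𝟏 η) ∈
      degEven 𝟏 by
    rw [← sub_sub_cancel (dOdd μ₁ 𝟏 η') (theta θ _)]
    exact Submodule.sub_mem _ (mem_sup_left ⟨_, rfl⟩) (mem_sup_right h)
  refine mem_degEven.2 fun p => ?_
  rw [θ_apply, show onE (inv₀ n) (dOdd μ₁ 𝟏 η) =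
    dOdd μ₁ 𝟏 (onOdd (inv₀ n) η) from hP.dOdd η, hη', map_add]
  cases p with
  | zero =>
    have h1 := dOdd_getzlerOdd_zero (torusMul_assoc 1) (fun x => (torusMul_one 1 x).2)
      (fun x => (torusMul_one 1 x).1) (dMul 1 θ) (dMul_cocycle θ 1) (onOdd (inv₀ n) η)
    have h5 := fMul_hochB θ 0 (η 0)
    refine (congrArg (· ∈ degenerate 𝟏 0) ?_).mpr (zero_mem _)
    rw [← h1]
    change hochB μ₁ 0 (fMul θ (0 + 1) (η 0)) + _ -
      (fMul θ 0 (hochB μ₁ 0 (η 0)) + _) = _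
    rw [← h5]
    change _ + hochB (dMul 1 θ) 0 (onOdd (inv₀ n) η 0) + _ - _ = _
    abel
  | succ p =>
    have h1 := dOdd_getzlerOdd_succ (torusMul_assoc 1) (fun x => (torusMul_one 1 x).2)
      (fun x => (torusMul_one 1 x).1) (dMul 1 θ) (dMul_cocycle θ 1)
      (fun x => (dMul_one θ 1 x).1) (fun x => (dMul_one θ 1 x).2) (onOdd (inv₀ n) η) p
    have h5 := fMul_hochB θ (2 * (p + 1)) (η (p + 1))
    have h6 := formMul_connesB θ (2 * p + 1) (η p)
    refine (congrArg (· ∈ degenerate 𝟏 (2 * (p + 1))) ?_).mpr h1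
    change hochB μ₁ (2 * (p + 1)) (fMul θ (2 * (p + 1) + 1) (η (p + 1))) +
      connesB 𝟏 (2 * p + 1) (fMul θ (2 * p + 1) (η p)) + _ -
      (fMul θ (2 * (p + 1)) (hochB μ₁ (2 * (p + 1)) (η (p + 1)) +
        connesB 𝟏 (2 * p + 1) (η p)) + _) = _
    rw [map_add, ← h5, show fMul θ (2 * (p + 1)) (connesB 𝟏 (2 * p + 1) (η p)) = _
      from h6]
    change _ + hochB (dMul 1 θ) (2 * (p + 1)) (onOdd (inv₀ n) η (p + 1)) + _ + _ - _ = _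
    abel

end Torus

/-! ### Pairings -/

section Pairing

variable {n : ℕ}

lemma prodAll_mono (q : QP n) (k : ℕ) (g : ℕ → Γ n) :
    prodAll (torusMul q) k (mono k g) = phase q k g • monomial (wt k g) := by
  induction k generalizing g with
  | zero =>
    have : phase q 0 g = 1 := by simp [phase, pSum]
    rw [this, one_smul, prodAll, mono, tp]
    simp [wt]
  | succ k ih =>
    rw [prodAll, comp_apply, torusMul, merge_mono, map_smul, ← torusMul, ih, smul_smul,
      phase_merge, wt_merge]

lemma tDer_monomial (i : Fin n) (g : Γ n) :
    torusDer i (monomial g) = (g i : ℂ) • monomial g := by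
  simp [torusDer, monomial]

def coordM (k : ℕ) (I : Fin k → Fin n) (g : ℕ → Γ n) : Matrix (Fin k) (Fin k) ℂ :=
  Matrix.of fun i j => (g (j + 1) (I i) : ℂ)

lemma pair_mono_q (q : QP n) (k : ℕ) (I : Fin k → Fin n) (g : ℕ → Γ n) :
    pairing q k I (mono k g) = cut (phase q) k g * ((k.factorial : ℂ)⁻¹ * (coordM k I g).det) := by
  have h1 : ∀ π : Equiv.Perm (Fin k), PiTensorProduct.map
      (Fin.cons LinearMap.id (fun j => torusDer (I (π j))) :
          Fin (k + 1) → (TorusModule n ⊸ TorusModule n)) (mono k g) =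
      (∏ j, coordM k I g (π j) j) • mono k g := fun π => by
    have h2 : (∏ j, coordM k I g (π j) j) =
        ∏ i : Fin (k + 1), (Fin.cons 1 fun j : Fin k => coordM k I g (π j) j : Fin (k + 1) → ℂ) i := by
      rw [Fin.prod_univ_succ]; simp
    rw [mono, tp, PiTensorProduct.map_tprod, h2, ← MultilinearMap.map_smul_univ]
    congr 1
    funext i
    refine Fin.cases ?_ (fun j => ?_) i
    · simp
    · simp [tDer_monomial, coordM]
  simp only [pairing, LinearMap.smul_apply, LinearMap.sum_apply, comp_apply, h1, map_smul,
    prodAll_mono, Matrix.det_apply, smul_eq_mul]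
  have h3 : torusTrace n (monomial (wt k g)) = if wt k g = 0 then 1 else 0 := by
    simp only [torusTrace, monomial, Finsupp.lapply_apply, Finsupp.single_apply]
  rw [h3, cut, mul_sum, mul_sum, mul_sum]
  refine sum_congr rfl fun π _ => ?_
  rw [show ((Equiv.Perm.sign π) • ∏ i, coordM k I g (π i) i) =
    ((Equiv.Perm.sign π : ℤ) : ℂ) * ∏ i, coordM k I g (π i) i by
      rw [← zsmul_eq_mul]; rfl]
  split_ifs <;> ring

lemma pair_utw (q : QP n) (k : ℕ) (I : Fin k → Fin n) (x : HT n k) :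
    pairing 1 k I (utw q k x) = pairing q k I x := by
  apply mono_eq (x := x); intro g
  have h1 : phase (1 : QP n) k g = 1 := by
    have : cocycleHom (1 : QP n) = 0 := by
      refine DFunLike.ext _ _ fun g => DFunLike.ext _ _ fun h => ?_
      exact congrArg Additive.ofMul (Units.ext (coc_one g h))
    simp [phase, pSum, this]
  rw [utw_mono, map_smul, pair_mono_q, pair_mono_q, smul_eq_mul, cut, cut,
    h1]
  split_ifs <;> ring

lemma pair_mono (k : ℕ) (I : Fin k → Fin n) (g : ℕ → Γ n) :
    pairing 1 k I (mono k g) = (if wt k g = 0 then 1 else 0) *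
      ((k.factorial : ℂ)⁻¹ * (coordM k I g).det) := by
  have h1 : phase (1 : QP n) k g = 1 := by
    have : cocycleHom (1 : QP n) = 0 := by
      refine DFunLike.ext _ _ fun g => DFunLike.ext _ _ fun h => ?_
      exact congrArg Additive.ofMul (Units.ext (coc_one g h))
    simp [phase, pSum, this]
  rw [pair_mono_q, cut, h1]

lemma pairing_degenerate (k : ℕ) (I : Fin k → Fin n) {x : HT n k}
    (hx : x ∈ degenerate 𝟏 k) : pairing 1 k I x = 0 := by
  suffices degenerate 𝟏 k ≤ LinearMap.ker (pairing 1 k I) from this hx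
  refine deg_le_of_mono fun g j h0 hk h => ?_
  rw [mem_ker, pair_mono, Matrix.det_eq_zero_of_column_eq_zero ⟨j - 1, by omega⟩]
  · simp
  · intro i
    simp only [coordM, Matrix.of_apply]
    rw [show j - 1 + 1 = j by omega, h]
    simp

lemma pairing_invPart (k : ℕ) (I : Fin k → Fin n) (x : HT n k) :
    pairing 1 k I (inv₀ n k x) = pairing 1 k I x := by
  apply mono_eq (x := x); intro g
  rw [inv₀_mono, map_smul, pair_mono, smul_eq_mul]
  split_ifs <;> ring

lemma pairing_comp_perm (q : QP n) (k : ℕ) (I : Fin k → Fin n) (π : Equiv.Perm (Fin k))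
    (x : HT n k) :
    pairing q k (I ∘ π) x = ((Equiv.Perm.sign π : ℤ) : ℂ) * pairing q k I x := by
  apply mono_eq (x := x); intro g
  rw [pair_mono_q, pair_mono_q,
    show coordM k (I ∘ π) g = (coordM k I g).submatrix π id from rfl, Matrix.det_permute]
  ring

lemma pair_not_inj (q : QP n) (k : ℕ) (I : Fin k → Fin n) (hI : ¬Function.Injective I)
    (x : HT n k) : pairing q k I x = 0 := by
  obtain ⟨a, b, hab, hne⟩ : ∃ a b, I a = I b ∧ a ≠ b := by
    simpa [Function.Injective] using hI
  apply mono_eq (x := x); intro g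
  rw [pair_mono_q, Matrix.det_zero_of_row_eq hne]
  · simp
  · funext j; simp [coordM, hab]

lemma pair_cB (k : ℕ) (I : Fin (k + 1) → Fin n) (x : HT n k) :
    pairing 1 (k + 1) I (connesB 𝟏 k x) = 0 := by
  have h1 : ∀ y, pairing 1 (k + 1) I (insertHead 𝟏 k y) = 0 := fun y => by
    apply mono_eq (x := y); intro g
    rw [insertHead_mono, pair_mono, wt_ins]
    split_ifs with h
    · have : (coordM (k + 1) I (seqIns g)).det = 0 := by
        refine Matrix.exists_mulVec_eq_zero_iff.1 ⟨fun _ => 1, fun h0 => ?_, ?_⟩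
        · simpa using congrFun h0 0
        · funext i
          have h2 := congrArg (fun w : Γ n => ((w (I i) : ℤ) : ℂ)) h
          simp only [wt, Finset.sum_apply, Int.cast_sum] at h2
          simp only [Matrix.mulVec, dotProduct, coordM, Matrix.of_apply, mul_one]
          rw [Finset.sum_range] at h2
          simpa [seqIns] using h2
      rw [this]; simp
    · simp
  rw [cB_eq, h1]

def psum (k : ℕ) (g : ℕ → Γ n) : LΓ n :=
  (List.range (k + 1)).map fun i => ∑ j ∈ range (i + 1), g j

/-- The functional on chains of total weight zero given by a homogeneous cochain. -/
def evalC (G : LΓ n → ℂ) (k : ℕ) : HT n k ⊸ ℂ :=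
  monoLift k fun g => if wt k g = 0 then G (psum k g) else 0

lemma psum_congr {k : ℕ} {g h : ℕ → Γ n} (H : ∀ i ≤ k, g i = h i) :
    psum k g = psum k h := by
  refine List.map_congr_left fun i hi => sum_congr rfl fun j hj => H j ?_
  simp only [List.mem_range, mem_range] at hi hj
  omega

lemma evalC_mono (G : LΓ n → ℂ) (k : ℕ) (g : ℕ → Γ n) :
    evalC G k (mono k g) = if wt k g = 0 then G (psum k g) else 0 :=
  monoLift_mono (fun g h H => by rw [wt_local k g h H, psum_congr H]) g

lemma face_mono (w : (Γ n) → (Γ n) → ℂ) (k i : ℕ) (hi : i ≤ k) (g : ℕ → Γ n) :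
    face (twistedMul w) k i (mono (k + 1) g) = w (g i) (g (i + 1)) • mono k fun m =>
      if m < i then g m else if m = i then g i + g (i + 1) else g (m + 1) := by
  rw [face_eq, mono, zp_rot_neg _ _ (by omega)]
  rw [show (tp (k + 1) fun m => if m + i ≤ k + 1 then (monomial (g (m + i)) : TorusModule n)
      else monomial (g (m + i - (k + 1 + 1)))) =
    mono (k + 1) fun m => if m + i ≤ k + 1 then g (m + i) else g (m + i - (k + 2)) from
      tp_congr fun m _ => by beta_reduce; split_ifs <;> rfl]
  rw [merge_mono, map_smul, mono, zp_rot_cast _ _ (by omega)]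
  congr 1
  · simp only [zero_add]
    rw [if_pos (by omega), if_pos (by omega), add_comm 1 i]
  · refine tp_congr fun m hm => ?_
    unfold sMerge
    grind

lemma face_last_mono (w : (Γ n) → (Γ n) → ℂ) (k : ℕ) (g : ℕ → Γ n) :
    face (twistedMul w) k (k + 1) (mono (k + 1) g) = w (g (k + 1)) (g 0) • mono k fun m =>
      if m = 0 then g (k + 1) + g 0 else g m := by
  rw [face_eq, mono, zp_rot_neg _ _ (by omega)]
  rw [show (tp (k + 1) fun m => if m + (k + 1) ≤ k + 1 then (monomial (g (m + (k + 1))) : TorusModule n)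
      else monomial (g (m + (k + 1) - (k + 1 + 1)))) =
    mono (k + 1) fun m => if m + (k + 1) ≤ k + 1 then g (m + (k + 1)) else g (m + (k + 1) - (k + 2)) from
      tp_congr fun m _ => by beta_reduce; split_ifs <;> rfl]
  rw [merge_mono, map_smul, mono, zp_rot_cast _ _ (by omega)]
  congr 1
  · grind
  · refine tp_congr fun m hm => ?_
    unfold sMerge
    grind

lemma psum_face (k i : ℕ) (hi : i ≤ k) (g : ℕ → Γ n) :
    (psum (k + 1) g).eraseIdx i = psum k fun m =>
      if m < i then g m else if m = i then g i + g (i + 1) else g (m + 1) := by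
  have hs : ∀ m, ∑ j ∈ range (m + 1), (if j < i then g j else if j = i then g i + g (i + 1)
      else g (j + 1)) = ∑ j ∈ range ((if m < i then m else m + 1) + 1), g j := fun m => by
    induction m with
    | zero =>
      rcases Nat.eq_zero_or_pos i with rfl | h
      · simp [sum_range_succ]
      · simp [h]
    | succ m ih =>
      rw [sum_range_succ, ih]
      rcases lt_trichotomy (m + 1) i with h | h | h
      · rw [if_pos (by omega), if_pos h, if_pos h, ← sum_range_succ]
      · rw [if_pos (by omega), if_neg (by omega), if_pos h, if_neg (by omega),
          sum_range_succ _ (m + 1 + 1), sum_range_succ _ (m + 1), ← h]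
        abel
      · rw [if_neg (by omega), if_neg (by omega), if_neg (by omega), if_neg (by omega),
          ← sum_range_succ]
  refine List.ext_getElem ?_ fun m h1 h2 => ?_
  · rw [List.length_eraseIdx_of_lt (by simp [psum]; omega)]
    simp [psum]
  · rw [List.getElem_eraseIdx]
    simp only [psum, List.getElem_map, List.getElem_range, hs]
    split_ifs <;> rfl

lemma psum_face_last (k : ℕ) (g : ℕ → Γ n) :
    shift (g (k + 1)) ((psum (k + 1) g).eraseIdx (k + 1)) = psum k fun m =>
      if m = 0 then g (k + 1) + g 0 else g m := by
  have hs : ∀ m, ∑ j ∈ range (m + 1), (if j = 0 then g (k + 1) + g 0 else g j) =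
      ∑ j ∈ range (m + 1), g j + g (k + 1) := fun m => by
    rw [sum_range_succ', sum_range_succ']
    simp; abel
  refine List.ext_getElem ?_ fun m h1 h2 => ?_
  · rw [shift, List.length_map, List.length_eraseIdx_of_lt (by simp [psum])]
    simp [psum]
  · have : m < k + 1 := by simpa [psum] using h2
    simp only [shift, List.getElem_map]
    rw [List.getElem_eraseIdx_of_lt _ this]
    simp only [psum, List.getElem_map, List.getElem_range, hs]

lemma evalC_hochB {G : LΓ n → ℂ} (hG : ∀ v, trans v G = G) (k : ℕ)
    (x : HT n (k + 1)) :
    evalC G k (hochB μ₁ k x) = evalC (del G) (k + 1) x := by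
  apply mono_eq (x := x); intro g
  have hw : ∀ i ≤ k, wt k (fun m => if m < i then g m else if m = i then g i + g (i + 1)
      else g (m + 1)) = wt (k + 1) g := fun i hi => by
    have := congrArg List.getLast? (psum_face k i hi g)
    simp only [psum, List.range_succ, List.map_append, List.map_cons, List.map_nil] at this
    rw [List.eraseIdx_append_of_lt_length (by simp; omega)] at this
    simpa [wt] using this.symm
  have hw' : wt k (fun m => if m = 0 then g (k + 1) + g 0 else g m) =
      wt (k + 1) g := by
    rw [wt, wt, sum_range_succ', sum_range_succ,
      sum_range_succ' _ k]
    simp; abel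
  rw [hochB_apply, map_sum, evalC_mono, del_eq_sum]
  simp only [map_smul, smul_eq_mul, torusMul]
  have hlen : (psum (k + 1) g).length = k + 2 := by simp [psum]
  rw [hlen]
  split_ifs with h0
  · refine sum_congr rfl fun i hi => ?_
    rw [mem_range] at hi
    by_cases hik : i ≤ k
    · rw [face_mono _ _ _ hik, map_smul, coc_one, one_smul, evalC_mono, hw i hik, if_pos h0,
        psum_face k i hik]
    · obtain rfl : i = k + 1 := by omega
      rw [face_last_mono, map_smul, coc_one, one_smul, evalC_mono, hw', if_pos h0,
        ← psum_face_last]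
      congr 1
      exact congrFun (hG (g (k + 1))) _
  · refine sum_eq_zero fun i hi => ?_
    rw [mem_range] at hi
    by_cases hik : i ≤ k
    · rw [face_mono _ _ _ hik, map_smul, evalC_mono, hw i hik, if_neg h0]; simp
    · obtain rfl : i = k + 1 := by omega
      rw [face_last_mono, map_smul, evalC_mono, hw', if_neg h0]; simp

lemma evalC_degenerate {G : LΓ n → ℂ} (hG : IsCoch G) (k : ℕ)
    {x : HT n k} (hx : x ∈ degenerate 𝟏 k) : evalC G k x = 0 := by
  suffices degenerate 𝟏 k ≤ LinearMap.ker (evalC G k) from this hx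
  refine deg_le_of_mono fun g j h0 hk h => ?_
  rw [mem_ker, evalC_mono]
  split_ifs
  · obtain ⟨a, rfl⟩ : ∃ a, j = a + 1 := ⟨j - 1, by omega⟩
    obtain ⟨b, rfl⟩ : ∃ b, k = a + 1 + b := ⟨k - (a + 1), by omega⟩
    have : psum (a + 1 + b) g = psum a g ++
        (List.range (b + 1)).map fun i => ∑ j ∈ range (a + 1 + i + 1), g j := by
      rw [psum, show a + 1 + b + 1 = (a + 1) + (b + 1) by omega, List.range_add, List.map_append,
        List.map_map]
      rfl
    rw [this, psum, List.range_succ, List.map_append, List.range_succ_eq_map, List.map_cons,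
      List.append_assoc]
    simp only [List.map_cons, List.map_nil, List.singleton_append, add_zero]
    rw [sum_range_succ _ (a + 1), h, add_zero]
    exact hG.normal _ _ _
  · rfl

lemma stdC_psum (k : ℕ) (I : List (Fin n)) (hI : I.length = k) (g : ℕ → Γ n) :
    stdC I (psum k g) = ∏ j : Fin k, (g (j + 1) (I.get (j.cast hI.symm)) : ℂ) := by
  suffices h : ∀ (I : List (Fin n)) (v : ℕ → Γ n), stdC I
      ((List.range (I.length + 1)).map v) =
      ∏ j : Fin I.length, (((v (j + 1) - v j) (I.get j) : ℤ) : ℂ) by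
    subst hI
    rw [psum, h]
    refine Finset.prod_congr rfl fun j _ => ?_
    rw [sum_range_succ _ (j + 1), add_sub_cancel_left]
    rfl
  intro I
  induction I with
  | nil => intro v; simp [stdC]
  | cons a J ih =>
    intro v
    change stdC (a :: J) (List.map v (List.range (J.length + 1 + 1))) = _
    rw [List.range_succ_eq_map, List.range_succ_eq_map, stdC]
    have h := ih fun i => v (i + 1)
    rw [List.range_succ_eq_map] at h
    simp only [List.map_cons, List.map_map, eMul] at h ⊢
    rw [show v (Nat.succ 0) :: List.map (v ∘ Nat.succ ∘ Nat.succ) (List.range J.length) =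
      v (0 + 1) :: List.map ((fun i => v (i + 1)) ∘ Nat.succ) (List.range J.length) from rfl, h]
    exact (Fin.prod_univ_succ fun j : Fin (J.length + 1) =>
      (((v (j + 1) - v j) ((a :: J).get j) : ℤ) : ℂ)).symm

lemma pairing_eq_sum (k : ℕ) (I : Fin k → Fin n) (x : HT n k) :
    pairing 1 k I x = (k.factorial : ℂ)⁻¹ * ∑ π : Equiv.Perm (Fin k),
      ((Equiv.Perm.sign π : ℤ) : ℂ) * evalC (stdC (List.ofFn (I ∘ π))) k x := by
  refine (LinearMap.congr_fun (g := (k.factorial : ℂ)⁻¹ • ∑ π : Equiv.Perm (Fin k),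
      ((Equiv.Perm.sign π : ℤ) : ℂ) • evalC (stdC (List.ofFn (I ∘ π))) k)
    (mono_ext fun g => ?_) x).trans (by simp)
  simp only [LinearMap.smul_apply, LinearMap.sum_apply, smul_eq_mul, pair_mono,
    evalC_mono, Matrix.det_apply]
  split_ifs
  · rw [one_mul]
    congr 1
    refine sum_congr rfl fun π _ => ?_
    rw [stdC_psum k _ (List.length_ofFn)]
    rw [show ∀ z : ℂ, (Equiv.Perm.sign π) • z = ((Equiv.Perm.sign π : ℤ) : ℂ) * z from fun z => by
      rw [← zsmul_eq_mul]; rfl]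
    congr 1
    refine Finset.prod_congr rfl fun j _ => ?_
    simp [coordM]
  · simp

lemma pairing_hochB (k : ℕ) (I : Fin k → Fin n) (x : HT n (k + 1)) :
    pairing 1 k I (hochB μ₁ k x) = 0 := by
  rw [pairing_eq_sum]
  have : ∀ J, evalC (stdC J) k (hochB μ₁ k x) = 0 := fun J => by
    rw [evalC_hochB (fun v => trans_stdC v J), del_stdC]
    apply mono_eq (x := x); intro g
    rw [evalC_mono]; simp
  simp [this]

lemma pair_bd {c : EV n}
    (hc : c ∈ boundaries μ₁ 𝟏) (p : ℕ) (I : Fin (2 * p) → Fin n) :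
    pairing 1 (2 * p) I (c p) = 0 := by
  obtain ⟨_, ⟨η, rfl⟩, d, hd, rfl⟩ := mem_sup.1 hc
  rw [Pi.add_apply, map_add, pairing_degenerate _ _ (mem_degEven.1 hd p), add_zero]
  cases p with
  | zero => rw [dOdd_zero]; exact pairing_hochB _ _ _
  | succ p =>
    rw [dOdd_succ, map_add]
    exact (congrArg₂ (· + ·) (pairing_hochB _ _ _) (pair_cB _ _ _)).trans (add_zero 0)

end Pairing

/-! ### Pairings detect periodic cyclic homology -/

section Detect

variable {n : ℕ}

lemma InvTo.trans_eq {G : LΓ n → ℂ} (h : InvTo n G) (v : Γ n) :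
    QTori.trans v G = G := by
  let S : AddSubgroup (Γ n) :=
    { carrier := {v | QTori.trans v G = G}
      zero_mem' := by funext x; rw [QTori.trans, shift_zero]
      add_mem' := fun {v w} hv hw => by
        funext x
        have h1 := congrFun hv (shift w x)
        have h2 := congrFun hw x
        simp only [QTori.trans, shift_shift] at h1 h2
        rw [QTori.trans, add_comm, h1, h2]
      neg_mem' := fun {v} hv => by
        funext x
        have h1 := congrFun hv (shift (-v) x)
        simp only [QTori.trans, shift_shift, neg_add_cancel, shift_zero] at h1
        exact h1.symm }
  suffices v ∈ S from this
  rw [← Finset.univ_sum_single v]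
  refine sum_mem fun j _ => ?_
  rw [show Pi.single j (v j) = v j • (Pi.single j 1 : Γ n) by
    rw [← Pi.single_smul]; simp]
  exact S.zsmul_mem (h j j.2) _

lemma ofFn_swap {k : ℕ} (I : Fin (k + 1) → Fin n) (i : Fin k) :
    ∃ A a b J, List.ofFn I = A ++ a :: b :: J ∧
      List.ofFn (I ∘ Equiv.swap i.castSucc i.succ) = A ++ b :: a :: J := by
  refine ⟨(List.ofFn I).take i, I i.castSucc, I i.succ, (List.ofFn I).drop (i + 2),
    List.ext_getElem (by simp; omega) fun m h1 h2 => ?_,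
    List.ext_getElem (by simp; omega) fun m h1 h2 => ?_⟩
  · simp only [List.length_ofFn] at h1
    simp only [List.getElem_ofFn, List.getElem_append, List.length_take, List.length_ofFn,
      List.getElem_take, List.getElem_cons, List.getElem_drop]
    have : min (i : ℕ) (k + 1) = i := by omega
    simp only [this]
    split_ifs
    · rfl
    · congr 1; ext; simp; omega
    · congr 1; ext; simp; omega
    · congr 1; ext; simp; omega
  · simp only [List.length_ofFn] at h1
    simp only [List.getElem_ofFn, List.getElem_append, List.length_take, List.length_ofFn,
      List.getElem_take, List.getElem_cons, List.getElem_drop, Function.comp_apply]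
    have : min (i : ℕ) (k + 1) = i := by omega
    simp only [this, Equiv.swap_apply_def, Fin.ext_iff, Fin.val_castSucc, Fin.val_succ]
    split_ifs <;> first | rfl | omega | (congr 1; omega) | (congr 1; ext; simp; omega) | (congr 1; ext; simp) | (congr 1; grind)

/-- A chain on which the coboundaries of invariant cochains vanish. -/
def IsInvC (k : ℕ) (z : HT n k) : Prop :=
  ∀ H : LΓ n → ℂ, IsCoch H → (∀ v, trans v H = H) → evalC (del H) k z = 0

lemma isInvCycle_zero (z : HT n 0) : IsInvC 0 z := fun H hH _ => by
  apply mono_eq (x := z); intro g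
  rw [evalC_mono]
  simp [psum, del_cons, del_nil, hH.nil]

lemma isInvCycle_succ (k : ℕ) (z : HT n (k + 1))
    (hz : hochB μ₁ k z ∈ degenerate 𝟏 k) : IsInvC (k + 1) z :=
  fun H hH hi => by rw [← evalC_hochB hi, evalC_degenerate hH k hz]

lemma evalC_add (G H : LΓ n → ℂ) (k : ℕ) (z : HT n k) :
    evalC (G + H) k z = evalC G k z + evalC H k z := by
  apply mono_eq (x := z) (hG := (evalC G k + evalC H k).isLinear); intro g
  simp only [LinearMap.add_apply, evalC_mono]
  split_ifs <;> simp

lemma evalC_smul (a : ℂ) (G : LΓ n → ℂ) (k : ℕ) (z : HT n k) :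
    evalC (a • G) k z = a * evalC G k z := by
  apply mono_eq (x := z); intro g
  simp only [evalC_mono, smul_eq_mul]
  split_ifs <;> simp

lemma evalC_zero (k : ℕ) (z : HT n k) : evalC 0 k z = 0 := by
  simpa using evalC_smul 0 0 k z

lemma evalC_swap {k : ℕ} {z : HT n k} (hz : IsInvC k z)
    (I : Fin k → Fin n) (π : Equiv.Perm (Fin k)) :
    evalC (stdC (List.ofFn (I ∘ π))) k z =
      ((Equiv.Perm.sign π : ℤ) : ℂ) * evalC (stdC (List.ofFn I)) k z := by
  cases k with
  | zero => simp [Subsingleton.elim π 1]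
  | succ k =>
    have hπ : π ∈ Submonoid.closure (Set.range fun i : Fin k => Equiv.swap i.castSucc i.succ) := by
      rw [Equiv.Perm.mclosure_swap_castSucc_succ]; trivial
    induction hπ using Submonoid.closure_induction generalizing I with
    | mem π h =>
      obtain ⟨i, rfl⟩ := h
      obtain ⟨A, a, b, J, h1, h2⟩ := ofFn_swap I i
      obtain ⟨H, k1, k2, k3⟩ := exists_del_swap A a b J
      have h3 := hz H k1 k2
      rw [k3, evalC_add] at h3
      simp only [h1, h2]
      rw [Equiv.Perm.sign_swap (Fin.castSucc_lt_succ).ne]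
      push_cast
      linear_combination h3
    | one => simp
    | mul π ρ _ _ h1 h2 =>
      rw [show I ∘ (π * ρ : Equiv.Perm _) = (I ∘ π) ∘ ρ from rfl, h2, h1, Equiv.Perm.sign_mul]
      push_cast
      ring

lemma pairing_eq_evalC {k : ℕ} {z : HT n k} (hz : IsInvC k z)
    (I : Fin k → Fin n) : pairing 1 k I z = evalC (stdC (List.ofFn I)) k z := by
  have hs : ∀ π : Equiv.Perm (Fin k), ((Equiv.Perm.sign π : ℤ) : ℂ) *
      (((Equiv.Perm.sign π : ℤ) : ℂ) * evalC (stdC (List.ofFn I)) k z) =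
      evalC (stdC (List.ofFn I)) k z := fun π => by
    rw [← mul_assoc, ← Int.cast_mul, ← Units.val_mul, Int.units_mul_self]; simp
  rw [pairing_eq_sum, sum_congr rfl fun π _ => by rw [evalC_swap hz I π, hs]]
  have : (k.factorial : ℂ) ≠ 0 := Nat.cast_ne_zero.2 k.factorial_ne_zero
  simp [Fintype.card_perm, this]

lemma stdC_length (I : List (Fin n)) (x : LΓ n) (h : x.length ≠ I.length + 1) :
    stdC I x = 0 := by
  induction I generalizing x with
  | nil => simpa [stdC] using h
  | cons a J ih =>
    match x with
    | [] => simp [stdC, eMul]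
    | [x] => simp [stdC, eMul]
    | x :: y :: r => simp [stdC, eMul, ih (y :: r) (by simpa using h)]

lemma evalC_stdC_eq_zero {k : ℕ} {z : HT n k} (hz : IsInvC k z)
    (hp : ∀ I, pairing 1 k I z = 0) (I : List (Fin n)) : evalC (stdC I) k z = 0 := by
  by_cases hI : I.length = k
  · subst hI
    have := pairing_eq_evalC hz I.get
    rw [hp, List.ofFn_get] at this
    exact this.symm
  · apply mono_eq (x := z); intro g
    rw [evalC_mono, stdC_length I _ (by simp [psum]; omega)]
    simp

def diffs (k : ℕ) (x : LΓ n) (i : ℕ) : Γ n :=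
  if i = 0 then x.getD 0 0 - x.getD k 0 else x.getD i 0 - x.getD (i - 1) 0

/-- The homogeneous cochain of a functional on chains. -/
def funC (k : ℕ) (φ : HT n k ⊸ ℂ) (x : LΓ n) : ℂ :=
  if x.length = k + 1 then φ (mono k (diffs k x)) else 0

lemma getD_shift (v : Γ n) (x : LΓ n) (i : ℕ) (h : i < x.length) :
    (shift v x).getD i 0 = x.getD i 0 + v := by
  simp [shift, h]

lemma trans_funC (k : ℕ) (φ : HT n k ⊸ ℂ) (v : Γ n) :
    trans v (funC k φ) = funC k φ := by
  funext x
  simp only [trans, funC]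
  rw [show (shift v x).length = x.length by simp [shift]]
  split_ifs with h
  · congr 1
    refine mono_cg fun i hi => ?_
    simp only [diffs]
    split_ifs
    · rw [getD_shift _ _ _ (by omega), getD_shift _ _ _ (by omega)]; abel
    · rw [getD_shift _ _ _ (by omega), getD_shift _ _ _ (by omega)]; abel
  · rfl

lemma getD_psum (k i : ℕ) (hi : i ≤ k) (g : ℕ → Γ n) :
    (psum k g).getD i 0 = ∑ j ∈ range (i + 1), g j := by
  rw [List.getD_eq_getElem _ _ (by simp [psum]; omega)]
  simp [psum]

lemma diffs_psum (k : ℕ) (g : ℕ → Γ n) (h : wt k g = 0) (i : ℕ) (hi : i ≤ k) :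
    diffs k (psum k g) i = g i := by
  rw [diffs]
  split_ifs with h0
  · subst h0
    rw [getD_psum _ _ (Nat.zero_le k), getD_psum _ _ le_rfl]
    change _ - wt k g = _
    rw [h]
    simp
  · obtain ⟨i, rfl⟩ : ∃ j, i = j + 1 := ⟨i - 1, by omega⟩
    rw [getD_psum _ _ hi, getD_psum _ _ (by omega), sum_range_succ]
    simp

lemma evalC_funC (k : ℕ) (φ : HT n k ⊸ ℂ)
    (z : HT n k) : evalC (funC k φ) k z = φ (inv₀ n k z) := by
  apply mono_eq (x := z); intro g
  rw [evalC_mono, inv₀_mono, map_smul]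
  split_ifs with h
  · rw [funC, if_pos (by simp [psum]), one_smul,
      mono_cg (diffs_psum k g h)]
  · simp

lemma psum_diffs (k : ℕ) (x : LΓ n) (hx : x.length = k + 1) :
    x = shift (x.getD k 0) (psum k (diffs k x)) := by
  have hs : ∀ i, ∑ j ∈ range (i + 1), diffs k x j = x.getD i 0 - x.getD k 0 := fun i => by
    induction i with
    | zero => simp [diffs]
    | succ i ih => rw [sum_range_succ, ih]; simp [diffs]
  refine List.ext_getElem (by simp [shift, psum, hx]) fun m h1 h2 => ?_
  simp only [shift, psum, List.getElem_map, List.getElem_range, hs, sub_add_cancel]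
  exact (List.getD_eq_getElem x 0 h1).symm

lemma wt_diffs (k : ℕ) (x : LΓ n) : wt k (diffs k x) = 0 := by
  have hs : ∀ i, ∑ j ∈ range (i + 1), diffs k x j = x.getD i 0 - x.getD k 0 := fun i => by
    induction i with
    | zero => simp [diffs]
    | succ i ih => rw [sum_range_succ, ih]; simp [diffs]
  rw [wt, hs, sub_self]

lemma del_funC (k : ℕ) {φ : HT n k ⊸ ℂ}
    (hφ : ∀ y, φ (hochB μ₁ k y) = 0) : del (funC k φ) = 0 := by
  funext x
  by_cases hx : x.length = k + 2
  · have ht : trans (x.getD (k + 1) 0) (del (funC k φ)) = del (funC k φ) := by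
      rw [← del_trans, trans_funC]
    have h1 : del (funC k φ) x =
        del (funC k φ) (psum (k + 1) (diffs (k + 1) x)) := by
      conv_lhs => rw [psum_diffs (k + 1) x hx]
      exact congrFun ht _
    have h2 := evalC_mono (del (funC k φ)) (k + 1) (diffs (k + 1) x)
    rw [if_pos (wt_diffs _ _), ← h1, ← evalC_hochB (trans_funC k φ),
      evalC_funC, (inv₀_itw 1).hochB, hφ] at h2
    rw [← h2]; rfl
  · rw [del_eq_sum]
    refine sum_eq_zero fun i hi => ?_
    rw [funC, if_neg, mul_zero]
    rw [List.length_eraseIdx_of_lt (mem_range.1 hi)]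
    rw [mem_range] at hi
    omega

lemma isCochain_funC (k : ℕ) {φ : HT n k ⊸ ℂ}
    (hφ : ∀ y ∈ degenerate 𝟏 k, φ y = 0) : IsCoch (funC k φ) := by
  refine ⟨if_neg (by simp), fun l y r => ?_⟩
  rw [funC]
  split_ifs with h
  · rw [List.length_append, List.length_cons, List.length_cons] at h
    refine hφ _ (mono_mem_deg (l.length + 1) (by omega) (by omega) ?_)
    rw [diffs, if_neg (by omega)]
    simp [List.getD_append_right]
  · rfl

lemma mem_of_pair {k : ℕ} {z : HT n k} (hz : IsInvC k z)
    (hp : ∀ I, pairing 1 k I z = 0) :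
    inv₀ n k z ∈ LinearMap.range (hochB μ₁ k) ⊔ degenerate 𝟏 k := by
  by_contra hn
  obtain ⟨φ, h1, h2⟩ := Submodule.exists_le_ker_of_notMem (K := ℂ) (V := HT n k)
    (p := LinearMap.range (hochB μ₁ k) ⊔ degenerate 𝟏 k) hn
  have h3 : ∀ y, φ (hochB μ₁ k y) = 0 := fun y =>
    h2 (mem_sup_left ⟨y, rfl⟩)
  have h4 : ∀ y ∈ degenerate 𝟏 k, φ y = 0 := fun y hy => h2 (mem_sup_right hy)
  obtain ⟨H, k1, k2, k3⟩ := exists_del_sub_mem n le_rfl _ (isCochain_funC k h4)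
    (fun j _ => trans_funC k φ _) (del_funC k h3)
  refine h1 ?_
  rw [← evalC_funC,
    show funC k φ = (funC k φ - del H) + del H by abel, evalC_add,
    hz H k1 k2.trans_eq, add_zero]
  refine stdSpan_ind (p := fun E => evalC E k z = 0) k3 (evalC_zero k z)
    (fun x y hx hy => by rw [evalC_add, hx, hy, add_zero]) fun a I => ?_
  rw [evalC_smul, evalC_stdC_eq_zero hz hp, mul_zero]

lemma ex_hochB_of_pair {k : ℕ} {z : HT n k} (hz : IsInvC k z)
    (hp : ∀ I, pairing 1 k I z = 0) (hP : inv₀ n k z = z) :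
    ∃ η, inv₀ n (k + 1) η = η ∧ z - hochB μ₁ k η ∈ degenerate 𝟏 k := by
  obtain ⟨_, ⟨η, rfl⟩, d, hd, h⟩ := mem_sup.1 (mem_of_pair hz hp)
  refine ⟨inv₀ n (k + 1) η, invPart_invPart _ _, ?_⟩
  rw [← (inv₀_itw 1).hochB]
  have h1 := congrArg (inv₀ n k) h
  rw [invPart_invPart, hP, map_add] at h1
  refine (congrArg (· ∈ degenerate 𝟏 k) ?_).mpr ((inv₀_itw 1).deg _ _ hd)
  rw [← h1]
  abel

lemma mem_bd_of_invPart {c : EV n}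
    (hc : c ∈ cycles μ₁ 𝟏) (hP : onE (inv₀ n) c = c)
    (hp : ∀ p I, pairing 1 (2 * p) I (c p) = 0) : c ∈ boundaries μ₁ 𝟏 := by
  have hc' := mem_degOdd.1 (show dEven _ _ c ∈ degOdd _ from hc)
  have hbB := hochB_connesB (torusMul_assoc (n := n) 1) (fun x => (torusMul_one 1 x).2)
      (fun x => (torusMul_one 1 x).1)
  let Q : ∀ p, HT n (2 * p + 1) → Prop := fun p η => inv₀ n _ η = η ∧
    hochB μ₁ (2 * p + 1) (c (p + 1) - connesB 𝟏 (2 * p + 1) η) ∈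
      degenerate 𝟏 (2 * p + 1)
  obtain ⟨η₀, a1, a2⟩ := ex_hochB_of_pair (isInvCycle_zero (c 0)) (hp 0) (congrFun hP 0)
  have q0 : Q 0 η₀ := by
    refine ⟨a1, (congrArg (· ∈ degenerate 𝟏 1) ?_).mpr (Submodule.sub_mem _ (hc' 0)
      (cB_deg _ _ (deg_le_unital _ _ a2)))⟩
    have := hbB 0 η₀
    rw [map_sub, dEven_apply, map_sub (connesB _ _), show hochB μ₁ (2 * 0 + 1)
      (connesB 𝟏 (2 * 0 + 1) η₀) = _ from eq_neg_of_add_eq_zero_left this]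
    abel
  have step : ∀ p η, Q p η → ∃ η', Q (p + 1) η' ∧ c (p + 1) - connesB 𝟏 (2 * p + 1) η -
      hochB μ₁ (2 * (p + 1)) η' ∈ degenerate 𝟏 (2 * (p + 1)) := by
    rintro p η ⟨h1, h2⟩
    obtain ⟨η', b1, b2⟩ := ex_hochB_of_pair (k := 2 * p + 1 + 1)
      (isInvCycle_succ _ _ h2) (fun I => by
        rw [map_sub, pair_cB, sub_zero]; exact hp (p + 1) I)
      (by rw [map_sub, (inv₀_itw 1).connesB, h1]
          exact congrArg (· - _) (congrFun hP (p + 1)))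
    refine ⟨η', ⟨b1, (congrArg (· ∈ degenerate 𝟏 (2 * (p + 1) + 1)) ?_).mpr
      (Submodule.sub_mem _ (Submodule.sub_mem _ (hc' (p + 1)) (cB_deg _ _
        (deg_le_unital _ _ b2))) (cB_cB_mem 𝟏 (2 * p + 1) η))⟩, b2⟩
    have := hbB (2 * (p + 1)) η'
    rw [map_sub, dEven_apply, map_sub (connesB _ _), map_sub (connesB _ _),
      show hochB μ₁ (2 * (p + 1) + 1)
      (connesB 𝟏 (2 * (p + 1) + 1) η') = _ from eq_neg_of_add_eq_zero_left this]
    change _ = _ - (connesB 𝟏 (2 * (p + 1)) (c (p + 1)) -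
      connesB 𝟏 (2 * (p + 1)) (connesB 𝟏 (2 * p + 1) η) -
      connesB 𝟏 (2 * (p + 1)) (hochB μ₁ (2 * (p + 1)) η')) -
      connesB 𝟏 (2 * (p + 1)) (connesB 𝟏 (2 * p + 1) η)
    abel
  choose! next n1 n2 using step
  let η : ∀ p, {η // Q p η} := fun p => Nat.rec ⟨η₀, q0⟩ (fun p η => ⟨next p η.1, n1 p η.1 η.2⟩) p
  refine mem_sup.2 ⟨_, ⟨fun p => (η p).1, rfl⟩, c - _, mem_degEven.2 fun p => ?_,
    add_sub_cancel _ _⟩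
  rw [Pi.sub_apply]
  cases p with
  | zero => exact a2
  | succ p =>
    rw [dOdd_succ]
    refine (congrArg (· ∈ degenerate 𝟏 (2 * (p + 1))) ?_).mpr (n2 p _ (η p).2)
    change _ - (_ + _) = _ - _ - hochB μ₁ (2 * (p + 1)) (η (p + 1)).1
    abel

lemma lieD_torusDer (i : Fin n) (k : ℕ) (x : HT n k) :
    lieD (torusDer i) k x = wMul (fun w => (w i : ℂ)) k x := by
  apply mono_eq (x := x); intro g
  have h : ∀ j ∈ range (k + 1), ϱ (TorusModule n) (j : ℤ) (hMap (torusDer i) k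
      (ϱ (TorusModule n) (-(j : ℤ)) (mono k g))) = ((g j i : ℤ) : ℂ) • mono k g := fun j hj => by
    rw [mem_range] at hj
    set y := ϱ (TorusModule n) (-(j : ℤ)) (mono k g) with hy
    have h1 : hMap (torusDer i) k y = ((g j i : ℤ) : ℂ) • y := by
      rw [hy, mono, zp_rot_neg _ _ (by omega), hMap_tp]
      obtain ⟨h, hh⟩ := ex_head k (fun m => if m + j ≤ k then
        (monomial (g (m + j)) : TorusModule n) else monomial (g (m + j - (k + 1))))
      rw [← hh, zero_add, if_pos (by omega), tDer_monomial, map_smul, hh]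
      congr 1
      refine tp_congr fun m _ => ?_
      split_ifs <;> grind
    rw [h1, map_smul, hy, zp_zp, add_neg_cancel, zp_zero]
  rw [lieD, LinearMap.sum_apply, wMul_mono]
  simp only [comp_apply]
  rw [sum_congr rfl h, ← sum_smul, wt]
  simp

lemma sub_invPart_mem_bd (q : QP n) {c : EV n}
    (hc : c ∈ cycles (torusMul q) 𝟏) :
    c - onE (inv₀ n) c ∈ boundaries (torusMul q) 𝟏 := by
  let N : (Γ n) → ℂ := fun w => ∑ j, (w j : ℂ) ^ 2
  have hN : ∀ w, N w = 0 ↔ w = 0 := fun w => by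
    have : N w = ((∑ j, w j ^ 2 : ℤ) : ℂ) := by simp [N]
    rw [this, Int.cast_eq_zero, Finset.sum_eq_zero_iff_of_nonneg fun j _ => sq_nonneg _]
    simp [funext_iff]
  have h1 : c - onE (inv₀ n) c = ∑ i, fun p => lieD (torusDer i) (2 * p)
      (onE (wMul fun w => (w i : ℂ) / N w) c p) := by
    funext p
    rw [Pi.sub_apply, Finset.sum_apply]
    simp only [onE_ap, lieD_torusDer]
    rw [sub_eq_iff_eq_add]
    refine LinearMap.congr_fun (f := LinearMap.id)
      (g := ∑ i, wMul (fun w => (w i : ℂ)) (2 * p) ∘ₗ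
        wMul (fun w => (w i : ℂ) / N w) (2 * p) + inv₀ n (2 * p)) (mono_ext fun g => ?_)
      (c p) |>.trans (by rw [LinearMap.add_apply, LinearMap.sum_apply]; rfl)
    simp only [LinearMap.add_apply, id_apply, LinearMap.sum_apply, comp_apply,
      wMul_mono, map_smul, inv₀_mono, smul_smul, ← sum_smul, ← add_smul]
    nth_rewrite 1 [← one_smul ℂ (mono (2 * p) g)]
    congr 1
    rw [sum_congr rfl fun i _ => (by rw [div_mul_eq_mul_div, ← sq] :
      ((wt (2 * p) g i : ℤ) : ℂ) / N (wt (2 * p) g) * (wt (2 * p) g i : ℂ) =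
      (wt (2 * p) g i : ℂ) ^ 2 / N (wt (2 * p) g)), ← Finset.sum_div]
    change _ = N _ / N _ + _
    split_ifs with h
    · rw [(hN _).2 h]; simp
    · rw [div_self fun h' => h ((hN _).1 h')]; simp
  rw [h1]
  refine Submodule.sum_mem _ fun i _ => ?_
  refine lieD_mem_bd (torusMul_assoc q) (fun x => (torusMul_one q x).2)
      (fun x => (torusMul_one q x).1) (torusDer i) (fun x y => ?_) ?_
      ((weightMul_itw q _).cycles hc)
  · induction x using torus_ind with
    | hadd x x' hx hx' => simp only [map_add, LinearMap.add_apply, hx, hx']; abel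
    | hm a g =>
      induction y using torus_ind with
      | hadd y y' hy hy' => simp only [map_add, hy, hy']; abel
      | hm b h =>
        simp only [torusMul, map_smul, LinearMap.smul_apply, twistedMul_monomial,
          tDer_monomial, smul_smul, ← add_smul]
        congr 1
        push_cast [Pi.add_apply]
        ring
  · rw [torusOne, tDer_monomial]; simp

lemma mem_bd_of_pair (q : QP n) {c : EV n}
    (hc : c ∈ cycles (torusMul q) 𝟏)
    (hp : ∀ p I, pairing q (2 * p) I (c p) = 0) : c ∈ boundaries (torusMul q) 𝟏 := by
  have h1 := mem_bd_of_invPart ((untwist_itw q).cycles hc)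
    (funext fun p => invPart_untwist q _ _) (fun p I => by
      rw [onE_ap, pair_utw, hp])
  have h2 := (rtw_itw q).boundaries h1
  rw [show onE (rtw q) (onE (utw q) c) = onE (inv₀ n) c from
    funext fun p => retwist_untwist q _ _] at h2
  rw [← sub_add_cancel c (onE (inv₀ n) c)]
  exact add_mem (sub_invPart_mem_bd q hc) h2

lemma pair_bd_tw (q : QP n) {c : EV n}
    (hc : c ∈ boundaries (torusMul q) 𝟏) (p : ℕ) (I : Fin (2 * p) → Fin n) :
    pairing q (2 * p) I (c p) = 0 := by
  rw [← pair_utw]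
  exact pair_bd ((untwist_itw q).boundaries hc) p I

end Detect

/-! ### Linearity of the connection form -/

section Linear

variable {V : Type} [AddCommGroup V] [Module ℂ V]

lemma lin_comp {U V' W X : Type*} [AddCommMonoid U] [Module ℂ U] [AddCommMonoid V']
    [Module ℂ V'] [AddCommMonoid W] [Module ℂ W] [AddCommMonoid X] [Module ℂ X]
    {B : Type*} [AddCommMonoid B] [Module ℂ B]
    {F : B → V' ⊸ W} (hF : IsLinearMap ℂ F) (f : W ⊸ X) (g : U ⊸ V') :
    IsLinearMap ℂ fun β => f ∘ₗ F β ∘ₗ g :=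
  ⟨fun x y => by rw [hF.map_add, LinearMap.add_comp, LinearMap.comp_add],
    fun a x => by rw [hF.map_smul, LinearMap.smul_comp, LinearMap.comp_smul]⟩

lemma lin_mergeHead (k : ℕ) :
    IsLinearMap ℂ fun β : Bil V => mergeHead β k :=
  ⟨fun x y => by simp only [mergeHead, LinearMap.comp_add, map_add],
    fun a x => by simp only [mergeHead, LinearMap.comp_smul, map_smul]⟩

lemma lin_face (k i : ℕ) : IsLinearMap ℂ fun β : Bil V => face β k i :=
  lin_comp (lin_mergeHead k) _ _

lemma lin_contr (μ : Bil V) (k : ℕ) :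
    IsLinearMap ℂ fun β : Bil V => contr μ β k :=
  lin_comp (lin_face (k + 1) 1) (mergeHead μ k) LinearMap.id

lemma lin_contrS (e : V) : ∀ k, IsLinearMap ℂ fun β : Bil V => contrS e β k
  | 0 => ⟨fun _ _ => (add_zero _).symm, fun a _ => (smul_zero a).symm⟩
  | k + 1 => by
    have h : ∀ i r, IsLinearMap ℂ fun β : Bil V =>
        insertHead e k ∘ₗ (rot V k ^ r).toLinearMap ∘ₗ face β k i := fun i r =>
      lin_comp (lin_face k i) (insertHead e k ∘ₗ (rot V k ^ r).toLinearMap)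
        LinearMap.id
    refine ⟨fun x y => ?_, fun a x => ?_⟩
    · simp only [contrS, (h _ _).map_add, smul_add, sum_add_distrib]
    · simp only [contrS, (h _ _).map_smul, smul_sum]
      refine sum_congr rfl fun i _ => sum_congr rfl fun r _ => smul_comm _ _ _

end Linear

section Transport

variable {n : ℕ}

def form (a : Fin n → Fin n → ℂ) : (Γ n) →+ (Γ n) →+ ℂ :=
  AddMonoidHom.mk' (fun g => AddMonoidHom.mk' (fun h => ∑ i, ∑ j, a i j * ((g i : ℂ) * (h j : ℂ)))
    fun h h' => by simp [mul_add, sum_add_distrib])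
    fun g g' => by ext h; simp [mul_add, add_mul, sum_add_distrib]

lemma form_apply (a : Fin n → Fin n → ℂ) (g h : Γ n) :
    form a g h = ∑ i, ∑ j, a i j * ((g i : ℂ) * (h j : ℂ)) := rfl

lemma lin_dMul : IsLinearMap ℂ fun a : Fin n → Fin n → ℂ => dMul 1 (form a) := by
  have h1 : ∀ w : (Γ n) → (Γ n) → ℂ, ∀ g h,
      twistedMul w (monomial g) (monomial h) = w g h • monomial (g + h) := twistedMul_monomial
  have key : ∀ {f g : TorusModule n ⊸ TorusModule n ⊸ TorusModule n},
      (∀ x y, f (monomial x) (monomial y) = g (monomial x) (monomial y)) → f = g := fun {f g} h => by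
    ext x y : 4
    exact h x y
  refine ⟨fun x y => key fun g h => ?_, fun c x => key fun g h => ?_⟩
  · simp only [dMul, LinearMap.add_apply, h1, form_apply, Pi.add_apply, add_mul,
      sum_add_distrib, add_smul]
  · simp only [dMul, LinearMap.smul_apply, h1, form_apply, Pi.smul_apply, smul_eq_mul, mul_assoc,
      ← mul_sum, smul_smul]

lemma lin_formMul (k : ℕ) :
    IsLinearMap ℂ fun a : Fin n → Fin n → ℂ => fMul (form a) k := by
  refine ⟨fun x y => mono_ext fun g => ?_, fun c x => mono_ext fun g => ?_⟩
  · rw [LinearMap.add_apply, fMul_mono, fMul_mono, fMul_mono, ← add_smul]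
    congr 1
    rw [cut, cut, cut]
    split_ifs
    · simp only [pSum, form_apply, Pi.add_apply, add_mul, sum_add_distrib]
    · simp
  · rw [LinearMap.smul_apply, fMul_mono, fMul_mono, smul_smul]
    congr 1
    rw [cut, cut]
    split_ifs
    · simp only [pSum, form_apply, Pi.smul_apply, smul_eq_mul, mul_assoc, ← mul_sum]
    · simp

lemma lin_theta (c : EV n) :
    IsLinearMap ℂ fun a : Fin n → Fin n → ℂ => theta (form a) c := by
  refine ⟨fun x y => funext fun p => ?_, fun r x => funext fun p => ?_⟩
  · simp only [θ_apply, Pi.add_apply, onE_ap, getzlerOp, (lin_formMul _).map_add,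
      lin_dMul.map_add, (lin_contr _ _).map_add,
      (lin_contrS _ _).map_add, LinearMap.add_apply]
    abel
  · simp only [θ_apply, Pi.add_apply, Pi.smul_apply, onE_ap, getzlerOp,
      (lin_formMul _).map_smul,
      lin_dMul.map_smul, (lin_contr _ _).map_smul,
      (lin_contrS _ _).map_smul, LinearMap.smul_apply, smul_add]

lemma theta_form (a : Fin n → Fin n → ℂ) (c : EV n) :
    theta (form a) c = ∑ i, ∑ j, a i j • theta (form (Pi.single i (Pi.single j 1))) c := by
  have h : a = ∑ i, ∑ j, a i j • (Pi.single i (Pi.single j 1) : Fin n → Fin n → ℂ) := by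
    funext i j
    simp only [Finset.sum_apply, Pi.smul_apply, smul_eq_mul, Pi.single_apply]
    rw [sum_eq_single i, sum_eq_single j]
    · simp
    · intro l _ hl; simp [Ne.symm hl]
    · simp
    · intro l _ hl
      refine sum_eq_zero fun m _ => ?_
      rw [if_neg (Ne.symm hl)]; simp
    · simp
  conv_lhs => rw [h]
  exact (map_sum (lin_theta c).mk' _ _).trans (sum_congr rfl fun i _ =>
    (map_sum (lin_theta c).mk' _ _).trans
      (sum_congr rfl fun j _ => map_smul (lin_theta c).mk' _ _))

/-! ### The derivative of the phases along a path -/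

/-- `f` has logarithmic derivative `a` at `t`. -/
def HasLogD (f : ℝ → ℂ) (a : ℂ) (t : ℝ) : Prop := HasDerivAt f (a * f t) t

lemma HasLogD.mul {f g : ℝ → ℂ} {a b : ℂ} {t : ℝ} (hf : HasLogD f a t)
    (hg : HasLogD g b t) : HasLogD (fun s => f s * g s) (a + b) t := by
  exact (HasDerivAt.fun_mul hf hg).congr_deriv (by ring)

lemma HasLogD.prod {ι : Type*} (s : Finset ι) {f : ι → ℝ → ℂ} {a : ι → ℂ} {t : ℝ}
    (h : ∀ i ∈ s, HasLogD (f i) (a i) t) :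
    HasLogD (fun x => ∏ i ∈ s, f i x) (∑ i ∈ s, a i) t := by
  classical
  induction s using Finset.induction_on with
  | empty => simpa [HasLogD] using hasDerivAt_const t (1 : ℂ)
  | insert i s hi ih =>
    simp only [Finset.prod_insert hi, sum_insert hi]
    exact (h i (Finset.mem_insert_self i s)).mul (ih fun j hj => h j (Finset.mem_insert_of_mem hj))

lemma HasLogD.zpow {f : ℝ → ℂ} {a : ℂ} {t : ℝ} (hf : HasLogD f a t) (h0 : f t ≠ 0)
    (m : ℤ) : HasLogD (fun s => f s ^ m) (m * a) t := by
  refine ((hasDerivAt_zpow m (f t) (Or.inl h0)).comp t hf).congr_deriv ?_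
  rw [zpow_sub_one₀ h0]
  field_simp

lemma HasLogD.inv {f : ℝ → ℂ} {a : ℂ} {t : ℝ} (hf : HasLogD f a t) (h0 : f t ≠ 0) :
    HasLogD (fun s => (f s)⁻¹) (-a) t := by
  simpa using hf.zpow h0 (-1)

lemma contDiff_zpow {f : ℝ → ℂ} (hf : ContDiff ℝ ∞ f) (h0 : ∀ t, f t ≠ 0) (m : ℤ) :
    ContDiff ℝ ∞ fun s => f s ^ m := by
  cases m with
  | ofNat m => simpa using hf.pow m
  | negSucc m =>
    simp only [zpow_negSucc]
    exact (hf.pow (m + 1)).inv fun t => pow_ne_zero _ (h0 t)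

lemma mono_induction {k : ℕ} {p : HT n k → Prop} (x : HT n k)
    (hm : ∀ g, p (mono k g)) (hadd : ∀ x y, p x → p y → p (x + y))
    (hsmul : ∀ (a : ℂ) x, p x → p (a • x)) : p x := by
  have h0 : p 0 := by simpa using hsmul 0 _ (hm 0)
  let S : Submodule ℂ (HT n k) := ⟨⟨⟨{x | p x}, fun {x y} => hadd x y⟩, h0⟩, fun a x => hsmul a x⟩
  exact mono_le (LinearMap.id : HT n k ⊸ _) (S := S) hm x

lemma phase_eq (q : QP n) (k : ℕ) (g : ℕ → Γ n) : phase q k g =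
    ∏ b ∈ range (k + 1), cocycle q (∑ a ∈ range b, g a) (g b) := by
  rw [phase, pSum, toMul_sum, Units.coe_prod]
  rfl

lemma phase_one (k : ℕ) (g : ℕ → Γ n) : phase (1 : QP n) k g = 1 := by
  simp [phase_eq, coc_one]

namespace QPath

variable {q : QP n} (γ : QPath q)

def rate (t : ℝ) (i j : Fin n) : ℂ :=
  if j < i then _root_.deriv (fun s => (γ.toFun s).val i j) t / (γ.toFun t).val i j else 0

lemma continuous_rate (i j : Fin n) : Continuous fun t => γ.rate t i j := by
  unfold rate
  split_ifs
  · exact ((γ.smooth i j).continuous_deriv (by simp)).div (γ.smooth i j).continuous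
      fun t => val_ne_zero _ i j
  · exact continuous_const

lemma contDiff_rate (i j : Fin n) : ContDiff ℝ ∞ fun t => γ.rate t i j := by
  unfold rate
  split_ifs
  · simp only [div_eq_mul_inv]
    exact ((contDiff_infty_iff_deriv.1 (γ.smooth i j)).2).mul
      ((γ.smooth i j).inv fun t => val_ne_zero _ i j)
  · exact contDiff_const

lemma hld_val (t : ℝ) (i j : Fin n) :
    HasLogD (fun s => (γ.toFun s).val i j)
      (_root_.deriv (fun s => (γ.toFun s).val i j) t / (γ.toFun t).val i j) t := by
  unfold HasLogD
  rw [div_mul_cancel₀ _ (val_ne_zero _ i j)]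
  exact ((γ.smooth i j).differentiable (by simp) t).hasDerivAt

lemma hld_cocycle (t : ℝ) (g h : Γ n) :
    HasLogD (fun s => cocycle (γ.toFun s) g h) (form (γ.rate t) g h) t := by
  unfold cocycle
  rw [form_apply]
  refine HasLogD.prod _ fun i _ => HasLogD.prod _ fun j _ => ?_
  rw [rate]
  split_ifs with hij
  · have := (γ.hld_val t i j).zpow (val_ne_zero _ i j) (g i * h j)
    push_cast at this
    exact (congrArg (HasLogD _ · t) (mul_comm _ _)).mpr this
  · simpa [HasLogD] using hasDerivAt_const t (1 : ℂ)

lemma mulDeriv_eq (t : ℝ) : γ.mulDeriv t = dMul (γ.toFun t) (form (γ.rate t)) := by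
  unfold mulDeriv dMul
  congr 1
  funext g h
  exact (γ.hld_cocycle t g h).deriv

lemma hld_phase (t : ℝ) (k : ℕ) (g : ℕ → Γ n) :
    HasLogD (fun s => phase (γ.toFun s) k g) (pSum (form (γ.rate t)) k g) t := by
  simp only [phase_eq]
  exact HasLogD.prod _ fun b _ => γ.hld_cocycle t _ _

lemma contDiff_phase (k : ℕ) (g : ℕ → Γ n) :
    ContDiff ℝ ∞ fun s => phase (γ.toFun s) k g := by
  simp only [phase_eq, cocycle]
  refine contDiff_prod fun b _ => contDiff_prod fun i _ => contDiff_prod fun j _ => ?_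
  split_ifs
  · exact contDiff_zpow (γ.smooth i j) (fun t => val_ne_zero _ i j) _
  · exact contDiff_const

lemma hasDerivAt_pairing (t : ℝ) (k : ℕ) (I : Fin k → Fin n) (w : HT n k) :
    HasDerivAt (fun s => pairing (γ.toFun s) k I w)
      (pairing 1 k I (fMul (form (γ.rate t)) k (utw (γ.toFun t) k w))) t := by
  induction w using mono_induction with
  | hm g =>
    simp only [pair_mono_q, utw_mono, map_smul, fMul_mono, smul_eq_mul, pair_mono_q, cut, phase_one]
    by_cases h : wt k g = 0
    · simp only [h, if_true]
      exact ((γ.hld_phase t k g).mul_const _).congr_deriv (by ring)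
    · simp only [h, if_false, zero_mul]
      exact hasDerivAt_const t 0
  | hadd x y hx hy =>
    simp only [map_add]
    exact hx.add hy
  | hsmul a x hx =>
    simp only [map_smul, smul_eq_mul]
    exact hx.const_mul a

lemma hasDerivAt_pair {k : ℕ} {c c' : ℝ → HT n k}
    (hc : SmoothFamily c c') (t : ℝ) (I : Fin k → Fin n) :
    HasDerivAt (fun s => pairing (γ.toFun s) k I (c s)) (pairing (γ.toFun t) k I (c' t) +
      pairing 1 k I (fMul (form (γ.rate t)) k (utw (γ.toFun t) k (c t)))) t := by
  obtain ⟨N, f, w, hf, h1, h2⟩ := hc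
  simp only [h1, h2, map_sum, map_smul, smul_eq_mul, ← sum_add_distrib]
  refine HasDerivAt.fun_sum fun j _ => ?_
  exact (((hf j).differentiable (by simp) t).hasDerivAt).mul (γ.hasDerivAt_pairing t k I (w j))

lemma untwist_getzlerOp (q : QP n) (θ : (Γ n) →+ (Γ n) →+ ℂ)
    (c : EV n) :
    onE (utw q) (getzlerOp (torusMul q) 𝟏 (dMul q θ) c) =
      getzlerOp μ₁ 𝟏 (dMul 1 θ) (onE (utw q) c) := by
  funext p
  have h := untwist_itw q
  rw [onE_ap, getzlerOp, map_add,
    contr_itw h.rot h.merge (untwist_dMul θ q),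
    contrS_itw h.rot h.ins (untwist_dMul θ q)]
  rfl

lemma hasDerivAt_flat {c : ℝ → EV n} (hc : γ.IsFlat c) (t : ℝ) (p : ℕ)
    (I : Fin (2 * p) → Fin n) :
    HasDerivAt (fun s => pairing (γ.toFun s) (2 * p) I (c s p))
      (pairing 1 (2 * p) I (theta (form (γ.rate t)) (onE (utw (γ.toFun t)) (c t)) p)) t := by
  obtain ⟨c', η, η', h1, h2, h3, h4⟩ := hc
  refine (γ.hasDerivAt_pair (h1 p) t I).congr_deriv ?_
  have h5 := pair_bd_tw (γ.toFun t) (c := c' t -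
    getzlerOp (torusMul (γ.toFun t)) 𝟏 (γ.mulDeriv t) (c t)) (by
      rw [← sub_add_cancel (c' t - _) (dOdd (torusMul (γ.toFun t)) 𝟏 (η t))]
      exact add_mem (mem_sup_right (h4 t)) (mem_sup_left ⟨_, rfl⟩)) p I
  rw [Pi.sub_apply, map_sub, sub_eq_zero] at h5
  have h6 : onE (inv₀ n) (onE (utw (γ.toFun t)) (c t)) =
      onE (utw (γ.toFun t)) (c t) := funext fun p => invPart_untwist _ _ _
  rw [h5, ← pair_utw, θ_apply, h6, ← untwist_getzlerOp, Pi.add_apply, map_add, mulDeriv_eq,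
    add_comm]
  rfl

end QPath

/-! ### Uniqueness of parallel transport -/

abbrev PIdx (n : ℕ) : Type := Σ p : Fin (n + 1), (Fin (2 * (p : ℕ)) → Fin n)

def pairCoord (x : PIdx n) : EV n ⊸ ℂ :=
  pairing 1 (2 * (x.1 : ℕ)) x.2 ∘ₗ LinearMap.proj (x.1 : ℕ)

lemma pair_zero_of_lt (q : QP n) {k : ℕ} (hk : n < k) (I : Fin k → Fin n)
    (x : HT n k) : pairing q k I x = 0 :=
  pair_not_inj q k I (fun h => by
    have := Fintype.card_le_of_injective I h
    simp at this
    omega) x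

lemma mem_bd_of_pairCoord {c : EV n}
    (hc : c ∈ cycles μ₁ 𝟏) (h : ∀ x, pairCoord x c = 0) :
    c ∈ boundaries μ₁ 𝟏 := by
  refine mem_bd_of_pair 1 hc fun p I => ?_
  by_cases hp : p < n + 1
  · exact h ⟨⟨p, hp⟩, I⟩
  · exact pair_zero_of_lt 1 (by omega) I _

lemma exists_theta_matrix (a : Fin n → Fin n → ℂ) (x : PIdx n) : ∃ N : PIdx n → ℂ,
    ∀ c ∈ cycles μ₁ 𝟏,
      pairCoord x (theta (form a) c) = ∑ y, N y * pairCoord y c := by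
  let Z := cycles (torusMul (1 : QP n)) 𝟏
  have h : pairCoord x ∘ₗ theta (form a) ∘ₗ Z.subtype ∈
      span ℂ (Set.range fun y : PIdx n => pairCoord y ∘ₗ Z.subtype) := by
    refine mem_span_of_iInf_ker_le_ker fun c hc => ?_
    simp only [Submodule.mem_iInf, mem_ker, comp_apply] at hc
    exact pair_bd (theta_boundaries _ (mem_bd_of_pairCoord c.2 hc)) _ _
  obtain ⟨N, hN⟩ := (Submodule.mem_span_range_iff_exists_fun ℂ).1 h
  refine ⟨N, fun c hc => ?_⟩
  have := LinearMap.congr_fun hN ⟨c, hc⟩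
  simp only [LinearMap.sum_apply, LinearMap.smul_apply, comp_apply, smul_eq_mul] at this
  exact this.symm

lemma linear_ode_eq_zero {E : Type*} [NormedAddCommGroup E] [NormedSpace ℝ E]
    {A : ℝ → E →L[ℝ] E} (hA : Continuous A) {f : ℝ → E} (hf : ∀ t, HasDerivAt f (A t (f t)) t)
    {s : ℝ} (h : f s = 0) (t : ℝ) : f t = 0 := by
  obtain ⟨K, hK⟩ := (isCompact_Icc (a := min s t - 1) (b := max s t + 1)).exists_bound_of_continuousOn
    hA.continuousOn
  have hs : s ∈ Set.Ioo (min s t - 1) (max s t + 1) :=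
    ⟨by linarith [min_le_left s t], by linarith [le_max_left s t]⟩
  have ht : t ∈ Set.Ioo (min s t - 1) (max s t + 1) :=
    ⟨by linarith [min_le_right s t], by linarith [le_max_right s t]⟩
  exact ODE_solution_unique_of_mem_Ioo (v := fun t => A t) (s := fun _ => Set.univ) (K := K.toNNReal)
    (f := f) (g := fun _ => 0)
    (fun u hu => ((A u).lipschitz.weaken (by
      rw [← NNReal.coe_le_coe, coe_nnnorm]
      exact (hK u ⟨hu.1.le, hu.2.le⟩).trans (Real.le_coe_toNNReal K))).lipschitzOnWith)
    hs (fun u _ => ⟨hf u, trivial⟩)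
    (fun u _ => ⟨by simpa using hasDerivAt_const u (0 : E), trivial⟩) h ht

namespace QPath

variable {q : QP n} (γ : QPath q)

lemma pair_flat_zero {c : ℝ → EV n} (hc : γ.IsFlat c) {s : ℝ}
    (h : ∀ p I, pairing (γ.toFun s) (2 * p) I (c s p) = 0) (t : ℝ) (p : ℕ)
    (I : Fin (2 * p) → Fin n) : pairing (γ.toFun t) (2 * p) I (c t p) = 0 := by
  by_cases hp : p < n + 1
  swap
  · exact pair_zero_of_lt _ (by omega) I _
  choose N hN using fun (i j : Fin n) =>
    exists_theta_matrix (n := n) (Pi.single i (Pi.single j 1))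
  let L : ∀ _ _ : Fin n, (PIdx n → ℂ) →L[ℝ] (PIdx n → ℂ) := fun i j =>
    ((Matrix.toLin' (Matrix.of (N i j))).restrictScalars ℝ).toContinuousLinearMap
  let f : ℝ → PIdx n → ℂ := fun t x => pairing (γ.toFun t) (2 * (x.1 : ℕ)) x.2 (c t x.1)
  have hf : ∀ t, HasDerivAt f ((∑ i, ∑ j, γ.rate t i j • L i j) (f t)) t := fun t => by
    refine hasDerivAt_pi.2 fun x => (γ.hasDerivAt_flat hc t x.1 x.2).congr_deriv ?_
    have hz : onE (utw (γ.toFun t)) (c t) ∈ cycles μ₁ 𝟏 := by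
      obtain ⟨_, _, _, _, _, h3, _⟩ := hc
      exact (untwist_itw _).cycles (h3 t)
    have hy : ∀ y : PIdx n, pairCoord y (onE (utw (γ.toFun t)) (c t)) = f t y :=
      fun y => pair_utw _ _ _ _
    have h1 : ∀ i j, pairCoord x (theta (form (Pi.single i (Pi.single j 1)))
        (onE (utw (γ.toFun t)) (c t))) = L i j (f t) x := fun i j => by
      rw [hN i j x _ hz]
      simp only [hy]
      rfl
    change pairCoord x (theta (form (γ.rate t)) (onE (utw (γ.toFun t)) (c t))) = _
    rw [theta_form]
    simp only [ContinuousLinearMap.sum_apply, Finset.sum_apply, ContinuousLinearMap.smul_apply,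
      Pi.smul_apply, ← h1]
    refine (map_sum (pairCoord x) _ _).trans (sum_congr rfl fun i _ =>
      (map_sum (pairCoord x) _ _).trans (sum_congr rfl fun j _ => map_smul _ _ _))
  have hA : Continuous fun t => ∑ i, ∑ j, γ.rate t i j • L i j :=
    continuous_finset_sum _ fun i _ => continuous_finset_sum _ fun j _ =>
      (γ.continuous_rate i j).smul continuous_const
  have := linear_ode_eq_zero hA hf (s := s) (funext fun x => h x.1 x.2) t
  exact congrFun this ⟨⟨p, hp⟩, I⟩

lemma sc_apply (s : γ.flat) (p : ℕ) (I : Fin (2 * p) → Fin n) :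
    γ.startClass s p I = pairing (γ.toFun 0) (2 * p) I (s.1 0 p) := by
  rw [γ.start]; rfl

lemma endClass_eq_zero_iff (s : γ.flat) :
    γ.endClass s = 0 ↔ ∀ p I, pairing (γ.toFun 1) (2 * p) I (s.1 1 p) = 0 := by
  have h : γ.endClass s = 0 ↔ s.1 1 ∈ boundaries (torusMul q) 𝟏 := by
    simp only [endClass, comp_apply, Submodule.mkQ_apply, Submodule.Quotient.mk_eq_zero]
    rfl
  rw [h, γ.finish]
  exact ⟨fun h p I => pair_bd_tw q h p I,
    mem_bd_of_pair q (γ.flat_mem_cycles s)⟩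

lemma sc_eq_zero (s : γ.flat) : γ.startClass s = 0 ↔ γ.endClass s = 0 := by
  rw [endClass_eq_zero_iff]
  constructor
  · refine fun h => γ.pair_flat_zero s.2 (s := 0) (fun p I => ?_) 1
    rw [← sc_apply, h]; rfl
  · intro h
    funext p I
    rw [sc_apply]
    exact γ.pair_flat_zero s.2 h 0 p I

end QPath

end Transport

/-! ### Periodic cyclic cocycles of degree two -/

section Bott

variable {n : ℕ}

def seqThree {A : Type*} (a b c : A) (m : ℕ) : A := if m = 0 then a else if m = 1 then b else c

def twoChain (g h : Γ n) : HT n 2 :=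
  mono 2 (seqThree (-(g + h)) g h) - mono 2 (seqThree (-(g + h)) h g)

lemma hochB_mono_two (a g h : Γ n) : hochB μ₁ 1 (mono 2 (seqThree a g h)) =
    mono 1 (fun m => if m = 0 then a + g else h) - mono 1 (fun m => if m = 0 then a else g + h) +
      mono 1 (fun m => if m = 0 then h + a else g) := by
  rw [hochB_apply, sum_range_succ, sum_range_succ, Finset.sum_range_one, torusMul,
    face_mono _ _ _ (by omega), face_mono _ _ _ (by omega), face_last_mono]
  simp only [coc_one, one_smul, pow_zero, pow_one, neg_smul, one_add_one_eq_two, neg_one_sq]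
  rw [sub_eq_add_neg]
  congr 1
  · congr 1
    · exact mono_cg fun i hi => by interval_cases i <;> simp [seqThree]
    · exact congrArg _ (mono_cg fun i hi => by interval_cases i <;> simp [seqThree])
  · exact mono_cg fun i hi => by interval_cases i <;> simp [seqThree]

lemma hochB_twoChain (g h : Γ n) : hochB μ₁ 1 (twoChain g h) = 0 := by
  rw [twoChain, map_sub, hochB_mono_two, hochB_mono_two,
    show -(g + h) + g = -h by abel, show -(g + h) + h = -g by abel,
    show g + -(g + h) = -h by abel, show h + -(g + h) = -g by abel, add_comm h g]
  abel

lemma wt_seqThree (g h : Γ n) :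
    wt 2 (seqThree (-(g + h)) g h) = 0 := by
  simp [wt, sum_range_succ, seqThree]

lemma inv₀_two (g h : Γ n) : inv₀ n 2 (twoChain g h) = twoChain g h := by
  rw [twoChain, map_sub, inv₀_mono, inv₀_mono, wt_seqThree, add_comm g h,
    wt_seqThree]
  simp

lemma pairing_twoChain (g h : Γ n) (I : Fin 2 → Fin n) :
    pairing 1 2 I (twoChain g h) = (g (I 0) : ℂ) * h (I 1) - g (I 1) * h (I 0) := by
  have h1 := wt_seqThree h g
  rw [add_comm] at h1
  rw [twoChain, map_sub, pair_mono, pair_mono, wt_seqThree, h1]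
  simp [Matrix.det_fin_two, coordM, seqThree, Nat.factorial]
  ring

lemma exists_cycle_of_hochB {z : HT n 2} (hz : hochB μ₁ 1 z = 0)
    (hP : inv₀ n 2 z = z) : ∃ c : EV n,
      c ∈ cycles μ₁ 𝟏 ∧ c 0 = 0 ∧ c 1 = z := by
  have hbB := hochB_connesB (torusMul_assoc (n := n) 1) (fun x => (torusMul_one 1 x).2)
      (fun x => (torusMul_one 1 x).1)
  let Q : ∀ p, HT n (2 * (p + 1)) → Prop := fun p η => inv₀ n _ η = η ∧
    hochB μ₁ (2 * (p + 1)) (connesB 𝟏 (2 * (p + 1)) η) ∈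
      degenerate 𝟏 (2 * (p + 1))
  have q0 : Q 0 z := by
    refine ⟨hP, (congrArg (· ∈ degenerate 𝟏 (2 * (0 + 1))) ?_).mpr
      (zero_mem _)⟩
    have h := hbB 1 z
    rw [hz, map_zero, add_zero] at h
    exact h
  have step : ∀ p η, Q p η → ∃ η', Q (p + 1) η' ∧
      hochB μ₁ (2 * (p + 1) + 1) η' + connesB 𝟏 (2 * (p + 1)) η ∈
        degenerate 𝟏 (2 * (p + 1) + 1) := by
    rintro p η ⟨h1, h2⟩
    obtain ⟨η', b1, b2⟩ := ex_hochB_of_pair (k := 2 * (p + 1) + 1)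
      (z := -connesB 𝟏 (2 * (p + 1)) η)
      (isInvCycle_succ _ _ (by
        rw [map_neg]
        exact (congrArg (· ∈ degenerate 𝟏 (2 * (p + 1))) (neg_one_smul ℂ _)).mp
          (smul_mem _ (-1) h2)))
      (fun I => by rw [map_neg, pair_cB, neg_zero])
      (by rw [map_neg, (inv₀_itw 1).connesB, h1])
    refine ⟨η', ⟨b1, ?_⟩, ?_⟩
    · refine (congrArg (· ∈ degenerate 𝟏 (2 * (p + 1 + 1))) ?_).mpr
        (add_mem (cB_deg _ _ (deg_le_unital _ _ b2))
          (cB_cB_mem 𝟏 (2 * (p + 1)) η))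
      have h := hbB (2 * (p + 1) + 1) η'
      refine (eq_neg_of_add_eq_zero_left h).trans ?_
      change _ = connesB 𝟏 (2 * (p + 1) + 1) (-connesB 𝟏 (2 * (p + 1)) η -
        hochB μ₁ (2 * (p + 1) + 1) η') +
          connesB 𝟏 (2 * (p + 1) + 1) (connesB 𝟏 (2 * (p + 1)) η)
      rw [map_sub, map_neg]
      abel
    · have b3 := (congrArg (· ∈ degenerate 𝟏 (2 * (p + 1) + 1)) (neg_one_smul ℂ _)).mp
          (smul_mem _ (-1) b2)
      refine (congrArg (· ∈ degenerate 𝟏 (2 * (p + 1) + 1)) ?_).mpr b3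
      abel
  choose! next n1 n2 using step
  let η : ∀ p, {η // Q p η} := fun p => Nat.rec ⟨z, q0⟩ (fun p η => ⟨next p η.1, n1 p η.1 η.2⟩) p
  let c : EV n := fun p => Nat.casesOn p 0 fun p => (η p).1
  refine ⟨c, mem_degOdd.2 fun p => ?_, rfl, rfl⟩
  rw [dEven_apply]
  cases p with
  | zero =>
    refine (congrArg (· ∈ degenerate 𝟏 (2 * 0 + 1)) ?_).mpr (zero_mem _)
    rw [show c 0 = 0 from rfl, map_zero, add_zero]
    exact hz
  | succ p => exact n2 p _ (η p).2

def push (ρ : (Γ n) →+ (Γ n)) : ∀ k, HT n k ⊸ HT n k :=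
  trf ρ fun _ _ => 1

lemma push_mono (ρ : (Γ n) →+ (Γ n)) (k : ℕ) (g : ℕ → Γ n) :
    push ρ k (mono k g) = mono k fun i => ρ (g i) :=
  (trf_mono (fun _ _ _ _ => rfl) k g).trans (one_smul _ _)

lemma push_itw (ρ : (Γ n) →+ (Γ n)) :
    Itw (push ρ) μ₁ μ₁ 𝟏 :=
  trf_itw (fun _ _ _ _ => rfl) (fun _ _ => rfl)
    (fun _ _ => by rw [coc_one, coc_one]) fun _ _ => rfl

def cProj (S : Set (Fin n)) [DecidablePred (· ∈ S)] : (Γ n) →+ (Γ n) :=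
  AddMonoidHom.mk' (fun g i => if i ∈ S then g i else 0) fun g h => by
    funext i
    simp only [Pi.add_apply]
    split_ifs <;> simp

lemma coordProj_apply (S : Set (Fin n)) [DecidablePred (· ∈ S)] (g : Γ n) (i : Fin n) :
    cProj S g i = if i ∈ S then g i else 0 := rfl

lemma cProj_single (S : Set (Fin n)) [DecidablePred (· ∈ S)] (i : Fin n) (hi : i ∈ S) :
    cProj S (Pi.single i 1) = Pi.single i 1 := by
  funext j
  rw [coordProj_apply]
  split_ifs with h
  · rfl
  · rw [Pi.single_eq_of_ne (by rintro rfl; exact h hi)]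

lemma pair_push_proj (i j : Fin n) (k : ℕ) (hk : 2 < k) (I : Fin k → Fin n)
    (x : HT n k) : pairing 1 k I (push (cProj {i, j}) k x) = 0 := by
  by_cases hI : Function.Injective I
  swap
  · exact pair_not_inj 1 k I hI _
  obtain ⟨b, hb⟩ : ∃ b, I b ∉ ({i, j} : Finset (Fin n)) := by
    by_contra! h
    have h1 := Finset.card_le_card_of_injOn (s := Finset.univ) I (fun b _ => h b) hI.injOn
    have h2 := Finset.card_le_two (a := i) (b := j)
    simp at h1
    omega
  apply mono_eq (x := x); intro g
  rw [push_mono, pair_mono, Matrix.det_eq_zero_of_row_eq_zero b]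
  · simp
  · intro a
    simp only [coordM, Matrix.of_apply, coordProj_apply]
    rw [if_neg (by simpa using hb), Int.cast_zero]

lemma ex_bottC (i j : Fin n) : ∃ c : EV n,
    c ∈ cycles μ₁ 𝟏 ∧ c 0 = 0 ∧
      c 1 = twoChain (Pi.single i 1) (Pi.single j 1) ∧
      ∀ p ≠ 1, ∀ I, pairing 1 (2 * p) I (c p) = 0 := by
  obtain ⟨c, h1, h2, h3⟩ := exists_cycle_of_hochB
    (hochB_twoChain (Pi.single i 1 : Γ n) (Pi.single j 1)) (inv₀_two _ _)
  refine ⟨onE (push (cProj {i, j})) c, (push_itw _).cycles h1, ?_, ?_, ?_⟩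
  · rw [onE_ap, h2, map_zero]
  · rw [onE_ap, h3]
    have key : ∀ a b : Γ n, cProj {i, j} a = a → cProj {i, j} b = b →
        push (cProj {i, j}) 2 (mono 2 (seqThree (-(a + b)) a b)) =
          mono 2 (seqThree (-(a + b)) a b) := fun a b ha hb => by
      rw [push_mono]
      refine mono_cg fun m hm => ?_
      unfold seqThree
      split_ifs
      · rw [map_neg, map_add, ha, hb]
      · exact ha
      · exact hb
    have hi := cProj_single {i, j} i (by simp)
    have hj := cProj_single {i, j} j (by simp)
    refine (map_sub (push (cProj {i, j}) 2) _ _).trans (congrArg₂ (· - ·) (key _ _ hi hj) ?_)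
    have := key _ _ hj hi
    rwa [add_comm (Pi.single j 1 : Γ n)] at this
  · intro p hp I
    rw [onE_ap]
    by_cases h0 : p = 0
    · subst h0
      rw [h2, map_zero, map_zero]
    · exact pair_push_proj i j _ (by omega) I _

/-- A periodic cyclic cocycle of the commutative torus dual to `e_i ∧ e_j`. -/
def bottC (i j : Fin n) : EV n := (ex_bottC i j).choose

lemma bottC_cyc (i j : Fin n) : bottC i j ∈ cycles μ₁ 𝟏 :=
  (ex_bottC i j).choose_spec.1

lemma bottC_zero (i j : Fin n) : bottC i j 0 = 0 := (ex_bottC i j).choose_spec.2.1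

lemma bottC_one (i j : Fin n) :
    bottC i j 1 = twoChain (Pi.single i 1) (Pi.single j 1) :=
  (ex_bottC i j).choose_spec.2.2.1

lemma pairing_bottC (i j : Fin n) (p : ℕ) (hp : p ≠ 1) (I : Fin (2 * p) → Fin n) :
    pairing 1 (2 * p) I (bottC i j p) = 0 :=
  (ex_bottC i j).choose_spec.2.2.2 p hp I

variable (n) in
def unitC : EV n := fun p => Nat.casesOn p (mono (2 * 0) 0) 0

lemma unitC_zero : unitC n 0 = mono (2 * 0) 0 := rfl

lemma unitC_succ (p : ℕ) : unitC n (p + 1) = 0 := rfl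

lemma unitC_cyc (q : QP n) : unitC n ∈ cycles (torusMul q) 𝟏 := by
  refine mem_degOdd.2 fun p => ?_
  rw [dEven_apply, unitC_succ, map_zero, zero_add]
  cases p with
  | zero =>
    refine cB_deg _ _ ?_
    rw [unitC_zero, mono]
    exact tp_unital 0 (Nat.zero_le _) rfl
  | succ p => rw [unitC_succ, map_zero]; exact zero_mem _

lemma pair_unitC_zero (q : QP n) (I : Fin (2 * 0) → Fin n) :
    pairing q (2 * 0) I (unitC n 0) = 1 := by
  have h : ∀ k, k = 0 → ∀ I : Fin k → Fin n, pairing q k I (mono k 0) = 1 := by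
    rintro k rfl I
    rw [pair_mono_q, cut, if_pos (by simp [wt]), phase_eq]
    simp [cocycle]
  exact h _ rfl I

lemma getzlerOp_unitC (μ D : TorusModule n ⊸ TorusModule n ⊸ TorusModule n) :
    getzlerOp μ 𝟏 D (unitC n) = 0 := by
  funext p
  rw [getzlerOp, unitC_succ, map_zero, zero_add]
  cases p with
  | zero => rfl
  | succ p => rw [unitC_succ, map_zero]; rfl

/-! ### The connection form on the cocycles of degree two -/

lemma pair_push_double (k : ℕ) (I : Fin k → Fin n) (x : HT n k) :
    pairing 1 k I (push (zsmulAddGroupHom 2) k x) = 2 ^ k * pairing 1 k I x := by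
  apply mono_eq (x := x); intro g
  rw [push_mono, pair_mono, pair_mono]
  have h1 : wt k (fun i => zsmulAddGroupHom 2 (g i)) = (2 : ℤ) • wt k g := by
    simp [wt, smul_sum]
  have h2 : coordM k I (fun i => zsmulAddGroupHom 2 (g i)) = (2 : ℂ) • coordM k I g := by
    ext a b; simp [coordM]
  rw [h1, h2, Matrix.det_smul, Fintype.card_fin]
  simp only [smul_eq_zero, OfNat.ofNat_ne_zero, false_or]
  ring

lemma theta_push_double (a : Fin n → Fin n → ℂ) (c : EV n) :
    theta (form a) (onE (push (zsmulAddGroupHom 2)) c) =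
      (4 : ℂ) • onE (push (zsmulAddGroupHom 2)) (theta (form a) c) := by
  have hf : ∀ g h : Γ n, form ((4 : ℂ) • a) g h =
      form a (zsmulAddGroupHom 2 g) (zsmulAddGroupHom 2 h) := fun g h => by
    simp only [form_apply]
    refine sum_congr rfl fun i _ => sum_congr rfl fun j _ => ?_
    simp
    ring
  have hi := push_itw (n := n) (zsmulAddGroupHom 2)
  have hw : ∀ k g, wt k (fun i => zsmulAddGroupHom 2 (g i : Γ n)) = 0 ↔
      wt k g = 0 := fun k g => by
    have : wt k (fun i => zsmulAddGroupHom 2 (g i)) = (2 : ℤ) • wt k g := by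
      simp [wt, smul_sum]
    rw [this, smul_eq_zero]; simp
  have hD : ∀ k (x : HT n (k + 1)), push (zsmulAddGroupHom 2) k
      (mergeHead (dMul 1 (form ((4 : ℂ) • a))) k x) =
      mergeHead (dMul 1 (form a)) k (push (zsmulAddGroupHom 2) (k + 1) x) :=
    trf_merge (fun _ _ _ _ => rfl) fun k g => by
      rw [coc_one, coc_one, hf]; ring
  have hF : ∀ k (x : HT n k), push (zsmulAddGroupHom 2) k
      (fMul (form ((4 : ℂ) • a)) k x) =
      fMul (form a) k (push (zsmulAddGroupHom 2) k x) := fun k x => by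
    apply mono_eq (x := x); intro g
    simp only [fMul_mono, map_smul, push_mono, cut, hw]
    congr 1
    split_ifs
    · simp only [pSum, map_sum, AddMonoidHom.finset_sum_apply, hf]
    · rfl
  have hP : ∀ k (x : HT n k), push (zsmulAddGroupHom 2) k (inv₀ n k x) =
      inv₀ n k (push (zsmulAddGroupHom 2) k x) := fun k x => by
    apply mono_eq (x := x); intro g
    simp only [inv₀_mono, map_smul, push_mono, hw]
  rw [← map_smul, ← (lin_theta c).map_smul]
  funext p
  rw [θ_apply, θ_apply, Pi.add_apply, onE_ap, onE_ap, onE_ap,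
    Pi.add_apply, map_add, onE_ap, hF]
  refine congrArg _ ?_
  rw [getzlerOp, getzlerOp, map_add, contr_itw hi.rot hi.merge hD,
    contrS_itw hi.rot hi.ins hD]
  simp only [onE_ap]
  rw [hP]
  exact congrArg (fun z => contr μ₁ (dMul 1 (form a)) (2 * p) z + _)
    (hP (2 * p + 2) (c (p + 1))).symm

lemma pairing_theta_bottC (a : Fin n → Fin n → ℂ) (i j : Fin n) (p : ℕ) (hp : p ≠ 0)
    (I : Fin (2 * p) → Fin n) : pairing 1 (2 * p) I (theta (form a) (bottC i j) p) = 0 := by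
  have h1 : onE (push (zsmulAddGroupHom 2)) (bottC i j) - (4 : ℂ) • bottC i j ∈
      boundaries μ₁ 𝟏 := by
    refine mem_bd_of_pair 1 (Submodule.sub_mem _
      ((push_itw _).cycles (bottC_cyc i j))
      (smul_mem _ _ (bottC_cyc i j))) fun p I => ?_
    rw [Pi.sub_apply, Pi.smul_apply, map_sub, map_smul, onE_ap, pair_push_double]
    by_cases h : p = 1
    · subst h; norm_num
    · rw [pairing_bottC i j p h]; simp
  have h2 := pair_bd (theta_boundaries (form a) h1) p I
  rw [map_sub, map_smul, theta_push_double, Pi.sub_apply, Pi.smul_apply, Pi.smul_apply, map_sub,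
    map_smul, map_smul, onE_ap, pair_push_double, smul_eq_mul, smul_eq_mul, sub_eq_zero] at h2
  have h3 : ((2 : ℂ) ^ (2 * p) - 1) * pairing 1 (2 * p) I (theta (form a) (bottC i j) p) = 0 := by
    linear_combination h2 / 4
  refine (mul_eq_zero.1 h3).resolve_left (sub_ne_zero.2 ?_)
  have : (2 : ℂ) ^ (2 * p) = ((2 ^ (2 * p) : ℕ) : ℂ) := by push_cast; rfl
  rw [this]
  exact_mod_cast (Nat.one_lt_two_pow (by omega : 2 * p ≠ 0)).ne'

lemma contr_twoChain (a : Fin n → Fin n → ℂ) (g h : Γ n) :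
    contr μ₁ (dMul 1 (form a)) 0 (twoChain g h) =
      (form a g h - form a h g) • mono 0 0 := by
  have key : ∀ g h : Γ n, contr μ₁ (dMul 1 (form a)) 0
      (mono 2 (seqThree (-(g + h)) g h)) = form a g h • mono 0 0 := fun g h => by
    rw [mono, contr_tp]
    obtain ⟨f, hf⟩ := ex_head 0 fun _ => (0 : TorusModule n)
    have h1 : mono (n := n) 0 0 = f (monomial 0) := by
      rw [hf]
      refine tp_congr fun m hm => ?_
      rw [if_pos (by omega)]; rfl
    rw [h1, ← map_smul, hf]
    refine tp_congr fun m hm => ?_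
    rw [if_pos (by omega), if_pos (by omega)]
    simp only [seqThree, dMul, torusMul, if_true, one_ne_zero, if_false, OfNat.ofNat_ne_zero,
      OfNat.ofNat_ne_one, twistedMul_monomial, map_smul, coc_one, smul_smul]
    rw [neg_add_cancel]; simp
  have h2 := key h g
  rw [add_comm h g] at h2
  rw [twoChain, map_sub, key, h2]
  exact (sub_smul (form a g h) (form a h g) (mono (n := n) 0 0)).symm

lemma theta_bottC (a : Fin n → Fin n → ℂ) (i j : Fin n) :
    theta (form a) (bottC i j) - (a i j - a j i) • unitC n ∈
      boundaries μ₁ 𝟏 := by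
  refine mem_bd_of_pair 1 (Submodule.sub_mem _
    (theta_cycles _ (bottC_cyc i j)) (smul_mem _ _ (unitC_cyc 1)))
    fun p I => ?_
  rw [Pi.sub_apply, Pi.smul_apply, map_sub, map_smul]
  cases p with
  | succ p =>
    rw [pairing_theta_bottC a i j _ (by omega), unitC_succ, map_zero, smul_zero, sub_zero]
  | zero =>
    have hs : ∀ i j : Fin n, form a (Pi.single i 1) (Pi.single j 1) = a i j := fun i j => by
      rw [form_apply, sum_eq_single i, sum_eq_single j]
      · simp
      · intro l _ hl; simp [hl]
      · simp
      · intro l _ hl; simp [hl]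
      · simp
    have h1 : theta (form a) (bottC i j) 0 = (a i j - a j i) • unitC n 0 := by
      rw [θ_apply, Pi.add_apply, onE_ap, bottC_zero, map_zero, zero_add, getzlerOp,
        onE_ap, onE_ap, bottC_zero, map_zero, map_zero, add_zero]
      change contr μ₁ (dMul 1 (form a)) 0 (inv₀ n 2 (bottC i j 1)) = _
      rw [bottC_one, inv₀_two, contr_twoChain, hs, hs]
      rfl
    rw [h1, map_smul, sub_self]

end Bott

/-! ### Flat sections -/

section Flat

variable {n : ℕ} {W : Type} [AddCommGroup W] [Module ℂ W]

lemma SmoothFamily.scalar {f : ℝ → ℂ} (hf : ContDiff ℝ ∞ f) (w : W) :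
    SmoothFamily (fun t => f t • w) fun t => deriv f t • w :=
  ⟨1, fun _ => f, fun _ => w, fun _ => hf, fun t => by simp, fun t => by simp⟩

lemma SmoothFamily.exists_smul {f : ℝ → ℂ} (hf : ContDiff ℝ ∞ f) {c c' : ℝ → W}
    (hc : SmoothFamily c c') : ∃ d, SmoothFamily (fun t => f t • c t) d := by
  obtain ⟨N, g, w, hg, h1, _⟩ := hc
  exact ⟨_, N, fun j t => f t * g j t, w, fun j => hf.mul (hg j),
    fun t => by simp [h1, smul_sum, smul_smul], fun t => rfl⟩

lemma SmoothFamily.exists_sum {ι : Type*} (s : Finset ι) {c : ι → ℝ → W}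
    (h : ∀ i, ∃ d, SmoothFamily (c i) d) : ∃ d, SmoothFamily (∑ i ∈ s, c i) d := by
  classical
  induction s using Finset.induction_on with
  | empty => exact ⟨0, SmoothFamily.zero⟩
  | insert i s hi ih =>
    obtain ⟨d, hd⟩ := h i
    obtain ⟨d', hd'⟩ := ih
    exact ⟨_, by rw [sum_insert hi]; exact hd.add hd'⟩

lemma retwist_dMul (q : QP n) (θ : (Γ n) →+ (Γ n) →+ ℂ) (k : ℕ)
    (x : HT n (k + 1)) :
    rtw q k (mergeHead (dMul 1 θ) k x) = mergeHead (dMul q θ) k (rtw q (k + 1) x) :=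
  trf_merge (cut_local (inv_phase_local q))
    (cut_merge (s := fun k g => (phase q k g)⁻¹) (w' := fun g h => θ g h * cocycle (1 : QP n) g h)
      (w := fun g h => θ g h * cocycle q g h) fun k g => by
      have := cocycle_ne_zero q (g 0) (g 1)
      have := phase_ne_zero q k (sMerge g)
      rw [coc_one, phase_merge]
      field_simp) k x

lemma retwist_getzlerOp (q : QP n) (θ : (Γ n) →+ (Γ n) →+ ℂ)
    (c : EV n) :
    onE (rtw q) (getzlerOp μ₁ 𝟏 (dMul 1 θ) c) =
      getzlerOp (torusMul q) 𝟏 (dMul q θ) (onE (rtw q) c) := by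
  funext p
  have h := rtw_itw q
  rw [onE_ap, getzlerOp, map_add,
    contr_itw h.rot h.merge (retwist_dMul q θ),
    contrS_itw h.rot h.ins (retwist_dMul q θ)]
  rfl

lemma retwist_one_mono_zero (q : QP n) (k : ℕ) :
    rtw q k (mono k 0) = mono k 0 := by
  rw [rtw_mono, cut, if_pos (by simp [wt]), phase_eq]
  simp [cocycle]

lemma retwist_unitC (q : QP n) : onE (rtw q) (unitC n) = unitC n := by
  funext p
  rw [onE_ap]
  cases p with
  | zero => exact retwist_one_mono_zero q _
  | succ p => rw [unitC_succ, map_zero]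

lemma pairing_retwist (q : QP n) (k : ℕ) (I : Fin k → Fin n) (x : HT n k) :
    pairing q k I (rtw q k x) = pairing 1 k I x := by
  rw [← pair_utw, untwist_retwist, pairing_invPart]

namespace QPath

variable {q : QP n} (γ : QPath q)

lemma smoothFamily_retwist (k : ℕ) (w : HT n k) :
    SmoothFamily (fun t => rtw (γ.toFun t) k w)
      fun t => (-1 : ℂ) • rtw (γ.toFun t) k (fMul (form (γ.rate t)) k w) := by
  induction w using mono_induction with
  | hm g =>
    simp only [fMul_mono, map_smul, rtw_mono, cut, smul_smul]
    by_cases h : wt k g = 0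
    · simp only [h, if_true]
      have h1 : ∀ t, deriv (fun t => (phase (γ.toFun t) k g)⁻¹) t =
          -1 * (pSum (form (γ.rate t)) k g * (phase (γ.toFun t) k g)⁻¹) := fun t => by
        rw [(((γ.hld_phase t k g).inv (phase_ne_zero _ k g) :) : HasDerivAt _ _ _).deriv]
        ring
      simp only [← h1]
      exact SmoothFamily.scalar ((γ.contDiff_phase k g).inv fun t => phase_ne_zero _ k g) _
    · simp only [h, if_false, zero_mul, mul_zero, zero_smul]
      exact SmoothFamily.zero
  | hadd x y hx hy =>
    simp only [map_add, smul_add]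
    exact hx.add hy
  | hsmul a x hx =>
    simp only [map_smul, smul_comm _ a]
    exact hx.smul a

lemma isFlat_unit : γ.IsFlat fun _ => unitC n := by
  refine ⟨fun _ => 0, fun _ => 0, fun _ => 0, fun p => ?_, fun p => SmoothFamily.zero,
    fun t => unitC_cyc _, fun t => ?_⟩
  · have := SmoothFamily.scalar (contDiff_const (c := (1 : ℂ))) (unitC n p)
    simp only [one_smul, deriv_const, zero_smul] at this
    exact this
  · rw [getzlerOp_unitC, map_zero, sub_zero, sub_zero]
    exact zero_mem _

def logVal (i j : Fin n) (t : ℝ) : ℂ := ∫ s in (0 : ℝ)..t, (γ.rate s i j - γ.rate s j i)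

lemma deriv_logVal (i j : Fin n) (t : ℝ) :
    HasDerivAt (γ.logVal i j) (γ.rate t i j - γ.rate t j i) t := by
  have hc : Continuous fun s => γ.rate s i j - γ.rate s j i :=
    (γ.continuous_rate i j).sub (γ.continuous_rate j i)
  exact intervalIntegral.integral_hasDerivAt_right (hc.intervalIntegrable _ _)
    (hc.stronglyMeasurableAtFilter _ _) hc.continuousAt

lemma contDiff_logVal (i j : Fin n) : ContDiff ℝ ∞ (γ.logVal i j) := by
  refine contDiff_infty_iff_deriv.2 ⟨fun t => (γ.deriv_logVal i j t).differentiableAt, ?_⟩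
  rw [show deriv (γ.logVal i j) = fun t => γ.rate t i j - γ.rate t j i from
    funext fun t => (γ.deriv_logVal i j t).deriv]
  exact (γ.contDiff_rate i j).sub (γ.contDiff_rate j i)

lemma logVal_zero (i j : Fin n) : γ.logVal i j 0 = 0 := intervalIntegral.integral_same

lemma exp_logVal (i j : Fin n) (hij : i < j) : exp (γ.logVal i j 1) = q.val i j := by
  have h1 : ∀ t, HasDerivAt (fun t => exp (γ.logVal i j t) * (γ.toFun t).val j i) 0 t := by
    intro t
    have h2 := (γ.deriv_logVal i j t).cexp.mul (γ.hld_val t j i)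
    refine h2.congr_deriv ?_
    have := val_ne_zero (γ.toFun t) j i
    rw [rate, rate, if_neg hij.not_gt, if_pos hij]
    ring
  have h2 := is_const_of_deriv_eq_zero (fun t => (h1 t).differentiableAt) (fun t => (h1 t).deriv) 1 0
  simp only [logVal_zero, exp_zero, one_mul, γ.finish, γ.start] at h2
  have h3 := q.skew i j
  refine mul_right_cancel₀ (val_ne_zero q j i) (h2.trans ?_)
  rw [h3]
  rfl

/-- The flat section through the cocycle dual to `e_i ∧ e_j`. -/
def bottSection (i j : Fin n) (t : ℝ) : EV n :=
  onE (rtw (γ.toFun t)) (bottC i j) + γ.logVal i j t • unitC n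

lemma isFlat_bottSection (i j : Fin n) : γ.IsFlat (γ.bottSection i j) := by
  have hex : ∀ x y : Fin n, ∃ ζ : OddChains (TorusModule n),
      theta (form (Pi.single x (Pi.single y 1))) (bottC i j) -
        ((Pi.single x (Pi.single y 1) : Fin n → Fin n → ℂ) i j -
          (Pi.single x (Pi.single y 1) : Fin n → Fin n → ℂ) j i) • unitC n -
        dOdd μ₁ 𝟏 ζ ∈ degEven 𝟏 := fun x y => by
    obtain ⟨_, ⟨ζ, rfl⟩, d, hd, h⟩ := mem_sup.1
      (theta_bottC (Pi.single x (Pi.single y 1)) i j)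
    refine ⟨ζ, ?_⟩
    rw [← h, add_sub_cancel_left]
    exact hd
  choose ζ hζ using hex
  let η : ℝ → OddChains (TorusModule n) := fun t =>
    ∑ x, ∑ y, (-1 * γ.rate t x y) • onOdd (rtw (γ.toFun t)) (ζ x y)
  have hη : ∀ p, ∃ d, SmoothFamily (fun t => η t p) d := fun p => by
    have h : (fun t => η t p) = ∑ x, ∑ y, fun t => (-1 * γ.rate t x y) •
        rtw (γ.toFun t) (2 * p + 1) (ζ x y p) := by
      funext t
      simp only [η, Finset.sum_apply]
      rfl
    rw [h]
    exact SmoothFamily.exists_sum _ fun x => SmoothFamily.exists_sum _ fun y =>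
      SmoothFamily.exists_smul (contDiff_const.mul (γ.contDiff_rate x y)) (γ.smoothFamily_retwist _ _)
  choose η' hη' using hη
  refine ⟨fun t => (-1 : ℂ) • onE (rtw (γ.toFun t))
      (onE (fMul (form (γ.rate t))) (bottC i j)) +
      (γ.rate t i j - γ.rate t j i) • unitC n, η, fun t p => η' p t, fun p => ?_,
    hη', fun t => ?_, fun t => ?_⟩
  · have h1 := SmoothFamily.scalar (γ.contDiff_logVal i j) (unitC n p)
    simp only [(γ.deriv_logVal i j _).deriv] at h1
    exact (γ.smoothFamily_retwist _ (bottC i j p)).add h1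
  · exact add_mem ((rtw_itw _).cycles (bottC_cyc i j))
      (smul_mem _ _ (unitC_cyc _))
  · set r := γ.rate t with hr
    have h1 : theta (form r) (bottC i j) - (r i j - r j i) • unitC n -
        ∑ x, ∑ y, r x y • dOdd μ₁ 𝟏 (ζ x y) ∈ degEven 𝟏 := by
      have h2 := Submodule.sum_mem (degEven 𝟏) fun x (_ : x ∈ Finset.univ) =>
        Submodule.sum_mem (degEven 𝟏) fun y (_ : y ∈ Finset.univ) =>
          smul_mem _ (r x y) (hζ x y)
      have h3 : ∀ i j, ∑ x, ∑ y, r x y * (Pi.single x (Pi.single y 1) : Fin n → Fin n → ℂ) i j =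
          r i j := fun i j => by
        rw [sum_eq_single i, sum_eq_single j]
        · simp
        · intro l _ hl; simp [Ne.symm hl]
        · simp
        · intro l _ hl
          refine sum_eq_zero fun m _ => ?_
          rw [Pi.single_eq_of_ne (Ne.symm hl)]; simp
        · simp
      simp only [smul_sub, sum_sub_distrib, ← theta_form, smul_smul, mul_sub, sub_smul,
        ← sum_smul, h3] at h2
      rw [sub_smul]
      exact h2
    have h2 := (rtw_itw (γ.toFun t)).degEven h1
    have h3 : onE (rtw (γ.toFun t))
        (∑ x, ∑ y, r x y • dOdd μ₁ 𝟏 (ζ x y)) =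
        (-1 : ℂ) • dOdd (torusMul (γ.toFun t)) 𝟏 (η t) := by
      simp only [η, map_sum, map_smul, smul_sum, smul_smul, ← mul_assoc, neg_mul_neg, one_mul,
        (rtw_itw (γ.toFun t)).dOdd]
      rfl
    have h4 : onE (rtw (γ.toFun t)) (onE (inv₀ n) (bottC i j)) =
        onE (rtw (γ.toFun t)) (bottC i j) := funext fun p => retwist_invPart _ _ _
    have h5 : getzlerOp (torusMul (γ.toFun t)) 𝟏 (γ.mulDeriv t) (γ.bottSection i j t) =
        onE (rtw (γ.toFun t)) (getzlerOp μ₁ 𝟏 (dMul 1 (form r))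
          (onE (inv₀ n) (bottC i j))) := by
      rw [retwist_getzlerOp, h4, bottSection, mulDeriv_eq]
      have h6 := getzlerOp_unitC (torusMul (γ.toFun t)) (dMul (γ.toFun t) (form r))
      funext p
      have h7 := congrFun h6 p
      simp only [getzlerOp, Pi.zero_apply] at h7
      simp only [getzlerOp, Pi.add_apply, Pi.smul_apply, map_add, map_smul]
      have h8 : ∀ a b c d : HT n (2 * p), c + d = 0 →
          a + γ.logVal i j t • c + (b + γ.logVal i j t • d) = a + b := fun a b c d h => by
        rw [add_add_add_comm, ← smul_add, h, smul_zero, add_zero]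
      exact h8 _ _ _ _ h7
    refine (congrArg (· ∈ degEven 𝟏) ?_).mpr (smul_mem _ (-1 : ℂ) h2)
    rw [h5, map_sub, map_sub, h3, θ_apply, map_add, map_smul, retwist_unitC]
    simp only [smul_sub, smul_add, neg_smul, one_smul]
    abel

/-- The flat section of the unit. -/
def unitFlat : γ.flat := ⟨_, γ.isFlat_unit⟩

/-- The flat section through the cocycle dual to `e_i ∧ e_j`. -/
def bottFlat (i j : Fin n) : γ.flat := ⟨_, γ.isFlat_bottSection i j⟩

lemma sc_unitFlat : γ.startClass γ.unitFlat = cohOne n := by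
  funext p I
  rw [sc_apply, γ.start]
  cases p with
  | zero => exact pair_unitC_zero 1 I
  | succ p => exact map_zero _

end QPath

def cohTwo (i j : Fin n) : Coh n := Pi.single 1 fun I =>
  (if I 0 = i then 1 else 0) * (if I 1 = j then 1 else 0) -
    (if I 1 = i then 1 else 0) * (if I 0 = j then 1 else 0)

lemma hkr_bottC (i j : Fin n) (p : ℕ) (I : Fin (2 * p) → Fin n) :
    pairing 1 (2 * p) I (bottC i j p) = cohTwo i j p I := by
  by_cases hp : p = 1
  · subst hp
    rw [cohTwo, Pi.single_eq_same, bottC_one]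
    refine (pairing_twoChain _ _ I).trans ?_
    simp [Pi.single_apply]
  · rw [pairing_bottC i j p hp, cohTwo, Pi.single_eq_of_ne hp]
    rfl

def unitClass (q : QP n) : torusHP q := Submodule.Quotient.mk ⟨unitC n, unitC_cyc q⟩

/-- The class dual to `e_i ∧ e_j`. -/
def bottClass (q : QP n) (i j : Fin n) : torusHP q :=
  Submodule.Quotient.mk ⟨onE (rtw q) (bottC i j),
    (rtw_itw q).cycles (bottC_cyc i j)⟩

namespace QPath

variable {q : QP n} (γ : QPath q)

lemma startClass_bottFlat (i j : Fin n) : γ.startClass (γ.bottFlat i j) = cohTwo i j := by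
  funext p I
  rw [sc_apply]
  change pairing _ _ _ (γ.bottSection i j 0 p) = _
  rw [bottSection, logVal_zero, zero_smul, add_zero, onE_ap, pairing_retwist, hkr_bottC]

lemma ec_unitFlat : γ.endClass γ.unitFlat = unitClass q := rfl

lemma endClass_bottFlat (i j : Fin n) :
    γ.endClass (γ.bottFlat i j) = bottClass q i j + γ.logVal i j 1 • unitClass q := by
  have h : (γ.bottFlat i j).1 1 = onE (rtw q) (bottC i j) + γ.logVal i j 1 • unitC n := by
    change γ.bottSection i j 1 = _
    rw [bottSection, γ.finish]
  rw [bottClass, unitClass, ← Submodule.Quotient.mk_smul, ← Submodule.Quotient.mk_add]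
  exact congrArg Submodule.Quotient.mk (Subtype.ext h)

end QPath

end Flat

/-! ### A criterion for mixed Hodge structures -/

lemma internal_of_unique {N : Type*} [AddCommGroup N] [Module ℂ N] {A : ℤ → Submodule ℂ N}
    (p₀ : ℤ) (h0 : A p₀ = ⊤) (h : ∀ p ≠ p₀, A p = ⊥) : DirectSum.IsInternal A := by
  refine DirectSum.isInternal_submodule_of_iSupIndep_of_iSup_eq_top (fun p => ?_)
    (eq_top_iff.2 (h0 ▸ le_iSup A p₀))
  by_cases hp : p = p₀
  · subst hp
    have : ⨆ j, ⨆ (_ : j ≠ p), A j = ⊥ := by simp +contextual [h]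
    rw [this]
    exact disjoint_bot_right
  · rw [h p hp]
    exact disjoint_bot_left

lemma exists_conjugation {B D : Type*} [AddCommGroup B] [AddCommGroup D] [Module ℂ D]
    {c : B →ₗ[ℤ] D} (h : IsBaseChange ℂ c) :
    ∃ σ : D →ₛₗ[starRingEnd ℂ] D, ∀ v, σ (c v) = c v := by
  let τ : ℂ ⊗[ℤ] B →ₗ[ℤ] ℂ ⊗[ℤ] B :=
    LinearMap.rTensor B ((starRingEnd ℂ).toAddMonoidHom.toIntLinearMap)
  have hτ : ∀ (z : ℂ) (b : B), τ (z ⊗ₜ b) = (starRingEnd ℂ z) ⊗ₜ b := fun z b => rfl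
  have hs : ∀ (a : ℂ) (x : ℂ ⊗[ℤ] B), τ (a • x) = starRingEnd ℂ a • τ x := fun a x => by
    induction x with
    | zero => simp
    | add x y hx hy => simp only [smul_add, map_add, hx, hy]
    | tmul z b => rw [smul_tmul', hτ, hτ, smul_tmul', smul_eq_mul,
        map_mul, smul_eq_mul]
  refine ⟨⟨⟨fun x => h.equiv (τ (h.equiv.symm x)), fun x y => by simp⟩, fun a x => ?_⟩, fun v => ?_⟩
  · simp only [map_smul, hs]
  · change h.equiv (τ (h.equiv.symm (c v))) = c v
    rw [h.equiv_symm_apply, hτ, map_one, h.equiv_tmul, one_smul]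

lemma conj_conj {B D : Type*} [AddCommGroup B] [AddCommGroup D] [Module ℂ D]
    {c : B →ₗ[ℤ] D} (h : IsBaseChange ℂ c) (σ : D →ₛₗ[starRingEnd ℂ] D) (hσ : ∀ v, σ (c v) = c v)
    (x : D) : σ (σ x) = x := by
  induction x using h.inductionOn with
  | zero => simp
  | tmul v => rw [hσ, hσ]
  | smul a x hx => rw [LinearMap.map_smulₛₗ, LinearMap.map_smulₛₗ, hx, Complex.conj_conj]
  | add x y hx hy => rw [map_add, map_add, hx, hy]

namespace HodgeData

lemma mk_mem_induced {X : HodgeData} {k : ℤ} {S : Submodule ℂ X.dR} {x : X.W k} :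
    (Submodule.Quotient.mk x : X.gr k) ∈ X.induced k S ↔
      ∃ y ∈ X.W k, y ∈ S ∧ (x : X.dR) - y ∈ X.W (k - 1) := by
  rw [induced, Submodule.mem_map]
  constructor
  · rintro ⟨y, hy, h⟩
    exact ⟨y, y.2, hy, (Submodule.Quotient.eq ((X.W (k - 1)).comap (X.W k).subtype)).1 h.symm⟩
  · rintro ⟨y, hk, hy, h⟩
    exact ⟨⟨y, hk⟩, hy, ((Submodule.Quotient.eq ((X.W (k - 1)).comap (X.W k).subtype)).2 h).symm⟩

lemma induced_eq_top {X : HodgeData} {k : ℤ} {S : Submodule ℂ X.dR}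
    (h : ∀ x ∈ X.W k, ∃ y ∈ X.W k, y ∈ S ∧ x - y ∈ X.W (k - 1)) : X.induced k S = ⊤ := by
  refine eq_top_iff.2 fun x _ => ?_
  obtain ⟨x, rfl⟩ := Submodule.Quotient.mk_surjective _ x
  exact mk_mem_induced.2 (h x x.2)

lemma induced_eq_bot {X : HodgeData} {k : ℤ} {S : Submodule ℂ X.dR}
    (h : ∀ y ∈ X.W k, y ∈ S → y ∈ X.W (k - 1)) : X.induced k S = ⊥ := by
  refine eq_bot_iff.2 ?_
  rintro _ ⟨y, hy, rfl⟩
  exact (Submodule.Quotient.mk_eq_zero _).2 (h y y.2 hy)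

/-- Weight and Hodge filtrations of the type of an extension of a Hodge structure of type `(1, 1)`
by the Hodge structure of type `(0, 0)` spanned by `u`. -/
structure IsFrame (X : HodgeData) (u : X.dR) : Prop where
  W_neg : ∀ k < 0, X.W k = ⊥
  W_low : ∀ k, 0 ≤ k → k < 2 → X.W k = span ℂ {u}
  W_high : ∀ k, 2 ≤ k → X.W k = ⊤
  F_nonpos : ∀ k ≤ 0, X.F k = ⊤
  compl : IsCompl (span ℂ {u}) (X.F 1)
  F_high : ∀ k, 2 ≤ k → X.F k = ⊥

lemma IsFrame.isMixedHodge {X : HodgeData} {v₀ : X.B} (h : X.IsFrame (X.c v₀))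
    (hfin : Module.Finite ℤ X.B) (hc : IsBaseChange ℂ X.c) : X.IsMixedHodge where
  finite := hfin
  baseChange := hc
  F_anti := fun a b hab => by
    rcases le_or_gt a 0 with ha | ha
    · rw [h.F_nonpos a ha]; exact le_top
    · rcases le_or_gt 2 b with hb | hb
      · rw [h.F_high b hb]; exact bot_le
      · obtain rfl : a = b := by omega
        exact le_rfl
  F_bounded := ⟨0, 2, h.F_nonpos 0 le_rfl, h.F_high 2 le_rfl⟩
  W_mono := fun a b hab => by
    rcases lt_or_ge a 0 with ha | ha
    · rw [h.W_neg a ha]; exact bot_le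
    · rcases le_or_gt 2 b with hb | hb
      · rw [h.W_high b hb]; exact le_top
      · rw [h.W_low a ha (by omega), h.W_low b (by omega) hb]
  W_bounded := ⟨-1, 2, h.W_neg _ (by norm_num), h.W_high _ le_rfl⟩
  W_rational := fun k => by
    refine le_antisymm ?_ (span_le.2 fun x hx => hx.1)
    rcases lt_or_ge k 0 with hk | hk
    · rw [h.W_neg k hk]; exact bot_le
    · rcases le_or_gt 2 k with hk2 | hk2
      · rw [h.W_high k hk2]
        rintro x -
        induction x using hc.inductionOn with
        | zero => exact zero_mem _
        | tmul v => exact subset_span ⟨trivial, v, rfl⟩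
        | smul a x hx => exact smul_mem _ _ hx
        | add x y hx hy => exact add_mem hx hy
      · rw [h.W_low k hk hk2]
        refine span_le.2 ?_
        rintro _ rfl
        exact subset_span ⟨mem_span_singleton_self _, v₀, rfl⟩
  opposed := by
    obtain ⟨σ, hσ⟩ := exists_conjugation hc
    have hσσ := conj_conj hc σ hσ
    have hF : ∀ y ∈ span ℂ {X.c v₀}, y ∈ X.F 1 → y = 0 := fun y h1 h2 =>
      Submodule.disjoint_def.1 h.compl.disjoint y h1 h2
    have hF' : ∀ p, 1 ≤ p → ∀ y ∈ span ℂ {X.c v₀}, y ∈ X.F p → y = 0 := by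
      intro p hp y h1 h2
      rcases le_or_gt 2 p with h3 | h3
      · rw [h.F_high p h3] at h2; exact h2
      · obtain rfl : p = 1 := by omega
        exact hF y h1 h2
    have hspan : ∀ y ∈ span ℂ {X.c v₀}, σ y ∈ span ℂ {X.c v₀} := by
      intro y hy
      obtain ⟨a, rfl⟩ := mem_span_singleton.1 hy
      rw [LinearMap.map_smulₛₗ, hσ]
      exact smul_mem _ _ (mem_span_singleton_self _)
    have hσ0 : ∀ y, σ y = 0 → y = 0 := fun y hy => by rw [← hσσ y, hy, map_zero]
    have hdec : ∀ x, ∃ y ∈ X.F 1, x - y ∈ span ℂ {X.c v₀} := fun x => by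
      obtain ⟨a, ha, b, hb, rfl⟩ := mem_sup.1
        (h.compl.sup_eq_top.symm ▸ mem_top : x ∈ _)
      exact ⟨b, hb, by simpa using ha⟩
    refine ⟨σ, hσ, fun k => ?_⟩
    by_cases h0 : k = 0
    · subst h0
      have hW := h.W_low 0 le_rfl (by norm_num)
      have hW' := h.W_neg (0 - 1) (by norm_num)
      refine internal_of_unique 0 ?_ fun p hp => ?_
      · rw [induced_eq_top, induced_eq_top, inf_top_eq]
        · exact fun x hx => ⟨x, hx, by simp [h.F_nonpos], by simp⟩
        · exact fun x hx => ⟨x, hx, by simp [h.F_nonpos], by simp⟩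
      · rcases lt_or_gt_of_ne hp with hp | hp
        · rw [X.induced_eq_bot (S := (X.F (0 - p)).comap σ), inf_bot_eq]
          intro y hy hyS
          rw [hW] at hy
          rw [hW']
          exact hσ0 y (hF' (0 - p) (by omega) _ (hspan y hy) hyS)
        · rw [X.induced_eq_bot (S := X.F p), bot_inf_eq]
          intro y hy hyS
          rw [hW] at hy
          rw [hW']
          exact hF' p (by omega) y hy hyS
    by_cases h2 : k = 2
    · subst h2
      have hW := h.W_high 2 le_rfl
      have hW' := h.W_low (2 - 1) (by norm_num) (by norm_num)
      refine internal_of_unique 1 ?_ fun p hp => ?_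
      · rw [induced_eq_top, induced_eq_top, inf_top_eq]
        · intro x _
          obtain ⟨y, h1, h2⟩ := hdec (σ x)
          refine ⟨σ y, by simp [hW], ?_, ?_⟩
          · rw [mem_comap, hσσ]; exact h1
          · rw [hW', ← hσσ x, ← map_sub]
            exact hspan _ h2
        · intro x _
          obtain ⟨y, h1, h2⟩ := hdec x
          exact ⟨y, by simp [hW], h1, by rwa [hW']⟩
      · rcases lt_or_gt_of_ne hp with hp | hp
        · rw [X.induced_eq_bot (S := (X.F (2 - p)).comap σ), inf_bot_eq]
          intro y _ hyS
          rw [mem_comap, h.F_high _ (by omega)] at hyS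
          rw [hσ0 y hyS]
          exact zero_mem _
        · rw [X.induced_eq_bot (S := X.F p), bot_inf_eq]
          intro y _ hyS
          rw [h.F_high _ (by omega)] at hyS
          rw [(mem_bot ℂ).1 hyS]
          exact zero_mem _
    · have hW : X.W k ≤ X.W (k - 1) := by
        rcases lt_or_ge k 0 with hk | hk
        · rw [h.W_neg k hk]; exact bot_le
        · rcases lt_or_ge k 2 with hk2 | hk2
          · rw [h.W_low k hk hk2, h.W_low (k - 1) (by omega) (by omega)]
          · rw [h.W_high (k - 1) (by omega)]; exact le_top
      have hb : ∀ S, X.induced k S = ⊥ := fun S => X.induced_eq_bot fun y hy _ => hW hy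
      refine internal_of_unique 0 ?_ fun p _ => by rw [hb, bot_inf_eq]
      rw [induced_eq_top, induced_eq_top, inf_top_eq]
      · exact fun x hx => ⟨0, zero_mem _, zero_mem _, by simpa using hW hx⟩
      · exact fun x hx => ⟨0, zero_mem _, zero_mem _, by simpa using hW hx⟩

end HodgeData

open HodgeData

/-! ### Extensions of Tate structures -/

section Tate

variable {M : Type} [AddCommGroup M]

def cLift {W : Type*} [AddCommGroup W] [Module ℂ W] (f : M →ₗ[ℤ] W) : ℂ ⊗[ℤ] M ⊸ W :=
  (TensorProduct.isBaseChange ℤ M ℂ).lift f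

lemma cLift_tmul {W : Type*} [AddCommGroup W] [Module ℂ W] (f : M →ₗ[ℤ] W) (z : ℂ) (m : M) :
    cLift f (z ⊗ₜ m) = z • f m := by
  have h := (TensorProduct.isBaseChange ℤ M ℂ).lift_eq f m
  rw [cLift, ← mul_one z, ← smul_eq_mul, ← smul_tmul', map_smul, smul_eq_mul,
    mul_one]
  exact congrArg _ h

lemma tensor_ext {W : Type*} [AddCommGroup W] [Module ℂ W] {f g : ℂ ⊗[ℤ] M ⊸ W}
    (h : ∀ m : M, f (1 ⊗ₜ m) = g (1 ⊗ₜ m)) : f = g :=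
  (TensorProduct.isBaseChange ℤ M ℂ).algHom_ext _ _ h

lemma two_pi_I_ne_zero : ϖ ≠ 0 := Complex.two_pi_I_ne_zero

lemma tate_c (j : ℤ) (m : M) : (tate M j).c m = (ϖ ^ (-j)) ⊗ₜ[ℤ] m := rfl

lemma tate_one_c (m : M) : (Θ M).c m = ϖ⁻¹ ⊗ₜ[ℤ] m := by
  rw [tate_c, zpow_neg_one]

lemma unitHodge_c (a : ℤ) : ⊡.c a = (1 : ℂ) ⊗ₜ[ℤ] a := by
  refine (tate_c 0 a).trans ?_
  rw [neg_zero, zpow_zero]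

lemma tate_ext {W : Type*} [AddCommGroup W] [Module ℂ W] {j : ℤ} {f g : (tate M j).dR ⊸ W}
    (h : ∀ m : (tate M j).B, f ((tate M j).c m) = g ((tate M j).c m)) : f = g := by
  refine tensor_ext (M := M) fun m => ?_
  have hz : (ϖ ^ j * ϖ ^ (-j)) = 1 := by
    rw [← zpow_add₀ two_pi_I_ne_zero, add_neg_cancel, zpow_zero]
  have h1 : (1 : ℂ) ⊗ₜ[ℤ] m = ϖ ^ j •
      ((ϖ ^ (-j)) ⊗ₜ[ℤ] m) := by
    rw [smul_tmul', smul_eq_mul, hz]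
  rw [h1]
  exact (map_smul f _ _).trans ((congrArg _ (h m)).trans (map_smul g _ _).symm)

/-- The complex linear map with prescribed values on the lattice. -/
def tateLift {W : Type*} [AddCommGroup W] [Module ℂ W] {j : ℤ} (f : (tate M j).B →ₗ[ℤ] W) :
    (tate M j).dR ⊸ W :=
  cLift (M := M) (ϖ ^ j • f)

lemma tateLift_c {W : Type*} [AddCommGroup W] [Module ℂ W] {j : ℤ} (f : (tate M j).B →ₗ[ℤ] W)
    (m : (tate M j).B) : tateLift f ((tate M j).c m) = f m := by
  refine (cLift_tmul (M := M) _ _ m).trans ?_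
  change ϖ ^ (-j) • (ϖ ^ j • f m) = f m
  rw [smul_smul, ← zpow_add₀ two_pi_I_ne_zero, neg_add_cancel, zpow_zero, one_smul]

end Tate

namespace Extension

variable {M : Type} [AddCommGroup M] (E : Extension (Θ M) ⊡)

def gen : E.mid.B := E.i.onB (1 : ℤ)

lemma i_onB (a : ℤ) : E.i.onB a = a • E.gen := by
  have e : @Eq ⊡.B (a • (1 : ℤ)) a := mul_one a
  exact (congrArg E.i.onB e.symm).trans (map_zsmul E.i.onB a (1 : ℤ))

lemma p_gen : E.p.onB E.gen = 0 := E.exact.apply_apply_eq_zero _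

lemma i_onDR : E.i.onDR (⊡.c (1 : ℤ)) = E.mid.c E.gen := E.i.comm _

lemma exists_eq_smul_gen {v : E.mid.B} (h : E.p.onB v = 0) : ∃ a : ℤ, v = a • E.gen := by
  obtain ⟨a, rfl⟩ := (E.exact v).1 h
  exact ⟨a, E.i_onB a⟩

lemma p_c_gen : E.p.onDR (E.mid.c E.gen) = 0 := by
  rw [E.p.comm, E.p_gen, map_zero]

variable [Module.Free ℤ M]

lemma ex_split : ∃ (rB : E.mid.B →ₗ[ℤ] ℤ) (sB : (Θ M).B →ₗ[ℤ] E.mid.B),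
    rB E.gen = 1 ∧ (∀ m, E.p.onB (sB m) = m) ∧ ∀ v, v = rB v • E.gen + sB (E.p.onB v) := by
  let pB : E.mid.B →ₗ[ℤ] M := E.p.onB
  obtain ⟨sB, hs⟩ : ∃ sB : (Θ M).B →ₗ[ℤ] E.mid.B, pB ∘ₗ sB = LinearMap.id :=
    Module.projective_lifting_property pB LinearMap.id E.surj
  have hs' : ∀ m, E.p.onB (sB m) = m := fun m => LinearMap.congr_fun hs m
  have hex : ∀ v, ∃ a : ℤ, v - sB (E.p.onB v) = a • E.gen := fun v =>
    E.exists_eq_smul_gen (by rw [map_sub, hs', sub_self])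
  choose r hr using hex
  have hinj : ∀ a b : ℤ, a • E.gen = b • E.gen → a = b := fun a b h => by
    rw [← E.i_onB, ← E.i_onB] at h
    exact E.inj h
  refine ⟨(AddMonoidHom.mk' r fun v w => hinj _ _ ?_).toIntLinearMap, sB, hinj _ _ ?_, hs',
    fun v => ?_⟩
  · rw [add_smul, ← hr, ← hr, ← hr, map_add, map_add]; abel
  · change r E.gen • E.gen = _
    rw [← hr, E.p_gen]
    simp
  · change v = r v • E.gen + _
    rw [← hr, sub_add_cancel]

lemma ex_split_dR : ∃ (rB : E.mid.B →ₗ[ℤ] ℤ) (R : E.mid.dR ⊸ ℂ)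
    (S : (Θ M).dR ⊸ E.mid.dR), rB E.gen = 1 ∧ (∀ v, R (E.mid.c v) = rB v) ∧
      (∀ x, E.p.onDR (S x) = x) ∧ ∀ x, x = R x • E.mid.c E.gen + S (E.p.onDR x) := by
  obtain ⟨rB, sB, h1, h2, h3⟩ := E.ex_split
  have hb := E.isMixedHodge.baseChange
  let R : E.mid.dR ⊸ ℂ := hb.lift ((Int.castAddHom ℂ).toIntLinearMap ∘ₗ rB)
  let S : (Θ M).dR ⊸ E.mid.dR := tateLift (E.mid.c ∘ₗ sB)
  have hR : ∀ v, R (E.mid.c v) = rB v := fun v => hb.lift_eq _ v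
  have hS : ∀ m, S ((Θ M).c m) = E.mid.c (sB m) := fun m => tateLift_c _ m
  refine ⟨rB, R, S, h1, hR, fun x => ?_, fun x => ?_⟩
  · refine LinearMap.congr_fun (f := E.p.onDR ∘ₗ S) (g := LinearMap.id) (tate_ext fun m => ?_) x
    rw [comp_apply, hS, E.p.comm, h2]
    rfl
  · refine LinearMap.congr_fun (f := LinearMap.id)
      (g := toSpanSingleton ℂ E.mid.dR (E.mid.c E.gen) ∘ₗ R + S ∘ₗ E.p.onDR)
      (hb.algHom_ext _ _ fun v => ?_) x
    simp only [LinearMap.add_apply, comp_apply, id_apply,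
      LinearMap.toSpanSingleton_apply, hR, E.p.comm, hS]
    conv_lhs => rw [h3 v, map_add, map_zsmul]
    rw [Int.cast_smul_eq_zsmul]

lemma mem_span_gen {x : E.mid.dR} (h : E.p.onDR x = 0) : x ∈ span ℂ {E.mid.c E.gen} := by
  obtain ⟨_, R, S, _, _, _, h3⟩ := E.ex_split_dR
  rw [h3 x, h, map_zero, add_zero]
  exact smul_mem _ _ (mem_span_singleton_self _)

lemma c_gen_ne_zero : E.mid.c E.gen ≠ 0 := fun h => by
  obtain ⟨rB, R, S, h1, h2, _, _⟩ := E.ex_split_dR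
  have h3 := h2 E.gen
  rw [h, map_zero, h1, Int.cast_one] at h3
  exact zero_ne_one h3

lemma isFrame : E.mid.IsFrame (E.mid.c E.gen) := by
  have hM := E.isMixedHodge
  obtain ⟨σ, hσ, hint⟩ := hM.opposed
  have hσσ := conj_conj hM.baseChange σ hσ
  set u := E.mid.c E.gen with hu
  have hu0 : u ≠ 0 := E.c_gen_ne_zero
  have hdisj : ∀ k p p', p ≠ p' → ∀ x, ∀ hx : x ∈ E.mid.W k, x ∉ E.mid.W (k - 1) →
      x ∈ E.mid.F p → σ x ∈ E.mid.F (k - p) → x ∈ E.mid.F p' → σ x ∈ E.mid.F (k - p') → False := by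
    intro k p p' hp x hx hx' h1 h2 h3 h4
    have hd := ((hint k).submodule_iSupIndep).pairwiseDisjoint hp
    have hz := Submodule.disjoint_def.1 hd (Submodule.Quotient.mk ⟨x, hx⟩)
      ⟨mk_mem_induced.2 ⟨x, hx, h1, by simp⟩, mk_mem_induced.2 ⟨x, hx, h2, by simp⟩⟩
      ⟨mk_mem_induced.2 ⟨x, hx, h3, by simp⟩, mk_mem_induced.2 ⟨x, hx, h4, by simp⟩⟩
    exact hx' ((Submodule.Quotient.mk_eq_zero ((E.mid.W (k - 1)).comap (E.mid.W k).subtype)).1 hz)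
  have huF : ∀ k ≤ 0, u ∈ E.mid.F k := fun k hk => by
    rw [hu, ← E.i_onDR]
    refine E.i.map_F k _ ?_
    rw [show ⊡.F k = ⊤ from if_pos hk]
    trivial
  have huW : ∀ k, 0 ≤ k → u ∈ E.mid.W k := fun k hk => by
    rw [hu, ← E.i_onDR]
    refine E.i.map_W k _ ?_
    rw [show ⊡.W k = ⊤ from if_pos (by omega)]
    trivial
  have hXW : ∀ k < 2, ∀ x ∈ E.mid.W k, x ∈ span ℂ {u} := fun k hk x hx => by
    refine E.mem_span_gen ?_
    have := E.p.map_W k x hx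
    rw [show (Θ M).W k = ⊥ from if_neg (by omega)] at this
    exact this
  have hXF : ∀ k, 2 ≤ k → ∀ x ∈ E.mid.F k, x ∈ span ℂ {u} := fun k hk x hx => by
    refine E.mem_span_gen ?_
    have := E.p.map_F k x hx
    rw [show (Θ M).F k = ⊥ from if_neg (by omega)] at this
    exact this
  have hline : ∀ (S : Submodule ℂ E.mid.dR) x, x ∈ S → x ∈ span ℂ {u} → u ∉ S → x = 0 := by
    intro S x hx hxu hS
    obtain ⟨a, rfl⟩ := mem_span_singleton.1 hxu
    by_contra h0
    have ha : a ≠ 0 := fun h => h0 (by rw [h, zero_smul])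
    exact hS (by simpa [smul_smul, ha] using S.smul_mem a⁻¹ hx)
  obtain ⟨a, b, ha, hb⟩ := hM.W_bounded
  have hWneg : ∀ k < 0, u ∉ E.mid.W k := by
    have key : ∀ m : ℕ, a + m < 0 → u ∉ E.mid.W (a + m) := fun m => by
      induction m with
      | zero => intro _ h; rw [Nat.cast_zero, add_zero, ha] at h; exact hu0 h
      | succ m ih =>
        intro hm h
        have h1 : u ∉ E.mid.W (a + (m + 1 : ℕ) - 1) := by
          rw [show a + (m + 1 : ℕ) - 1 = a + m by push_cast; ring]
          exact ih (by push_cast at hm; omega)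
        refine hdisj _ 0 (a + (m + 1 : ℕ)) hm.ne' u h h1 (huF 0 le_rfl) ?_ (huF _ hm.le) ?_
        · rw [hσ]; exact huF _ (by omega)
        · rw [hσ]; exact huF _ (by omega)
    intro k hk h
    rcases le_or_gt k a with h1 | h1
    · have := hM.W_mono h1 h
      rw [ha] at this
      exact hu0 this
    · have h2 := key (k - a).toNat
      rw [show a + ((k - a).toNat : ℤ) = k by omega] at h2
      exact h2 hk h
  have hWn : ∀ k < 0, E.mid.W k = ⊥ := fun k hk => (Submodule.eq_bot_iff _).2 fun x hx =>
    hline _ x hx (hXW k (by omega) x hx) (hWneg k hk)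
  have hWl : ∀ k, 0 ≤ k → k < 2 → E.mid.W k = span ℂ {u} := fun k h0 h2 =>
    le_antisymm (hXW k h2) (span_le.2 (by rintro _ rfl; exact huW k h0))
  have huF1 : ∀ k, 1 ≤ k → u ∉ E.mid.F k := fun k hk h => by
    have h1 := hM.F_anti hk h
    refine hdisj 0 0 1 (by norm_num) u (huW 0 le_rfl) (hWneg _ (by norm_num)) (huF 0 le_rfl) ?_ h1 ?_
    · rw [hσ]; exact huF _ (by omega)
    · rw [hσ]; exact huF _ (by omega)
  have hFh : ∀ k, 2 ≤ k → E.mid.F k = ⊥ := fun k hk => (Submodule.eq_bot_iff _).2 fun x hx =>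
    hline _ x hx (hXF k hk x hx) (huF1 k (by omega))
  have hσ0 : ∀ y, σ y = 0 → y = 0 := fun y hy => by rw [← hσσ y, hy, map_zero]
  have hpieces : ∀ k p, 2 ≤ p ∨ 2 ≤ k - p →
      E.mid.induced k (E.mid.F p) ⊓ E.mid.induced k ((E.mid.F (k - p)).comap σ) = ⊥ := by
    rintro k p (hp | hp)
    · rw [E.mid.induced_eq_bot (S := E.mid.F p), bot_inf_eq]
      intro y _ hy
      rw [hFh p hp] at hy
      rw [(mem_bot ℂ).1 hy]
      exact zero_mem _
    · rw [E.mid.induced_eq_bot (S := (E.mid.F (k - p)).comap σ), inf_bot_eq]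
      intro y _ hy
      rw [mem_comap, hFh _ hp] at hy
      rw [hσ0 y hy]
      exact zero_mem _
  have hWstep : ∀ k, 3 ≤ k → E.mid.W k ≤ E.mid.W (k - 1) := fun k hk x hx => by
    have h1 := (hint k).submodule_iSup_eq_top
    rw [iSup_eq_bot.2 fun p => hpieces k p (by omega)] at h1
    have h2 : (Submodule.Quotient.mk ⟨x, hx⟩ : E.mid.gr k) ∈ (⊥ : Submodule ℂ (E.mid.gr k)) := by
      rw [h1]; trivial
    exact (Submodule.Quotient.mk_eq_zero ((E.mid.W (k - 1)).comap (E.mid.W k).subtype)).1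
      ((mem_bot ℂ).1 h2)
  have hW2 : E.mid.W 2 = ⊤ := by
    have key : ∀ m : ℕ, E.mid.W (2 + m) ≤ E.mid.W 2 := fun m => by
      induction m with
      | zero => simp
      | succ m ih =>
        refine le_trans (hWstep _ (by push_cast; omega)) ?_
        rwa [show (2 : ℤ) + (m + 1 : ℕ) - 1 = 2 + m by push_cast; ring]
    rw [eq_top_iff, ← hb]
    exact (hM.W_mono (by omega : b ≤ 2 + (b.toNat : ℕ))).trans (key _)
  have hF1 : span ℂ {u} ⊔ E.mid.F 1 = ⊤ := by
    refine eq_top_iff.2 fun x _ => ?_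
    have h1 : E.mid.induced 2 (E.mid.F 1) = ⊤ := by
      rw [eq_top_iff, ← (hint 2).submodule_iSup_eq_top]
      refine iSup_le fun p => ?_
      by_cases hp : p = 1
      · subst hp; exact inf_le_left
      · rw [hpieces 2 p (by omega)]; exact bot_le
    have hx2 : x ∈ E.mid.W 2 := by rw [hW2]; trivial
    have h2 : (Submodule.Quotient.mk ⟨x, hx2⟩ : E.mid.gr 2) ∈ E.mid.induced 2 (E.mid.F 1) := by
      rw [h1]; trivial
    obtain ⟨y, _, hy, hxy⟩ := mk_mem_induced.1 h2
    rw [hWl _ (by norm_num) (by norm_num)] at hxy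
    exact mem_sup.2 ⟨_, hxy, y, hy, sub_add_cancel _ _⟩
  refine ⟨hWn, hWl, fun k hk => eq_top_iff.2 (hW2 ▸ hM.W_mono hk), fun k hk => ?_,
    ⟨Submodule.disjoint_def.2 fun x h1 h2 => hline _ x h2 h1 (huF1 1 le_rfl), codisjoint_iff.2 hF1⟩,
    hFh⟩
  rw [eq_top_iff, ← hF1]
  refine sup_le (span_le.2 (by rintro _ rfl; exact huF k hk)) (hM.F_anti (by omega))

end Extension

/-! ### Carlson's classification -/

lemma bc_of_inverse {B D : Type*} [AddCommGroup B] [AddCommGroup D] [Module ℂ D]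
    {c : B →ₗ[ℤ] D} (g : D ⊸ ℂ ⊗[ℤ] B) (h1 : ∀ v, g (c v) = 1 ⊗ₜ v)
    (h2 : ∀ x, x ∈ span ℂ (Set.range c)) : IsBaseChange ℂ c := by
  let f : ℂ ⊗[ℤ] B ⊸ D := (TensorProduct.isBaseChange ℤ B ℂ).lift c
  have hf : ∀ v, f (1 ⊗ₜ v) = c v := fun v => (TensorProduct.isBaseChange ℤ B ℂ).lift_eq c v
  refine IsBaseChange.of_equiv (LinearEquiv.ofLinear f g (LinearMap.ext fun x => ?_)
    ((TensorProduct.isBaseChange ℤ B ℂ).algHom_ext _ _ fun v => ?_)) hf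
  · rw [comp_apply, id_apply]
    induction h2 x using Submodule.span_induction with
    | mem x hx => obtain ⟨v, rfl⟩ := hx; rw [h1, hf]
    | zero => rw [map_zero, map_zero]
    | add x y _ _ hx hy => rw [map_add, map_add, hx, hy]
    | smul a x _ hx => rw [map_smul, map_smul, hx]
  · exact (congrArg g (hf v)).trans (h1 v)

lemma tate_span {M : Type} [AddCommGroup M] (j : ℤ) (x : (tate M j).dR) :
    x ∈ span ℂ (Set.range (tate M j).c) := by
  have h : (span ℂ (Set.range (tate M j).c)).mkQ = 0 := tate_ext fun m => by
    rw [LinearMap.zero_apply, Submodule.mkQ_apply, Submodule.Quotient.mk_eq_zero]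
    exact subset_span ⟨m, rfl⟩
  exact (Submodule.Quotient.mk_eq_zero _).1 (LinearMap.congr_fun h x)

lemma ue_c (a : ℤ) : ℮ (⊡.c a) = a := by
  rw [unitHodge_c]
  exact (TensorProduct.rid_tmul (R := ℤ) (1 : ℂ) a).trans (zsmul_one a)

lemma ue_smul (b : ℂ) (y : ⊡.dR) :
    ℮ (b • y) = b * ℮ y := by
  have h : ∀ y : ℂ ⊗[ℤ] ℤ, TensorProduct.rid ℤ ℂ (b • y) = b * TensorProduct.rid ℤ ℂ y := fun y => by
    induction y with
    | zero => simp
    | add x y hx hy => simp only [smul_add, map_add, hx, hy, mul_add]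
    | tmul z a => simp [smul_tmul', mul_left_comm]
  exact h y

lemma ue_smul_c (b : ℂ) : ℮ (b • ⊡.c (1 : ℤ)) = b := by
  rw [ue_smul, ue_c, Int.cast_one, mul_one]

lemma unitHodge_eq_smul (y : ⊡.dR) : y = ℮ y • ⊡.c (1 : ℤ) :=
  (℮).injective (ue_smul_c _).symm

lemma unitHodge_ext {W : Type*} [AddCommGroup W] [Module ℂ W] {f g : ⊡.dR ⊸ W}
    (h : ∀ a, f (⊡.c a) = g (⊡.c a)) : f = g := LinearMap.ext fun y => by
  rw [unitHodge_eq_smul y, map_smul, map_smul]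
  exact congrArg _ (h (1 : ℤ))

namespace Extension

variable {M : Type} [AddCommGroup M] [Module.Free ℤ M]

lemma ex_smul_gen (E : Extension (Θ M) ⊡) (x : E.mid.dR)
    (h : E.p.onDR x = 0) : ∃ a : ℂ, x = a • E.mid.c E.gen := by
  obtain ⟨a, ha⟩ := mem_span_singleton.1 (E.mem_span_gen h)
  exact ⟨a, ha.symm⟩

lemma Congr.of_hom {E E' : Extension (Θ M) ⊡} (f : Hom E.mid E'.mid)
    (hi : f.onB E.gen = E'.gen) (hp : ∀ v, E'.p.onB (f.onB v) = E.p.onB v) : E.Congr E' := by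
  have hE := E.isFrame
  have hE' := E'.isFrame
  obtain ⟨rB, R, S, hg, hR, hS, hdec⟩ := E.ex_split_dR
  have hfi' : ∀ y : ℤ, f.onB (E.i.onB y) = E'.i.onB y := fun y =>
    ((congrArg f.onB (E.i_onB y)).trans (map_zsmul f.onB y E.gen)).trans
      ((congrArg (y • ·) hi).trans (E'.i_onB y).symm)
  have hfi : ∀ y, f.onB (E.i.onB y) = E'.i.onB y := hfi'
  have hu : f.onDR (E.mid.c E.gen) = E'.mid.c E'.gen := by rw [f.comm, hi]
  have hpd : ∀ x, E'.p.onDR (f.onDR x) = E.p.onDR x := fun x => by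
    refine LinearMap.congr_fun (f := E'.p.onDR ∘ₗ f.onDR) (g := E.p.onDR)
      (E.isMixedHodge.baseChange.algHom_ext _ _ fun v => ?_) x
    rw [comp_apply, f.comm, E'.p.comm, hp, E.p.comm]
  have hB : Function.Bijective f.onB := by
    refine ⟨(injective_iff_map_eq_zero _).2 fun v hv => ?_, fun w => ?_⟩
    · obtain ⟨y, rfl⟩ := (E.exact v).1 (by rw [← hp, hv, map_zero])
      rw [hfi] at hv
      rw [E'.inj (hv.trans (map_zero _).symm), map_zero]
    · obtain ⟨v, hv⟩ := E.surj (E'.p.onB w)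
      obtain ⟨y, hy⟩ := (E'.exact (w - f.onB v)).1 (by rw [map_sub, hp, hv, sub_self])
      exact ⟨v + E.i.onB y, by rw [map_add, hfi, hy, add_sub_cancel]⟩
  have hD : Function.Bijective f.onDR := by
    refine ⟨(injective_iff_map_eq_zero _).2 fun x hx => ?_, fun z => ?_⟩
    · obtain ⟨a, rfl⟩ := E.ex_smul_gen x (by rw [← hpd, hx, map_zero])
      rw [map_smul, hu] at hx
      rw [(smul_eq_zero.1 hx).resolve_right E'.c_gen_ne_zero, zero_smul]
    · obtain ⟨a, ha⟩ := E'.ex_smul_gen (z - f.onDR (S (E'.p.onDR z)))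
        (by rw [map_sub, hpd, hS, sub_self])
      exact ⟨S (E'.p.onDR z) + a • E.mid.c E.gen, by rw [map_add, map_smul, hu, ← ha, add_sub_cancel]⟩
  let eB := LinearEquiv.ofBijective f.onB hB
  let eD := LinearEquiv.ofBijective f.onDR hD
  have hB1 : ∀ v, eB.symm (f.onB v) = v := eB.symm_apply_apply
  have hB2 : ∀ v, f.onB (eB.symm v) = v := eB.apply_symm_apply
  have hD1 : ∀ v, eD.symm (f.onDR v) = v := eD.symm_apply_apply
  have hD2 : ∀ v, f.onDR (eD.symm v) = v := eD.apply_symm_apply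
  refine ⟨f, ⟨eB.symm.toLinearMap, eD.symm.toLinearMap, fun w => ?_, fun k z hz => ?_,
    fun k z hz => ?_⟩, hB1, hB2, hD1, hD2, hfi, hp⟩
  · refine hD.1 ?_
    change f.onDR (eD.symm (E'.mid.c w)) = f.onDR (E.mid.c (eB.symm w))
    rw [hD2, f.comm, hB2]
  · change eD.symm z ∈ E.mid.F k
    rcases le_or_gt k 0 with hk | hk
    · rw [hE.F_nonpos k hk]; trivial
    rcases le_or_gt 2 k with hk2 | hk2
    · rw [hE'.F_high k hk2] at hz
      rw [(mem_bot ℂ).1 hz, map_zero]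
      exact zero_mem _
    obtain rfl : k = 1 := by omega
    obtain ⟨y, hy, x, hx, hyx⟩ := mem_sup.1
      (hE.compl.sup_eq_top.symm ▸ mem_top : eD.symm z ∈ _)
    obtain ⟨a, rfl⟩ := mem_span_singleton.1 hy
    have h1 : z = a • E'.mid.c E'.gen + f.onDR x := by
      rw [← hD2 z, ← hyx, map_add, map_smul, hu]
    have h2 : a • E'.mid.c E'.gen ∈ E'.mid.F 1 := by
      rw [← sub_eq_iff_eq_add] at h1
      rw [← h1]
      exact Submodule.sub_mem _ hz (f.map_F 1 x hx)
    have h3 := Submodule.disjoint_def.1 hE'.compl.disjoint _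
      (smul_mem _ a (mem_span_singleton_self _)) h2
    rw [← hyx, (smul_eq_zero.1 h3).resolve_right E'.c_gen_ne_zero, zero_smul, zero_add]
    exact hx
  · change eD.symm z ∈ E.mid.W k
    rcases lt_or_ge k 0 with hk | hk
    · rw [hE'.W_neg k hk] at hz
      rw [(mem_bot ℂ).1 hz, map_zero]
      exact zero_mem _
    rcases le_or_gt 2 k with hk2 | hk2
    · rw [hE.W_high k hk2]; trivial
    rw [hE'.W_low k hk hk2] at hz
    obtain ⟨a, rfl⟩ := mem_span_singleton.1 hz
    rw [hE.W_low k hk hk2, ← hu, ← map_smul, hD1]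
    exact smul_mem _ _ (mem_span_singleton_self _)

/-- The middle term of the extension with Carlson datum `ψ`. -/
def mMid (ψ : (Θ M).dR ⊸ ⊡.dR) : HodgeData where
  dR := ⊡.dR × (Θ M).dR
  B := ⊡.B × (Θ M).B
  c := ⊡.c.prodMap (Θ M).c
  F k := if k ≤ 0 then ⊤ else if k < 2 then LinearMap.range (ψ.prod LinearMap.id) else ⊥
  W k := if k < 0 then ⊥ else if k < 2 then
    LinearMap.range (LinearMap.inl ℂ ⊡.dR (Θ M).dR) else ⊤

variable (ψ : (Θ M).dR ⊸ ⊡.dR)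

def mInl : ⊡.dR ⊸ (mMid ψ).dR := LinearMap.inl ℂ ⊡.dR (Θ M).dR

def mInr : (Θ M).dR ⊸ (mMid ψ).dR := LinearMap.inr ℂ ⊡.dR (Θ M).dR

def mFst : (mMid ψ).dR ⊸ ⊡.dR := LinearMap.fst ℂ ⊡.dR (Θ M).dR

def mSnd : (mMid ψ).dR ⊸ (Θ M).dR := LinearMap.snd ℂ ⊡.dR (Θ M).dR

def mInlB : ⊡.B →ₗ[ℤ] (mMid ψ).B := LinearMap.inl ℤ ⊡.B (Θ M).B

def mInrB : (Θ M).B →ₗ[ℤ] (mMid ψ).B := LinearMap.inr ℤ ⊡.B (Θ M).B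

def mFstB : (mMid ψ).B →ₗ[ℤ] ⊡.B := LinearMap.fst ℤ ⊡.B (Θ M).B

def mSndB : (mMid ψ).B →ₗ[ℤ] (Θ M).B := LinearMap.snd ℤ ⊡.B (Θ M).B

lemma mFst_inl (y : ⊡.dR) : mFst ψ (mInl ψ y) = y := rfl
lemma mSnd_inl (y : ⊡.dR) : mSnd ψ (mInl ψ y) = 0 := rfl
lemma mFst_inr (x : (Θ M).dR) : mFst ψ (mInr ψ x) = 0 := rfl
lemma mSnd_inr (x : (Θ M).dR) : mSnd ψ (mInr ψ x) = x := rfl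
lemma mFst_c (v : (mMid ψ).B) :
    mFst ψ ((mMid ψ).c v) = ⊡.c (mFstB ψ v) := rfl
lemma mSnd_c (v : (mMid ψ).B) :
    mSnd ψ ((mMid ψ).c v) = (Θ M).c (mSndB ψ v) := rfl

lemma model_ext {z w : (mMid ψ).dR} (h1 : mFst ψ z = mFst ψ w)
    (h2 : mSnd ψ z = mSnd ψ w) : z = w := Prod.ext h1 h2

lemma model_ext_B {z w : (mMid ψ).B} (h1 : mFstB ψ z = mFstB ψ w)
    (h2 : mSndB ψ z = mSndB ψ w) : z = w := Prod.ext h1 h2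

lemma mInl_c (a : ⊡.B) : mInl ψ (⊡.c a) = (mMid ψ).c (mInlB ψ a) :=
  model_ext ψ rfl (map_zero (Θ M).c).symm

lemma mInr_c (m : (Θ M).B) :
    mInr ψ ((Θ M).c m) = (mMid ψ).c (mInrB ψ m) :=
  model_ext ψ (map_zero ⊡.c).symm rfl

lemma model_decomp (z : (mMid ψ).dR) :
    z = mInl ψ (mFst ψ z) + mInr ψ (mSnd ψ z) := by
  refine model_ext ψ ?_ ?_
  · rw [map_add, mFst_inl, mFst_inr, add_zero]
  · rw [map_add, mSnd_inl, mSnd_inr, zero_add]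

lemma model_decomp_B (z : (mMid ψ).B) :
    z = mInlB ψ (mFstB ψ z) + mInrB ψ (mSndB ψ z) :=
  Prod.ext (add_zero z.1).symm (zero_add z.2).symm

lemma mMid_W_low {k : ℤ} (h0 : 0 ≤ k) (h2 : k < 2) :
    (mMid ψ).W k = LinearMap.range (mInl ψ) :=
  (if_neg (by omega)).trans (if_pos h2)

lemma mMid_F_mid {k : ℤ} (h0 : 0 < k) (h2 : k < 2) :
    (mMid ψ).F k = LinearMap.range (mInl ψ ∘ₗ ψ + mInr ψ) := by
  have h : (mMid ψ).F k = LinearMap.range (ψ.prod LinearMap.id) :=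
    (if_neg (by omega)).trans (if_pos h2)
  refine h.trans (congrArg LinearMap.range ?_)
  refine LinearMap.ext fun x => model_ext ψ ?_ ?_
  · exact (add_zero (ψ x)).symm
  · exact (zero_add x).symm

lemma mMid_F_one : (mMid ψ).F 1 = LinearMap.range (mInl ψ ∘ₗ ψ + mInr ψ) :=
  mMid_F_mid ψ zero_lt_one one_lt_two

lemma mem_mMid_F {z : (mMid ψ).dR} :
    z ∈ (mMid ψ).F 1 ↔ mFst ψ z = ψ (mSnd ψ z) := by
  rw [mMid_F_one]
  constructor
  · rintro ⟨x, rfl⟩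
    rw [LinearMap.add_apply, comp_apply, map_add, map_add, mFst_inl, mFst_inr,
      mSnd_inl, mSnd_inr, add_zero, zero_add]
  · intro h
    exact ⟨mSnd ψ z, by rw [LinearMap.add_apply, comp_apply, ← h, ← model_decomp]⟩

lemma mMid_isFrame :
    (mMid ψ).IsFrame ((mMid ψ).c (mInlB ψ (1 : ℤ))) := by
  rw [show (mMid ψ).c (mInlB ψ (1 : ℤ)) = mInl ψ (⊡.c (1 : ℤ)) from
    (mInl_c ψ (1 : ℤ)).symm]
  have hW : LinearMap.range (mInl ψ) = span ℂ {mInl ψ (⊡.c (1 : ℤ))} := by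
    refine le_antisymm ?_ (span_le.2 ?_)
    · rintro _ ⟨y, rfl⟩
      refine mem_span_singleton.2 ⟨℮ y, ?_⟩
      rw [← map_smul, ← unitHodge_eq_smul]
    · rintro _ rfl
      exact ⟨_, rfl⟩
  refine ⟨fun k hk => if_pos hk, fun k h0 h2 => (mMid_W_low ψ h0 h2).trans hW, fun k hk => ?_,
    fun k hk => if_pos hk, ?_, fun k hk => ?_⟩
  · exact (if_neg (by omega)).trans (if_neg (by omega))
  · rw [← hW]
    refine ⟨Submodule.disjoint_def.2 ?_, codisjoint_iff.2 (eq_top_iff.2 fun z _ => ?_)⟩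
    · rintro _ ⟨y, rfl⟩ h
      rw [mem_mMid_F, mFst_inl, mSnd_inl, map_zero] at h
      rw [h, map_zero]
    · refine mem_sup.2 ⟨mInl ψ (mFst ψ z - ψ (mSnd ψ z)), ⟨_, rfl⟩,
        mInl ψ (ψ (mSnd ψ z)) + mInr ψ (mSnd ψ z), ?_, ?_⟩
      · rw [mMid_F_one]
        exact ⟨mSnd ψ z, rfl⟩
      · rw [← add_assoc, ← map_add, sub_add_cancel, ← model_decomp]
  · exact (if_neg (by omega)).trans (if_neg (by omega))

lemma mMid_bc : IsBaseChange ℂ (mMid ψ).c := by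
  let g₁ : ⊡.dR ⊸ ℂ ⊗[ℤ] (mMid ψ).B :=
    tateLift (j := 0) (TensorProduct.mk ℤ ℂ (mMid ψ).B 1 ∘ₗ mInlB ψ)
  let g₂ : (Θ M).dR ⊸ ℂ ⊗[ℤ] (mMid ψ).B :=
    tateLift (j := 1) (TensorProduct.mk ℤ ℂ (mMid ψ).B 1 ∘ₗ mInrB ψ)
  refine bc_of_inverse (g₁ ∘ₗ mFst ψ + g₂ ∘ₗ mSnd ψ) (fun v => ?_) fun x => ?_
  · have e1 : g₁ (⊡.c (mFstB ψ v)) = 1 ⊗ₜ mInlB ψ (mFstB ψ v) := tateLift_c _ _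
    have e2 : g₂ ((Θ M).c (mSndB ψ v)) = 1 ⊗ₜ mInrB ψ (mSndB ψ v) :=
      tateLift_c _ _
    rw [LinearMap.add_apply, comp_apply, comp_apply, mFst_c, mSnd_c, e1,
      e2, ← TensorProduct.tmul_add, ← model_decomp_B]
  · have h1 : span ℂ (Set.range ⊡.c) ≤
        (span ℂ (Set.range (mMid ψ).c)).comap (mInl ψ) := by
      rw [span_le]
      rintro _ ⟨a, rfl⟩
      exact subset_span ⟨mInlB ψ a, (mInl_c ψ a).symm⟩
    have h2 : span ℂ (Set.range (Θ M).c) ≤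
        (span ℂ (Set.range (mMid ψ).c)).comap (mInr ψ) := by
      rw [span_le]
      rintro _ ⟨a, rfl⟩
      exact subset_span ⟨mInrB ψ a, (mInr_c ψ a).symm⟩
    rw [model_decomp ψ x]
    exact add_mem (h1 (tate_span 0 _)) (h2 (tate_span 1 _))

variable [Module.Finite ℤ M]

lemma mMid_isMHS : (mMid ψ).IsMixedHodge := by
  refine (mMid_isFrame ψ).isMixedHodge ?_ (mMid_bc ψ)
  change Module.Finite ℤ (ℤ × M)
  infer_instance

def model : Extension (Θ M) ⊡ where
  mid := mMid ψ
  isMixedHodge := mMid_isMHS ψ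
  i :=
    { onB := mInlB ψ
      onDR := mInl ψ
      comm := mInl_c ψ
      map_F := fun k x hx => by
        rcases le_or_gt k 0 with hk | hk
        · rw [(mMid_isFrame ψ).F_nonpos k hk]; trivial
        · rw [show ⊡.F k = ⊥ from if_neg (by omega)] at hx
          rw [(mem_bot ℂ).1 hx, map_zero]
          exact zero_mem _
      map_W := fun k x hx => by
        rcases lt_or_ge k 0 with hk | hk
        · rw [show ⊡.W k = ⊥ from if_neg (by omega)] at hx
          rw [(mem_bot ℂ).1 hx, map_zero]
          exact zero_mem _
        · refine (mMid_isMHS ψ).W_mono hk ?_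
          rw [mMid_W_low ψ le_rfl (by norm_num)]
          exact ⟨x, rfl⟩ }
  p :=
    { onB := mSndB ψ
      onDR := mSnd ψ
      comm := mSnd_c ψ
      map_F := fun k x hx => by
        rcases le_or_gt 2 k with hk | hk
        · rw [(mMid_isFrame ψ).F_high k hk] at hx
          rw [(mem_bot ℂ).1 hx, map_zero]
          exact zero_mem _
        · rw [show (Θ M).F k = ⊤ from if_pos (by omega)]; trivial
      map_W := fun k x hx => by
        rcases le_or_gt 2 k with hk | hk
        · rw [show (Θ M).W k = ⊤ from if_pos (by omega)]; trivial
        · have h1 := (mMid_isMHS ψ).W_mono (show k ≤ 1 by omega) hx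
          rw [mMid_W_low ψ zero_le_one (by norm_num)] at h1
          obtain ⟨a, rfl⟩ := h1
          rw [mSnd_inl]
          exact zero_mem _ }
  inj := LinearMap.inl_injective (R := ℤ) (M := ⊡.B) (M₂ := (Θ M).B)
  surj := LinearMap.snd_surjective (R := ℤ) (M := ⊡.B) (M₂ := (Θ M).B)
  exact := Function.Exact.inl_snd (R := ℤ) (M := ⊡.B) (N := (Θ M).B)

end Extension

lemma tate_F_of_le {M : Type} [AddCommGroup M] {j k : ℤ} (h : k ≤ j) : (tate M j).F k = ⊤ :=
  if_pos h

namespace Extension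

variable {M : Type} [AddCommGroup M]

lemma retraction_W [Module.Free ℤ M] (E : Extension (Θ M) ⊡)
    (r : E.mid.dR ⊸ ⊡.dR) (k : ℤ) (x : E.mid.dR) (hx : x ∈ E.mid.W k) :
    r x ∈ ⊡.W k := by
  rcases lt_or_ge k 0 with hk | hk
  · rw [E.isFrame.W_neg k hk] at hx
    rw [(mem_bot ℂ).1 hx, map_zero]
    exact zero_mem _
  · rw [show ⊡.W k = ⊤ from if_pos (by omega)]; trivial

lemma section_W [Module.Free ℤ M] (E : Extension (Θ M) ⊡)
    (s : (Θ M).dR ⊸ E.mid.dR) (k : ℤ) (x : (Θ M).dR) (hx : x ∈ (Θ M).W k) :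
    s x ∈ E.mid.W k := by
  rcases lt_or_ge k 2 with hk | hk
  · rw [show (Θ M).W k = ⊥ from if_neg (by omega)] at hx
    rw [(mem_bot ℂ).1 hx, map_zero]
    exact zero_mem _
  · rw [E.isFrame.W_high k hk]; trivial

lemma section_F [Module.Free ℤ M] (E : Extension (Θ M) ⊡)
    (s : (Θ M).dR ⊸ E.mid.dR) (h : ∀ x, s x ∈ E.mid.F 1) (k : ℤ) (x : (Θ M).dR)
    (hx : x ∈ (Θ M).F k) : s x ∈ E.mid.F k := by
  rcases lt_or_ge k 2 with hk | hk
  · exact E.isMixedHodge.F_anti (by omega) (h x)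
  · rw [show (Θ M).F k = ⊥ from if_neg (by omega)] at hx
    rw [(mem_bot ℂ).1 hx, map_zero]
    exact zero_mem _

/-- The extension `E` has an integral section and a Hodge section, which differ by `ψ`. -/
def HasSec (E : Extension (Θ M) ⊡) (ψ : (Θ M).dR ⊸ ⊡.dR) :
    Prop :=
  ∃ (sB : (Θ M).B →ₗ[ℤ] E.mid.B) (s : (Θ M).dR ⊸ E.mid.dR),
    (∀ m, E.p.onB (sB m) = m) ∧ (∀ x, s x ∈ E.mid.F 1) ∧
    ∀ m, s ((Θ M).c m) = E.mid.c (sB m) + E.i.onDR (ψ ((Θ M).c m))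

lemma exists_i_onDR [Module.Free ℤ M] (E : Extension (Θ M) ⊡) {x : E.mid.dR}
    (h : E.p.onDR x = 0) : ∃ y, x = E.i.onDR y := by
  obtain ⟨a, rfl⟩ := E.ex_smul_gen x h
  exact ⟨a • ⊡.c (1 : ℤ), by rw [map_smul, E.i_onDR]⟩

lemma HasCarlson.hasSections [Module.Free ℤ M] {E : Extension (Θ M) ⊡}
    {ψ : (Θ M).dR ⊸ ⊡.dR} (h : E.HasCarlson ψ) : E.HasSec ψ := by
  obtain ⟨rB, r, s, hrB, hr, _, hs, hF, _, rfl⟩ := h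
  obtain ⟨_, sB, _, hsB, _⟩ := E.ex_split
  have hri : ∀ y, r (E.i.onDR y) = y := fun y => by
    refine LinearMap.congr_fun (f := r ∘ₗ E.i.onDR) (g := LinearMap.id) (unitHodge_ext fun a => ?_) y
    rw [comp_apply, E.i.comm, hr, hrB, id_apply]
  have hpi : ∀ y, E.p.onB (E.i.onB y) = 0 := E.exact.apply_apply_eq_zero
  refine ⟨sB - E.i.onB ∘ₗ rB ∘ₗ sB, s, fun m => ?_, fun x => hF 1 x ?_, fun m => ?_⟩
  · rw [LinearMap.sub_apply, comp_apply, map_sub, hpi, hsB, sub_zero]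
  · rw [tate_F_of_le le_rfl]; trivial
  · obtain ⟨y, hy⟩ := E.exists_i_onDR (x := s ((Θ M).c m) -
      E.mid.c ((sB - E.i.onB ∘ₗ rB ∘ₗ sB) m)) (by
        rw [map_sub, hs, E.p.comm, LinearMap.sub_apply, comp_apply, map_sub, hpi, hsB,
          sub_zero, sub_self])
    have h1 := congrArg r hy
    rw [map_sub, hr, LinearMap.sub_apply, comp_apply, map_sub, comp_apply, hrB,
      sub_self, map_zero, sub_zero, hri] at h1
    rw [comp_apply, h1, ← hy, add_sub_cancel]

lemma ex_hasSec [Module.Free ℤ M] (E : Extension (Θ M) ⊡) :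
    ∃ ψ, E.HasSec ψ := by
  obtain ⟨_, sB, _, hsB, _⟩ := E.ex_split
  obtain ⟨_, R, S', _, _, _, hdec⟩ := E.ex_split_dR
  let S : (Θ M).dR ⊸ E.mid.dR := tateLift (E.mid.c ∘ₗ sB)
  have hS : ∀ m, S ((Θ M).c m) = E.mid.c (sB m) := fun m => tateLift_c _ m
  let P := (E.mid.F 1).projectionOnto _ E.isFrame.compl.symm
  let s : (Θ M).dR ⊸ E.mid.dR := (E.mid.F 1).subtype ∘ₗ P ∘ₗ S
  have hs : ∀ x, s x ∈ E.mid.F 1 := fun x => (P (S x)).2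
  have hsS : ∀ x, s x - S x ∈ span ℂ {E.mid.c E.gen} := fun x => by
    refine (Submodule.projectionOnto_apply_eq_zero_iff E.isFrame.compl.symm).1 ?_
    rw [map_sub]
    exact sub_eq_zero.2 (Submodule.projectionOnto_apply_left E.isFrame.compl.symm (P (S x)))
  clear_value s S
  refine ⟨toSpanSingleton ℂ ⊡.dR (⊡.c (1 : ℤ)) ∘ₗ R ∘ₗ (s - S), sB, s, hsB,
    hs, fun m => ?_⟩
  have e : ∀ x, E.i.onDR ((toSpanSingleton ℂ ⊡.dR (⊡.c (1 : ℤ)) ∘ₗ R ∘ₗ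
      (s - S)) x) = R (s x - S x) • E.mid.c E.gen := fun x => by
    rw [← E.i_onDR, ← map_smul]
    rfl
  rw [e, ← hS]
  obtain ⟨a, ha⟩ := mem_span_singleton.1 (hsS ((Θ M).c m))
  have h1 := hdec (s ((Θ M).c m) - S ((Θ M).c m))
  rw [show E.p.onDR (s ((Θ M).c m) - S ((Θ M).c m)) = 0 by
    rw [← ha, map_smul, E.p_c_gen, smul_zero], map_zero, add_zero] at h1
  rw [← h1, add_sub_cancel]

variable [Module.Free ℤ M] [Module.Finite ℤ M]

lemma HasSec.congr {E : Extension (Θ M) ⊡}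
    {ψ : (Θ M).dR ⊸ ⊡.dR} (h : E.HasSec ψ) : (model ψ).Congr E := by
  obtain ⟨sB, s, h1, h2, h3⟩ := h
  have hE := E.isFrame
  have hf := mMid_isFrame ψ
  refine Congr.of_hom (E := model ψ) ⟨E.i.onB ∘ₗ mFstB ψ + sB ∘ₗ mSndB ψ,
    E.i.onDR ∘ₗ (mFst ψ - ψ ∘ₗ mSnd ψ) + s ∘ₗ mSnd ψ, fun v => ?_, fun k z hz => ?_,
    fun k z hz => ?_⟩ ?_ fun v => ?_
  · have e : mSnd ψ ((mMid ψ).c v) = (Θ M).c (mSndB ψ v) := rfl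
    have e' : mFst ψ ((mMid ψ).c v) = ⊡.c (mFstB ψ v) := rfl
    change E.i.onDR (mFst ψ ((mMid ψ).c v) - ψ (mSnd ψ ((mMid ψ).c v))) +
      s (mSnd ψ ((mMid ψ).c v)) = E.mid.c (E.i.onB (mFstB ψ v) + sB (mSndB ψ v))
    rw [e, e', h3, map_sub, map_add, E.i.comm]
    abel
  · change E.i.onDR (mFst ψ z - ψ (mSnd ψ z)) + s (mSnd ψ z) ∈ E.mid.F k
    rcases le_or_gt k 0 with hk | hk
    · rw [hE.F_nonpos k hk]; trivial
    rcases le_or_gt 2 k with hk2 | hk2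
    · rw [show (model ψ).mid.F k = ⊥ from hf.F_high k hk2] at hz
      have hz0 : z = (0 : (mMid ψ).dR) := hz
      rw [hz0, map_zero (mFst ψ), map_zero (mSnd ψ), map_zero, sub_zero, map_zero, map_zero,
        add_zero]
      exact zero_mem _
    obtain rfl : k = 1 := by omega
    rw [(mem_mMid_F ψ).1 hz, sub_self, map_zero, zero_add]
    exact h2 _
  · change E.i.onDR (mFst ψ z - ψ (mSnd ψ z)) + s (mSnd ψ z) ∈ E.mid.W k
    rcases le_or_gt 2 k with hk2 | hk2
    · rw [hE.W_high k hk2]; trivial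
    rcases lt_or_ge k 0 with hk | hk
    · rw [show (model ψ).mid.W k = ⊥ from hf.W_neg k hk] at hz
      have hz0 : z = (0 : (mMid ψ).dR) := hz
      rw [hz0, map_zero (mFst ψ), map_zero (mSnd ψ), map_zero, sub_zero, map_zero, map_zero,
        add_zero]
      exact zero_mem _
    rw [show (model ψ).mid.W k = _ from mMid_W_low ψ hk hk2] at hz
    obtain ⟨y, rfl⟩ := hz
    rw [mFst_inl, mSnd_inl, map_zero, sub_zero, map_zero, add_zero]
    refine E.i.map_W k y ?_
    rw [show ⊡.W k = ⊤ from if_pos (by omega)]; trivial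
  · have e : mSndB ψ (mInlB ψ (1 : ℤ)) = 0 := rfl
    change E.i.onB (1 : ℤ) + sB (mSndB ψ (mInlB ψ (1 : ℤ))) = _
    exact (congrArg (E.i.onB (1 : ℤ) + ·) ((congrArg sB e).trans (map_zero sB))).trans (add_zero _)
  · change E.p.onB (E.i.onB (mFstB ψ v) + sB (mSndB ψ v)) = mSndB ψ v
    rw [map_add, h1, E.exact.apply_apply_eq_zero, zero_add]

lemma HasSec.baerSum {E₁ E₂ E₃ : Extension (Θ M) ⊡}
    {ψ₁ ψ₂ : (Θ M).dR ⊸ ⊡.dR} (h₁ : E₁.HasSec ψ₁) (h₂ : E₂.HasSec ψ₂)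
    (h : IsBaerSum E₁ E₂ E₃) : E₃.HasSec (ψ₁ + ψ₂) := by
  obtain ⟨s₁, t₁, a₁, b₁, c₁⟩ := h₁
  obtain ⟨s₂, t₂, a₂, b₂, c₂⟩ := h₂
  obtain ⟨φ, hp, hi⟩ := h
  have hpi₁ : ∀ y, E₁.p.onB (E₁.i.onB y) = 0 := E₁.exact.apply_apply_eq_zero
  have hpi₂ : ∀ y, E₂.p.onB (E₂.i.onB y) = 0 := E₂.exact.apply_apply_eq_zero
  have pi : ∀ (E : Extension (Θ M) ⊡) y, E.p.onDR (E.i.onDR y) = 0 := fun E y => by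
    refine LinearMap.congr_fun (f := E.p.onDR ∘ₗ E.i.onDR) (g := 0) (unitHodge_ext fun a => ?_) y
    rw [comp_apply, E.i.comm, E.p.comm, E.exact.apply_apply_eq_zero, map_zero,
      LinearMap.zero_apply]
  have pt : ∀ (E : Extension (Θ M) ⊡) (t : (Θ M).dR ⊸ E.mid.dR)
      (s : (Θ M).B →ₗ[ℤ] E.mid.B) (ψ : (Θ M).dR ⊸ ⊡.dR),
      (∀ m, E.p.onB (s m) = m) →
      (∀ m, t ((Θ M).c m) = E.mid.c (s m) + E.i.onDR (ψ ((Θ M).c m))) →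
      ∀ x, E.p.onDR (t x) = x := fun E t s ψ hs ht x => by
    refine LinearMap.congr_fun (f := E.p.onDR ∘ₗ t) (g := LinearMap.id) (tate_ext fun m => ?_) x
    rw [comp_apply, ht, map_add, E.p.comm, hs, pi, add_zero, id_apply]
  have pt₁ := pt E₁ t₁ s₁ ψ₁ a₁ c₁
  have pt₂ := pt E₂ t₂ s₂ ψ₂ a₂ c₂
  let sB : (Θ M).B →ₗ[ℤ] (fibreProduct E₁ E₂).B := LinearMap.codRestrict _ (s₁.prod s₂)
    fun m => (a₁ m).trans (a₂ m).symm
  let s : (Θ M).dR ⊸ (fibreProduct E₁ E₂).dR := LinearMap.codRestrict _ (t₁.prod t₂)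
    fun x => (pt₁ x).trans (pt₂ x).symm
  let j₁ : ⊡.dR ⊸ (fibreProduct E₁ E₂).dR := LinearMap.codRestrict _ (E₁.i.onDR.prod 0)
    fun y => (pi E₁ y).trans (map_zero E₂.p.onDR).symm
  let j₂ : ⊡.dR ⊸ (fibreProduct E₁ E₂).dR :=
    LinearMap.codRestrict _ ((0 : ⊡.dR ⊸ E₁.mid.dR).prod E₂.i.onDR)
    fun y => (map_zero E₁.p.onDR).trans (pi E₂ y).symm
  have hj₁ : ∀ y, φ.onDR (j₁ y) = E₃.i.onDR y := fun y => by
    refine LinearMap.congr_fun (f := φ.onDR ∘ₗ j₁) (unitHodge_ext fun a => ?_) y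
    let v : (fibreProduct E₁ E₂).B := ⟨(E₁.i.onB a, E₂.i.onB 0),
      (hpi₁ _).trans (hpi₂ _).symm⟩
    have e : j₁ (⊡.c a) = (fibreProduct E₁ E₂).c v := Subtype.ext (Prod.ext
      (E₁.i.comm _) ((congrArg E₂.mid.c (map_zero E₂.i.onB)).trans (map_zero E₂.mid.c)).symm)
    rw [comp_apply, e, φ.comm, hi _ _ v rfl, add_zero, E₃.i.comm]
  have hj₂ : ∀ y, φ.onDR (j₂ y) = E₃.i.onDR y := fun y => by
    refine LinearMap.congr_fun (f := φ.onDR ∘ₗ j₂) (unitHodge_ext fun a => ?_) y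
    let v : (fibreProduct E₁ E₂).B := ⟨(E₁.i.onB 0, E₂.i.onB a),
      (hpi₁ _).trans (hpi₂ _).symm⟩
    have e : j₂ (⊡.c a) = (fibreProduct E₁ E₂).c v := Subtype.ext (Prod.ext
      ((congrArg E₁.mid.c (map_zero E₁.i.onB)).trans (map_zero E₁.mid.c)).symm (E₂.i.comm _))
    rw [comp_apply, e, φ.comm, hi _ _ v rfl, zero_add, E₃.i.comm]
  refine ⟨φ.onB ∘ₗ sB, φ.onDR ∘ₗ s, fun m => ?_, fun x => φ.map_F 1 _ ⟨b₁ x, b₂ x⟩, fun m => ?_⟩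
  · rw [comp_apply, hp]
    exact a₁ m
  · have e : s ((Θ M).c m) = (fibreProduct E₁ E₂).c (sB m) +
        (j₁ (ψ₁ ((Θ M).c m)) + j₂ (ψ₂ ((Θ M).c m))) := by
      refine Subtype.ext (Prod.ext ?_ ?_)
      · exact (c₁ m).trans (congrArg (E₁.mid.c (s₁ m) + ·) (add_zero _).symm)
      · exact (c₂ m).trans (congrArg (E₂.mid.c (s₂ m) + ·) (zero_add _).symm)
    rw [comp_apply, e, map_add, map_add, hj₁, hj₂, φ.comm, LinearMap.add_apply, map_add,
      comp_apply]

lemma model_hasCarlson (ψ : (Θ M).dR ⊸ ⊡.dR) : (model ψ).HasCarlson ψ := by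
  have hp : ∀ x, mSnd ψ ((mInl ψ ∘ₗ ψ + mInr ψ) x) = x := fun x => by
    rw [LinearMap.add_apply, comp_apply, map_add, mSnd_inl, mSnd_inr, zero_add]
  have hr : ∀ x, mFst ψ ((mInl ψ ∘ₗ ψ + mInr ψ) x) = ψ x := fun x => by
    rw [LinearMap.add_apply, comp_apply, map_add, mFst_inl, mFst_inr, add_zero]
  refine ⟨mFstB ψ, mFst ψ, mInl ψ ∘ₗ ψ + mInr ψ, fun y => rfl, mFst_c ψ,
    (model ψ).retraction_W _, hp, (model ψ).section_F _ fun x => ?_, (model ψ).section_W _,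
    LinearMap.ext fun x => (hr x).symm⟩
  exact (mem_mMid_F ψ).2 ((hr x).trans (congrArg ψ (hp x)).symm)

lemma model_isBaerSum (ψ₁ ψ₂ : (Θ M).dR ⊸ ⊡.dR) :
    IsBaerSum (model ψ₁) (model ψ₂) (model (ψ₁ + ψ₂)) := by
  let P₁ : (fibreProduct (model ψ₁) (model ψ₂)).dR ⊸ (mMid ψ₁).dR :=
    LinearMap.fst ℂ _ _ ∘ₗ Submodule.subtype _
  let P₂ : (fibreProduct (model ψ₁) (model ψ₂)).dR ⊸ (mMid ψ₂).dR :=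
    LinearMap.snd ℂ _ _ ∘ₗ Submodule.subtype _
  let Q₁ : (fibreProduct (model ψ₁) (model ψ₂)).B →ₗ[ℤ] (mMid ψ₁).B :=
    LinearMap.fst ℤ _ _ ∘ₗ Submodule.subtype _
  let Q₂ : (fibreProduct (model ψ₁) (model ψ₂)).B →ₗ[ℤ] (mMid ψ₂).B :=
    LinearMap.snd ℤ _ _ ∘ₗ Submodule.subtype _
  have hP : ∀ z, mSnd ψ₁ (P₁ z) = mSnd ψ₂ (P₂ z) := fun z => z.2
  let f : (fibreProduct (model ψ₁) (model ψ₂)).dR ⊸ (mMid (ψ₁ + ψ₂)).dR :=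
    mInl (ψ₁ + ψ₂) ∘ₗ (mFst ψ₁ ∘ₗ P₁ + mFst ψ₂ ∘ₗ P₂) +
      mInr (ψ₁ + ψ₂) ∘ₗ mSnd ψ₁ ∘ₗ P₁
  have hf1 : ∀ z, mFst (ψ₁ + ψ₂) (f z) = mFst ψ₁ (P₁ z) + mFst ψ₂ (P₂ z) :=
    fun z => add_zero _
  have hf2 : ∀ z, mSnd (ψ₁ + ψ₂) (f z) = mSnd ψ₁ (P₁ z) := fun z => zero_add _
  refine ⟨⟨mInlB (ψ₁ + ψ₂) ∘ₗ (mFstB ψ₁ ∘ₗ Q₁ + mFstB ψ₂ ∘ₗ Q₂) +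
      mInrB (ψ₁ + ψ₂) ∘ₗ mSndB ψ₁ ∘ₗ Q₁, f, fun v => ?_, fun k z hz => ?_, fun k z hz => ?_⟩,
    fun v => zero_add _, fun y y' v hv => ?_⟩
  · refine model_ext _ ((hf1 _).trans ?_) ((hf2 _).trans ?_)
    · refine ((map_add ⊡.c _ _).symm.trans ?_)
      exact congrArg ⊡.c (add_zero _).symm
    · exact congrArg (Θ M).c (zero_add _).symm
  · change f z ∈ (mMid (ψ₁ + ψ₂)).F k
    rcases le_or_gt k 0 with hk | hk
    · rw [(mMid_isFrame (ψ₁ + ψ₂)).F_nonpos k hk]; trivial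
    rcases le_or_gt 2 k with hk2 | hk2
    · have h1 : P₁ z ∈ (mMid ψ₁).F k := hz.1
      have h2 : P₂ z ∈ (mMid ψ₂).F k := hz.2
      rw [(mMid_isFrame ψ₁).F_high k hk2, mem_bot] at h1
      rw [(mMid_isFrame ψ₂).F_high k hk2, mem_bot] at h2
      have h3 : f z = 0 := by
        refine model_ext _ ((hf1 z).trans ?_) ((hf2 z).trans ?_)
        · rw [h1, h2, map_zero, map_zero, add_zero, map_zero]
        · rw [h1, map_zero, map_zero]
      rw [h3]
      exact zero_mem _
    obtain rfl : k = 1 := by omega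
    have h1 : mFst ψ₁ (P₁ z) = ψ₁ (mSnd ψ₁ (P₁ z)) := (mem_mMid_F ψ₁).1 hz.1
    have h2 : mFst ψ₂ (P₂ z) = ψ₂ (mSnd ψ₂ (P₂ z)) := (mem_mMid_F ψ₂).1 hz.2
    rw [mem_mMid_F, hf1, hf2, h1, h2, LinearMap.add_apply, hP]
  · change f z ∈ (mMid (ψ₁ + ψ₂)).W k
    rcases le_or_gt 2 k with hk2 | hk2
    · rw [(mMid_isFrame (ψ₁ + ψ₂)).W_high k hk2]; trivial
    have h1 : P₁ z ∈ (mMid ψ₁).W k := hz.1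
    have h2 : P₂ z ∈ (mMid ψ₂).W k := hz.2
    rcases lt_or_ge k 0 with hk | hk
    · rw [(mMid_isFrame ψ₁).W_neg k hk, mem_bot] at h1
      rw [(mMid_isFrame ψ₂).W_neg k hk, mem_bot] at h2
      have h3 : f z = 0 := by
        refine model_ext _ ((hf1 z).trans ?_) ((hf2 z).trans ?_)
        · rw [h1, h2, map_zero, map_zero, add_zero, map_zero]
        · rw [h1, map_zero, map_zero]
      rw [h3]
      exact zero_mem _
    · rw [mMid_W_low _ hk hk2] at h1 ⊢
      obtain ⟨y, hy⟩ := h1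
      refine ⟨mFst _ (f z), model_ext _ (mFst_inl _ _) ?_⟩
      rw [mSnd_inl, hf2, ← hy, mSnd_inl]
  · have e1 : Q₁ v = mInlB ψ₁ y := congrArg Prod.fst hv
    have e2 : Q₂ v = mInlB ψ₂ y' := congrArg Prod.snd hv
    refine model_ext_B _ ?_ ?_
    · exact (add_zero _).trans (congrArg₂ (fun a b => mFstB ψ₁ a + mFstB ψ₂ b) e1 e2)
    · have e3 : mSndB ψ₁ (Q₁ v) = 0 := (congrArg (mSndB ψ₁) e1).trans rfl
      exact (zero_add (mSndB ψ₁ (Q₁ v))).trans e3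

end Extension

section CarlsonClass

variable {M : Type} [AddCommGroup M]

lemma one_tmul_eq (m : M) :
    (show (Θ M).dR from (1 : ℂ) ⊗ₜ[ℤ] m) = ϖ • (Θ M).c m := by
  rw [tate_one_c]
  refine Eq.trans ?_ (smul_tmul' (R := ℤ) _ _ m).symm
  rw [smul_eq_mul, mul_inv_cancel₀ two_pi_I_ne_zero]

lemma ue_tmul (ψ : (Θ M).dR ⊸ ⊡.dR) (m : M) :
    ℮ (ψ ((1 : ℂ) ⊗ₜ[ℤ] m)) =
      2 * pi * ⅈ * ℮ (ψ ((Θ M).c m)) := by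
  refine (congrArg (fun x => ℮ (ψ x)) (one_tmul_eq m)).trans ?_
  exact (congrArg ℮ (map_smul ψ _ _)).trans (ue_smul _ _)

lemma ue_tmul_add (ψ : (Θ M).dR ⊸ ⊡.dR) (m m' : M) :
    ℮ (ψ ((1 : ℂ) ⊗ₜ[ℤ] (m + m'))) =
      ℮ (ψ ((1 : ℂ) ⊗ₜ[ℤ] m)) + ℮ (ψ ((1 : ℂ) ⊗ₜ[ℤ] m')) := by
  rw [ue_tmul, ue_tmul, ue_tmul, ← mul_add,
    ← map_add, ← map_add]
  exact congrArg (fun x => _ * ℮ (ψ x)) (map_add (Θ M).c m m')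

/-- The character `m ↦ exp (ψ (1 ⊗ m))`. -/
def expC (ψ : (Θ M).dR ⊸ ⊡.dR) : M →+ Additive ℂˣ :=
  AddMonoidHom.mk' (fun m => Additive.ofMul (Units.mk0
    (exp (℮ (ψ ((1 : ℂ) ⊗ₜ[ℤ] m)))) (exp_ne_zero _))) fun m m' => by
    refine Additive.toMul.injective (Units.ext ?_)
    exact (congrArg exp (ue_tmul_add ψ m m')).trans (exp_add _ _)

lemma expClass_apply (ψ : (Θ M).dR ⊸ ⊡.dR) (m : M) :
    ((expC ψ m).toMul : ℂ) = exp (℮ (ψ ((1 : ℂ) ⊗ₜ[ℤ] m))) := rfl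

lemma expClass_eq_iff {ψ ψ' : (Θ M).dR ⊸ ⊡.dR} :
    expC ψ = expC ψ' ↔ ∀ m : M, exp (℮ (ψ ((1 : ℂ) ⊗ₜ[ℤ] m))) =
      exp (℮ (ψ' ((1 : ℂ) ⊗ₜ[ℤ] m))) := by
  refine ⟨fun h m => ?_, fun h => AddMonoidHom.ext fun m => ?_⟩
  · rw [← expClass_apply, h, expClass_apply]
  · exact Additive.toMul.injective (Units.ext (h m))

lemma expClass_add (ψ ψ' : (Θ M).dR ⊸ ⊡.dR) :
    expC (ψ + ψ') = expC ψ + expC ψ' := by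
  refine AddMonoidHom.ext fun m => Additive.toMul.injective (Units.ext ?_)
  exact (congrArg exp (map_add ℮ _ _)).trans (exp_add _ _)

lemma exp_two_pi_iff {a b : ℂ} :
    exp (2 * pi * ⅈ * a) = exp (2 * pi * ⅈ * b) ↔
      ∃ k : ℤ, a = b + k := by
  rw [Complex.exp_eq_exp_iff_exists_int]
  refine exists_congr fun k => ⟨fun h => ?_, fun h => by rw [h]; ring⟩
  refine mul_left_cancel₀ two_pi_I_ne_zero (h.trans ?_)
  ring

lemma expClass_surjective [Module.Free ℤ M] :
    Function.Surjective (expC : ((Θ M).dR ⊸ ⊡.dR) → (M →+ Additive ℂˣ)) := by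
  intro χ
  let b := Module.Free.chooseBasis ℤ M
  let g : M →ₗ[ℤ] ℂ := b.constr ℤ fun i => log ((χ (b i)).toMul : ℂˣ)
  let ψ : (Θ M).dR ⊸ ⊡.dR :=
    toSpanSingleton ℂ ⊡.dR (⊡.c (1 : ℤ)) ∘ₗ cLift (M := M) g
  have hψ : ∀ m : M, ℮ (ψ ((1 : ℂ) ⊗ₜ[ℤ] m)) = g m := fun m => by
    have h1 : cLift (M := M) g ((1 : ℂ) ⊗ₜ[ℤ] m) = g m :=
      (cLift_tmul g 1 m).trans (one_smul ℂ _)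
    exact (ue_smul_c _).trans h1
  refine ⟨ψ, ?_⟩
  have h : (expC ψ).toIntLinearMap = χ.toIntLinearMap := b.ext fun i => by
    refine Additive.toMul.injective (Units.ext ?_)
    refine (congrArg exp (hψ (b i))).trans ?_
    rw [Module.Basis.constr_basis]
    exact exp_log (Units.ne_zero _)
  exact AddMonoidHom.ext fun m => LinearMap.congr_fun h m

variable [Module.Free ℤ M] [Module.Finite ℤ M]

lemma Extension.model_congr_iff {ψ ψ' : (Θ M).dR ⊸ ⊡.dR} :
    (Extension.model ψ).Congr (Extension.model ψ') ↔ expC ψ = expC ψ' := by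
  open Extension in
  rw [expClass_eq_iff]
  simp only [ue_tmul, exp_two_pi_iff]
  constructor
  · rintro ⟨f, _, _, _, _, _, hi, hp⟩ m
    let m' : (Θ M).B := m
    let fd : (mMid ψ).dR ⊸ (mMid ψ').dR := f.onDR
    let fb : (mMid ψ).B →ₗ[ℤ] (mMid ψ').B := f.onB
    have hc : ∀ v, fd ((mMid ψ).c v) = (mMid ψ').c (fb v) := f.comm
    have hib : ∀ a, fb (mInlB ψ a) = mInlB ψ' a := hi
    have hpb : ∀ v, mSndB ψ' (fb v) = mSndB ψ v := hp
    have hF : ∀ x, x ∈ (mMid ψ).F 1 → fd x ∈ (mMid ψ').F 1 := f.map_F 1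
    clear_value fd fb
    have hi' : ∀ y, fd (mInl ψ y) = mInl ψ' y := fun y => by
      refine LinearMap.congr_fun (f := fd ∘ₗ mInl ψ) (unitHodge_ext fun a => ?_) y
      rw [comp_apply, mInl_c, mInl_c, hc, hib]
    have h1 := hF (mInl ψ (ψ ((Θ M).c m')) + mInr ψ ((Θ M).c m')) (by
      rw [mem_mMid_F, map_add, map_add, mFst_inl, mSnd_inl, mFst_inr,
        mSnd_inr, add_zero, zero_add])
    have hm : mSndB ψ (mInrB ψ m') = m' := rfl
    rw [map_add, hi', mInr_c, hc, mem_mMid_F, map_add, map_add, mFst_inl,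
      mSnd_inl, zero_add, mFst_c, mSnd_c, hpb, hm] at h1
    have h3 := congrArg ℮ h1
    rw [map_add] at h3
    change ∃ k : ℤ, ℮ (ψ ((Θ M).c m')) = ℮ (ψ' ((Θ M).c m')) + k
    obtain ⟨k, hk⟩ : ∃ k : ℤ, ℮ (⊡.c (mFstB ψ' (fb (mInrB ψ m')))) = k :=
      ⟨_, ue_c _⟩
    refine ⟨-k, ?_⟩
    rw [← h3, hk]
    push_cast
    ring
  · intro h
    have h' : ∀ m : (Θ M).B, ∃ k : ℤ, ℮ (ψ ((Θ M).c m)) =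
      ℮ (ψ' ((Θ M).c m)) + k := h
    choose l hl using h'
    have hl' : ∀ m : (Θ M).B,
        ⊡.c (-l m : ℤ) = ψ' ((Θ M).c m) - ψ ((Θ M).c m) := fun m => by
      refine (℮).injective ?_
      rw [ue_c, map_sub, hl]
      push_cast
      ring
    let L : (Θ M).B →ₗ[ℤ] ⊡.B := AddMonoidHom.toIntLinearMap
      (AddMonoidHom.mk' (fun m : (Θ M).B => (show ⊡.B from (-l m : ℤ))) fun m m' => by
        have h1 : Function.Injective ⊡.c := fun a b hab => by
          have h2 := congrArg ℮ hab
          have h3 := (ue_c a).symm.trans (h2.trans (ue_c b))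
          exact Int.cast_injective h3
        refine h1 ?_
        rw [map_add]
        refine (hl' _).trans ((congrArg₂ (· + ·) (hl' m) (hl' m')).trans ?_).symm
        rw [map_add, map_add, map_add]
        abel)
    have hL : ∀ m, ⊡.c (L m) = ψ' ((Θ M).c m) - ψ ((Θ M).c m) := hl'
    refine HasSec.congr ⟨mInrB ψ' + mInlB ψ' ∘ₗ L,
      mInl ψ' ∘ₗ ψ' + mInr ψ', fun m => ?_, fun x => ?_, fun m => ?_⟩
    · change mSndB ψ' (mInrB ψ' m + mInlB ψ' (L m)) = m
      rw [map_add]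
      exact add_zero _
    · exact (mMid_F_one ψ').symm ▸ (⟨x, rfl⟩ : _ ∈ LinearMap.range (mInl ψ' ∘ₗ ψ' + mInr ψ'))
    · change mInl ψ' (ψ' ((Θ M).c m)) + mInr ψ' ((Θ M).c m) =
        (mMid ψ').c (mInrB ψ' m + mInlB ψ' (L m)) + mInl ψ' (ψ ((Θ M).c m))
      rw [map_add, ← mInl_c, ← mInr_c, hL, map_sub]
      abel

namespace Ext

open Extension

lemma mk_eq_iff {X Y : HodgeData} {E E' : Extension X Y} : mk E = mk E' ↔ E.Congr E' :=
  Quotient.eq (r := Extension.setoid X Y)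

lemma mk_model_eq_iff {ψ ψ' : (Θ M).dR ⊸ ⊡.dR} :
    mk (model ψ) = mk (model ψ') ↔ expC ψ = expC ψ' :=
  mk_eq_iff.trans model_congr_iff

lemma mk_eq_of_sec {E : Extension (Θ M) ⊡}
    {ψ : (Θ M).dR ⊸ ⊡.dR} (h : E.HasSec ψ) : mk E = mk (model ψ) :=
  (mk_eq_iff.2 h.congr).symm

lemma hasCarlson_iff {x : QTori.Ext (Θ M) ⊡} {ψ : (Θ M).dR ⊸ ⊡.dR} :
    x.HasCarlson ψ ↔ x = mk (model ψ) := by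
  constructor
  · rintro ⟨E, rfl, h⟩
    exact mk_eq_of_sec h.hasSections
  · rintro rfl
    exact ⟨_, rfl, model_hasCarlson ψ⟩

lemma ex_mk_model (x : QTori.Ext (Θ M) ⊡) : ∃ ψ, x = mk (model ψ) := by
  obtain ⟨E, rfl⟩ := Quotient.exists_rep x
  obtain ⟨ψ, h⟩ := E.ex_hasSec
  exact ⟨ψ, mk_eq_of_sec h⟩

lemma isSum_model (ψ ψ' : (Θ M).dR ⊸ ⊡.dR) :
    IsSum (mk (model ψ)) (mk (model ψ')) (mk (model (ψ + ψ'))) :=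
  ⟨_, _, _, rfl, rfl, rfl, model_isBaerSum ψ ψ'⟩

lemma exists_equiv : ∃ κ : QTori.Ext (Θ M) ⊡ ≃ (M →+ Additive ℂˣ),
    (∀ x y z, x.IsSum y z → κ z = κ x + κ y) ∧ ∀ x ψ, x.HasCarlson ψ → κ x = expC ψ := by
  choose Ψ hΨ using (ex_mk_model (M := M))
  have key : ∀ ψ, expC (Ψ (mk (model ψ))) = expC ψ := fun ψ =>
    mk_model_eq_iff.1 (hΨ _).symm
  have key' : ∀ (E : Extension (Θ M) ⊡) ψ, E.HasSec ψ →
      expC (Ψ (mk E)) = expC ψ := fun E ψ h => by rw [mk_eq_of_sec h, key]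
  have hbij : Function.Bijective fun x => expC (Ψ x) := by
    refine ⟨fun x y h => ?_, fun χ => ?_⟩
    · rw [hΨ x, hΨ y, mk_model_eq_iff]
      exact h
    · obtain ⟨ψ, rfl⟩ := expClass_surjective χ
      exact ⟨_, key ψ⟩
  refine ⟨Equiv.ofBijective _ hbij, ?_, ?_⟩
  · rintro _ _ _ ⟨E₁, E₂, E₃, rfl, rfl, rfl, h⟩
    obtain ⟨ψ₁, h₁⟩ := E₁.ex_hasSec
    obtain ⟨ψ₂, h₂⟩ := E₂.ex_hasSec
    change expC (Ψ (mk E₃)) = expC (Ψ (mk E₁)) + expC (Ψ (mk E₂))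
    rw [key' _ _ h₁, key' _ _ h₂, key' _ _ (h₁.baerSum h₂ h), expClass_add]
  · intro x ψ h
    change expC (Ψ x) = expC ψ
    rw [hasCarlson_iff.1 h, key]

end Ext

end CarlsonClass

/-! ### Chern numbers of families of idempotents on the two-torus -/

section Curvature

open Set hiding pi range

variable {A : Type*} [NormedRing A] [NormedAlgebra ℝ A] [CompleteSpace A] (τ : A →L[ℝ] ℂ)

def pd (v : ℝ × ℝ) (f : ℝ × ℝ → A) (z : ℝ × ℝ) : A := fderiv ℝ f z v

lemma contDiff_pd {f : ℝ × ℝ → A} (hf : ContDiff ℝ ∞ f) (v : ℝ × ℝ) : ContDiff ℝ ∞ (pd v f) :=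
  (hf.fderiv_right (m := ∞) (by simp)).clm_apply contDiff_const

lemma pd_mul {f g : ℝ × ℝ → A} {z : ℝ × ℝ} (hf : DifferentiableAt ℝ f z)
    (hg : DifferentiableAt ℝ g z) (v : ℝ × ℝ) :
    pd v (fun z => f z * g z) z = pd v f z * g z + f z * pd v g z := by
  simp [pd, fderiv_fun_mul' hf hg, add_comm]

lemma diff_inv {f : ℝ × ℝ → A} {z : ℝ × ℝ} (hf : DifferentiableAt ℝ f z)
    (hu : IsUnit (f z)) : DifferentiableAt ℝ (fun z => Ring.inverse (f z)) z := by
  obtain ⟨u, hu⟩ := hu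
  have h := hasFDerivAt_ringInverse (𝕜 := ℝ) u
  rw [hu] at h
  exact (h.comp z hf.hasFDerivAt).differentiableAt

lemma pd_inverse {f : ℝ × ℝ → A} {z : ℝ × ℝ} (hf : DifferentiableAt ℝ f z) (hu : IsUnit (f z))
    (v : ℝ × ℝ) : pd v (fun z => Ring.inverse (f z)) z =
      -(Ring.inverse (f z) * pd v f z * Ring.inverse (f z)) := by
  obtain ⟨u, hu⟩ := hu
  have h := hasFDerivAt_ringInverse (𝕜 := ℝ) u
  rw [hu] at h
  have h2 := (h.comp z hf.hasFDerivAt).fderiv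
  refine (DFunLike.congr_fun h2 v).trans ?_
  simp [pd, ← hu, Ring.inverse_unit, mul_assoc]

lemma pd_comm {f : ℝ × ℝ → A} (hf : ContDiff ℝ ∞ f) (v w z : ℝ × ℝ) :
    pd v (pd w f) z = pd w (pd v f) z := by
  have hd : DifferentiableAt ℝ (fderiv ℝ f) z :=
    (hf.fderiv_right (m := ∞) (by simp)).differentiable (by simp) z
  have h : ∀ v w, pd v (pd w f) z = fderiv ℝ (fderiv ℝ f) z v w := fun v w => by
    change fderiv ℝ (fun z => fderiv ℝ f z w) z v = _
    rw [fderiv_clm_apply hd (differentiableAt_const _)]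
    simp
  rw [h, h]
  exact (hf.contDiffAt.isSymmSndFDerivAt (by
    simpa using (WithTop.coe_le_coe.2 le_top : ((2 : ℕ∞) : WithTop ℕ∞) ≤ ((⊤ : ℕ∞) : WithTop ℕ∞)))) v w

/-- The trace of the curvature of the connection `E d`. -/
def curv (E : ℝ × ℝ → A) (z : ℝ × ℝ) : ℂ :=
  τ (E z * (pd (1, 0) E z * pd (0, 1) E z - pd (0, 1) E z * pd (1, 0) E z))

lemma continuous_curv {E : ℝ × ℝ → A} (hE : ContDiff ℝ ∞ E) : Continuous (curv τ E) := by
  have h1 := (contDiff_pd hE (1, 0)).continuous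
  have h2 := (contDiff_pd hE (0, 1)).continuous
  have h3 := hE.continuous
  unfold curv
  fun_prop

variable {τ}

lemma curvature_identity (hτ : ∀ x y, τ (x * y) = τ (y * x)) {E P T S Tx Ty Ex Ey p : A} (hS : S * T = 1) (hS' : T * S = 1)
    (hP : P * P = P) (hp : p * P + P * p = p) (hE : T * P = E * T)
    (hx : Tx * P + T * p = Ex * T + E * Tx) (hy : Ty * P = Ey * T + E * Ty) :
    τ (E * (Ex * Ey - Ey * Ex)) =
      τ (p * (S * Ty)) - τ (P * (S * Tx * (S * Ty))) + τ (P * (S * Ty * (S * Tx))) := by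
  set a := S * Tx with ha
  set b := S * Ty with hb
  have hTx : Tx = T * a := by rw [ha, ← mul_assoc, hS', one_mul]
  have hTy : Ty = T * b := by rw [hb, ← mul_assoc, hS', one_mul]
  have conj : ∀ x y : A, T * x = y * T → y = T * x * S := fun x y h => by
    rw [h, mul_assoc, hS', mul_one]
  have e1 := conj _ _ hE
  have e2 : Ex = T * (a * P + p - P * a) * S := conj _ _ (by
    rw [mul_sub, mul_add, ← mul_assoc, ← hTx, hx, ← mul_assoc, hE, mul_assoc, ← hTx]; abel)
  have e3 : Ey = T * (b * P - P * b) * S := conj _ _ (by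
    rw [mul_sub, ← mul_assoc, ← hTy, hy, ← mul_assoc, hE, mul_assoc, ← hTy]; abel)
  have hpp : P * p * P = 0 := by
    have h : P * p * P + P * p * P = P * p * P := by
      calc _ = P * (p * P + P * p) * P := by
            rw [mul_add, add_mul, ← mul_assoc, ← mul_assoc, hP, mul_assoc (P * p), hP]
        _ = _ := by rw [hp]
    simpa using h
  have hP2 : ∀ x, P * (P * x) = P * x := fun x => by rw [← mul_assoc, hP]
  have cyc : ∀ x, τ (P * x * P) = τ (P * x) := fun x => by rw [hτ, hP2]
  have htr : ∀ u v : A, τ (E * (T * u * S * (T * v * S))) = τ (P * (u * v)) := fun u v => by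
    have : T * P * S * (T * u * S * (T * v * S)) = T * (P * (u * v)) * S := by
      simp only [mul_assoc]
      simp only [← mul_assoc S T, hS, one_mul]
    rw [e1, this, hτ, ← mul_assoc, hS, one_mul]
  have h0 : ∀ x, P * (p * (P * x)) = 0 := fun x => by
    simp only [← mul_assoc, hpp, zero_mul]
  have c1 := cyc (a * P * b)
  have c2 := cyc (p * b)
  have c3 := cyc (a * b)
  have c4 := cyc (b * P * a)
  have c5 := cyc (b * a)
  have c6 : τ (P * (a * P * b)) = τ (P * (b * P * a)) := by
    have := hτ (P * a) (P * b)
    simpa only [mul_assoc] using this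
  have c7 : τ (P * (b * (P * p))) = 0 := by
    have := hτ (P * b) (P * p)
    rw [mul_assoc P p, h0, map_zero] at this
    simpa only [mul_assoc] using this
  have c8 : τ (P * (b * p)) = τ (p * (P * b)) := by rw [← mul_assoc, hτ]
  have c9 : τ (p * b) = τ (p * (P * b)) + τ (P * (p * b)) := by
    rw [← map_add, ← mul_assoc p P b, ← mul_assoc P p b, ← add_mul, hp]
  rw [mul_sub, map_sub, e2, e3, htr, htr]
  simp only [mul_assoc] at c1 c2 c3 c4 c5 c6
  simp only [mul_add, mul_sub, add_mul, sub_mul, mul_assoc, hP2, h0, map_add, map_sub, map_zero]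
  linear_combination c1 + c2 - c3 - c4 + c5 + c6 - c7 + c8 - c9

lemma transgression (hτ : ∀ x y, τ (x * y) = τ (y * x)) {E T : ℝ × ℝ → A} {P : ℝ → A} (hE : ContDiff ℝ ∞ E) (hT : ContDiff ℝ ∞ T)
    (hP : ContDiff ℝ ∞ P) (hPP : ∀ x, P x * P x = P x) {l y₀ y₁ : ℝ} (hl : 0 ≤ l) (hy : y₀ ≤ y₁)
    (hu : ∀ z ∈ Icc 0 l ×ˢ Icc y₀ y₁, IsUnit (T z))
    (hTE : ∀ x, ∀ y ∈ Ioo (y₀ - 1) (y₁ + 1), T (x, y) * P x = E (x, y) * T (x, y))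
    (hP0 : P 0 = P l) (hT0 : ∀ y, T (0, y) = T (l, y)) :
    ∫ x in (0 : ℝ)..l, ∫ y in y₀..y₁, curv τ E (x, y) =
      (∫ x in (0 : ℝ)..l, τ (P x * (Ring.inverse (T (x, y₀)) * pd (1, 0) T (x, y₀)))) -
        ∫ x in (0 : ℝ)..l, τ (P x * (Ring.inverse (T (x, y₁)) * pd (1, 0) T (x, y₁))) := by
  have dT : Differentiable ℝ T := hT.differentiable (by simp)
  have dE : Differentiable ℝ E := hE.differentiable (by simp)
  have dTv : ∀ v, Differentiable ℝ (pd v T) := fun v => (contDiff_pd hT v).differentiable (by simp)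
  have dP : Differentiable ℝ fun z : ℝ × ℝ => P z.1 :=
    (hP.differentiable (by simp)).comp differentiable_fst
  have pP : ∀ z, pd (0, 1) (fun z : ℝ × ℝ => P z.1) z = 0 := fun z => by
    have := (((hP.differentiable (by simp)) z.1).hasFDerivAt.comp z hasFDerivAt_fst).fderiv
    exact (DFunLike.congr_fun this (0, 1)).trans (by simp)
  let form (v z : ℝ × ℝ) : A := P z.1 * (Ring.inverse (T z) * pd v T z)
  have dform : ∀ v, ∀ z ∈ Icc 0 l ×ˢ Icc y₀ y₁, DifferentiableAt ℝ (form v) z := fun v z hz =>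
    (dP z).mul ((diff_inv (dT z) (hu z hz)).mul (dTv v z))
  have hform : ∀ v w, ∀ z ∈ Icc 0 l ×ˢ Icc y₀ y₁, pd w (form v) z =
      pd w (fun z : ℝ × ℝ => P z.1) z * (Ring.inverse (T z) * pd v T z) +
      P z.1 * (-(Ring.inverse (T z) * pd w T z * Ring.inverse (T z)) * pd v T z +
        Ring.inverse (T z) * pd w (pd v T) z) := fun v w z hz => by
    have h1 := diff_inv (dT z) (hu z hz)
    refine (pd_mul (dP z) (h1.mul (dTv v z)) w).trans ?_
    refine congrArg (_ + P z.1 * ·) ((pd_mul h1 (dTv v z) w).trans ?_)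
    rw [pd_inverse (dT z) (hu z hz)]
  have hpt : ∀ z ∈ Icc 0 l ×ˢ Icc y₀ y₁, τ (pd (1, 0) (form (0, 1)) z) +
      -τ (pd (0, 1) (form (1, 0)) z) = curv τ E z := by
    intro z hz
    have hmem : z.2 ∈ Ioo (y₀ - 1) (y₁ + 1) := ⟨by linarith [hz.2.1], by linarith [hz.2.2]⟩
    have hev : (fun z : ℝ × ℝ => T z * P z.1) =ᶠ[nhds z] fun z => E z * T z :=
      Filter.eventually_of_mem ((isOpen_Ioo.preimage continuous_snd).mem_nhds hmem)
        fun w hw => hTE w.1 w.2 hw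
    have key : ∀ v, pd v T z * P z.1 + T z * pd v (fun z : ℝ × ℝ => P z.1) z =
        pd v E z * T z + E z * pd v T z := fun v => by
      rw [← pd_mul (dT z) (dP z), ← pd_mul (dE z) (dT z)]
      exact DFunLike.congr_fun hev.fderiv_eq v
    have hy := key (0, 1)
    rw [pP, mul_zero, add_zero] at hy
    have hp : pd (1, 0) (fun z : ℝ × ℝ => P z.1) z * P z.1 +
        P z.1 * pd (1, 0) (fun z : ℝ × ℝ => P z.1) z = pd (1, 0) (fun z : ℝ × ℝ => P z.1) z := by
      rw [← pd_mul (dP z) (dP z)]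
      simp only [hPP]
    rw [hform _ _ z hz, hform _ _ z hz, pP, curv,
      curvature_identity hτ (Ring.inverse_mul_cancel _ (hu z hz))
        (Ring.mul_inverse_cancel _ (hu z hz)) (hPP z.1) hp (hTE z.1 z.2 hmem) (key (1, 0)) hy,
      pd_comm hT (1, 0) (0, 1)]
    simp only [zero_mul, zero_add, mul_add, map_add, neg_mul, mul_neg, map_neg, mul_assoc]
    ring
  have hform0 : ∀ y, form (0, 1) (l, y) = form (0, 1) (0, y) := fun y => by
    have h2 : ∀ x, pd (0, 1) T (x, y) = deriv (fun y => T (x, y)) y := fun x => by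
      have := ((dT (x, y)).hasFDerivAt.comp y (hasFDerivAt_prodMk_right x y)).fderiv
      rw [← fderiv_apply_one_eq_deriv]
      exact ((DFunLike.congr_fun this 1).trans (by simp [pd])).symm
    simp only [form, h2, hP0, hT0]
  have hcurv := continuous_curv τ hE
  have e0 : uIcc 0 l ×ˢ uIcc y₀ y₁ = Icc 0 l ×ˢ Icc y₀ y₁ := by rw [uIcc_of_le hl, uIcc_of_le hy]
  have e1 : Ioo (min 0 l) (max 0 l) ×ˢ Ioo (min y₀ y₁) (max y₀ y₁) \ ∅ ⊆ Icc 0 l ×ˢ Icc y₀ y₁ := by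
    rw [min_eq_left hl, max_eq_right hl, min_eq_left hy, max_eq_right hy, diff_empty]
    exact prod_mono Ioo_subset_Icc_self Ioo_subset_Icc_self
  have hd : ∀ v, ∀ z ∈ Icc 0 l ×ˢ Icc y₀ y₁, HasFDerivAt (fun z => τ (form v z))
      (τ ∘L fderiv ℝ (form v) z) z := fun v z hz =>
    τ.hasFDerivAt.comp z (dform v z hz).hasFDerivAt
  have main := MeasureTheory.integral2_divergence_prod_of_hasFDerivAt_off_countable
    (fun z => τ (form (0, 1) z)) (fun z => -τ (form (1, 0) z))
    (fun z => τ ∘L fderiv ℝ (form (0, 1)) z) (fun z => -(τ ∘L fderiv ℝ (form (1, 0)) z))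
    0 y₀ l y₁ ∅ countable_empty
    (fun z hz => (hd _ z (e0 ▸ hz)).continuousAt.continuousWithinAt)
    (fun z hz => (hd _ z (e0 ▸ hz)).continuousAt.neg.continuousWithinAt)
    (fun z hz => hd _ z (e1 hz)) (fun z hz => (hd _ z (e1 hz)).neg)
    (hcurv.continuousOn.congr (fun z hz => hpt z (e0 ▸ hz)) |>.integrableOn_compact
      (isCompact_uIcc.prod isCompact_uIcc))
  simp only [hform0] at main
  rw [add_sub_cancel_right] at main
  refine Eq.trans ?_ (main.trans ?_)
  · refine intervalIntegral.integral_congr fun x hx => intervalIntegral.integral_congr fun y hy' => ?_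
    exact (hpt (x, y) (e0 ▸ ⟨hx, hy'⟩)).symm
  · simp only [intervalIntegral.integral_neg, neg_sub_neg]
    rfl

end Curvature

section Intertwiner

open Set hiding pi range
open intervalIntegral

variable {A : Type*} [NormedRing A] [NormedAlgebra ℝ A] [CompleteSpace A] {τ : A →L[ℝ] ℂ}

lemma pd_one {f : ℝ × ℝ → A} (hf : Differentiable ℝ f) (x y : ℝ) :
    pd (1, 0) f (x, y) = deriv (fun x => f (x, y)) x := by
  have := ((hf (x, y)).hasFDerivAt.comp x (hasFDerivAt_prodMk_left (𝕜 := ℝ) x y)).fderiv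
  rw [← fderiv_apply_one_eq_deriv]
  exact ((DFunLike.congr_fun this 1).trans (by simp [pd])).symm

def connForm (τ : A →L[ℝ] ℂ) (P V : ℝ → A) (x : ℝ) : ℂ :=
  τ (P x * (Ring.inverse (V x) * deriv V x))

variable (τ) in
/-- There is a loop of intertwiners from `E (·, 0)` to `E (·, y)` that computes the integral of the
curvature between `0` and `y`. -/
def Linked (E : ℝ × ℝ → A) (l y : ℝ) : Prop :=
  ∃ V : ℝ → A, ContDiff ℝ ∞ V ∧ V 0 = V l ∧ (∀ x, IsUnit (V x)) ∧
    (∀ x, V x * E (x, 0) = E (x, y) * V x) ∧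
    ∫ x in (0 : ℝ)..l, ∫ y in (0 : ℝ)..y, curv τ E (x, y) =
      -∫ x in (0 : ℝ)..l, connForm τ (fun x => E (x, 0)) V x

lemma idempotent_add {e : A} (h : e * e = e) : e * e + (1 - e) * (1 - e) = 1 := by
  rw [mul_sub, sub_mul 1 e e, h]; simp

variable {E : ℝ × ℝ → A} {l : ℝ}

lemma Linked.step (hτ : ∀ x y, τ (x * y) = τ (y * x)) (hE : ContDiff ℝ ∞ E)
    (hEE : ∀ z, E z * E z = E z) (hl : 0 ≤ l) (hper : ∀ y, E (0, y) = E (l, y)) {y₀ y₁ : ℝ}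
    (hy : y₀ ≤ y₁) (hu : ∀ x, ∀ y ∈ Icc y₀ y₁,
      IsUnit (E (x, y) * E (x, y₀) + (1 - E (x, y)) * (1 - E (x, y₀))))
    (h : Linked τ E l y₀) : Linked τ E l y₁ := by
  obtain ⟨V, hV, hV0, hVu, hVE, hint⟩ := h
  let T (z : ℝ × ℝ) : A := (E z * E (z.1, y₀) + (1 - E z) * (1 - E (z.1, y₀))) * V z.1
  have hT : ContDiff ℝ ∞ T := by
    have h1 : ContDiff ℝ ∞ fun z : ℝ × ℝ => E (z.1, y₀) :=
      hE.comp (contDiff_fst.prodMk contDiff_const)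
    exact ((hE.mul h1).add ((contDiff_const.sub hE).mul (contDiff_const.sub h1))).mul
      (hV.comp contDiff_fst)
  have hTE : ∀ x y, T (x, y) * E (x, 0) = E (x, y) * T (x, y) := fun x y => by
    have e1 := hEE (x, y)
    have e2 := hEE (x, y₀)
    simp only [T]
    rw [mul_assoc, hVE, ← mul_assoc, ← mul_assoc]
    congr 1
    rw [add_mul, mul_add, mul_assoc, e2, mul_assoc (1 - E (x, y)), sub_mul 1 (E (x, y₀)), one_mul, e2,
      sub_self, mul_zero, ← mul_assoc, e1, ← mul_assoc (E (x, y)), mul_sub (E (x, y)), mul_one, e1,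
      sub_self, zero_mul]
  have hT₀ : ∀ x, T (x, y₀) = V x := fun x => by
    simp only [T]
    rw [idempotent_add (hEE _), one_mul]
  have hTu : ∀ x, ∀ y ∈ Icc y₀ y₁, IsUnit (T (x, y)) := fun x y hy => (hu x y hy).mul (hVu x)
  have main := transgression hτ hE hT (P := fun x => E (x, 0))
    (hE.comp (contDiff_id.prodMk contDiff_const)) (fun x => hEE _) hl hy
    (fun z hz => hTu z.1 z.2 hz.2) (fun x y _ => hTE x y) (hper 0)
    (fun y => by simp only [T, hper, hV0])
  have hd := hT.differentiable (by simp)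
  simp only [pd_one hd, hT₀] at main
  refine ⟨fun x => T (x, y₁), hT.comp (contDiff_id.prodMk contDiff_const), by simp only [T, hper, hV0],
    fun x => hTu x y₁ ⟨hy, le_rfl⟩, fun x => hTE x y₁, ?_⟩
  have hc := continuous_curv τ hE
  have hcx : ∀ x, Continuous fun y => curv τ E (x, y) := fun x => by fun_prop
  have hcc : ∀ a b, Continuous fun x => ∫ y in a..b, curv τ E (x, y) := fun a b =>
    continuous_parametric_intervalIntegral_of_continuous' (f := fun x y => curv τ E (x, y))
      (by simpa [Function.uncurry_def] using hc) a b
  have hsplit : ∀ x, ∫ y in (0 : ℝ)..y₁, curv τ E (x, y) =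
      (∫ y in (0 : ℝ)..y₀, curv τ E (x, y)) + ∫ y in y₀..y₁, curv τ E (x, y) := fun x =>
    (integral_add_adjacent_intervals ((hcx x).intervalIntegrable _ _)
      ((hcx x).intervalIntegrable _ _)).symm
  simp only [hsplit]
  rw [integral_add ((hcc _ _).intervalIntegrable _ _) ((hcc _ _).intervalIntegrable _ _), hint, main]
  simp only [connForm]
  ring

lemma linked (hτ : ∀ x y, τ (x * y) = τ (y * x)) (hE : ContDiff ℝ ∞ E)
    (hEE : ∀ z, E z * E z = E z) (hl : 0 < l) (hper : ∀ y, Function.Periodic (fun x => E (x, y)) l)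
    {b : ℝ} (hb : 0 ≤ b) : Linked τ E l b := by
  have hper0 : ∀ y, E (0, y) = E (l, y) := fun y => by simpa using (hper y 0).symm
  let G (p : ℝ × ℝ × ℝ) : A := E (p.1, p.2.2) * E (p.1, p.2.1) + (1 - E (p.1, p.2.2)) * (1 - E (p.1, p.2.1))
  have hG : Continuous G := by have := hE.continuous; fun_prop
  have hG1 : ∀ x y, G (x, y, y) = 1 := fun x y => idempotent_add (hEE _)
  obtain ⟨δ, hδ, hδ'⟩ := Metric.uniformContinuousOn_iff.1
    ((isCompact_Icc (a := (0 : ℝ)) (b := l)).prod ((isCompact_Icc (a := (0 : ℝ)) (b := b)).prod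
      (isCompact_Icc (a := (0 : ℝ)) (b := b))) |>.uniformContinuousOn_of_continuous hG.continuousOn) 1
    one_pos
  have hunit : ∀ y₀ ∈ Icc 0 b, ∀ y ∈ Icc 0 b, dist y y₀ < δ → ∀ x, IsUnit (G (x, y₀, y)) := by
    intro y₀ h0 y h1 hd x
    obtain ⟨x', hx', hxx⟩ := Function.Periodic.exists_mem_Ico₀
      (f := fun x => G (x, y₀, y)) (c := l) (fun x => by
        have h1 := hper y x
        have h2 := hper y₀ x
        simp only at h1 h2
        simp only [G, h1, h2]) hl x
    change G (x, y₀, y) = _ at hxx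
    rw [hxx]
    have := hδ' (x', y₀, y) ⟨Ico_subset_Icc_self hx', h0, h1⟩ (x', y₀, y₀)
      ⟨Ico_subset_Icc_self hx', h0, h0⟩ (by simpa [Prod.dist_eq, hδ] using hd)
    rw [hG1, dist_comm, dist_eq_norm] at this
    have := isUnit_one_sub_of_norm_lt_one this
    rwa [sub_sub_cancel] at this
  obtain ⟨N, hN⟩ := exists_nat_gt (b / δ)
  have hN0 : (0 : ℝ) < N := lt_of_le_of_lt (by positivity) hN
  have hstep : b / N < δ := by rw [div_lt_comm₀ hN0 hδ]; exact hN
  have key : ∀ k : ℕ, k ≤ N → Linked τ E l (k * (b / N)) := by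
    intro k
    induction k with
    | zero =>
      refine fun _ => ⟨fun _ => 1, contDiff_const, rfl, fun _ => isUnit_one, fun x => by simp, ?_⟩
      simp [connForm]
    | succ k ih =>
      intro hk
      have hk' : ((k : ℝ) + 1) ≤ N := by exact_mod_cast hk
      have hbN : 0 ≤ b / N := by positivity
      have hle : ((k : ℝ) + 1) * (b / N) ≤ b := by
        calc _ ≤ N * (b / N) := by gcongr
          _ = b := by field_simp
      have h0 : 0 ≤ k * (b / N) := by positivity
      push_cast
      refine Linked.step (y₀ := (k : ℝ) * (b / N)) hτ hE hEE hl.le hper0 (by linarith) (fun x y hy =>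
        hunit _ ⟨h0, by linarith⟩ y ⟨by linarith [hy.1], by linarith [hy.2]⟩ ?_ x) (ih (by omega))
      rw [Real.dist_eq, abs_of_nonneg (by linarith [hy.1])]
      linarith [hy.2]
  have := key N le_rfl
  rwa [mul_div_cancel₀ _ hN0.ne'] at this

end Intertwiner

section Winding

open Set hiding pi range
open Matrix intervalIntegral

attribute [local instance] Matrix.linftyOpNormedRing Matrix.linftyOpNormedAlgebra

variable {m : ℕ}

lemma diff_det : Differentiable ℝ fun M : Matrix (Fin m) (Fin m) ℂ => M.det := by
  have he : ∀ i j, Differentiable ℝ fun M : Matrix (Fin m) (Fin m) ℂ => M i j := fun i j =>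
    (LinearMap.toContinuousLinearMap (Matrix.entryLinearMap ℝ ℂ i j)).differentiable
  simp only [Matrix.det_apply]
  fun_prop

lemma hasDerivAt_det {W : ℝ → Matrix (Fin m) (Fin m) ℂ} (hW : Differentiable ℝ W) {x : ℝ}
    (hu : IsUnit (W x)) : HasDerivAt (fun x => (W x).det)
      ((W x).det * (Ring.inverse (W x) * deriv W x).trace) x := by
  obtain ⟨u, hu⟩ := hu
  have h1 := (diff_det (W x)).hasFDerivAt.comp_hasDerivAt x (hW x).hasDerivAt
  refine h1.congr_deriv ?_
  set H := deriv W x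
  have h2 : HasDerivAt (fun t : ℝ => (W x + t • H).det) (fderiv ℝ (fun M => M.det) (W x) H) 0 := by
    have h3 : HasDerivAt (fun t : ℝ => W x + t • H) H 0 := by
      have := ((hasDerivAt_id (0 : ℝ)).smul_const H).const_add (W x)
      rwa [one_smul] at this
    refine HasFDerivAt.comp_hasDerivAt (f := fun t : ℝ => W x + t • H) 0 ?_ h3
    rw [zero_smul, add_zero]
    exact (diff_det _).hasFDerivAt
  refine h2.unique ?_
  have h5 : ∀ t : ℝ, (W x + t • H).det = (W x).det * (1 + (Ring.inverse (W x) * H).trace * t +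
      ((1 + (Polynomial.X : Polynomial ℂ) • (Ring.inverse (W x) * H).map Polynomial.C).det.divX.divX).eval
        (t : ℂ) * t ^ 2) := fun t => by
    rw [← Matrix.det_one_add_smul, ← Matrix.det_mul, mul_add, mul_one, mul_smul_comm, ← mul_assoc, ← hu,
      Ring.inverse_unit, Units.mul_inv, one_mul]
    rfl
  generalize (Matrix.det (1 + (Polynomial.X : Polynomial ℂ) •
    (Ring.inverse (W x) * H).map Polynomial.C)).divX.divX = p at h5
  have h6 : HasDerivAt (fun t : ℝ => (t : ℂ)) 1 0 := ofRealCLM.hasDerivAt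
  have h7 := ((((h6.const_mul (Ring.inverse (W x) * H).trace).const_add 1).add
    ((p.hasDerivAt ((0 : ℝ) : ℂ)).comp_ofReal.mul (h6.pow 2))).const_mul (W x).det)
  refine (h7.congr_deriv (by simp)).congr_of_eventuallyEq (Filter.Eventually.of_forall h5)

lemma exists_winding {W : ℝ → Matrix (Fin m) (Fin m) ℂ} (hW : ContDiff ℝ ∞ W)
    (hu : ∀ x, IsUnit (W x)) {l : ℝ} (h0 : W 0 = W l) :
    ∃ k : ℤ, ∫ x in (0 : ℝ)..l, (Ring.inverse (W x) * deriv W x).trace =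
      k * (2 * pi * ⅈ) := by
  have hd := hW.differentiable (by simp)
  have hc : Continuous fun x => (Ring.inverse (W x) * deriv W x).trace := by
    have h1 : Continuous fun x => Ring.inverse (W x) := continuous_iff_continuousAt.2 fun x => by
      obtain ⟨u, hu⟩ := hu x
      have := NormedRing.inverse_continuousAt u
      rw [hu] at this
      exact this.comp hd.continuous.continuousAt
    exact (h1.mul (hW.continuous_deriv (by simp))).matrix_trace
  set F : ℝ → ℂ := fun x => ∫ t in (0 : ℝ)..x, (Ring.inverse (W t) * deriv W t).trace
  have hF : ∀ x, HasDerivAt F _ x := fun x => hc.integral_hasStrictDerivAt 0 x |>.hasDerivAt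
  have hconst : ∀ x, HasDerivAt (fun x => (W x).det * exp (-F x)) 0 x := fun x => by
    refine ((hasDerivAt_det hd (hu x)).mul (hF x).neg.cexp).congr_deriv ?_
    ring
  have h1 := is_const_of_deriv_eq_zero (fun x => (hconst x).differentiableAt)
    (fun x => (hconst x).deriv) l 0
  simp only [← h0] at h1
  have h2 := mul_left_cancel₀ ((Matrix.isUnit_iff_isUnit_det _).1 (hu 0)).ne_zero h1
  rw [show F 0 = 0 from integral_same, neg_zero, exp_zero, exp_neg, inv_eq_one,
    Complex.exp_eq_one_iff] at h2
  exact h2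

end Winding

section ChernNumber

open Set hiding pi range
open Matrix intervalIntegral

attribute [local instance] Matrix.linftyOpNormedRing Matrix.linftyOpNormedAlgebra

variable {m : ℕ}

def traceL (m : ℕ) : Matrix (Fin m) (Fin m) ℂ →L[ℝ] ℂ :=
  LinearMap.toContinuousLinearMap (Matrix.traceLinearMap (Fin m) ℝ ℂ)

lemma traceL_comm (x y : Matrix (Fin m) (Fin m) ℂ) : traceL m (x * y) = traceL m (y * x) :=
  Matrix.trace_mul_comm x y

lemma trace_corner {A : Type*} [Ring A] {τ : A →+ ℂ} (hτ : ∀ x y, τ (x * y) = τ (y * x))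
    {P V S p v : A} (hP : P * P = P) (hp : p * P + P * p = p) (hVP : V * P = P * V)
    (h1 : V * S = 1) (h2 : S * V = 1) :
    τ ((P * S + (1 - P)) * (p * V + P * v - p)) = τ (P * (S * v)) := by
  have hP2 : ∀ x, P * (P * x) = P * x := fun x => by rw [← mul_assoc, hP]
  have hSP : S * P = P * S := by
    calc S * P = S * (P * V) * S := by rw [mul_assoc, mul_assoc, h1, mul_one]
      _ = P * S := by rw [← hVP, ← mul_assoc, h2, one_mul]
  have hpp : ∀ x, P * (p * (P * x)) = 0 := fun x => by
    have h : P * p * P + P * p * P = P * p * P := by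
      calc _ = P * (p * P + P * p) * P := by
            rw [mul_add, add_mul, ← mul_assoc, ← mul_assoc, hP, mul_assoc (P * p), hP]
        _ = _ := by rw [hp]
    rw [← mul_assoc, ← mul_assoc, show P * p * P = 0 by simpa using h, zero_mul]
  have hz : ∀ x, x * P = P * x → τ (P * (x * p)) = 0 := fun x hx => by
    rw [← hP2, hτ, ← mul_assoc P x p, ← hx, mul_assoc, mul_assoc, hτ, mul_assoc, mul_assoc, hpp,
      map_zero]
  have hQ : (1 - P) * p = p * P := by rw [sub_mul, one_mul, sub_eq_iff_eq_add]; exact hp.symm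
  have e : (P * S + (1 - P)) * (p * V + P * v - p) =
      P * S * p * V + P * (S * v) - P * (S * p) + (p * P * V - p * P) := by
    have e1 : (1 - P) * (P * v) = 0 := by rw [sub_mul, one_mul, hP2, sub_self]
    have e2 : P * (S * (P * v)) = P * (S * v) := by rw [← mul_assoc S, hSP, mul_assoc, hP2]
    rw [add_mul, mul_sub, mul_add, mul_sub, mul_add, e1, add_zero, ← mul_assoc (1 - P), hQ, mul_assoc P S
      (P * v), e2, mul_assoc P S p, ← mul_assoc (P * S) p V, mul_assoc P S p]
  have z1 : τ (P * S * p * V) = 0 := by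
    have := hz 1 (by rw [one_mul, mul_one])
    rw [one_mul] at this
    rw [hτ, mul_assoc P S, ← mul_assoc V, hVP, mul_assoc P V, ← mul_assoc V S, h1, one_mul, this]
  have z2 : τ (p * P * V) = 0 := by
    rw [← hP, mul_assoc, mul_assoc P P, ← hVP, ← mul_assoc P V P, ← mul_assoc, hτ, hpp, map_zero]
  have z3 : τ (p * P) = 0 := by rw [hτ]; simpa using hz 1 (by rw [one_mul, mul_one])
  rw [e, map_add, map_sub, map_add, map_sub, z1, z2, z3, hz S hSP]
  ring

lemma exists_chern_number {E : ℝ × ℝ → Matrix (Fin m) (Fin m) ℂ} (hE : ContDiff ℝ ∞ E)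
    (hEE : ∀ z, E z * E z = E z) {l b : ℝ} (hl : 0 < l) (hb : 0 ≤ b)
    (hper : ∀ y, Function.Periodic (fun x => E (x, y)) l) (hperb : ∀ x, E (x, 0) = E (x, b)) :
    ∃ k : ℤ, ∫ x in (0 : ℝ)..l, ∫ y in (0 : ℝ)..b, curv (traceL m) E (x, y) =
      (2 * pi * ⅈ) * k := by
  have : CompleteSpace (Matrix (Fin m) (Fin m) ℂ) := FiniteDimensional.complete ℝ _
  obtain ⟨V, hV, hV0, hVu, hVE, hint⟩ := linked traceL_comm hE hEE hl hper hb
  set P : ℝ → Matrix (Fin m) (Fin m) ℂ := fun x => E (x, 0) with hPdef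
  have hP : ContDiff ℝ ∞ P := hE.comp (contDiff_id.prodMk contDiff_const)
  have hPP : ∀ x, P x * P x = P x := fun x => hEE _
  have hVP : ∀ x, V x * P x = P x * V x := fun x => (hVE x).trans (by rw [← hperb])
  let W (x : ℝ) := P x * V x + (1 - P x)
  have hW : ContDiff ℝ ∞ W := (hP.mul hV).add (contDiff_const.sub hP)
  have dP := hP.differentiable (by simp)
  have dV := hV.differentiable (by simp)
  have hinv : ∀ x, W x * (P x * Ring.inverse (V x) + (1 - P x)) = 1 := fun x => by
    have h1 := Ring.mul_inverse_cancel _ (hVu x)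
    have h2 := hPP x
    have h3 := hVP x
    simp only [W]
    generalize Ring.inverse (V x) = S at *
    have e1 : P x * V x * (P x * S) = P x := by
      rw [← h3, mul_assoc, ← mul_assoc (P x) (P x), h2, ← mul_assoc, h3, mul_assoc, h1, mul_one]
    have e2 : P x * V x * (1 - P x) = 0 := by
      rw [mul_sub, mul_one, mul_assoc, h3, ← mul_assoc, h2, sub_self]
    have e3 : (1 - P x) * (P x * S) = 0 := by rw [← mul_assoc, sub_mul, one_mul, h2, sub_self, zero_mul]
    have e4 : (1 - P x) * (1 - P x) = 1 - P x := by rw [mul_sub, sub_mul 1 (P x) (P x), h2]; simp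
    rw [add_mul, mul_add, mul_add, e1, e2, e3, e4]
    simp
  have hinv' : ∀ x, (P x * Ring.inverse (V x) + (1 - P x)) * W x = 1 := fun x =>
    mul_eq_one_comm.1 (hinv x)
  have hWu : ∀ x, IsUnit (W x) := fun x => ⟨⟨_, _, hinv x, hinv' x⟩, rfl⟩
  have hWi : ∀ x, Ring.inverse (W x) = P x * Ring.inverse (V x) + (1 - P x) := fun x =>
    Ring.inverse_unit (⟨_, _, hinv x, hinv' x⟩ : (Matrix (Fin m) (Fin m) ℂ)ˣ)
  have dmul : ∀ {f g : ℝ → Matrix (Fin m) (Fin m) ℂ} (_ : Differentiable ℝ f) (_ : Differentiable ℝ g) x,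
      HasDerivAt (fun x => f x * g x) (deriv f x * g x + f x * deriv g x) x := fun hf hg x =>
    (hf x).hasDerivAt.mul (hg x).hasDerivAt
  have hW' : ∀ x, deriv W x = deriv P x * V x + P x * deriv V x - deriv P x := fun x =>
    (((dmul dP dV x).add ((dP x).hasDerivAt.const_sub 1)).congr_deriv (sub_eq_add_neg _ _).symm).deriv
  have hP0 : P 0 = P l := by simpa using (hper 0 0).symm
  obtain ⟨k, hk⟩ := exists_winding hW hWu (l := l) (by simp only [W, hP0, hV0])
  refine ⟨-k, hint.trans ?_⟩
  have h : ∀ x, connForm (traceL m) P V x = (Ring.inverse (W x) * deriv W x).trace := fun x => by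
    rw [hWi, hW']
    refine (trace_corner (τ := (traceL m).toLinearMap.toAddMonoidHom) traceL_comm (hPP x) ?_ (hVP x)
      (Ring.mul_inverse_cancel _ (hVu x)) (Ring.inverse_mul_cancel _ (hVu x))).symm
    have h := dmul dP dP x
    rw [show (fun x => P x * P x) = P from funext hPP] at h
    exact h.unique (dP x).hasDerivAt
  simp only [h, hk]
  push_cast
  ring

end ChernNumber

section Lattice

open Set hiding pi range
open MeasureTheory Matrix Function

attribute [local instance] Matrix.linftyOpNormedRing Matrix.linftyOpNormedAlgebra

variable {n : ℕ}

def cube (n : ℕ) : Set (Fin n → ℝ) := Icc 0 fun _ => 2 * pi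

lemma integral_average {G : (Fin n → ℝ) → ℂ} (hG : Continuous G) (a : Fin n) :
    ∫ θ in cube n, ∫ s in (0 : ℝ)..2 * pi, G (update θ a s) =
      2 * pi * ∫ θ in cube n, G θ := by
  obtain ⟨m, rfl⟩ : ∃ m, n = m + 1 := ⟨n - 1, by have := a.isLt; omega⟩
  set e : ℝ × (Fin m → ℝ) ≃ᵐ (Fin (m + 1) → ℝ) := (MeasurableEquiv.piFinSuccAbove (fun _ => ℝ) a).symm
  have hem : MeasurePreserving e :=
    (volume_preserving_piFinSuccAbove (fun _ : Fin (m + 1) => ℝ) a).symm _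
  have heπ : e ⁻¹' cube (m + 1) = Icc 0 (2 * pi) ×ˢ cube m :=
    ((Fin.insertNthOrderIso (fun _ => ℝ) a).preimage_Icc _ _).trans (Icc_prod_eq _ _)
  have he : ∀ p, e p = a.insertNth p.1 p.2 := fun p => rfl
  have hcube : IsCompact (cube m) := isCompact_Icc
  have hec : Continuous fun p : ℝ × (Fin m → ℝ) => G (a.insertNth p.1 p.2) :=
    hG.comp (Continuous.finInsertNth (A := fun _ => ℝ) a continuous_fst continuous_snd)
  have hc : Continuous fun y => ∫ s in (0 : ℝ)..2 * pi, G (a.insertNth s y) :=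
    intervalIntegral.continuous_parametric_intervalIntegral_of_continuous'
      (f := fun y s => G (a.insertNth s y)) (hec.comp continuous_swap) 0 _
  have hset : ∀ F : (Fin (m + 1) → ℝ) → ℂ, (Continuous fun p : ℝ × (Fin m → ℝ) => F (e p)) →
      ∫ θ in cube (m + 1), F θ = ∫ y in cube m, ∫ x in (0 : ℝ)..2 * pi, F (e (x, y)) := by
    intro F hF
    rw [← hem.map_eq, setIntegral_map_equiv, heπ, Measure.volume_eq_prod, ← Measure.prod_restrict,
      integral_prod_symm]
    · simp only [intervalIntegral.integral_of_le Real.two_pi_pos.le, integral_Icc_eq_integral_Ioc]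
    · rw [Measure.prod_restrict]
      exact hF.continuousOn.integrableOn_compact (isCompact_Icc.prod hcube)
  rw [hset G hec, hset _ (by
    simpa only [he, Fin.update_insertNth] using! hc.comp continuous_snd),
    ← integral_const_mul]
  simp only [he, Fin.update_insertNth, intervalIntegral.integral_const]
  simp

lemma ex_const_int {X : Type*} [TopologicalSpace X] [PreconnectedSpace X] [Nonempty X]
    {f : X → ℂ} (hf : Continuous f) {c : ℂ} (hc : c ≠ 0) (h : ∀ x, ∃ k : ℤ, f x = c * k) :
    ∃ k : ℤ, ∀ x, f x = c * k := by
  choose k hk using h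
  have hk' : Continuous k := Int.isClosedEmbedding_coe_real.isEmbedding.continuous_iff.2 (by
    have : ((↑) ∘ k : X → ℝ) = fun x => (c⁻¹ * f x).re := by
      funext x; simp [hk, hc]
    rw [this]
    fun_prop)
  obtain ⟨x₀⟩ := ‹Nonempty X›
  exact ⟨k x₀, fun x => by rw [hk, PreconnectedSpace.constant ‹_› hk' (x := x) (y := x₀)]⟩

lemma exists_trace_eq {m : ℕ} {M : Matrix (Fin m) (Fin m) ℂ} (h : M * M = M) :
    ∃ k : ℤ, M.trace = 1 * k := by
  have h1 : IsIdempotentElem M.toLin' := by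
    rw [IsIdempotentElem, Module.End.mul_eq_comp, ← Matrix.toLin'_mul, h]
  exact ⟨_, by rw [← Matrix.trace_toLin'_eq,
    (LinearMap.IsIdempotentElem.isProj_range _ h1).trace, one_mul, Int.cast_natCast]⟩

lemma volume_cube : (volume.real (cube n) : ℂ) = (2 * pi) ^ n := by
  have : volume.real (cube n) = (2 * pi) ^ n := by
    rw [Measure.real, cube, Real.volume_Icc_pi_toReal (a := 0) fun _ => Real.two_pi_pos.le]
    simp
  rw [this]; push_cast; rfl

namespace SmoothIdempotent

variable (P : SmoothIdempotent n)

lemma cd_onTorus : ContDiff ℝ ∞ P.onTorus := by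
  have h : ∀ a b, ContDiff ℝ ∞ fun θ => P.onTorus θ a b := fun a b =>
    contDiffOn_univ.1 ((P.smooth a b).comp (s := univ) (contDiffOn_univ.2 (contDiff_pi.2 fun i =>
      (contDiff_exp (𝕜 := ℝ)).comp (((ofRealCLM.contDiff).comp
        (contDiff_apply ℝ ℝ i)).mul contDiff_const))) fun _ _ _ => exp_ne_zero _)
  have h2 : P.onTorus = fun θ => ∑ i, ∑ j, P.onTorus θ i j • Matrix.single i j (1 : ℂ) := by
    funext θ
    conv_lhs => rw [matrix_eq_sum_single (P.onTorus θ)]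
    simp [Matrix.smul_single]
  rw [h2]
  exact ContDiff.sum fun i _ => ContDiff.sum fun j _ => (h i j).smul contDiff_const

lemma onTorus_idem (θ : Fin n → ℝ) : P.onTorus θ * P.onTorus θ = P.onTorus θ :=
  P.idem _ fun _ => exp_ne_zero _

lemma deriv_eq (j : Fin n) (θ : Fin n → ℝ) :
    P.deriv j θ = (-ⅈ) • fderiv ℝ P.onTorus θ (Pi.single j 1) := by
  ext a b
  have h := (LinearMap.toContinuousLinearMap (Matrix.entryLinearMap ℝ ℂ a b)).hasFDerivAt.comp θ
    (P.cd_onTorus.differentiable (by simp) θ).hasFDerivAt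
  exact congrArg (-ⅈ * ·) (DFunLike.congr_fun h.fderiv (Pi.single j 1))

def plane (a b : Fin n) (θ : Fin n → ℝ) (z : ℝ × ℝ) : Matrix (Fin P.size) (Fin P.size) ℂ :=
  P.onTorus (update (update θ a z.1) b z.2)

lemma hasFDerivAt_update {a b : Fin n} (hab : a ≠ b) (θ : Fin n → ℝ) (z : ℝ × ℝ) :
    HasFDerivAt (fun z : ℝ × ℝ => update (update θ a z.1) b z.2)
      ((ContinuousLinearMap.fst ℝ ℝ ℝ).smulRight (Pi.single a 1 : Fin n → ℝ) +
        (ContinuousLinearMap.snd ℝ ℝ ℝ).smulRight (Pi.single b 1 : Fin n → ℝ)) z := by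
  have h : (fun z : ℝ × ℝ => update (update θ a z.1) b z.2) = fun z => update (update θ a 0) b 0 +
      (z.1 • (Pi.single a 1 : Fin n → ℝ) + z.2 • (Pi.single b 1 : Fin n → ℝ)) := by
    funext z i
    by_cases hb : i = b
    · subst hb; simp [hab.symm]
    · by_cases ha : i = a
      · subst ha; simp [hb]
      · simp [ha, hb]
  rw [h]
  exact ((hasFDerivAt_fst.smul_const _).add (hasFDerivAt_snd.smul_const _)).const_add _

lemma contDiff_plane (a b : Fin n) (θ : Fin n → ℝ) : ContDiff ℝ ∞ (P.plane a b θ) :=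
  P.cd_onTorus.comp (contDiff_pi.2 fun i => by
    by_cases hb : i = b
    · subst hb; simpa using contDiff_snd
    · by_cases ha : i = a
      · subst ha; simpa [hb] using contDiff_fst
      · simpa [ha, hb] using contDiff_const)

lemma pd_plane {a b : Fin n} (hab : a ≠ b) (θ : Fin n → ℝ) (v z : ℝ × ℝ) :
    pd v (P.plane a b θ) z = fderiv ℝ P.onTorus (update (update θ a z.1) b z.2)
      (v.1 • Pi.single a 1 + v.2 • Pi.single b 1) := by
  have h := (P.cd_onTorus.differentiable (by simp) _).hasFDerivAt.comp z
    (hasFDerivAt_update hab θ z)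
  exact DFunLike.congr_fun h.fderiv v

lemma chernForm_one (I : Fin (2 * 1) → Fin n) (θ : Fin n → ℝ) : P.chernForm 1 I θ =
    (P.onTorus θ * (P.deriv (I 0) θ * P.deriv (I 1) θ - P.deriv (I 1) θ * P.deriv (I 0) θ)).trace := by
  have h : (Finset.univ : Finset (Equiv.Perm (Fin (2 * 1)))) = {1, Equiv.swap 0 1} := by decide
  have hs : (1 : Equiv.Perm (Fin (2 * 1))) ≠ Equiv.swap 0 1 := by decide
  rw [chernForm, h, Finset.sum_pair hs, Equiv.Perm.sign_swap (by decide)]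
  simp [mul_add, List.ofFn_succ, sub_eq_add_neg]

lemma chernForm_plane {I : Fin (2 * 1) → Fin n} (hI : I 0 ≠ I 1) (θ : Fin n → ℝ) (x y : ℝ) :
    P.chernForm 1 I (update (update θ (I 0) x) (I 1) y) =
      -curv (traceL P.size) (P.plane (I 0) (I 1) θ) (x, y) := by
  simp only [chernForm_one, curv, P.pd_plane hI, deriv_eq, one_smul, zero_smul, add_zero, zero_add]
  change _ = -Matrix.trace _
  rw [← Matrix.trace_neg, ← mul_neg]
  simp only [smul_mul_smul_comm, neg_mul_neg, Complex.I_mul_I, neg_smul, one_smul, plane]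
  congr 2
  abel

lemma cont_chern_one (I : Fin (2 * 1) → Fin n) : Continuous (P.chernForm 1 I) := by
  have h1 := P.cd_onTorus.continuous
  have h2 : ∀ j, Continuous fun θ => fderiv ℝ P.onTorus θ (Pi.single j 1) := fun j =>
    ((P.cd_onTorus.fderiv_right (m := ∞) (by simp)).clm_apply contDiff_const).continuous
  have : P.chernForm 1 I = fun θ => traceL P.size (P.onTorus θ *
      (P.deriv (I 0) θ * P.deriv (I 1) θ - P.deriv (I 1) θ * P.deriv (I 0) θ)) :=
    funext fun θ => P.chernForm_one I θ
  rw [this]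
  simp only [deriv_eq]
  have := h2 (I 0)
  have := h2 (I 1)
  fun_prop

lemma chern_one {I : Fin (2 * 1) → Fin n} (hI : I 0 ≠ I 1) {c : ℂ}
    (h : ∀ θ, ∫ x in (0 : ℝ)..2 * pi, ∫ y in (0 : ℝ)..2 * pi,
      curv (traceL P.size) (P.plane (I 0) (I 1) θ) (x, y) = c) :
    P.chern 1 I = -((2 * pi : ℂ) ^ 2)⁻¹ * c := by
  have hc := P.cont_chern_one I
  have hpi : (2 * pi : ℂ) ≠ 0 := by simp [Real.pi_ne_zero]
  have hc2 : Continuous fun θ => ∫ y in (0 : ℝ)..2 * pi, P.chernForm 1 I (update θ (I 1) y) :=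
    intervalIntegral.continuous_parametric_intervalIntegral_of_continuous'
      (f := fun θ y => P.chernForm 1 I (update θ (I 1) y))
      (hc.comp (continuous_fst.update (I 1) continuous_snd)) 0 _
  have e1 := integral_average hc (I 1)
  have e2 := integral_average hc2 (I 0)
  simp only [P.chernForm_plane hI, intervalIntegral.integral_neg, h, setIntegral_const] at e2
  rw [e1, Complex.real_smul, volume_cube] at e2
  have e3 : ∫ θ in cube n, P.chernForm 1 I θ = ((2 * pi : ℂ) ^ 2)⁻¹ * ((2 * pi) ^ n * -c) := by
    rw [e2]; field_simp
  change ((2 * pi : ℝ) : ℂ)⁻¹ ^ n * ∫ θ in cube n, P.chernForm 1 I θ = _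
  rw [e3]
  push_cast
  rw [inv_pow]
  field_simp

lemma chern_zero {I : Fin (2 * 0) → Fin n} {c : ℂ} (h : ∀ θ, (P.onTorus θ).trace = c) :
    P.chern 0 I = c := by
  have h0 : ∀ θ, P.chernForm 0 I θ = c := fun θ => by
    have hu : (Finset.univ : Finset (Equiv.Perm (Fin (2 * 0)))) = {1} := by decide
    rw [chernForm, hu, Finset.sum_singleton]
    simp [h]
  have hpi : (2 * pi : ℂ) ≠ 0 := by simp [Real.pi_ne_zero]
  change ((2 * pi : ℝ) : ℂ)⁻¹ ^ n * ∫ θ in cube n, P.chernForm 0 I θ = _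
  simp only [h0, setIntegral_const]
  rw [Complex.real_smul, volume_cube]
  push_cast
  rw [inv_pow]
  field_simp

lemma exists_chern_zero (I : Fin (2 * 0) → Fin n) : ∃ k : ℤ, P.chern 0 I = k := by
  obtain ⟨k, hk⟩ := ex_const_int
    ((traceL P.size).continuous.comp P.cd_onTorus.continuous) one_ne_zero
    fun θ => exists_trace_eq (P.onTorus_idem θ)
  exact ⟨k, P.chern_zero fun θ => (hk θ).trans (one_mul _)⟩

lemma periodic_onTorus (θ : Fin n → ℝ) (a : Fin n) (x : ℝ) :
    P.onTorus (update θ a (x + 2 * pi)) = P.onTorus (update θ a x) := by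
  refine congrArg P.E (funext fun i => ?_)
  by_cases hi : i = a
  · subst hi
    simp [add_mul, exp_add]
  · simp [hi]

lemma exists_chern_one (I : Fin (2 * 1) → Fin n) :
    ∃ k : ℤ, P.chern 1 I = ϖ⁻¹ * k := by
  have hpi : (2 * pi : ℂ) ≠ 0 := by simp [Real.pi_ne_zero]
  by_cases hI : I 0 = I 1
  · refine ⟨0, ?_⟩
    have h0 : ∀ θ, P.chernForm 1 I θ = 0 := fun θ => by rw [chernForm_one, hI]; simp
    simp [chern, h0]
  · have hc : Continuous fun θ => ∫ x in (0 : ℝ)..2 * pi, ∫ y in (0 : ℝ)..2 * pi,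
        P.chernForm 1 I (update (update θ (I 0) x) (I 1) y) := by
      have := P.cont_chern_one I
      refine intervalIntegral.continuous_parametric_intervalIntegral_of_continuous' (f := fun θ x =>
        ∫ y in (0 : ℝ)..2 * pi, P.chernForm 1 I (update (update θ (I 0) x) (I 1) y)) ?_ 0 _
      refine intervalIntegral.continuous_parametric_intervalIntegral_of_continuous'
        (f := fun (p : (Fin n → ℝ) × ℝ) y => P.chernForm 1 I (update (update p.1 (I 0) p.2) (I 1) y)) ?_ 0 _
      exact this.comp (((continuous_fst.comp continuous_fst).update _
        (continuous_snd.comp continuous_fst)).update _ continuous_snd)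
    simp only [P.chernForm_plane hI, intervalIntegral.integral_neg] at hc
    obtain ⟨k, hk⟩ := ex_const_int (neg_neg (fun _ => _ : _ → ℂ) ▸ hc.neg) Complex.two_pi_I_ne_zero fun θ =>
      exists_chern_number (P.contDiff_plane (I 0) (I 1) θ) (fun z => P.onTorus_idem _) Real.two_pi_pos
        Real.two_pi_pos.le (fun y x => by
          simp only [plane, update_comm hI, P.periodic_onTorus]) (fun x => by
          have := P.periodic_onTorus (update θ (I 0) x) (I 1) 0
          rw [zero_add] at this
          exact this.symm)
    refine ⟨k, (P.chern_one hI hk).trans ?_⟩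
    field_simp
    linear_combination (-(k : ℂ)) * Complex.I_sq

end SmoothIdempotent

lemma chernLattice_zero {z : Coh n} (hz : z ∈ chernLattice n) (I : Fin (2 * 0) → Fin n) :
    ∃ k : ℤ, z 0 I = k := by
  induction hz using AddSubgroup.closure_induction with
  | mem z hz => obtain ⟨P, rfl⟩ := hz; exact P.exists_chern_zero I
  | zero => exact ⟨0, by simp⟩
  | add x y _ _ hx hy =>
    obtain ⟨a, ha⟩ := hx
    obtain ⟨b, hb⟩ := hy
    exact ⟨a + b, by simp [ha, hb]⟩
  | neg x _ hx => obtain ⟨a, ha⟩ := hx; exact ⟨-a, by simp [ha]⟩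

lemma chernLattice_one {z : Coh n} (hz : z ∈ chernLattice n) (I : Fin (2 * 1) → Fin n) :
    ∃ k : ℤ, z 1 I = ϖ⁻¹ * k := by
  induction hz using AddSubgroup.closure_induction with
  | mem z hz => obtain ⟨P, rfl⟩ := hz; exact P.exists_chern_one I
  | zero => exact ⟨0, by simp⟩
  | add x y _ _ hx hy =>
    obtain ⟨a, ha⟩ := hx
    obtain ⟨b, hb⟩ := hy
    exact ⟨a + b, by simp [ha, hb, mul_add]⟩
  | neg x _ hx => obtain ⟨a, ha⟩ := hx; exact ⟨-a, by simp [ha]⟩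

end Lattice

section Generators

open Set hiding pi range
open Matrix Function

attribute [local instance] Matrix.linftyOpNormedRing Matrix.linftyOpNormedAlgebra

variable {n : ℕ}

namespace SmoothIdempotent

variable (P : SmoothIdempotent n) {p : ℕ}

lemma chernForm_comp_perm (I : Fin (2 * p) → Fin n) (σ : Equiv.Perm (Fin (2 * p)))
    (θ : Fin n → ℝ) :
    P.chernForm p (I ∘ σ) θ = ((Equiv.Perm.sign σ : ℤ) : ℂ) * P.chernForm p I θ := by
  have hs : ((Equiv.Perm.sign σ : ℤ) : ℂ) * ((Equiv.Perm.sign σ : ℤ) : ℂ) = 1 := by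
    rw [← Int.cast_mul, ← Units.val_mul, Int.units_mul_self, Units.val_one, Int.cast_one]
  rw [chernForm, chernForm, mul_left_comm]
  refine congrArg (fun c : ℂ => (p.factorial : ℂ)⁻¹ * c) ?_
  rw [mul_sum]
  refine Fintype.sum_equiv (Equiv.mulLeft σ) _ _ fun π => ?_
  rw [Equiv.coe_mulLeft, Equiv.Perm.sign_mul, Units.val_mul, Int.cast_mul, ← mul_assoc, ← mul_assoc, hs,
    one_mul]
  rfl

lemma chern_comp_perm (I : Fin (2 * p) → Fin n) (σ : Equiv.Perm (Fin (2 * p))) :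
    P.chern p (I ∘ σ) = ((Equiv.Perm.sign σ : ℤ) : ℂ) * P.chern p I := by
  simp only [chern, chernForm_comp_perm, MeasureTheory.integral_const_mul]
  exact mul_left_comm _ _ _

lemma chern_not_inj {I : Fin (2 * p) → Fin n} (hI : ¬Injective I) (θ : Fin n → ℝ) :
    P.chernForm p I θ = 0 := by
  obtain ⟨a, b, hab, hne⟩ : ∃ a b, I a = I b ∧ a ≠ b := by simpa [Injective] using hI
  have h := P.chernForm_comp_perm I (Equiv.swap a b) θ
  have hc : I ∘ Equiv.swap a b = I := funext fun k => by
    by_cases ha : k = a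
    · simp [ha, hab]
    · by_cases hb : k = b
      · simp [hb, hab]
      · simp [Equiv.swap_apply_of_ne_of_ne ha hb]
  rw [hc, Equiv.Perm.sign_swap hne] at h
  push_cast at h
  linear_combination h / 2

lemma chernForm_eq_zero {I : Fin (2 * p) → Fin n} (k : Fin (2 * p)) {θ : Fin n → ℝ}
    (h : P.deriv (I k) θ = 0) : P.chernForm p I θ = 0 := by
  have h0 : ∀ π : Equiv.Perm (Fin (2 * p)), (List.ofFn fun j => P.deriv (I (π j)) θ).prod = 0 := fun π =>
    List.prod_eq_zero (List.mem_ofFn.2 ⟨π.symm k, by simpa using h⟩)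
  simp [chernForm, h0]

lemma deriv_eq_zero {k : Fin n}
    (h : ∀ (θ : Fin n → ℝ) (t : ℝ), P.onTorus (θ + t • (Pi.single k 1 : Fin n → ℝ)) = P.onTorus θ)
    (θ : Fin n → ℝ) : P.deriv k θ = 0 := by
  have h1 : HasDerivAt (fun t : ℝ => P.onTorus (θ + t • (Pi.single k 1 : Fin n → ℝ)))
      (fderiv ℝ P.onTorus θ (Pi.single k 1)) 0 := by
    refine HasFDerivAt.comp_hasDerivAt (l := P.onTorus)
      (f := fun t : ℝ => θ + t • (Pi.single k 1 : Fin n → ℝ)) 0 ?_ ?_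
    · rw [zero_smul, add_zero]
      exact (P.cd_onTorus.differentiable (by simp) θ).hasFDerivAt
    · have := ((hasDerivAt_id (0 : ℝ)).smul_const (Pi.single k 1 : Fin n → ℝ)).const_add θ
      rwa [one_smul] at this
  simp only [h] at h1
  rw [deriv_eq, h1.unique (hasDerivAt_const _ _), smul_zero]

def trivial (n : ℕ) : SmoothIdempotent n where
  size := 1
  E _ := 1
  smooth _ _ := contDiffOn_const
  idem _ _ := mul_one 1

lemma chern_trivial : (trivial n).chern = cohOne n := by
  funext p I
  cases p with
  | zero => exact chern_zero _ fun θ => Matrix.trace_one.trans (by simp [cohOne]; rfl)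
  | succ p =>
    have h : ∀ θ, (trivial n).chernForm (p + 1) I θ = 0 := fun θ =>
      chernForm_eq_zero _ ⟨0, by omega⟩ (deriv_eq_zero _ (fun _ _ => rfl) θ)
    simp [chern, h, cohOne]

end SmoothIdempotent

lemma cohOne_mem_chern : cohOne n ∈ chernLattice n :=
  AddSubgroup.subset_closure ⟨_, SmoothIdempotent.chern_trivial⟩

def proj₁ : Matrix (Fin 2) (Fin 2) ℂ := !![1, 0; 0, 0]

def proj₂ : Matrix (Fin 2) (Fin 2) ℂ := !![0, 0; 0, 1]

def rotation (φ : ℝ) : Matrix (Fin 2) (Fin 2) ℂ :=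
  Complex.cos φ • 1 + Complex.sin φ • !![0, -1; 1, 0]

/-- The clutching matrix of the Bott bundle. -/
def clutch (φ : ℝ) (g : ℂ) : Matrix (Fin 2) (Fin 2) ℂ :=
  rotation φ * (proj₁ + g • proj₂) * rotation (-φ)

/-- The Bott idempotent. -/
def bott (φ : ℝ) (g : ℂ) : Matrix (Fin 2) (Fin 2) ℂ := clutch φ g * proj₁ * clutch φ g⁻¹

lemma rotation_mul (φ : ℝ) : rotation (-φ) * rotation φ = 1 := by
  have h := Complex.cos_sq_add_sin_sq φ
  ext a b
  fin_cases a <;> fin_cases b <;> simp [rotation, Matrix.mul_apply] <;>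
    first | ring1 | linear_combination h

lemma proj₁_mul : proj₁ * proj₁ = proj₁ := by
  ext a b
  fin_cases a <;> fin_cases b <;> simp [proj₁, Matrix.mul_apply]

lemma clutch_mul (φ : ℝ) {g h : ℂ} (hg : g * h = 1) : clutch φ g * clutch φ h = 1 := by
  have e : (proj₁ + g • proj₂) * (proj₁ + h • proj₂) = 1 := by
    ext a b
    fin_cases a <;> fin_cases b <;> simp [proj₁, proj₂, Matrix.mul_apply, hg]
  rw [clutch, clutch, mul_assoc, ← mul_assoc (rotation (-φ)), ← mul_assoc (rotation (-φ)), rotation_mul,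
    one_mul, ← mul_assoc, mul_assoc (rotation φ), e, mul_one]
  simpa using rotation_mul (-φ)

lemma bott_mul {φ : ℝ} {g : ℂ} (hg : g ≠ 0) : bott φ g * bott φ g = bott φ g := by
  rw [bott, mul_assoc, ← mul_assoc (clutch φ g⁻¹), ← mul_assoc (clutch φ g⁻¹),
    clutch_mul φ (inv_mul_cancel₀ hg), one_mul, ← mul_assoc, mul_assoc (clutch φ g), proj₁_mul]

lemma clutch_zero (g : ℂ) : clutch 0 g = proj₁ + g • proj₂ := by simp [clutch, rotation]

lemma clutch_half (g : ℂ) : clutch (pi / 2) g = proj₂ + g • proj₁ := by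
  ext a b
  fin_cases a <;> fin_cases b <;> simp [clutch, rotation, proj₁, proj₂, Matrix.mul_apply]

lemma bott_flat {φ : ℝ} (h : φ = 0 ∨ φ = pi / 2) {g : ℂ} (hg : g ≠ 0) : bott φ g = proj₁ := by
  rcases h with rfl | rfl
  · rw [bott, clutch_zero, clutch_zero]
    ext a b
    fin_cases a <;> fin_cases b <;> simp [proj₁, proj₂, Matrix.mul_apply]
  · rw [bott, clutch_half, clutch_half]
    ext a b
    fin_cases a <;> fin_cases b <;> simp [proj₁, proj₂, Matrix.mul_apply, hg]

lemma cd_rotM : ContDiff ℝ ∞ rotation := by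
  have h : ContDiff ℝ ∞ fun φ : ℝ => (φ : ℂ) := ofRealCLM.contDiff
  exact ((Complex.contDiff_cos.restrict_scalars ℝ |>.comp h).smul contDiff_const).add
    ((Complex.contDiff_sin.restrict_scalars ℝ |>.comp h).smul contDiff_const)

lemma contDiffAt_clutch {E : Type*} [NormedAddCommGroup E] [NormedSpace ℝ E] {φ : E → ℝ} {g : E → ℂ}
    {x : E} (hφ : ContDiffAt ℝ ∞ φ x) (hg : ContDiffAt ℝ ∞ g x) :
    ContDiffAt ℝ ∞ (fun x => clutch (φ x) (g x)) x :=
  ((cd_rotM.contDiffAt.comp x hφ).mul (contDiffAt_const.add (hg.smul contDiffAt_const))).mul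
    (cd_rotM.contDiffAt.comp x hφ.neg)

def ramp (t : ℝ) : ℝ := pi / 2 * Real.smoothTransition (t + 1 / 2)

lemma contDiff_ramp : ContDiff ℝ ∞ ramp :=
  contDiff_const.mul (Real.smoothTransition.contDiff.comp (contDiff_id.add contDiff_const))

lemma ramp_of_le {t : ℝ} (h : t ≤ -1) : ramp t = 0 := by
  rw [ramp, Real.smoothTransition.zero_of_nonpos (by linarith), mul_zero]

lemma ramp_of_ge {t : ℝ} (h : 1 ≤ t) : ramp t = pi / 2 := by
  rw [ramp, Real.smoothTransition.one_of_one_le (by linarith), mul_one]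

lemma ramp_flat {t : ℝ} (h : 1 ≤ |t|) : ramp t = 0 ∨ ramp t = pi / 2 :=
  (le_abs'.1 h).imp ramp_of_le ramp_of_ge

lemma contDiffAt_bott {i j : Fin n} {x : Fin n → ℂ} (hx : ∀ i, x i ≠ 0) :
    ContDiffAt ℝ ∞ (fun x : Fin n → ℂ => bott (ramp (arg (-x j))) (x i)) x := by
  have hi : ContDiffAt ℝ ∞ (fun x : Fin n → ℂ => x i) x := (contDiff_apply ℝ ℂ i).contDiffAt
  have hj : ContDiffAt ℝ ∞ (fun x : Fin n → ℂ => -x j) x := (contDiff_apply ℝ ℂ j).neg.contDiffAt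
  by_cases hs : -x j ∈ Complex.slitPlane
  · have harg : ContDiffAt ℝ ∞ (fun x : Fin n → ℂ => arg (-x j)) x := by
      simp only [← Complex.log_im]
      exact Complex.imCLM.contDiff.contDiffAt.comp x
        (((Complex.contDiffAt_log hs).restrict_scalars ℝ).comp x hj)
    have ht := contDiff_ramp.contDiffAt.comp x harg
    exact ((contDiffAt_clutch ht hi).mul contDiffAt_const).mul (contDiffAt_clutch ht (hi.inv (hx i)))
  · refine (contDiffAt_const (c := proj₁)).congr_of_eventuallyEq ?_
    have hre : (-x j).re < 0 := by
      rw [Complex.mem_slitPlane_iff, not_or, not_lt, not_ne_iff] at hs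
      exact lt_of_le_of_ne hs.1 fun h => hx j (neg_eq_zero.1 (Complex.ext h hs.2))
    have h1 : ∀ᶠ y in nhds x, (-y j).re < 0 :=
      (show Continuous fun y : Fin n → ℂ => (-y j).re by fun_prop).continuousAt.eventually (gt_mem_nhds hre)
    have h2 : ∀ᶠ y in nhds x, y i ≠ 0 := (continuous_apply i).continuousAt.eventually_ne (hx i)
    filter_upwards [h1, h2] with y hy hy2
    refine bott_flat (ramp_flat ?_) hy2
    by_contra h
    push_neg at h
    have := Complex.abs_arg_lt_pi_div_two_iff.1 (h.trans (by linarith [Real.pi_gt_three]))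
    rcases this with h | h
    · exact absurd h hy.le.not_gt
    · rw [h] at hy; simp at hy

namespace SmoothIdempotent

def bottE (i j : Fin n) : SmoothIdempotent n where
  size := 2
  E x := bott (ramp (arg (-x j))) (x i)
  smooth a b x hx := ((LinearMap.toContinuousLinearMap
    (Matrix.entryLinearMap ℝ ℂ a b)).contDiff.contDiffAt.comp x (contDiffAt_bott hx)).contDiffWithinAt
  idem x hx := bott_mul (hx i)

variable {i j : Fin n}

lemma onTorus_bottE (θ : Fin n → ℝ) : (bottE i j).onTorus θ =
    bott (ramp (arg (-exp (θ j * ⅈ)))) (exp (θ i * ⅈ)) := rfl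

lemma bott_angle {y : ℝ} (hy : y ∈ Ioo (0 - 1) (2 * pi + 1)) {g : ℂ} (hg : g ≠ 0) :
    bott (ramp (arg (-exp (y * ⅈ)))) g = bott (ramp (y - pi)) g := by
  have hπ := Real.pi_gt_three
  have e : ∀ k : ℤ, y - pi + k * (2 * pi) ∈ Ioc (-pi) pi →
      arg (-exp (y * ⅈ)) = y - pi + k * (2 * pi) := fun k hk => by
    have h : -exp (y * ⅈ) =
        exp ((y - pi + k * (2 * pi) : ℝ) * ⅈ) := by
      push_cast
      rw [show ((y : ℂ) - pi + k * (2 * pi)) * ⅈ =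
        y * ⅈ - pi * ⅈ + k * (2 * pi * ⅈ) by ring, exp_add,
        Complex.exp_int_mul_two_pi_mul_I, Complex.exp_sub, Complex.exp_pi_mul_I, mul_one, div_neg, div_one]
    rw [h, Complex.exp_mul_I, Complex.arg_cos_add_sin_mul_I hk]
  rcases lt_or_ge 0 y with h0 | h0
  · rcases le_or_gt y (2 * pi) with h1 | h1
    · rw [e 0 ⟨by push_cast; linarith, by push_cast; linarith⟩]; simp
    · rw [e (-1) ⟨by push_cast; linarith [hy.2], by push_cast; linarith [hy.2]⟩,
        bott_flat (ramp_flat _) hg, bott_flat (ramp_flat _) hg]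
      · exact le_abs.2 (Or.inl (by linarith))
      · exact le_abs.2 (Or.inr (by push_cast; linarith [hy.2]))
  · rw [e 1 ⟨by push_cast; linarith [hy.1], by push_cast; linarith⟩,
      bott_flat (ramp_flat _) hg, bott_flat (ramp_flat _) hg]
    · exact le_abs.2 (Or.inr (by linarith))
    · exact le_abs.2 (Or.inl (by push_cast; linarith [hy.1]))

lemma integral_curv_bott (hij : i ≠ j) (θ : Fin n → ℝ) :
    ∫ x in (0 : ℝ)..2 * pi, ∫ y in (0 : ℝ)..2 * pi,
      curv (traceL 2) ((bottE i j).plane i j θ) (x, y) = -(2 * pi * ⅈ) := by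
  have : CompleteSpace (Matrix (Fin 2) (Fin 2) ℂ) := FiniteDimensional.complete ℝ _
  let T (z : ℝ × ℝ) := clutch (ramp (z.2 - pi)) (exp (z.1 * ⅈ))
  have hg : ∀ x : ℝ, exp (x * ⅈ) ≠ 0 := fun x => exp_ne_zero _
  have hT : ContDiff ℝ ∞ T := contDiff_iff_contDiffAt.2 fun z => contDiffAt_clutch
    (contDiff_ramp.comp (contDiff_snd.sub contDiff_const)).contDiffAt
    ((contDiff_exp (𝕜 := ℝ)).comp
      ((ofRealCLM.contDiff.comp contDiff_fst).mul contDiff_const)).contDiffAt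
  have hinv : ∀ z, T z * clutch (ramp (z.2 - pi)) (exp (z.1 * ⅈ))⁻¹ = 1 := fun z =>
    clutch_mul _ (mul_inv_cancel₀ (hg _))
  have hinv' : ∀ z, clutch (ramp (z.2 - pi)) (exp (z.1 * ⅈ))⁻¹ * T z = 1 := fun z =>
    clutch_mul _ (inv_mul_cancel₀ (hg _))
  have hRi : ∀ z, Ring.inverse (T z) =
      clutch (ramp (z.2 - pi)) (exp (z.1 * ⅈ))⁻¹ := fun z =>
    Ring.inverse_unit (⟨_, _, hinv z, hinv' z⟩ : (Matrix (Fin 2) (Fin 2) ℂ)ˣ)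
  have main := transgression (traceL_comm (m := 2)) ((bottE i j).contDiff_plane i j θ) hT
    (P := fun _ => proj₁) contDiff_const (fun _ => proj₁_mul) (l := 2 * pi) (y₀ := 0)
    (y₁ := 2 * pi) Real.two_pi_pos.le Real.two_pi_pos.le (fun z _ => ⟨⟨_, _, hinv z, hinv' z⟩, rfl⟩)
    (fun x y hy => by
      have : (bottE i j).plane i j θ (x, y) =
          bott (ramp (y - pi)) (exp (x * ⅈ)) := by
        rw [← bott_angle hy (hg x), plane, onTorus_bottE]
        simp [hij]
        rfl
      rw [this, bott, mul_assoc]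
      exact (congrArg (_ * ·) (hinv' (x, y))).trans (mul_one _) |>.symm) rfl
    (fun y => by simp [T, Complex.exp_two_pi_mul_I])
  have hd : ∀ (x : ℝ) (U V : Matrix (Fin 2) (Fin 2) ℂ),
      _root_.deriv (fun x : ℝ => U + exp (x * ⅈ) • V) x =
      (exp (x * ⅈ) * ⅈ) • V := fun x U V => by
    have h1 : HasDerivAt (fun x : ℝ => exp (x * ⅈ)) (exp (x * ⅈ) * ⅈ) x := by
      have := ((ofRealCLM.hasDerivAt (x := x)).mul_const ⅈ).cexp
      simpa using this
    exact ((h1.smul_const V).const_add U).deriv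
  have t0 : ramp (0 - pi) = 0 := ramp_of_le (by linarith [Real.pi_gt_three])
  have t1 : ramp (2 * pi - pi) = pi / 2 :=
    ramp_of_ge (by linarith [Real.pi_gt_three])
  have htr : ∀ M : Matrix (Fin 2) (Fin 2) ℂ, traceL 2 M = M.trace := fun _ => rfl
  have a0 : ∀ x, traceL 2 (proj₁ * (Ring.inverse (T (x, 0)) * pd (1, 0) T (x, 0))) = 0 := fun x => by
    rw [pd_one (hT.differentiable (by simp)), hRi]
    simp only [T, t0, clutch_zero]
    erw [hd]
    rw [htr]
    simp [Matrix.trace_fin_two, Matrix.mul_apply, proj₁, proj₂]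
  have a1 : ∀ x, traceL 2 (proj₁ * (Ring.inverse (T (x, 2 * pi)) * pd (1, 0) T (x, 2 * pi))) =
      ⅈ := fun x => by
    rw [pd_one (hT.differentiable (by simp)), hRi]
    simp only [T, t1, clutch_half]
    erw [hd]
    rw [htr]
    simp [Matrix.trace_fin_two, Matrix.mul_apply, proj₁, proj₂, hg]
  refine main.trans ((congrArg₂ (· - ·) (intervalIntegral.integral_congr fun x _ => a0 x)
    (intervalIntegral.integral_congr fun x _ => a1 x)).trans ?_)
  simp

lemma chern_bottBundle (hij : i ≠ j) : (bottE i j).chern =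
    cohOne n - ϖ⁻¹ • cohTwo i j := by
  have hvan : ∀ k, k ≠ i → k ≠ j → ∀ θ, (bottE i j).deriv k θ = 0 := fun k hi hj =>
    deriv_eq_zero _ fun θ t => by
      simp [onTorus_bottE, hi.symm, hj.symm]; rfl
  have hz : ∀ p (I : Fin (2 * p) → Fin n), (∀ θ, (bottE i j).chernForm p I θ = 0) →
      (bottE i j).chern p I = 0 := fun p I h => by simp [chern, h]
  have hij1 : (bottE i j).chern 1 ![i, j] = -ϖ⁻¹ := by
    refine (chern_one _ (I := (![i, j] : Fin (2 * 1) → Fin n)) hij fun θ => integral_curv_bott hij θ).trans ?_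
    have hpi : (pi : ℂ) ≠ 0 := by simp [Real.pi_ne_zero]
    field_simp
    simp
  funext p I
  change _ = cohOne n p I - ϖ⁻¹ * cohTwo i j p I
  rcases p with _ | _ | p
  · rw [chern_zero (c := 1) _ fun θ => ?_]
    · simp [cohOne, cohTwo]
    · have h0 := exp_ne_zero (θ i * ⅈ)
      change (bott _ _).trace = 1
      rw [bott, Matrix.trace_mul_comm, ← mul_assoc, clutch_mul _ (inv_mul_cancel₀ h0), one_mul]
      simp [proj₁, Matrix.trace_fin_two]
  · by_cases hout : ∃ k, I k ≠ i ∧ I k ≠ j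
    · obtain ⟨k, h1, h2⟩ := hout
      rw [hz _ I fun θ => chernForm_eq_zero _ k (hvan _ h1 h2 θ)]
      fin_cases k <;> simp_all [cohOne, cohTwo]
    · push Not at hout
      have hI : I = ![I 0, I 1] := by funext k; fin_cases k <;> rfl
      by_cases h0 : I 0 = i <;> by_cases h1 : I 1 = i
      · rw [hz _ I fun θ => chern_not_inj _ (fun h => absurd (h (h0.trans h1.symm)) (by decide)) θ]
        simp [cohOne, cohTwo, h0, h1, hij]
      · rw [hI, hout 1 h1, h0, hij1]
        simp [cohOne, cohTwo, hij.symm]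
      · have hs : I = (![i, j] : Fin (2 * 1) → Fin n) ∘ Equiv.swap 0 1 := by
          rw [hI, hout 0 h0, h1]; funext k; fin_cases k <;> simp
        rw [hs, chern_comp_perm, hij1, Equiv.Perm.sign_swap (by decide)]
        simp [cohOne, cohTwo, hij, hij.symm]
      · rw [hz _ I fun θ => chern_not_inj _
          (fun h => absurd (h ((hout 0 h0).trans (hout 1 h1).symm)) (by decide)) θ]
        simp [cohOne, cohTwo, h0, h1]
  · rw [hz _ I fun θ => ?_]
    · simp [cohOne, cohTwo]
    · by_cases hout : ∃ k, I k ≠ i ∧ I k ≠ j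
      · obtain ⟨k, h1, h2⟩ := hout
        exact chernForm_eq_zero _ k (hvan _ h1 h2 θ)
      · push Not at hout
        refine chern_not_inj _ (fun h => ?_) θ
        have hc := Finset.card_le_card_of_injOn (s := Finset.univ) (t := {i, j}) I
          (fun k _ => by by_cases hk : I k = i <;> simp [hk]; exact hout k hk) h.injOn
        have := hc.trans Finset.card_le_two
        simp at this

end SmoothIdempotent

lemma cohTwo_mem_chern (i j : Fin n) (h : i < j) :
    ϖ⁻¹ • cohTwo i j ∈ chernLattice n := by
  have h1 : (SmoothIdempotent.bottE i j).chern ∈ chernLattice n := AddSubgroup.subset_closure ⟨_, rfl⟩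
  have h2 := sub_mem cohOne_mem_chern h1
  rwa [SmoothIdempotent.chern_bottBundle h.ne, sub_sub_cancel] at h2

end Generators

/-! ### The period map -/

section Period

variable {n : ℕ}

lemma wedge_swap (i j : Fin n) : (wedge j i : wedgeTwo n) = -wedge i j := by
  have h := AlternatingMap.map_swap (exteriorPower.ιMulti ℤ 2)
    ![(Pi.single i 1 : Γ n), Pi.single j 1] (show (0 : Fin 2) ≠ 1 by decide)
  rw [wedge, wedge, ← h]
  congr 1
  ext k
  fin_cases k <;> rfl

lemma wedge_self (i : Fin n) : (wedge i i : wedgeTwo n) = 0 :=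
  AlternatingMap.map_eq_zero_of_eq _ _ (i := 0) (j := 1) rfl (by decide)

lemma wedge_hom_ext {A : Type*} [AddCommGroup A] {f g : wedgeTwo n →+ A}
    (h : ∀ i j, i < j → f (wedge i j) = g (wedge i j)) : f = g := by
  have h' : ∀ i j, f (wedge i j) = g (wedge i j) := fun i j => by
    rcases lt_trichotomy i j with hij | rfl | hij
    · exact h i j hij
    · rw [wedge_self, map_zero, map_zero]
    · rw [wedge_swap, map_neg, map_neg, h j i hij]
  have : f.toIntLinearMap = g.toIntLinearMap := by
    refine exteriorPower.linearMap_ext ?_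
    refine (Pi.basisFun ℤ (Fin n)).ext_alternating fun v _ => ?_
    have e : (fun k => Pi.basisFun ℤ (Fin n) (v k)) =
        ![(Pi.single (v 0) 1 : Γ n), Pi.single (v 1) 1] := by
      funext k
      fin_cases k <;> simp
    rw [e]
    exact h' (v 0) (v 1)
  exact AddMonoidHom.ext fun m => LinearMap.congr_fun this m

abbrev Idx (n : ℕ) : Type := {x : Fin n × Fin n // x.1 < x.2}

lemma sum_indexPair {A : Type*} [AddCommMonoid A] (F : Fin n → Fin n → A) :
    ∑ x : Idx n, F x.1.1 x.1.2 = ∑ i, ∑ j, if i < j then F i j else 0 := by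
  rw [← Fintype.sum_prod_type' fun i j => if i < j then F i j else 0, ← Finset.sum_filter]
  exact (Finset.sum_subtype _ (fun x => by simp) fun x : Fin n × Fin n => F x.1 x.2).symm

def wc (x : Idx n) : wedgeTwo n →ₗ[ℤ] ℤ :=
  exteriorPower.alternatingMapLinearEquiv
    ((Matrix.detRowAlternating (R := ℤ) (n := Fin 2)).compLinearMap
      (LinearMap.pi ![LinearMap.proj x.1.1, LinearMap.proj x.1.2]))

lemma wc_wedge (x y : Idx n) :
    wc x (wedge y.1.1 y.1.2) = if x = y then 1 else 0 := by
  obtain ⟨⟨i, j⟩, hij⟩ := x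
  obtain ⟨⟨k, l⟩, hkl⟩ := y
  rw [wc, wedge, exteriorPower.alternatingMapLinearEquiv_apply_ιMulti,
    AlternatingMap.compLinearMap_apply]
  refine (Matrix.det_fin_two _).trans ?_
  simp only [LinearMap.pi_apply, Matrix.cons_val_zero, Matrix.cons_val_one, LinearMap.proj_apply,
    Pi.single_apply, Subtype.mk.injEq, Prod.mk.injEq]
  simp only at hij hkl
  split_ifs <;> omega

lemma wedge_expand (m : wedgeTwo n) :
    m = ∑ x : Idx n, wc x m • wedge x.1.1 x.1.2 := by
  let g : wedgeTwo n →ₗ[ℤ] wedgeTwo n :=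
    ∑ x : Idx n, toSpanSingleton ℤ _ (wedge x.1.1 x.1.2) ∘ₗ wc x
  have h : AddMonoidHom.id (wedgeTwo n) = g.toAddMonoidHom := wedge_hom_ext fun i j hij => by
    change _ = g _
    have := fun x => wc_wedge x ⟨(i, j), hij⟩
    simp only at this
    simp [g, LinearMap.sum_apply, this]
  refine (DFunLike.congr_fun h m).trans ?_
  change g m = _
  simp [g, LinearMap.sum_apply]

def uLin : ⊡.dR ⊸ ℂ :=
  ⟨⟨℮, map_add ℮⟩, ue_smul⟩

def dualHom (x : Idx n) : (wedgeTwist n).dR ⊸ ⊡.dR :=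
  toSpanSingleton ℂ ⊡.dR (⊡.c (1 : ℤ)) ∘ₗ
    cLift (M := wedgeTwo n) ((Int.castAddHom ℂ).toIntLinearMap ∘ₗ wc x)

lemma uLin_dualHom (x : Idx n) (m : wedgeTwo n) :
    uLin (dualHom x ((1 : ℂ) ⊗ₜ[ℤ] m)) = wc x m := by
  refine (ue_smul_c _).trans ((cLift_tmul _ _ _).trans ?_)
  rw [one_smul]
  rfl

/-- The Carlson datum with coordinates `-Λ`. -/
def carl (Λ : Idx n → ℂ) : (wedgeTwist n).dR ⊸ ⊡.dR :=
  ∑ x, (-Λ x) • dualHom x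

lemma carlson_apply (Λ : Idx n → ℂ) (m : wedgeTwo n) :
    ℮ (carl Λ ((1 : ℂ) ⊗ₜ[ℤ] m)) = -∑ x, wc x m * Λ x := by
  change uLin _ = _
  refine (congrArg uLin (LinearMap.sum_apply _ _ _)).trans ?_
  rw [map_sum, ← sum_neg_distrib]
  refine sum_congr rfl fun x _ => ?_
  refine (map_smul uLin (-Λ x) (dualHom x ((1 : ℂ) ⊗ₜ[ℤ] m))).trans ?_
  exact (congrArg (-Λ x * ·) (uLin_dualHom x m)).trans (by ring)

lemma carl_wedge (Λ : Idx n → ℂ) (x : Idx n) :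
    ℮ (carl Λ ((1 : ℂ) ⊗ₜ[ℤ] wedge x.1.1 x.1.2)) = -Λ x := by
  rw [carlson_apply]
  simp [wc_wedge]

variable (n) in
/-- The period map. -/
def periodMap (q : QP n) : QTori.Ext (wedgeTwist n) ⊡ :=
  Ext.mk (Extension.model (M := wedgeTwo n) (carl fun x => log (q.val x.1.1 x.1.2)))

lemma periodMap_eq_iff {q : QP n} {ψ : (wedgeTwist n).dR ⊸ ⊡.dR} :
    periodMap n q = Ext.mk (Extension.model (M := wedgeTwo n) ψ) ↔ ∀ x : Idx n,
      exp (-℮ (ψ ((1 : ℂ) ⊗ₜ[ℤ] wedge x.1.1 x.1.2))) = q.val x.1.1 x.1.2 := by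
  rw [periodMap]
  refine Ext.mk_model_eq_iff.trans ?_
  have key : ∀ x : Idx n, exp (℮ (carl
      (fun x => log (q.val x.1.1 x.1.2)) ((1 : ℂ) ⊗ₜ[ℤ] wedge x.1.1 x.1.2))) =
      (q.val x.1.1 x.1.2)⁻¹ := fun x => by
    rw [carl_wedge, exp_neg, exp_log (val_ne_zero q _ _)]
  constructor
  · intro h x
    rw [exp_neg]
    exact inv_eq_iff_eq_inv.2 ((expClass_eq_iff.1 h (wedge x.1.1 x.1.2)).symm.trans (key x))
  · intro h
    refine wedge_hom_ext fun i j hij => Additive.toMul.injective (Units.ext ?_)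
    refine (key ⟨(i, j), hij⟩).trans ?_
    rw [← h ⟨(i, j), hij⟩, exp_neg, inv_inv]
    rfl

lemma QP.ext_of_lt {q r : QP n} (h : ∀ i j, i < j → q.val i j = r.val i j) : q = r := by
  ext i j
  rcases lt_trichotomy i j with hij | rfl | hij
  · exact h i j hij
  · rw [q.diag, r.diag]
  · rw [eq_inv_of_mul_eq_one_left (q.skew i j), eq_inv_of_mul_eq_one_left (r.skew i j), h j i hij]

def parameterOf (ψ : (wedgeTwist n).dR ⊸ ⊡.dR) : QP n where
  val i j := exp (-uLin (ψ ((1 : ℂ) ⊗ₜ[ℤ] wedge i j)))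
  diag i := by
    rw [wedge_self, TensorProduct.tmul_zero]
    refine (congrArg (fun z => exp (-uLin z)) (map_zero ψ)).trans ?_
    rw [map_zero, neg_zero, exp_zero]
  skew i j := by
    rw [wedge_swap i j, TensorProduct.tmul_neg, ← exp_add]
    rw [show uLin (ψ (-(1 : ℂ) ⊗ₜ[ℤ] wedge i j)) = -uLin (ψ ((1 : ℂ) ⊗ₜ[ℤ] wedge i j)) from
      (congrArg uLin (map_neg ψ _)).trans (map_neg uLin _), neg_neg, neg_add_cancel,
      exp_zero]

lemma periodMap_param (ψ : (wedgeTwist n).dR ⊸ ⊡.dR) :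
    periodMap n (parameterOf ψ) = Ext.mk (Extension.model (M := wedgeTwo n) ψ) :=
  periodMap_eq_iff.2 fun _ => rfl

lemma isLieGroupIso_periodMap : IsLieGroupIso (periodMap n) where
  bijective := by
    refine ⟨fun q r h => QP.ext_of_lt fun i j hij => ?_, fun x => ?_⟩
    · have h1 := periodMap_eq_iff.1 h ⟨(i, j), hij⟩
      rw [← h1]
      exact periodMap_eq_iff.1 (rfl : periodMap n r = _) ⟨(i, j), hij⟩
    · obtain ⟨ψ, rfl⟩ := Ext.ex_mk_model (M := wedgeTwo n) x
      exact ⟨_, periodMap_param ψ⟩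
  map_mul q r := by
    have h : periodMap n (q * r) = Ext.mk (Extension.model (M := wedgeTwo n)
        (carl (fun x => log (q.val x.1.1 x.1.2)) +
          carl fun x => log (r.val x.1.1 x.1.2))) := by
      refine periodMap_eq_iff.2 fun x => ?_
      refine (congrArg (fun w => exp (-w)) (map_add ℮ _ _)).trans ?_
      rw [carl_wedge,
        carl_wedge, neg_add, neg_neg, neg_neg, exp_add,
        exp_log (val_ne_zero q _ _), exp_log (val_ne_zero r _ _)]
      rfl
    rw [h]
    exact Ext.isSum_model _ _
  holomorphic q₀ := by
    refine ⟨⋂ x : Idx n, (fun z => z x.1.1 x.1.2 * (q₀.val x.1.1 x.1.2)⁻¹) ⁻¹' Complex.slitPlane,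
      fun z => carl fun x => log (z x.1.1 x.1.2 * (q₀.val x.1.1 x.1.2)⁻¹) +
        log (q₀.val x.1.1 x.1.2), ?_, ?_, ?_, ?_⟩
    · exact isOpen_iInter_of_finite fun x => Complex.isOpen_slitPlane.preimage (by fun_prop)
    · refine Set.mem_iInter.2 fun x => ?_
      rw [Set.mem_preimage, mul_inv_cancel₀ (val_ne_zero q₀ _ _)]
      exact Complex.one_mem_slitPlane
    · intro l
      simp only [carl, map_sum, map_smul, smul_eq_mul]
      refine DifferentiableOn.fun_sum fun x _ => DifferentiableOn.mul_const (DifferentiableOn.neg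
        (DifferentiableOn.add_const _ (DifferentiableOn.clog (by fun_prop) fun z hz => ?_))) _
      exact Set.mem_iInter.1 hz x
    · intro q _
      refine Ext.hasCarlson_iff.2 (periodMap_eq_iff.2 fun x => ?_)
      have h1 := val_ne_zero q x.1.1 x.1.2
      have h2 := val_ne_zero q₀ x.1.1 x.1.2
      rw [carl_wedge, neg_neg, exp_add,
        exp_log (mul_ne_zero h1 (inv_ne_zero h2)), exp_log h2, inv_mul_cancel_right₀ h2]
  inv_holomorphic := by
    refine ⟨parameterOf, fun ψ => Ext.hasCarlson_iff.2 (periodMap_param ψ), fun m l i j => ?_⟩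
    let f : (Fin m → ℂ) ⊸ ℂ :=
      uLin ∘ₗ LinearMap.applyₗ ((1 : ℂ) ⊗ₜ[ℤ] wedge i j : (wedgeTwist n).dR) ∘ₗ l
    exact (LinearMap.toContinuousLinearMap f).differentiable.fun_neg.cexp

end Period

section Coordinates

variable {n : ℕ}

def wcs : (wedgeTwist n).dR ⊸ (Idx n → ℂ) :=
  LinearMap.pi fun x => uLin ∘ₗ dualHom x

lemma wedgeCoords_c (m : (wedgeTwist n).B) (x : Idx n) :
    wcs ((wedgeTwist n).c m) x = ϖ⁻¹ * wc x m := by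
  have h := uLin_dualHom x m
  have h1 : ((1 : ℂ) ⊗ₜ[ℤ] m : (wedgeTwist n).dR) =
      ϖ • (wedgeTwist n).c m := one_tmul_eq (M := wedgeTwo n) m
  rw [show dualHom x ((1 : ℂ) ⊗ₜ[ℤ] m) = dualHom x (ϖ • (wedgeTwist n).c m)
    from congrArg _ h1, map_smul, map_smul, smul_eq_mul] at h
  rw [← h, inv_mul_cancel_left₀ two_pi_I_ne_zero]
  rfl

def wedgeVec (x : Idx n) : (wedgeTwist n).dR :=
  show ℂ ⊗[ℤ] wedgeTwo n from 1 ⊗ₜ[ℤ] wedge x.1.1 x.1.2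

def ofWedge : (Idx n → ℂ) ⊸ (wedgeTwist n).dR :=
  Fintype.linearCombination ℂ wedgeVec

lemma ofWedge_apply (f : Idx n → ℂ) :
    ofWedge f = ∑ x, f x • wedgeVec x := rfl

lemma wedgeCoords_ofCoords (f : Idx n → ℂ) : wcs (ofWedge f) = f := by
  funext x
  rw [ofWedge_apply, map_sum, Finset.sum_apply]
  have h : ∀ y : Idx n,
      wcs (wedgeVec y) x = if x = y then 1 else 0 :=
    fun y => (uLin_dualHom x _).trans (by rw [wc_wedge]; split_ifs <;> simp)
  simp only [map_smul, Pi.smul_apply, smul_eq_mul]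
  rw [sum_eq_single x]
  · exact (congrArg (f x * ·) (h x)).trans (by simp)
  · intro y _ hy
    exact (congrArg (f y * ·) (h y)).trans (by simp [hy.symm])
  · simp

lemma ofWedge_coords (z : (wedgeTwist n).dR) : ofWedge (wcs z) = z := by
  refine LinearMap.congr_fun (f := ofWedge ∘ₗ wcs) (g := LinearMap.id)
    (tate_ext (M := wedgeTwo n) fun m => ?_) z
  have h1 := fun x => wedgeCoords_c (n := n) m x
  change ofWedge (wcs ((wedgeTwist n).c m)) = (wedgeTwist n).c m
  rw [ofWedge_apply]
  simp only [h1]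
  have h2 : ∀ x : Idx n, (ϖ⁻¹ * wc x m) •
      wedgeVec x =
      (wedgeTwist n).c (wc x m • wedge x.1.1 x.1.2 : wedgeTwo n) := fun x => by
    refine Eq.trans ?_ (tate_one_c (M := wedgeTwo n) _).symm
    change (ϖ⁻¹ * wc x m) •
      ((1 : ℂ) ⊗ₜ[ℤ] wedge x.1.1 x.1.2 : ℂ ⊗[ℤ] wedgeTwo n) =
      ϖ⁻¹ ⊗ₜ[ℤ] (wc x m • wedge x.1.1 x.1.2)
    rw [TensorProduct.tmul_smul, smul_tmul', smul_tmul',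
      smul_eq_mul, mul_one, zsmul_eq_mul, mul_comm]
  refine (sum_congr rfl fun x _ => h2 x).trans ?_
  refine (map_sum (wedgeTwist n).c (fun x : Idx n =>
    (show (wedgeTwist n).B from wc x m • wedge x.1.1 x.1.2)) Finset.univ).symm.trans ?_
  exact congrArg (wedgeTwist n).c (wedge_expand m).symm

def latV (Λ : Idx n → ℂ) (v : ℤ × (Idx n → ℤ)) : ℂ × (Idx n → ℂ) :=
  (v.1 + ∑ x, ϖ⁻¹ * v.2 x * Λ x,
    fun x => ϖ⁻¹ * v.2 x)

/-- Coordinates that identify `X` with the extension of `(∧² L)(-1)` by `ℤ` with coordinates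
`-Λ`. -/
structure Coordinates (X : HodgeData) (Λ : Idx n → ℂ) where
  eD : (ℂ × (Idx n → ℂ)) ≃ₗ[ℂ] X.dR
  eB : (ℤ × (Idx n → ℤ)) ≃ₗ[ℤ] X.B
  c_eB : ∀ v, X.c (eB v) = eD (latV Λ v)
  F_nonpos : ∀ k ≤ 0, X.F k = ⊤
  F_one : ∀ w, eD w ∈ X.F 1 ↔ w.1 = 0
  F_high : ∀ k, 2 ≤ k → X.F k = ⊥
  W_neg : ∀ k < 0, X.W k = ⊥
  W_low : ∀ k, 0 ≤ k → k < 2 → X.W k = span ℂ {eD (1, 0)}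
  W_high : ∀ k, 2 ≤ k → X.W k = ⊤

namespace Coordinates

open Extension

variable {X : HodgeData} {Λ : Idx n → ℂ} (C : Coordinates X Λ)

lemma isFrame : X.IsFrame (X.c (C.eB (1, 0))) := by
  have h : X.c (C.eB (1, 0)) = C.eD (1, 0) := by
    rw [C.c_eB]
    congr 1
    ext <;> simp [latV]
  rw [h]
  refine ⟨C.W_neg, C.W_low, C.W_high, C.F_nonpos, ⟨Submodule.disjoint_def.2 fun z h1 h2 => ?_,
    codisjoint_iff.2 (eq_top_iff.2 fun z _ => ?_)⟩, C.F_high⟩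
  · obtain ⟨a, rfl⟩ := mem_span_singleton.1 h1
    rw [← map_smul, C.F_one] at h2
    have : a = 0 := by simpa using h2
    rw [this, zero_smul]
  · obtain ⟨w, rfl⟩ := C.eD.surjective z
    refine mem_sup.2 ⟨w.1 • C.eD (1, 0),
      smul_mem _ _ (mem_span_singleton_self _), C.eD (0, w.2),
      (C.F_one _).2 rfl, ?_⟩
    rw [← map_smul, ← map_add]
    congr 1
    ext <;> simp

def equivB : (mMid (M := wedgeTwo n) (carl Λ)).B ≃ₗ[ℤ] X.B :=
  (LinearEquiv.prodCongr (LinearEquiv.refl ℤ ℤ) (LinearEquiv.ofLinear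
    (LinearMap.pi fun x : Idx n => wc x)
    (Fintype.linearCombination ℤ fun x => wedge x.1.1 x.1.2)
    (LinearMap.ext fun f => funext fun x => by
      simp [Fintype.linearCombination_apply, wc_wedge])
    (LinearMap.ext fun m => by
      simpa [Fintype.linearCombination_apply] using (wedge_expand m).symm))).trans C.eB

def modelCoords (Λ : Idx n → ℂ) :
    (mMid (M := wedgeTwo n) (carl Λ)).dR ⊸ ℂ × (Idx n → ℂ) :=
  LinearMap.prod (uLin ∘ₗ (mFst (M := wedgeTwo n) (carl Λ) -
    carl Λ ∘ₗ mSnd (M := wedgeTwo n) (carl Λ)))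
    (wcs ∘ₗ mSnd (M := wedgeTwo n) (carl Λ))

lemma modelCoords_bij (Λ : Idx n → ℂ) : Function.Bijective (modelCoords Λ) := by
  set ψ := carl Λ
  have h2 : ∀ w : ℂ × (Idx n → ℂ), mSnd (M := wedgeTwo n) ψ (mInl (M := wedgeTwo n) ψ
      (w.1 • ⊡.c (1 : ℤ) + ψ (ofWedge w.2)) +
      mInr (M := wedgeTwo n) ψ (ofWedge w.2)) = ofWedge w.2 := fun w => zero_add _
  refine ⟨(injective_iff_map_eq_zero _).2 fun z hz => ?_, fun w => ?_⟩
  · have h1 : ℮ (mFst (M := wedgeTwo n) ψ z - ψ (mSnd (M := wedgeTwo n) ψ z)) = 0 :=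
      congrArg Prod.fst hz
    have h2 : wcs (mSnd (M := wedgeTwo n) ψ z) = 0 := congrArg Prod.snd hz
    have h3 : mSnd (M := wedgeTwo n) ψ z = 0 :=
      (ofWedge_coords _).symm.trans ((congrArg _ h2).trans (map_zero _))
    have h4 := (℮).injective (h1.trans (map_zero ℮).symm)
    rw [show ψ (mSnd (M := wedgeTwo n) ψ z) = 0 from (congrArg ψ h3).trans (map_zero ψ), sub_zero] at h4
    exact model_ext (M := wedgeTwo n) ψ (h4.trans (map_zero _).symm) (h3.trans (map_zero _).symm)
  · refine ⟨mInl (M := wedgeTwo n) ψ (w.1 • ⊡.c (1 : ℤ) + ψ (ofWedge w.2)) +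
      mInr (M := wedgeTwo n) ψ (ofWedge w.2), Prod.ext ?_ ?_⟩
    · have h1 : mFst (M := wedgeTwo n) ψ (mInl (M := wedgeTwo n) ψ
          (w.1 • ⊡.c (1 : ℤ) + ψ (ofWedge w.2)) +
          mInr (M := wedgeTwo n) ψ (ofWedge w.2)) =
          w.1 • ⊡.c (1 : ℤ) + ψ (ofWedge w.2) := add_zero _
      refine (congrArg ℮ (congrArg₂ (· - ·) h1 (congrArg ψ (h2 w)))).trans ?_
      exact (congrArg ℮ (add_sub_cancel_right _ _)).trans (ue_smul_c _)
    · exact (congrArg wcs (h2 w)).trans (wedgeCoords_ofCoords _)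

def equivD : (mMid (M := wedgeTwo n) (carl Λ)).dR ≃ₗ[ℂ] X.dR :=
  (LinearEquiv.ofBijective (modelCoords Λ) (modelCoords_bij Λ)).trans C.eD

lemma equivD_apply (z) : C.equivD z = C.eD (modelCoords Λ z) := rfl

lemma c_equivB (v : (mMid (M := wedgeTwo n) (carl Λ)).B) :
    X.c (C.equivB v) = C.equivD ((mMid (M := wedgeTwo n) (carl Λ)).c v) := by
  obtain ⟨a, m⟩ := v
  refine (C.c_eB (a, fun x => wc x m)).trans ?_
  rw [equivD_apply]
  refine congrArg C.eD (Prod.ext ?_ (funext fun x => (wedgeCoords_c m x).symm))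
  change ((show ℤ from a : ℤ) : ℂ) + ∑ x, _ = ℮ (⊡.c a - carl Λ ((wedgeTwist n).c m))
  have h1 := carlson_apply Λ m
  have h2 := ue_tmul (M := wedgeTwo n) (carl Λ) m
  have h3 := h2.symm.trans h1
  have h4 : ℮ (carl Λ ((wedgeTwist n).c m)) =
      ϖ⁻¹ * -∑ x, wc x m * Λ x := by
    rw [← h3]
    exact (inv_mul_cancel_left₀ two_pi_I_ne_zero _).symm
  refine Eq.trans ?_ ((map_sub ℮ _ _).trans
    (congrArg₂ (· - ·) (ue_c a) h4)).symm
  simp only [mul_neg, sub_neg_eq_add, mul_sum, mul_assoc]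

lemma isMixedHodge (C : Coordinates X Λ) : X.IsMixedHodge := by
  refine HodgeData.IsFrame.isMixedHodge C.isFrame (Module.Finite.equiv C.eB) ?_
  exact (IsBaseChange.iff_of_equiv_comm C.equivB C.equivD (LinearMap.ext C.c_equivB)).1
    (mMid_bc (M := wedgeTwo n) _)

def hom : Hom (mMid (M := wedgeTwo n) (carl Λ)) X where
  onB := C.equivB
  onDR := C.equivD
  comm v := (C.c_equivB v).symm
  map_F k z hz := by
    have hf := mMid_isFrame (M := wedgeTwo n) (carl Λ)
    rcases le_or_gt k 0 with hk | hk
    · rw [C.F_nonpos k hk]; trivial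
    rcases le_or_gt 2 k with hk2 | hk2
    · rw [hf.F_high k hk2, mem_bot] at hz
      rw [hz, map_zero]
      exact zero_mem _
    obtain rfl : k = 1 := by omega
    refine (C.F_one _).2 ?_
    change ℮ (_ - _) = 0
    rw [(mem_mMid_F (M := wedgeTwo n) _).1 hz]
    exact (congrArg ℮ (sub_self _)).trans (map_zero _)
  map_W k z hz := by
    have hf := mMid_isFrame (M := wedgeTwo n) (carl Λ)
    rcases le_or_gt 2 k with hk2 | hk2
    · rw [C.W_high k hk2]; trivial
    rcases lt_or_ge k 0 with hk | hk
    · rw [hf.W_neg k hk, mem_bot] at hz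
      rw [hz, map_zero]
      exact zero_mem _
    rw [hf.W_low k hk hk2] at hz
    obtain ⟨a, rfl⟩ := mem_span_singleton.1 hz
    rw [C.isFrame.W_low k hk hk2, map_smul]
    refine smul_mem _ _ (mem_span_singleton.2 ⟨1, ?_⟩)
    rw [one_smul]
    refine Eq.trans ?_ (C.c_equivB _)
    refine congrArg (fun v => X.c (C.eB v)) (Prod.ext rfl (funext fun x => ?_))
    exact (map_zero (wc x)).symm

def inclusion : Hom ⊡ X := (model (M := wedgeTwo n) (carl Λ)).i.trans C.hom

def projection : Hom X (wedgeTwist n) where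
  onB := mSndB (M := wedgeTwo n) (carl Λ) ∘ₗ C.equivB.symm.toLinearMap
  onDR := mSnd (M := wedgeTwo n) (carl Λ) ∘ₗ C.equivD.symm.toLinearMap
  comm v := by
    obtain ⟨v, rfl⟩ := C.equivB.surjective v
    rw [c_equivB]
    change mSnd (M := wedgeTwo n) _ (C.equivD.symm (C.equivD _)) =
      (wedgeTwist n).c (mSndB (M := wedgeTwo n) _ (C.equivB.symm (C.equivB v)))
    rw [LinearEquiv.symm_apply_apply, LinearEquiv.symm_apply_apply]
    rfl
  map_F k z hz := by
    rcases le_or_gt 2 k with hk | hk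
    · rw [C.F_high k hk, mem_bot] at hz
      rw [hz, map_zero]
      exact zero_mem _
    · rw [show (wedgeTwist n).F k = ⊤ from if_pos (by omega)]; trivial
  map_W k z hz := by
    rcases le_or_gt 2 k with hk | hk
    · rw [show (wedgeTwist n).W k = ⊤ from if_pos (by omega)]; trivial
    · have h1 := C.isMixedHodge.W_mono (show k ≤ 1 by omega) hz
      rw [C.isFrame.W_low 1 zero_le_one one_lt_two] at h1
      obtain ⟨a, rfl⟩ := mem_span_singleton.1 h1
      have h2 := C.c_equivB (mInlB (M := wedgeTwo n) (carl Λ) (1 : ℤ))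
      have h3 : C.equivB (mInlB (M := wedgeTwo n) (carl Λ) (1 : ℤ)) = C.eB (1, 0) :=
        congrArg C.eB (Prod.ext rfl (funext fun x => map_zero (wc x)))
      rw [← h3, h2, map_smul]
      change a • mSnd (M := wedgeTwo n) _ (C.equivD.symm (C.equivD _)) ∈ _
      rw [LinearEquiv.symm_apply_apply]
      have h4 : mSnd (M := wedgeTwo n) (carl Λ) ((mMid (M := wedgeTwo n) (carl Λ)).c
        (mInlB (M := wedgeTwo n) (carl Λ) (1 : ℤ))) = 0 := map_zero (wedgeTwist n).c
      rw [h4, smul_zero]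
      exact zero_mem _

lemma inclusion_one : C.inclusion.onDR (⊡.c (1 : ℤ)) = C.eD (1, 0) := by
  refine (C.inclusion.comm _).trans ?_
  refine (C.c_eB (1, fun x => wc x 0)).trans (congrArg C.eD ?_)
  simp only [map_zero]
  ext <;> simp [latV]

lemma projection_eD (w) : C.projection.onDR (C.eD w) = ofWedge w.2 := by
  obtain ⟨z, rfl⟩ := (modelCoords_bij Λ).2 w
  change mSnd (M := wedgeTwo n) _ (C.equivD.symm (C.equivD z)) =
    ofWedge (wcs (mSnd (M := wedgeTwo n) _ z))
  rw [LinearEquiv.symm_apply_apply]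
  exact (ofWedge_coords _).symm

lemma incl_inj : Function.Injective C.inclusion.onB := by
  intro a b h
  exact LinearMap.inl_injective (R := ℤ) (M := ⊡.B) (M₂ := (wedgeTwist n).B) (C.equivB.injective h)

lemma proj_surj : Function.Surjective C.projection.onB :=
  (LinearMap.snd_surjective (R := ℤ) (M := ⊡.B) (M₂ := (wedgeTwist n).B)).comp
    C.equivB.symm.surjective

lemma exact : Function.Exact C.inclusion.onB C.projection.onB := by
  intro v
  obtain ⟨v, rfl⟩ := C.equivB.surjective v
  have h := (model (M := wedgeTwo n) (carl Λ)).exact v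
  have e : C.projection.onB (C.equivB v) = mSndB (M := wedgeTwo n) (carl Λ) v :=
    congrArg (mSndB (M := wedgeTwo n) (carl Λ)) (C.equivB.symm_apply_apply v)
  rw [e]
  refine h.trans ⟨?_, ?_⟩
  · rintro ⟨a, rfl⟩; exact ⟨a, rfl⟩
  · rintro ⟨a, ha⟩; exact ⟨a, C.equivB.injective ha⟩

lemma mk_eq : Ext.mk (⟨X, C.isMixedHodge, C.inclusion, C.projection, C.incl_inj,
    C.proj_surj, C.exact⟩ : Extension (wedgeTwist n) ⊡) =
    Ext.mk (model (M := wedgeTwo n) (carl Λ)) := by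
  refine (Ext.mk_eq_iff.2 (Congr.of_hom (M := wedgeTwo n) (E := model (M := wedgeTwo n) (carl Λ))
    (E' := ⟨X, C.isMixedHodge, C.inclusion, C.projection, C.incl_inj,
      C.proj_surj, C.exact⟩) C.hom rfl fun v => ?_)).symm
  exact congrArg (mSndB (M := wedgeTwo n) (carl Λ)) (C.equivB.symm_apply_apply v)

end Coordinates

end Coordinates

section Period

variable {n : ℕ} (q : QP n)

def pairCls (p : ℕ) (I : Fin (2 * p) → Fin n) : torusHP q ⊸ ℂ :=
  Submodule.liftQ _ (pairing q (2 * p) I ∘ₗ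
    (LinearMap.proj p : EV n ⊸ HT n (2 * p)) ∘ₗ
      (cycles (torusMul q) 𝟏).subtype) fun _ h => pair_bd_tw q h p I

lemma pairCls_unit_zero (I : Fin (2 * 0) → Fin n) : pairCls q 0 I (unitClass q) = 1 :=
  pair_unitC_zero q I

lemma pairCls_unitClass_one (I : Fin (2 * 1) → Fin n) : pairCls q 1 I (unitClass q) = 0 :=
  map_zero (pairing q (2 * 1) I)

lemma pairCls_bott (i j : Fin n) (p : ℕ) (I : Fin (2 * p) → Fin n) :
    pairCls q p I (bottClass q i j) = cohTwo i j p I := by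
  rw [← hkr_bottC, ← pairing_retwist q]
  rfl

lemma pair_deg_tw (k : ℕ) (I : Fin (2 * k) → Fin n) {x : HT n (2 * k)}
    (hx : x ∈ degenerate 𝟏 (2 * k)) : pairing q (2 * k) I x = 0 := by
  have h : (Pi.single k x : EV n) ∈ boundaries (torusMul q) 𝟏 := by
    refine (le_sup_right : degEven 𝟏 ≤ boundaries (torusMul q) 𝟏) ?_
    intro p _
    by_cases hp : p = k
    · subst hp; rw [Pi.single_eq_same]; exact hx
    · rw [Pi.single_eq_of_ne hp]; exact zero_mem _
  simpa using pair_bd_tw q h k I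

lemma pairCls_hodgeF {k : ℤ} {x : torusHP q} (hx : x ∈ hodgeF (torusMul q) 𝟏 k) {p : ℕ}
    (hp : (p : ℤ) < k) (I : Fin (2 * p) → Fin n) : pairCls q p I x = 0 := by
  obtain ⟨c, hc, rfl⟩ := hx
  exact pair_deg_tw q p I (hc p hp)

lemma mk_mem_hodgeF {k : ℤ} (c : cycles (torusMul q) 𝟏)
    (h : ∀ p : ℕ, (p : ℤ) < k → c.1 p = 0) :
    Submodule.Quotient.mk c ∈ hodgeF (torusMul q) 𝟏 k :=
  ⟨c, fun p hp => by
    change c.1 p ∈ _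
    rw [h p hp]; exact zero_mem _, rfl⟩

lemma cohTwo_pair (x y : Idx n) :
    cohTwo x.1.1 x.1.2 1 ![y.1.1, y.1.2] = if y = x then 1 else 0 := by
  obtain ⟨⟨i, j⟩, hij⟩ := x
  obtain ⟨⟨k, l⟩, hkl⟩ := y
  rw [cohTwo, Pi.single_eq_same]
  simp only [Subtype.mk.injEq, Prod.mk.injEq]
  change (if k = i then 1 else 0) * (if l = j then 1 else 0) -
    (if l = i then 1 else 0) * (if k = j then (1 : ℂ) else 0) = _
  simp only at hij hkl
  split_ifs <;> first | omega | simp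

def ofCoef : ℂ × (Idx n → ℂ) ⊸ torusHP q :=
  LinearMap.coprod (toSpanSingleton ℂ _ (unitClass q))
    (Fintype.linearCombination ℂ fun x : Idx n => bottClass q x.1.1 x.1.2)

lemma ofCoef_apply (w : ℂ × (Idx n → ℂ)) :
    ofCoef q w = w.1 • unitClass q + ∑ x, w.2 x • bottClass q x.1.1 x.1.2 := rfl

lemma pairCls_coef_zero (w : ℂ × (Idx n → ℂ)) (I : Fin (2 * 0) → Fin n) :
    pairCls q 0 I (ofCoef q w) = w.1 := by
  have h : ∀ i j : Fin n, cohTwo i j 0 I = 0 := fun i j => by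
    rw [cohTwo, Pi.single_eq_of_ne (by decide)]; rfl
  simp [ofCoef_apply, pairCls_unit_zero, pairCls_bott, h]

lemma pairCls_coef_one (w : ℂ × (Idx n → ℂ)) (y : Idx n) :
    pairCls q 1 ![y.1.1, y.1.2] (ofCoef q w) = w.2 y := by
  simp [ofCoef_apply, pairCls_unitClass_one, pairCls_bott, cohTwo_pair]

lemma ofCoef_injective : Function.Injective (ofCoef q) := fun w w' h =>
  Prod.ext (by rw [← pairCls_coef_zero q w Fin.elim0, h, pairCls_coef_zero])
    (funext fun x => by rw [← pairCls_coef_one q w x, h, pairCls_coef_one])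

lemma ofCoef_mem_hodgeF_one (w : ℂ × (Idx n → ℂ)) :
    ofCoef q w ∈ hodgeF (torusMul q) 𝟏 1 ↔ w.1 = 0 := by
  refine ⟨fun h => ?_, fun h => ?_⟩
  · rw [← pairCls_coef_zero q w Fin.elim0]
    exact pairCls_hodgeF q h (by norm_num) _
  · rw [ofCoef_apply, h, zero_smul, zero_add]
    refine Submodule.sum_mem _ fun x _ => smul_mem _ _ (mk_mem_hodgeF q _ fun p hp => ?_)
    obtain rfl : p = 0 := by omega
    change rtw q _ (bottC x.1.1 x.1.2 0) = 0
    rw [bottC_zero, map_zero]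

lemma ofCoef_zero_of_F {w : ℂ × (Idx n → ℂ)} {k : ℤ} (hk : 2 ≤ k)
    (h : ofCoef q w ∈ hodgeF (torusMul q) 𝟏 k) : w = 0 :=
  Prod.ext (by
    rw [← pairCls_coef_zero q w Fin.elim0]
    exact pairCls_hodgeF q h (by push_cast; omega) _) (funext fun x => by
    rw [← pairCls_coef_one q w x]
    exact pairCls_hodgeF q h (by push_cast; omega) _)

lemma hodgeF_nonpos {k : ℤ} (hk : k ≤ 0) : hodgeF (torusMul q) 𝟏 k = ⊤ := by
  refine eq_top_iff.2 fun x _ => ?_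
  obtain ⟨c, rfl⟩ := Submodule.Quotient.mk_surjective _ x
  exact mk_mem_hodgeF q c fun p hp => by omega

def cohCoef (n : ℕ) : Coh n ⊸ ℂ × (Idx n → ℂ) where
  toFun z := (z 0 Fin.elim0, fun x => z 1 ![x.1.1, x.1.2])
  map_add' _ _ := rfl
  map_smul' _ _ := rfl

def transport (Λ : Idx n → ℂ) (w : ℂ × (Idx n → ℂ)) : ℂ × (Idx n → ℂ) :=
  (w.1 + ∑ x, w.2 x * Λ x, w.2)

namespace QPath

variable {q} (γ : QPath q)

def logs (x : Idx n) : ℂ := γ.logVal x.1.1 x.1.2 1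

/-- The flat sections of weight at most two. -/
def coefFlat (w : ℂ × (Idx n → ℂ)) : γ.flat :=
  w.1 • γ.unitFlat + ∑ x, w.2 x • γ.bottFlat x.1.1 x.1.2

lemma sc_coefFlat (w : ℂ × (Idx n → ℂ)) :
    γ.startClass (γ.coefFlat w) = w.1 • cohOne n + ∑ x, w.2 x • cohTwo x.1.1 x.1.2 := by
  simp [coefFlat, sc_unitFlat, startClass_bottFlat]

lemma ec_coefFlat (w : ℂ × (Idx n → ℂ)) :
    γ.endClass (γ.coefFlat w) = ofCoef q (transport γ.logs w) := by
  simp only [coefFlat, map_add, map_sum, map_smul, ec_unitFlat, endClass_bottFlat, smul_add,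
    sum_add_distrib, ofCoef_apply, transport, logs, add_smul, sum_smul, smul_smul]
  abel

lemma sc_coefFlat_zero (w : ℂ × (Idx n → ℂ)) (I : Fin (2 * 0) → Fin n) :
    γ.startClass (γ.coefFlat w) 0 I = w.1 := by
  have h : ∀ i j : Fin n, cohTwo i j 0 I = 0 := fun i j => by
    rw [cohTwo, Pi.single_eq_of_ne (by decide)]; rfl
  simp [sc_coefFlat, cohOne, h]

lemma sc_coefFlat_one (w : ℂ × (Idx n → ℂ)) (y : Idx n) :
    γ.startClass (γ.coefFlat w) 1 ![y.1.1, y.1.2] = w.2 y := by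
  simp [sc_coefFlat, cohOne, cohTwo_pair]

lemma sc_coefFlat_high (w : ℂ × (Idx n → ℂ)) {p : ℕ} (hp : 2 ≤ p) :
    γ.startClass (γ.coefFlat w) p = 0 := by
  have h : ∀ i j : Fin n, cohTwo i j p = 0 := fun i j => by
    rw [cohTwo, Pi.single_eq_of_ne (by omega)]
  funext I
  simp [sc_coefFlat, cohOne, h, show p ≠ 0 by omega]

lemma sc_coefFlat_mem (w : ℂ × (Idx n → ℂ)) :
    γ.startClass (γ.coefFlat w) ∈ cohWeight n 2 := fun _ hp =>
  γ.sc_coefFlat_high w (by have : (2 : ℤ) < 2 * _ := hp; omega)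

lemma coef_sc_coefFlat (w : ℂ × (Idx n → ℂ)) :
    cohCoef n (γ.startClass (γ.coefFlat w)) = w :=
  Prod.ext (γ.sc_coefFlat_zero w _) (funext fun x => γ.sc_coefFlat_one w x)

lemma startClass_eq_zero {s : γ.flat} (h : γ.startClass s ∈ cohWeight n 2)
    (h0 : cohCoef n (γ.startClass s) = 0) : γ.startClass s = 0 := by
  funext p I
  obtain hp | rfl | rfl : 2 ≤ p ∨ p = 0 ∨ p = 1 := by omega
  · have := h p (show (2 : ℤ) < 2 * p by omega)
    exact congrFun this I
  · rw [show I = Fin.elim0 from funext fun i => Fin.elim0 i]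
    exact congrArg Prod.fst h0
  · have hlt : ∀ i j, i < j → γ.startClass s 1 ![i, j] = 0 := fun i j hij =>
      congrFun (congrArg Prod.snd h0) ⟨(i, j), hij⟩
    have hI : ∀ J : Fin (2 * 1) → Fin n, J = ![J 0, J 1] := fun J => by
      funext k; fin_cases k <;> rfl
    rcases lt_trichotomy (I 0) (I 1) with hij | hij | hij
    · rw [hI I]; exact hlt _ _ hij
    · rw [sc_apply]
      exact pair_not_inj _ _ _ (fun hinj => absurd (hinj hij) (by decide)) _
    · have h2 := pairing_comp_perm (γ.toFun 0) (2 * 1) (![I 1, I 0] : Fin (2 * 1) → Fin n)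
        (Equiv.swap 0 1) (s.1 0 1)
      rw [← sc_apply, ← sc_apply, hlt _ _ hij, mul_zero] at h2
      refine Eq.trans ?_ h2
      exact congrArg (γ.startClass s 1) (funext fun k => by fin_cases k <;> rfl)

lemma endClass_eq {s : γ.flat} (h : γ.startClass s ∈ cohWeight n 2) :
    γ.endClass s = ofCoef q (transport γ.logs (cohCoef n (γ.startClass s))) := by
  rw [← ec_coefFlat, ← sub_eq_zero, ← map_sub, ← sc_eq_zero]
  refine γ.startClass_eq_zero ?_ ?_
  · rw [map_sub]
    exact Submodule.sub_mem _ h (γ.sc_coefFlat_mem _)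
  · rw [map_sub, map_sub, coef_sc_coefFlat, sub_self]

lemma sc_mem_of_ec {s : γ.flat} {k : ℤ} (h : γ.endClass s ∈ γ.weight k) :
    γ.startClass s ∈ cohWeight n k := by
  obtain ⟨s', hs', h'⟩ := h
  rw [← sub_eq_zero, ← map_sub, ← sc_eq_zero, map_sub, sub_eq_zero] at h'
  rw [← h']; exact hs'

lemma cohWeight_mono {k l : ℤ} (h : k ≤ l) : cohWeight n k ≤ cohWeight n l :=
  fun _ hz p hp => hz p (lt_of_le_of_lt h hp)

lemma weight_mono {k l : ℤ} (h : k ≤ l) : γ.weight k ≤ γ.weight l :=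
  Submodule.map_mono (Submodule.comap_mono (cohWeight_mono h))

lemma ofCoef_mem_W (w : ℂ × (Idx n → ℂ)) : ofCoef q w ∈ γ.weight 2 := by
  refine ⟨γ.coefFlat (w.1 - ∑ x, w.2 x * γ.logs x, w.2), γ.sc_coefFlat_mem _, ?_⟩
  rw [ec_coefFlat, transport, sub_add_cancel]

lemma weight_two : γ.weight 2 = LinearMap.range (ofCoef q) := by
  refine le_antisymm ?_ ?_
  · rintro _ ⟨s, hs, rfl⟩
    exact ⟨_, (γ.endClass_eq hs).symm⟩
  · rintro _ ⟨w, rfl⟩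
    exact γ.ofCoef_mem_W w

lemma weight_low {k : ℤ} (h0 : 0 ≤ k) (h2 : k < 2) : γ.weight k = span ℂ {unitClass q} := by
  refine le_antisymm ?_ ((Submodule.span_singleton_le_iff_mem _ _).2
    ⟨γ.unitFlat, ?_, γ.ec_unitFlat⟩)
  · rintro _ ⟨s, hs, rfl⟩
    have h : (cohCoef n (γ.startClass s)).2 = 0 := funext fun x =>
      congrFun (hs 1 (show k < 2 * ((1 : ℕ) : ℤ) by omega)) _
    rw [γ.endClass_eq (cohWeight_mono h2.le hs), transport, ofCoef_apply, h]
    simp only [Pi.zero_apply, zero_smul, Finset.sum_const_zero, add_zero]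
    exact smul_mem _ _ (mem_span_singleton_self _)
  · intro p hp
    have hp : k < 2 * (p : ℤ) := hp
    rw [sc_unitFlat]
    funext I
    exact if_neg (by omega)

lemma weight_neg {k : ℤ} (hk : k < 0) : γ.weight k = ⊥ := by
  refine (Submodule.eq_bot_iff _).2 ?_
  rintro _ ⟨s, hs, rfl⟩
  rw [← sc_eq_zero]
  funext p
  exact hs p (show k < 2 * (p : ℤ) by omega)

lemma mem_lattice_iff (x : torusHP q) :
    x ∈ γ.lattice ∧ x ∈ γ.weight 2 ↔ ∃ v, x = ofCoef q (latV γ.logs v) := by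
  have key : ∀ v : ℤ × (Idx n → ℤ), latV γ.logs v =
      transport γ.logs (v.1, fun x => ϖ⁻¹ * v.2 x) := fun v => rfl
  constructor
  · rintro ⟨⟨s, hs, rfl⟩, hw⟩
    have hw := γ.sc_mem_of_ec hw
    obtain ⟨a, ha⟩ := chernLattice_zero hs Fin.elim0
    choose b hb using fun x : Idx n => chernLattice_one hs ![x.1.1, x.1.2]
    refine ⟨(a, b), (γ.endClass_eq hw).trans ?_⟩
    rw [key]
    exact congrArg (fun w => ofCoef q (transport γ.logs w)) (Prod.ext ha (funext hb))
  · rintro ⟨v, rfl⟩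
    refine ⟨?_, γ.ofCoef_mem_W _⟩
    rw [key, ← ec_coefFlat]
    refine ⟨_, ?_, rfl⟩
    change γ.startClass _ ∈ chernLattice n
    rw [sc_coefFlat]
    refine add_mem ?_ (sum_mem fun x _ => ?_)
    · rw [Int.cast_smul_eq_zsmul]
      exact zsmul_mem cohOne_mem_chern _
    · change (ϖ⁻¹ * v.2 x) • cohTwo x.1.1 x.1.2 ∈ _
      rw [mul_comm _ (v.2 x : ℂ), mul_smul, Int.cast_smul_eq_zsmul]
      exact zsmul_mem (cohTwo_mem_chern _ _ x.2) _

lemma exp_logs (x : Idx n) : exp (γ.logs x) = q.val x.1.1 x.1.2 :=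
  γ.exp_logVal _ _ x.2

lemma weight_eq (γ' : QPath q) {k : ℤ} (hk : k ≤ 2) : γ.weight k = γ'.weight k := by
  obtain h | h | rfl : k < 0 ∨ (0 ≤ k ∧ k < 2) ∨ k = 2 := by omega
  · rw [weight_neg _ h, weight_neg _ h]
  · rw [weight_low _ h.1 h.2, weight_low _ h.1 h.2]
  · rw [weight_two, weight_two]

lemma lattice_le (γ' : QPath q) :
    γ.lattice ⊓ (γ.weight 2).restrictScalars ℤ ≤ γ'.lattice ⊓ (γ'.weight 2).restrictScalars ℤ := by
  intro x hx
  obtain ⟨v, rfl⟩ := (γ.mem_lattice_iff x).1 hx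
  refine (γ'.mem_lattice_iff _).2 ?_
  have h : ∀ x, ∃ k : ℤ, γ.logs x = γ'.logs x + k * (2 * pi * ⅈ) := fun x =>
    Complex.exp_eq_exp_iff_exists_int.1 ((γ.exp_logs x).trans (γ'.exp_logs x).symm)
  choose k hk using h
  refine ⟨(v.1 + ∑ x, v.2 x * k x, v.2), congrArg (ofCoef q) (Prod.ext ?_ rfl)⟩
  simp only [latV, hk]
  push_cast
  rw [add_assoc, ← sum_add_distrib]
  refine congrArg _ (sum_congr rfl fun x _ => ?_)
  field_simp [two_pi_I_ne_zero]
  ring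

lemma lattice_eq (γ' : QPath q) :
    γ.lattice ⊓ (γ.weight 2).restrictScalars ℤ = γ'.lattice ⊓ (γ'.weight 2).restrictScalars ℤ :=
  le_antisymm (γ.lattice_le γ') (γ'.lattice_le γ)

def coordD : (ℂ × (Idx n → ℂ)) ≃ₗ[ℂ] ((kTheory γ).weightStep 2).dR :=
  (LinearEquiv.ofInjective (ofCoef q) (ofCoef_injective q)).trans
    (LinearEquiv.ofEq _ (γ.weight 2) γ.weight_two.symm)

def coordBHom : ℤ × (Idx n → ℤ) →+ ((kTheory γ).weightStep 2).B where
  toFun v := ⟨⟨ofCoef q (latV γ.logs v), ((γ.mem_lattice_iff _).2 ⟨v, rfl⟩).1⟩,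
    ((γ.mem_lattice_iff _).2 ⟨v, rfl⟩).2⟩
  map_zero' := by
    refine Subtype.ext (Subtype.ext ((congrArg (ofCoef q) ?_).trans (map_zero _)))
    ext <;> simp [latV]
  map_add' v w := by
    refine Subtype.ext (Subtype.ext ((congrArg (ofCoef q) ?_).trans (map_add (ofCoef q) _ _)))
    ext
    · simp [latV, mul_add, add_mul, sum_add_distrib]; ring
    · simp [latV, mul_add]

lemma coordBHom_bijective : Function.Bijective γ.coordBHom := by
  constructor
  · intro v w h
    have h := ofCoef_injective q (congrArg (fun b => b.1.1) h)
    have h2 : v.2 = w.2 := funext fun x => by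
      have := congrFun (congrArg Prod.snd h) x
      exact_mod_cast mul_left_cancel₀ (inv_ne_zero two_pi_I_ne_zero) this
    have h1 := congrArg Prod.fst h
    simp only [latV, h2, add_left_inj] at h1
    exact Prod.ext (by exact_mod_cast h1) h2
  · rintro ⟨⟨x, hx⟩, hw⟩
    obtain ⟨v, rfl⟩ := (γ.mem_lattice_iff x).1 ⟨hx, hw⟩
    exact ⟨v, rfl⟩

def coordinates : Coordinates ((kTheory γ).weightStep 2) γ.logs where
  eD := γ.coordD
  eB := (AddEquiv.ofBijective γ.coordBHom γ.coordBHom_bijective).toIntLinearEquiv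
  c_eB _ := rfl
  F_nonpos k hk := by
    refine eq_top_iff.2 fun z _ => ?_
    change (show γ.weight 2 from z).1 ∈ hodgeF (torusMul q) 𝟏 k
    rw [hodgeF_nonpos q hk]
    exact mem_top
  F_one w := ofCoef_mem_hodgeF_one q w
  F_high k hk := by
    refine (Submodule.eq_bot_iff _).2 fun z hz => ?_
    obtain ⟨w, rfl⟩ := γ.coordD.surjective z
    rw [ofCoef_zero_of_F q hk hz, map_zero]
  W_neg k hk := by
    refine (Submodule.eq_bot_iff _).2 fun z hz => ?_
    have hz : (show γ.weight 2 from z).1 ∈ γ.weight k := hz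
    rw [γ.weight_neg hk] at hz
    exact Subtype.ext hz
  W_low k h0 h2 := by
    have hu : ∀ a : ℂ, ofCoef q (a, 0) = a • unitClass q := fun a => by simp [ofCoef_apply]
    refine le_antisymm (fun z hz => ?_) ((Submodule.span_singleton_le_iff_mem _ _).2 ?_)
    · have hz : (show γ.weight 2 from z).1 ∈ γ.weight k := hz
      rw [γ.weight_low h0 h2] at hz
      obtain ⟨a, ha⟩ := mem_span_singleton.1 hz
      refine mem_span_singleton.2 ⟨a, ?_⟩
      rw [← map_smul]
      refine Subtype.ext (Eq.trans ?_ ha)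
      rw [← hu]
      refine congrArg (ofCoef q) ?_
      ext <;> simp
    · change ofCoef q (1, 0) ∈ γ.weight k
      rw [γ.weight_low h0 h2, hu, one_smul]
      exact mem_span_singleton_self _
  W_high k hk := eq_top_iff.2 fun z _ => γ.weight_mono hk (show γ.weight 2 from z).2

lemma isCanonical : IsCanonical γ γ.coordinates.inclusion γ.coordinates.projection := by
  refine ⟨⟨γ.unitFlat, ?_, γ.sc_unitFlat, ?_⟩, fun s h => ?_⟩
  · exact γ.weight_mono (show (0 : ℤ) ≤ 2 by norm_num)
      (by rw [γ.weight_low le_rfl (by norm_num)]; exact mem_span_singleton_self _)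
  · have h1 : ((1 : ℂ) ⊗ₜ[ℤ] (1 : ℤ) : ⊡.dR) = ⊡.c (1 : ℤ) := (unitHodge_c _).symm
    refine (congrArg γ.coordinates.inclusion.onDR h1).trans (γ.coordinates.inclusion_one.trans ?_)
    refine Subtype.ext ?_
    change ofCoef q (1, 0) = unitClass q
    simp [ofCoef_apply]
  · have hw := γ.sc_mem_of_ec h
    have h1 : (kTheory γ).weightStepMk 2 (γ.endClass s) h =
        γ.coordinates.eD (transport γ.logs (cohCoef n (γ.startClass s))) :=
      Subtype.ext (γ.endClass_eq hw)
    refine (congrArg γ.coordinates.projection.onDR h1).trans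
      ((γ.coordinates.projection_eD _).trans ?_)
    have h2 : degTwo (γ.startClass s) = _ := (sum_indexPair fun i j =>
      (γ.startClass s 1 ![i, j] ⊗ₜ[ℤ] wedge i j : ℂ ⊗[ℤ] wedgeTwo n)).symm
    refine Eq.trans ?_ h2.symm
    refine sum_congr rfl fun x _ => ?_
    exact (smul_tmul' _ _ _).trans (congrArg (· ⊗ₜ _) (mul_one _))

lemma isPeriod : IsPeriod γ (periodMap n q) := by
  refine ⟨γ.coordinates.isMixedHodge, _, _, γ.coordinates.incl_inj,
    γ.coordinates.proj_surj, γ.coordinates.exact, γ.isCanonical,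
    Eq.trans ?_ γ.coordinates.mk_eq.symm⟩
  refine periodMap_eq_iff.2 fun x => ?_
  rw [carl_wedge, neg_neg, γ.exp_logs]

end QPath

end Period

lemma nonempty_qPath {n : ℕ} (q : QP n) : Nonempty (QPath q) := by
  let ψ := carl (n := n) fun x => log (q.val x.1.1 x.1.2)
  have h : ∀ (t : ℝ) i j, (parameterOf ((t : ℂ) • ψ)).val i j =
      exp (-(t * uLin (ψ ((1 : ℂ) ⊗ₜ[ℤ] wedge i j)))) := fun t i j =>
    congrArg (fun z => exp (-z)) (map_smul uLin (t : ℂ) (ψ ((1 : ℂ) ⊗ₜ[ℤ] wedge i j)))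
  refine ⟨⟨fun t => parameterOf ((t : ℂ) • ψ), fun i j => ?_, ?_, ?_⟩⟩
  · simp only [h]
    exact (contDiff_exp (𝕜 := ℝ)).comp
      ((ofRealCLM.contDiff.mul contDiff_const).neg)
  · ext i j
    rw [h]
    simp [show (1 : QP n).val i j = 1 from rfl]
  · refine QP.ext_of_lt fun i j hij => ?_
    rw [h, Complex.ofReal_one, one_mul]
    refine (congrArg (fun z => exp (-z))
      (carl_wedge _ ⟨(i, j), hij⟩)).trans ?_
    rw [neg_neg]
    exact exp_log (val_ne_zero q i j)

end QTori

end

theorem mainTheorem6 (n : ℕ) :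
    (∀ q : QP n, Nonempty (QPath q)) ∧
    (∀ (q : QP n) (γ γ' : QPath q),
      (∀ k ≤ 2, γ.weight k = γ'.weight k) ∧
      γ.lattice ⊓ (γ.weight 2).restrictScalars ℤ =
        γ'.lattice ⊓ (γ'.weight 2).restrictScalars ℤ) ∧
    (∃ period : QP n → QTori.Ext (wedgeTwist n) unitHodge,
      (∀ (q : QP n) (γ : QPath q), IsPeriod γ (period q)) ∧ IsLieGroupIso period) ∧
    ∃ κ : QTori.Ext (wedgeTwist n) unitHodge ≃ (wedgeTwo n →+ Additive ℂˣ),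
      (∀ x y z, x.IsSum y z → κ z = κ x + κ y) ∧
      ∀ x ψ, x.HasCarlson ψ → ∀ v : wedgeTwo n,
        ((κ x v).toMul : ℂ) = Complex.exp (unitHodgeEquiv (ψ ((1 : ℂ) ⊗ₜ[ℤ] v))) := by
  obtain ⟨κ, hadd, hκ⟩ := Ext.exists_equiv (M := wedgeTwo n)
  refine ⟨nonempty_qPath, fun q γ γ' => ⟨fun k hk => γ.weight_eq γ' hk, γ.lattice_eq γ'⟩,
    ⟨periodMap n, fun q γ => γ.isPeriod, isLieGroupIso_periodMap⟩, κ, hadd, fun x ψ h v => ?_⟩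
  exact congrArg (fun f : wedgeTwo n →+ Additive ℂˣ => ((Additive.toMul (f v) : ℂˣ) : ℂ)) (hκ x ψ h)
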